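/- **Setting.** Let $0<\varepsilon\le 1$, $t_k=k\varepsilon$, $n\ge 1$, $T\ge 0$, $\alpha\in(0,2]$, and let $\Gamma$ be a finite measure on the unit sphere $S_{d_1}$ of $\mathbb R^{d_1}$. A Lévy-stable process with index $\alpha$ and spectral measure $\Gamma$ is a càdlàg process with independent increments such that, for $s\le t$, $E\,e^{i\theta'(X_t-X_s)}=e^{(t-s)\psi(\theta)}$, where $\psi(\theta)=-\int_{S_{d_1}}|\theta'z|^\alpha\bigl(1-i\,\mathrm{sign}(\theta'z)\tan\frac{\alpha\pi}{2}\bigr)\Gamma(dz)$ if $\alpha\ne1$ and $\psi(\theta)=-\int_{S_{d_1}}|\theta'z|\bigl(1+\frac{2i}{\pi}\mathrm{sign}(\theta'z)\ln|\theta'z|\bigr)\Gamma(dz)$ if $\alpha=1$. On $(\Omega,\mathcal F,P^0)$ let the signal $X$ be such a process, with initial law $\mu_0$ and with $X_0$ independent of the increments, and let $V$ be a standard $\mathbb R^{d_2}$-valued Brownian motion independent of $X$. Let $h=(h_1,\dots,h_{d_2})'$ have rapidly decreasing (Schwartz) components. The observations are $Y_0=0$, $Y_{t_k}=Y_{t_{k-1}}+\varepsilon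 h(X_{t_k})+V_{t_k}-V_{t_{k-1}}$, and, for $k\ge1$, $$\varrho_k^\varepsilon(x)=\exp\Bigl\{(Y_{t_k}-Y_{t_{k-1}})'h(x)-\frac{\varepsilon\,(h'h)(x)}{2}\Bigr\}-1,\qquad \xi_k^\varepsilon(x)=\begin{cases}\varrho_k^\varepsilon(x),&\varrho_k^\varepsilon(x)<0,\\ \varrho_k^\varepsilon(x)-\lfloor\varrho_k^\varepsilon(x)\rfloor,&\text{otherwise.}\end{cases}$$ On a second probability space $(\Omega^*,\mathcal F^*,P^*)$ let $\{\rho^i\}_{i\le n}$ be i.i.d. with law $\mu_0$, $\{\tilde X^i\}_{i\ge1}$ independent Lévy-stable processes with index $\alpha$ and spectral measure $\Gamma$, and $\{U^{i,k}\}_{i,k\ge 1}$ independent and uniform on $[0,1]$, the three families being independent of one another. Let $\hat P=P^0\otimes P^*$, with expectation $\hat E$. **Particle system.** At time $0$ there are $n$ particles $X_0^{i,n}=\rho^i$. On $[t_{k-1},t_k)$ the particle with label $i$ moves as $X_t^{i,n}=X_{t_{k-1}}^{i,n}+\tilde X_t^i-\tilde X_{t_{k-1}}^i$. At time $t_k$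 a particle with label $i$ located at $x=X_{t_k-}^{i,n}$ is replaced by $\lfloor\varrho_k^\varepsilon(x)\rfloor+1+\mathbf 1\{U^{i,k}\le\varrho_k^\varepsilon(x)-\lfloor\varrho_k^\varepsilon(x)\rfloor\}$ particles at $x$ if $\varrho_k^\varepsilon(x)\ge0$; if $\varrho_k^\varepsilon(x)<0$ it is kept when $U^{i,k}>|\varrho_k^\varepsilon(x)|$ and removed otherwise. The particles alive are then relabelled $1,\dots,\|\mu^n_{t_k}\|$, in the order of the labels of their parents. Let $\|\mu_t^n\|$ be the number of particles alive at time $t$, $\mu_t^n=\frac1n\sum_{i=1}^{\|\mu_t^n\|}\delta_{X_t^{i,n}}$, and $\langle\mu,\varphi\rangle=\int\varphi\,d\mu$. Let $\mathcal Y^t$ be generated by $\{Y_{t_k}:t_k\le t\}$ and the $P^0$-null sets, and let $$\mathcal G^t=\bigcap_{\delta>0}\Bigl(\sigma\{X_s^{i,n},\,i\le\|\mu_s^n\|,\,s\le t+\delta\}\vee\mathcal Y^{T\vee t}\vee\sigma\{U^{i,k}:t_k\le t\}\Bigr).$$ Let $\mathcal L$ be the infinitesimal generator of the signal on bounded measurable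 functions ($\mathcal L\varphi$ is the bounded pointwise limit of $(P_u\varphi-\varphi)/u$ as $u\downarrow0$, $P_u$ being the transition semigroup), and let $\mathcal T$ be the set of bounded measurable real functions $\varphi$ for which $\mathcal L\varphi$ exists and is bounded and measurable. $[Z]$ denotes the quadratic variation process of $Z$. For a process $Q$ with $Q_0=0$, let $$\hat E^U\{Q_t\}=\sum_{k=1}^{\lfloor t/\varepsilon\rfloor+1}\hat E\bigl\{Q_{t_k\wedge t}-Q_{t_{k-1}\wedge t}\bigm|\mathcal H_k\bigr\},\qquad \mathcal H_k=\mathcal F\vee\sigma\{\rho^i,\ \tilde X^i,\ U^{i,j}: i\ge 1,\ j<k\},$$ that is, in the increment of $Q$ over $(t_{k-1},t_k]$ the expectation is taken only with respect to the branching variables $\{U^{i,k}\}_i$ of time $t_k$. **Claim.** There are constants $c(r)>0$, $r\ge2$, depending on $r$ only, such that in every such setting the following holds for every $\varphi\in\mathcal T$. (i) For all $t\ge0$, $$\langle\mu_t^n,\varphi\rangle=\langle\mu_0^n,\varphi\rangle+\int_0^t\langle\mu_s^n,\mathcal L\varphi\rangle\,ds+\sum_{k=1}^{\lfloor t/\varepsilon\rfloor}\langle\mu_{k\varepsilon-}^n,\varrho_k^\varepsilon\varphi\rangle+\mathcal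 M_t^n(\varphi),$$ where $\{\mathcal M_t^n(\varphi)\}_{t\ge0}$ is a $\{\mathcal G^t\}$-martingale with almost surely càdlàg paths. (ii) The quadratic variation processes below exist, $[\mathcal M^n(\varphi)]_t$ is integrable, and for every $t\ge0$, almost surely, $$\hat E^U\{[\mathcal M^n(\varphi)]_t\}=\frac1{n^2}\sum_{k=0}^{\lfloor t/\varepsilon\rfloor}\sum_{i=1}^{\|\mu_{t_k}^n\|}\bigl([\varphi(X^{i,n})]_{t_{k+1}\wedge t}-[\varphi(X^{i,n})]_{t_k}\bigr)+\frac1n\sum_{k=1}^{\lfloor t/\varepsilon\rfloor}\bigl\langle\mu_{k\varepsilon-}^n,(|\xi_k^\varepsilon|-(\xi_k^\varepsilon)^2)\varphi^2\bigr\rangle,$$ where in the $k$-th summand $X^{i,n}$ is the path, on $[t_k,t_{k+1}]$, of the particle that has label $i$ at time $t_k$, before the branching at $t_{k+1}$. (iii) Put $D_t=[\mathcal M^n(\varphi)]_t-\hat E^U\{[\mathcal M^n(\varphi)]_t\}$. For all $r\ge2$, all real sequences $\{f_k\}_{k\ge1}$ and all $0\le s<t\le T$, $$\hat E\Bigl\{\Bigl|\sum_{k=\lfloor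 s/\varepsilon\rfloor+1}^{\lfloor t/\varepsilon\rfloor}f_k\bigl(D_{k\varepsilon}-D_{(k-1)\varepsilon}\bigr)\Bigr|^r\Bigr\}\le c(r)\,(\|h'h\|_\infty\vee1)^{r/2}\Bigl|\sum_{k=\lfloor s/\varepsilon\rfloor+1}^{\lfloor t/\varepsilon\rfloor}f_k^2\Bigr|^{r/2}\frac{\varepsilon^{1/2}}{n^r}\Bigl(\sup_{0\le\tau\le T}\hat E\{\langle\mu_\tau^n,1\rangle^r\}\Bigr)\|\varphi\|_\infty^{2r}.$$ -/

import Mathlib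

open MeasureTheory ProbabilityTheory Filter Topology Set
open scoped NNReal ENNReal RealInnerProductSpace SchwartzMap

universe u v

noncomputable section

/-- The Euclidean space `ℝ^d`. -/
abbrev Vec (d : ℕ) : Type := EuclideanSpace ℝ (Fin d)

/-- Right-continuity with left limits. -/
def IsCadlag {β : Type*} [TopologicalSpace β] (f : ℝ≥0 → β) : Prop :=
  ∀ t, ContinuousWithinAt f (Ici t) t ∧ ∃ l, Tendsto f (𝓝[<] t) (𝓝 l)

/-! ### Quadratic variation -/

/-- `Q` is the quadratic variation process `[Z]` (normalised by `[Z]_0 = 0`): a process with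
nondecreasing càdlàg paths which at every time `t` is the limit in probability of the sums of
squared increments of `Z`, along every sequence of partitions
`0 = p m 0 ≤ p m 1 ≤ ... ≤ p m (K m) = t` whose mesh tends to `0`. -/
structure IsQuadraticVariation {Ω : Type*} [MeasurableSpace Ω] (P : Measure Ω)
    (Z Q : ℝ≥0 → Ω → ℝ) : Prop where
  measurable : ∀ t, Measurable (Q t)
  paths : ∀ᵐ ω ∂P, Q 0 ω = 0 ∧ Monotone (fun t => Q t ω) ∧ IsCadlag (fun t => Q t ω)
  tendsto : ∀ (t : ℝ≥0) (p : ℕ → ℕ → ℝ≥0) (K : ℕ → ℕ),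
    (∀ m, Monotone (p m)) → (∀ m, p m 0 = 0) → (∀ m, p m (K m) = t) →
    (∀ δ : ℝ≥0, 0 < δ → ∀ᶠ m in atTop, ∀ j < K m, p m (j + 1) - p m j ≤ δ) →
    TendstoInMeasure P
      (fun m ω => ∑ j ∈ Finset.range (K m), (Z (p m (j + 1)) ω - Z (p m j) ω) ^ 2) atTop (Q t)

/-! ### Lévy-stable processes and their generators -/

/-- The exponent of a stable law with index `α` and spectral measure `Γ` on the unit sphere. -/
def stableExponent {d : ℕ} (α : ℝ) (Γ : Measure (Metric.sphere (0 : Vec d) 1)) (θ : Vec d) : ℂ :=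
  if α = 1 then
    -∫ z, ((|⟪θ, (z : Vec d)⟫| : ℝ) : ℂ) *
      (1 + 2 * Complex.I / (Real.pi : ℂ) * (Real.sign ⟪θ, (z : Vec d)⟫ : ℂ) *
        (Real.log |⟪θ, (z : Vec d)⟫| : ℂ)) ∂Γ
  else
    -∫ z, ((|⟪θ, (z : Vec d)⟫| ^ α : ℝ) : ℂ) *
      (1 - Complex.I * (Real.sign ⟪θ, (z : Vec d)⟫ : ℂ) *
        (Real.tan (α * Real.pi / 2) : ℂ)) ∂Γ

/-- A càdlàg process with independent increments such that the logarithm of the characteristic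
function of `X t - X s` is `(t - s)` times the stable exponent. -/
structure IsLevyStable {d : ℕ} {Ω : Type*} [MeasurableSpace Ω] (P : Measure Ω) (α : ℝ)
    (Γ : Measure (Metric.sphere (0 : Vec d) 1)) (X : ℝ≥0 → Ω → Vec d) : Prop where
  measurable : ∀ t, Measurable (X t)
  cadlag : ∀ ω, IsCadlag (fun t => X t ω)
  indep : HasIndepIncrements X P
  charFun_increment : ∀ s t : ℝ≥0, s ≤ t → ∀ θ : Vec d,
    charFun (P.map (fun ω => X t ω - X s ω)) θ
      = Complex.exp ((((t : ℝ) - (s : ℝ) : ℝ) : ℂ) * stableExponent α Γ θ)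

/-- A standard Brownian motion in `ℝ^d`: the components are independent real Brownian motions. -/
structure IsBrownianVec {d : ℕ} {Ω : Type*} [MeasurableSpace Ω] (P : Measure Ω)
    (V : ℝ≥0 → Ω → Vec d) : Prop where
  measurable : ∀ t, Measurable (V t)
  brownian : ∀ i : Fin d, IsBrownianReal (fun t ω => V t ω i) P
  indep : iIndepFun (fun (i : Fin d) (ω : Ω) (t : ℝ≥0) => V t ω i) P

/-- The transition semigroup of a process with stationary independent increments. -/
def transition {d : ℕ} {Ω : Type*} [MeasurableSpace Ω] (P : Measure Ω) (X : ℝ≥0 → Ω → Vec d)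
    (t : ℝ≥0) (φ : Vec d → ℝ) (x : Vec d) : ℝ :=
  ∫ ω, φ (x + (X t ω - X 0 ω)) ∂P

/-- `φ` is a bounded measurable function in the domain of the (weak) infinitesimal generator `𝓛`
of the semigroup of `X` on bounded measurable functions, and `𝓛 φ = g` is bounded and measurable:
`g` is the bounded pointwise limit of `(P_t φ - φ) / t` as `t ↓ 0`. -/
structure HasGenerator {d : ℕ} {Ω : Type*} [MeasurableSpace Ω] (P : Measure Ω)
    (X : ℝ≥0 → Ω → Vec d) (φ g : Vec d → ℝ) : Prop where
  measurable : Measurable φ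
  bounded : ∃ C : ℝ, ∀ x, |φ x| ≤ C
  measurable_gen : Measurable g
  bounded_gen : ∃ C : ℝ, ∀ x, |g x| ≤ C
  bounded_quotient : ∃ C : ℝ, ∀ (t : ℝ≥0) (x : Vec d), 0 < t →
    |(transition P X t φ x - φ x) / t| ≤ C
  tendsto : ∀ x, Tendsto (fun t : ℝ≥0 => (transition P X t φ x - φ x) / t) (𝓝[>] 0) (𝓝 (g x))

/-! ### The filtering model, the observations and the sources of randomness -/

/-- The signal `X`, the observation noise `V` and the sensor function `h` on the probability space
`(Ω, P)`, and the initial positions `ρ`, the stable processes `Xp` and the uniform variables `U`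
on the auxiliary probability space `(Ω', P')`. -/
structure FilterModel (d₁ d₂ : ℕ) (Ω Ω' : Type*) [MeasurableSpace Ω] [MeasurableSpace Ω'] where
  P : Measure Ω
  P' : Measure Ω'
  probP : IsProbabilityMeasure P
  probP' : IsProbabilityMeasure P'
  α : ℝ
  α_pos : 0 < α
  α_le : α ≤ 2
  Γ : Measure (Metric.sphere (0 : Vec d₁) 1)
  finiteΓ : IsFiniteMeasure Γ
  h : 𝓢(Vec d₁, Vec d₂)
  ε : ℝ≥0
  ε_pos : 0 < ε
  ε_le : ε ≤ 1
  n : ℕ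
  n_pos : 0 < n
  /-- the law of the initial state of the signal -/
  μ₀ : Measure (Vec d₁)
  /-- the signal -/
  X : ℝ≥0 → Ω → Vec d₁
  stableX : IsLevyStable P α Γ X
  initX : P.map (X 0) = μ₀
  indepX : IndepFun (X 0) (fun ω (t : ℝ≥0) => X t ω - X 0 ω) P
  /-- the observation noise -/
  V : ℝ≥0 → Ω → Vec d₂
  brownianV : IsBrownianVec P V
  indepXV : IndepFun (fun ω (t : ℝ≥0) => X t ω) (fun ω (t : ℝ≥0) => V t ω) P
  /-- the initial particle positions -/
  ρ : Fin n → Ω' → Vec d₁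
  measurableρ : ∀ i, Measurable (ρ i)
  lawρ : ∀ i, P'.map (ρ i) = μ₀
  indepρ : iIndepFun ρ P'
  /-- the stable processes that move the particles -/
  Xp : ℕ → ℝ≥0 → Ω' → Vec d₁
  stableXp : ∀ i, IsLevyStable P' α Γ (Xp i)
  indepXp : iIndepFun (fun (i : ℕ) (ω : Ω') (t : ℝ≥0) => Xp i t ω) P'
  /-- the uniform variables that decide on branching: `U i k` is used for the particle with label
  `i` at the observation time `kε` -/
  U : ℕ → ℕ → Ω' → ℝ
  measurableU : ∀ i k, Measurable (U i k)
  lawU : ∀ i k, P'.map (U i k) = (volume : Measure ℝ).restrict (Icc 0 1)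
  indepU : iIndepFun (fun (ik : ℕ × ℕ) => U ik.1 ik.2) P'
  indepρXp : IndepFun (fun ω (i : Fin n) => ρ i ω)
    (fun ω (i : ℕ) (t : ℝ≥0) => Xp i t ω) P'
  indepρXpU : IndepFun
    (fun ω => ((fun i : Fin n => ρ i ω), (fun (i : ℕ) (t : ℝ≥0) => Xp i t ω)))
    (fun ω (i k : ℕ) => U i k ω) P'

/-- The empirical measure `(1/n) ∑ δ_x`, the sum being over the list `L`. -/
def empirical {d : ℕ} (n : ℕ) (L : List (Vec d)) : Measure (Vec d) :=
  (n : ℝ≥0∞)⁻¹ • (L.map Measure.dirac).sum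

namespace FilterModel

variable {d₁ d₂ : ℕ} {Ω Ω' : Type*} [MeasurableSpace Ω] [MeasurableSpace Ω']
  (𝔐 : FilterModel d₁ d₂ Ω Ω')

/-- The product probability measure on `Ω × Ω'`. -/
def Phat : Measure (Ω × Ω') := 𝔐.P.prod 𝔐.P'

/-- The observation times `t_k = kε`. -/
def tk (k : ℕ) : ℝ≥0 := k * 𝔐.ε

/-- The observation `Y_{t_k}`, with `Y_0 = 0`. -/
def Y : ℕ → Ω → Vec d₂
  | 0, _ => 0
  | k + 1, ω => Y k ω + ((𝔐.tk (k + 1) : ℝ) - (𝔐.tk k : ℝ)) • 𝔐.h (𝔐.X (𝔐.tk (k + 1)) ω)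
      + (𝔐.V (𝔐.tk (k + 1)) ω - 𝔐.V (𝔐.tk k) ω)

/-- `ϱ_k(x) = exp((Y_{t_k} - Y_{t_{k-1}})' h(x) - (t_k - t_{k-1}) (h'h)(x) / 2) - 1`, for
`k ≥ 1`. -/
def weight (k : ℕ) (x : Vec d₁) (ω : Ω) : ℝ :=
  Real.exp (⟪𝔐.Y k ω - 𝔐.Y (k - 1) ω, 𝔐.h x⟫
    - ((𝔐.tk k : ℝ) - (𝔐.tk (k - 1) : ℝ)) * ⟪𝔐.h x, 𝔐.h x⟫ / 2) - 1

/-- `ξ_k(x)`: equal to `ϱ_k(x)` if that is negative, and to its fractional part otherwise. -/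
def xi (k : ℕ) (x : Vec d₁) (ω : Ω) : ℝ :=
  if 𝔐.weight k x ω < 0 then 𝔐.weight k x ω else 𝔐.weight k x ω - ⌊𝔐.weight k x ω⌋

/-! ### The branching particle system -/

/-- The number of particles that replace the particle with label `i`, located at `x` just before
time `t_k`. -/
def offspring (k i : ℕ) (x : Vec d₁) (ω : Ω × Ω') : ℕ :=
  if 0 ≤ 𝔐.weight k x ω.1 then
    ⌊𝔐.weight k x ω.1⌋₊ + 1 +
      (if 𝔐.U i k ω.2 ≤ 𝔐.weight k x ω.1 - ⌊𝔐.weight k x ω.1⌋ then 1 else 0)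
  else if |𝔐.weight k x ω.1| < 𝔐.U i k ω.2 then 1 else 0

/-- If `L` lists the particles at time `t_k`, the position at time `t ≥ t_k` of the particle with
label `i`, when it moves as `Xp i`. -/
def evolve (k : ℕ) (L : List (Vec d₁)) (i : ℕ) (t : ℝ≥0) (ω : Ω × Ω') : Vec d₁ :=
  L.getD i 0 + (𝔐.Xp i t ω.2 - 𝔐.Xp i (𝔐.tk k) ω.2)

/-- The left limit at time `t_{k+1}` of the position of the particle with label `i`. -/
def evolveLeft (k : ℕ) (L : List (Vec d₁)) (i : ℕ) (ω : Ω × Ω') : Vec d₁ :=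
  L.getD i 0 + (Function.leftLim (fun t => 𝔐.Xp i t ω.2) (𝔐.tk (k + 1)) - 𝔐.Xp i (𝔐.tk k) ω.2)

/-- The particles alive at time `t_k` after branching, listed by their labels `0, 1, 2, ...`; the
offspring of one generation are relabelled in the order of the labels of their parents. -/
def gen : ℕ → Ω × Ω' → List (Vec d₁)
  | 0, ω => List.ofFn (fun i : Fin 𝔐.n => 𝔐.ρ i ω.2)
  | k + 1, ω => (List.range (gen k ω).length).flatMap fun i =>
      List.replicate (𝔐.offspring (k + 1) i (𝔐.evolveLeft k (gen k ω) i ω) ω)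
        (𝔐.evolveLeft k (gen k ω) i ω)

/-- The particles at time `t`: for `t ∈ [t_k, t_{k+1})` those of `gen k`, moved up to time `t`. -/
def particles (t : ℝ≥0) (ω : Ω × Ω') : List (Vec d₁) :=
  (List.range (𝔐.gen ⌊t / 𝔐.ε⌋₊ ω).length).map fun i =>
    𝔐.evolve ⌊t / 𝔐.ε⌋₊ (𝔐.gen ⌊t / 𝔐.ε⌋₊ ω) i t ω

/-- The particles just before time `t_k`, for `k ≥ 1`. -/
def particlesLeft : ℕ → Ω × Ω' → List (Vec d₁)
  | 0, ω => 𝔐.gen 0 ω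
  | k + 1, ω => (List.range (𝔐.gen k ω).length).map fun i =>
      𝔐.evolveLeft k (𝔐.gen k ω) i ω

/-- The particle density profile `μ_t^n`. -/
def μn (t : ℝ≥0) (ω : Ω × Ω') : Measure (Vec d₁) := empirical 𝔐.n (𝔐.particles t ω)

/-- The left limit `μ_{t_k-}^n` of the particle density profile, for `k ≥ 1`. -/
def μnLeft (k : ℕ) (ω : Ω × Ω') : Measure (Vec d₁) := empirical 𝔐.n (𝔐.particlesLeft k ω)

/-- The process `φ(X^{i,n})` between the times `t_k` and `t_{k+1}`, that is, `φ` along the path of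
the particle that has label `i` at time `t_k` (kept constant before `t_k` and after `t_{k+1}`, and
`0` if there is no such particle). -/
def segment (φ : Vec d₁ → ℝ) (k i : ℕ) (u : ℝ≥0) (ω : Ω × Ω') : ℝ :=
  if i < (𝔐.gen k ω).length then
    φ (𝔐.evolve k (𝔐.gen k ω) i (min (max u (𝔐.tk k)) (𝔐.tk (k + 1))) ω)
  else 0

/-! ### σ-algebras -/

/-- `𝒴^t`: generated by the observations up to time `t` and the null sets. -/
@[reducible] def obsSigma (t : ℝ≥0) : MeasurableSpace Ω :=
  (⨆ (k : ℕ) (_ : 𝔐.tk k ≤ t), MeasurableSpace.comap (𝔐.Y k) inferInstance) ⊔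
    MeasurableSpace.generateFrom {A | MeasurableSet A ∧ 𝔐.P A = 0}

/-- The σ-algebra generated by the particle system up to time `t`: by the number of particles and
the position of the particle with label `i` (if there is one, and `0` otherwise), at all times
`s ≤ t`. -/
@[reducible] def particleSigma (t : ℝ≥0) : MeasurableSpace (Ω × Ω') :=
  ⨆ (s : ℝ≥0) (_ : s ≤ t),
    (MeasurableSpace.comap (fun ω => (𝔐.particles s ω).length) ⊤ ⊔
      ⨆ i : ℕ, MeasurableSpace.comap (fun ω => (𝔐.particles s ω).getD i 0) inferInstance)

/-- The σ-algebra generated by the uniform variables `U i k` with `1 ≤ k` and `t_k ≤ t`. -/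
@[reducible] def uniformSigma (t : ℝ≥0) : MeasurableSpace (Ω × Ω') :=
  ⨆ (i : ℕ) (k : ℕ) (_ : 1 ≤ k ∧ 𝔐.tk k ≤ t),
    MeasurableSpace.comap (fun ω => 𝔐.U i k ω.2) inferInstance

/-- The σ-algebra of everything except the uniform variables of the observation times
`t_k, t_{k+1}, ...`. -/
@[reducible] def exceptU (k : ℕ) : MeasurableSpace (Ω × Ω') :=
  MeasurableSpace.comap Prod.fst inferInstance ⊔
  (⨆ i, MeasurableSpace.comap (fun ω : Ω × Ω' => 𝔐.ρ i ω.2) inferInstance) ⊔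
  (⨆ (i : ℕ) (t : ℝ≥0), MeasurableSpace.comap (fun ω : Ω × Ω' => 𝔐.Xp i t ω.2) inferInstance) ⊔
  (⨆ (i : ℕ) (j : ℕ) (_ : j < k),
    MeasurableSpace.comap (fun ω : Ω × Ω' => 𝔐.U i j ω.2) inferInstance)

/-- `Ê^U{Q_t}` for a process `Q` with `Q_0 = 0`: in the increment of `Q` over each interval
`(t_{k-1}, t_k]`, the expectation is taken with respect to the uniform variables `U i k` of that
observation time only, all other sources of randomness and the earlier uniform variables being
kept fixed. -/
def expU (Q : ℝ≥0 → Ω × Ω' → ℝ) (t : ℝ≥0) (ω : Ω × Ω') : ℝ :=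
  ∑ k ∈ Finset.Icc 1 (⌊t / 𝔐.ε⌋₊ + 1),
    (𝔐.Phat[fun ω' => Q (min (𝔐.tk k) t) ω' - Q (min (𝔐.tk (k - 1)) t) ω' | 𝔐.exceptU k]) ω

end FilterModel

/-! ### Measurability, and the filtration `𝒢` -/

/-- A random list with measurable length and measurable entries. -/
def MeasurableList {d : ℕ} {S : Type*} [MeasurableSpace S] (l : S → List (Vec d)) : Prop :=
  Measurable (fun ω => (l ω).length) ∧ ∀ i, Measurable (fun ω => (l ω).getD i 0)

theorem measurable_natIndex {β S : Type*} [MeasurableSpace S] [MeasurableSpace β]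
    {f : ℕ → S → β} (hf : ∀ i, Measurable (f i)) {N : S → ℕ} (hN : Measurable N) :
    Measurable (fun ω => f (N ω) ω) :=
  (measurable_from_prod_countable_right (f := fun p : ℕ × S => f p.1 p.2) hf).comp
    (hN.prodMk measurable_id)

theorem MeasurableList.nil {d : ℕ} {S : Type*} [MeasurableSpace S] :
    MeasurableList (fun _ : S => ([] : List (Vec d))) :=
  ⟨measurable_const, fun i => by simp⟩

theorem MeasurableList.append {d : ℕ} {S : Type*} [MeasurableSpace S] {l l' : S → List (Vec d)}
    (h : MeasurableList l) (h' : MeasurableList l') : MeasurableList (fun ω => l ω ++ l' ω) := by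
  refine ⟨by simpa only [List.length_append] using h.1.fun_add h'.1, fun i => ?_⟩
  have : (fun ω => (l ω ++ l' ω).getD i 0)
      = fun ω => if i < (l ω).length then (l ω).getD i 0
          else (l' ω).getD (i - (l ω).length) 0 := by
    funext ω
    split_ifs with hi
    · exact List.getD_append _ _ _ _ hi
    · exact List.getD_append_right _ _ _ _ (not_lt.1 hi)
  rw [this]
  refine Measurable.ite (h.1 (measurableSet_Ioi (a := i))) (h.2 i) ?_
  exact measurable_natIndex (f := fun j ω => (l' ω).getD j 0) h'.2
    ((measurable_from_nat (f := fun m => i - m)).comp h.1)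

theorem MeasurableList.replicate {d : ℕ} {S : Type*} [MeasurableSpace S] {m : S → ℕ}
    {x : S → Vec d} (hm : Measurable m) (hx : Measurable x) :
    MeasurableList (fun ω => List.replicate (m ω) (x ω)) := by
  refine ⟨by simpa using hm, fun i => ?_⟩
  have : (fun ω => (List.replicate (m ω) (x ω)).getD i 0)
      = fun ω => if i < m ω then x ω else 0 := by
    funext ω
    split_ifs with hi
    · simp [List.getD_eq_getElem?_getD, hi]
    · simp [List.getD_eq_getElem?_getD, hi]
  rw [this]
  exact Measurable.ite (hm (measurableSet_Ioi (a := i))) hx measurable_const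

theorem MeasurableList.flatMap_range {d : ℕ} {S : Type*} [MeasurableSpace S] {N : S → ℕ}
    {f : ℕ → S → List (Vec d)} (hN : Measurable N) (hf : ∀ i, MeasurableList (f i)) :
    MeasurableList (fun ω => (List.range (N ω)).flatMap fun i => f i ω) := by
  have key : ∀ n : ℕ, MeasurableList (fun ω => (List.range n).flatMap fun i => f i ω) := by
    intro n
    induction n with
    | zero => simpa using MeasurableList.nil
    | succ n ih => simpa [List.range_succ, List.flatMap_append] using ih.append (hf n)
  exact ⟨measurable_natIndex
      (f := fun n ω => ((List.range n).flatMap fun i => f i ω).length) (fun n => (key n).1) hN,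
    fun i => measurable_natIndex
      (f := fun n ω => ((List.range n).flatMap fun i => f i ω).getD i 0)
      (fun n => (key n).2 i) hN⟩

theorem MeasurableList.map_range {d : ℕ} {S : Type*} [MeasurableSpace S] {N : S → ℕ}
    {f : ℕ → S → Vec d} (hN : Measurable N) (hf : ∀ i, Measurable (f i)) :
    MeasurableList (fun ω => (List.range (N ω)).map fun i => f i ω) := by
  have := MeasurableList.flatMap_range hN
    (fun i => MeasurableList.replicate (measurable_const (a := 1)) (hf i))
  simpa [List.flatMap_singleton', ← List.map_eq_flatMap] using this

theorem measurable_leftLim {d : ℕ} {S : Type*} [MeasurableSpace S] {Z : ℝ≥0 → S → Vec d}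
    (hZ : ∀ t, Measurable (Z t)) (hc : ∀ ω, IsCadlag (fun t => Z t ω)) {t : ℝ≥0} (ht : 0 < t) :
    Measurable (fun ω => Function.leftLim (fun s => Z s ω) t) := by
  obtain ⟨u, -, hu, hlim⟩ := exists_seq_strictMono_tendsto' ht
  have hu' : Tendsto u atTop (𝓝[<] t) :=
    tendsto_nhdsWithin_iff.2 ⟨hlim, Eventually.of_forall fun n => (hu n).2⟩
  have : (𝓝[<] t).NeBot := hu'.neBot
  refine measurable_of_tendsto_metrizable (f := fun n ω => Z (u n) ω) (fun n => hZ (u n)) ?_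
  rw [tendsto_pi_nhds]
  intro ω
  obtain ⟨l, hl⟩ := (hc ω t).2
  rw [leftLim_eq_of_tendsto hl]
  exact hl.comp hu'

namespace FilterModel

variable {d₁ d₂ : ℕ} {Ω Ω' : Type*} [MeasurableSpace Ω] [MeasurableSpace Ω']
  (𝔐 : FilterModel d₁ d₂ Ω Ω')

theorem tk_succ_pos (k : ℕ) : 0 < 𝔐.tk (k + 1) :=
  mul_pos (by positivity) 𝔐.ε_pos

theorem measurable_Y (k : ℕ) : Measurable (𝔐.Y k) := by
  induction k with
  | zero => exact measurable_const
  | succ k ih =>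
    have h1 : Measurable fun ω => 𝔐.h (𝔐.X (𝔐.tk (k + 1)) ω) :=
      𝔐.h.continuous.measurable.comp (𝔐.stableX.measurable _)
    have h2 : Measurable fun ω => 𝔐.V (𝔐.tk (k + 1)) ω - 𝔐.V (𝔐.tk k) ω :=
      (𝔐.brownianV.measurable _).sub (𝔐.brownianV.measurable _)
    exact (ih.fun_add (h1.fun_const_smul ((𝔐.tk (k + 1) : ℝ) - (𝔐.tk k : ℝ)))).fun_add h2

theorem measurable_weight (k : ℕ) {S : Type*} [MeasurableSpace S] {x : S → Vec d₁} {w : S → Ω}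
    (hx : Measurable x) (hw : Measurable w) : Measurable (fun s => 𝔐.weight k (x s) (w s)) := by
  have h1 : Measurable fun s => 𝔐.h (x s) := 𝔐.h.continuous.measurable.comp hx
  have h2 : Measurable fun s => 𝔐.Y k (w s) - 𝔐.Y (k - 1) (w s) :=
    ((𝔐.measurable_Y k).comp hw).sub ((𝔐.measurable_Y (k - 1)).comp hw)
  exact ((Real.measurable_exp.comp ((h2.inner h1).sub
    (((h1.inner h1).const_mul _).div_const 2))).sub_const 1)

theorem measurable_offspring (k i : ℕ) {x : Ω × Ω' → Vec d₁} (hx : Measurable x) :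
    Measurable (fun ω => 𝔐.offspring k i (x ω) ω) := by
  have hw := 𝔐.measurable_weight k hx measurable_fst
  have hU : Measurable fun ω : Ω × Ω' => 𝔐.U i k ω.2 := (𝔐.measurableU i k).comp measurable_snd
  have hfl : Measurable fun ω : Ω × Ω' => ((⌊𝔐.weight k (x ω) ω.1⌋ : ℤ) : ℝ) :=
    (measurable_from_top (f := fun z : ℤ => (z : ℝ))).comp (Int.measurable_floor.comp hw)
  refine Measurable.ite (measurableSet_le measurable_const hw) ?_ ?_
  · exact ((Nat.measurable_floor.comp hw).add_const 1).add
      (Measurable.ite (measurableSet_le hU (hw.sub hfl)) measurable_const measurable_const)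
  · exact Measurable.ite (measurableSet_lt hw.abs hU) measurable_const measurable_const

theorem measurableList_gen (k : ℕ) : MeasurableList (𝔐.gen k) := by
  induction k with
  | zero =>
    refine ⟨by simp [gen], fun i => ?_⟩
    by_cases hi : i < 𝔐.n
    · have : (fun ω => (𝔐.gen 0 ω).getD i 0) = fun ω => 𝔐.ρ ⟨i, hi⟩ ω.2 := by
        funext ω
        simp [gen, List.getD_eq_getElem?_getD, hi]
      rw [this]
      exact (𝔐.measurableρ _).comp measurable_snd
    · have : (fun ω => (𝔐.gen 0 ω).getD i 0) = fun _ => 0 := by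
        funext ω
        simp [gen, List.getD_eq_getElem?_getD, hi]
      rw [this]
      exact measurable_const
  | succ k ih =>
    have hl : ∀ i, Measurable fun ω => 𝔐.evolveLeft k (𝔐.gen k ω) i ω := fun i =>
      (ih.2 i).add (((measurable_leftLim (𝔐.stableXp i).measurable (𝔐.stableXp i).cadlag
        (𝔐.tk_succ_pos k)).comp measurable_snd).sub
          (((𝔐.stableXp i).measurable _).comp measurable_snd))
    exact MeasurableList.flatMap_range ih.1 fun i =>
      MeasurableList.replicate (𝔐.measurable_offspring (k + 1) i (hl i)) (hl i)

theorem measurableList_particles (t : ℝ≥0) : MeasurableList (𝔐.particles t) :=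
  MeasurableList.map_range (𝔐.measurableList_gen _).1 fun i =>
    ((𝔐.measurableList_gen _).2 i).add ((((𝔐.stableXp i).measurable _).comp measurable_snd).sub
      (((𝔐.stableXp i).measurable _).comp measurable_snd))

theorem obsSigma_le (t : ℝ≥0) : 𝔐.obsSigma t ≤ (inferInstance : MeasurableSpace Ω) :=
  sup_le (iSup₂_le fun k _ => (𝔐.measurable_Y k).comap_le)
    (MeasurableSpace.generateFrom_le fun _ hA => hA.1)

theorem obsSigma_mono {s t : ℝ≥0} (h : s ≤ t) : 𝔐.obsSigma s ≤ 𝔐.obsSigma t := by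
  refine sup_le_sup (iSup_mono fun k => ?_) le_rfl
  exact iSup_mono' fun hk => ⟨hk.trans h, le_rfl⟩

theorem particleSigma_le (t : ℝ≥0) : 𝔐.particleSigma t ≤ (inferInstance : MeasurableSpace (Ω × Ω')) :=
  iSup₂_le fun s _ => sup_le (𝔐.measurableList_particles s).1.comap_le
    (iSup_le fun i => ((𝔐.measurableList_particles s).2 i).comap_le)

theorem particleSigma_mono {s t : ℝ≥0} (h : s ≤ t) : 𝔐.particleSigma s ≤ 𝔐.particleSigma t :=
  iSup₂_le fun u hu => le_iSup₂_of_le u (hu.trans h) le_rfl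

theorem uniformSigma_le (t : ℝ≥0) : 𝔐.uniformSigma t ≤ (inferInstance : MeasurableSpace (Ω × Ω')) :=
  iSup_le fun i => iSup₂_le fun k _ => ((𝔐.measurableU i k).comp measurable_snd).comap_le

theorem uniformSigma_mono {s t : ℝ≥0} (h : s ≤ t) : 𝔐.uniformSigma s ≤ 𝔐.uniformSigma t :=
  iSup_mono fun _ => iSup₂_le fun k hk => le_iSup₂_of_le k ⟨hk.1, hk.2.trans h⟩ le_rfl

/-- The filtration `𝒢` of the whole particle system construction: the particles up to immediately
after time `t`, all observations up to the horizon `T` (and up to `t` itself if `t > T`), and the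
uniform variables used up to time `t`. -/
def filtG (T : ℝ≥0) : Filtration ℝ≥0 (inferInstance : MeasurableSpace (Ω × Ω')) where
  seq t := ⨅ (δ : ℝ≥0) (_ : 0 < δ),
    (𝔐.particleSigma (t + δ) ⊔ MeasurableSpace.comap Prod.fst (𝔐.obsSigma (max T t)) ⊔
      𝔐.uniformSigma t)
  mono' := fun _ _ h => iInf₂_mono fun δ _ =>
    sup_le_sup (sup_le_sup (𝔐.particleSigma_mono (add_le_add_left h δ))
      (MeasurableSpace.comap_mono (𝔐.obsSigma_mono (max_le_max_left T h))))
      (𝔐.uniformSigma_mono h)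
  le' := fun _ => (iInf₂_le 1 one_pos).trans <|
    sup_le (sup_le (𝔐.particleSigma_le _)
      ((MeasurableSpace.comap_mono (𝔐.obsSigma_le _)).trans measurable_fst.comap_le))
      (𝔐.uniformSigma_le _)

end FilterModel

end

noncomputable section

open Finset (range mem_range sum_congr mul_sum sum_range_succ sum_sub_distrib sum_le_sum
  sum_nonneg sum_eq_zero sum_range_sub measurable_fun_sum sum_le_card_nsmul card_range
  sum_subset)
open MeasurableSpace (comap comap_comp comap_mono)
open ENNReal (ofReal ofReal_le_ofReal ofReal_mul measurable_ofReal)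
open Real (exp_le_one_iff exp_le_exp coe_toNNReal toNNReal_le_iff_le_coe rpow_add
  measurable_exp rpow_le_rpow_of_exponent_le fourier_eq' exp norm_eq_abs rpow_mul rpow_le_rpow
  mul_rpow rpow_nonneg exp_pos zero_rpow rpow_one
  rpow_natCast)
open Function (uncurry)
open Metric (sphere)
open scoped Real

/-! ### Bounded measurable functions -/

/-- Bounded real functions that are measurable with respect to `m`. -/
def BddMeas {S : Type*} (m : MeasurableSpace S) (f : S → ℝ) : Prop :=
  Measurable[m] f ∧ ∃ C, ∀ w, |f w| ≤ C

namespace BddMeas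

variable {S : Type*} {m m' : MeasurableSpace S} {f g : S → ℝ}

lemma mono (hf : BddMeas m f) (h : m ≤ m') : BddMeas m' f := ⟨hf.1.mono h le_rfl, hf.2⟩

lemma const (c : ℝ) : BddMeas m (fun _ => c) := ⟨measurable_const, |c|, fun _ => le_rfl⟩

lemma add (hf : BddMeas m f) (hg : BddMeas m g) : BddMeas m (fun w => f w + g w) := by
  obtain ⟨hf, C, hC⟩ := hf
  obtain ⟨hg, D, hD⟩ := hg
  exact ⟨hf.add hg, C + D, fun w => (abs_add_le _ _).trans (add_le_add (hC w) (hD w))⟩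

lemma neg (hf : BddMeas m f) : BddMeas m (fun w => -f w) := by
  obtain ⟨hf, C, hC⟩ := hf
  exact ⟨hf.neg, C, fun w => by simpa using hC w⟩

lemma sub (hf : BddMeas m f) (hg : BddMeas m g) : BddMeas m (fun w => f w - g w) := by
  simpa only [sub_eq_add_neg] using hf.add hg.neg

lemma mul (hf : BddMeas m f) (hg : BddMeas m g) : BddMeas m (fun w => f w * g w) := by
  obtain ⟨hf, C, hC⟩ := hf
  obtain ⟨hg, D, hD⟩ := hg
  exact ⟨hf.mul hg, C * D, fun w => by
    rw [abs_mul]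
    exact mul_le_mul (hC w) (hD w) (abs_nonneg _) ((abs_nonneg _).trans (hC w))⟩

lemma const_mul (c : ℝ) (hf : BddMeas m f) : BddMeas m (fun w => c * f w) := (const c).mul hf

lemma pow (hf : BddMeas m f) (k : ℕ) : BddMeas m (fun w => f w ^ k) := by
  obtain ⟨hf, C, hC⟩ := hf
  exact ⟨hf.pow_const k, C ^ k, fun w => by
    rw [abs_pow]; exact pow_le_pow_left₀ (abs_nonneg _) (hC w) k⟩

lemma abs (hf : BddMeas m f) : BddMeas m (fun w => |f w|) := by
  obtain ⟨hf, C, hC⟩ := hf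
  exact ⟨_root_.measurable_abs.comp hf, C, fun w => by simpa using hC w⟩

lemma max (hf : BddMeas m f) (hg : BddMeas m g) : BddMeas m (fun w => Max.max (f w) (g w)) := by
  obtain ⟨hf, C, hC⟩ := hf
  obtain ⟨hg, D, hD⟩ := hg
  exact ⟨hf.max hg, Max.max C D, fun w => abs_max_le_max_abs_abs.trans (max_le_max (hC w) (hD w))⟩

lemma sum {ι : Type*} {s : Finset ι} {f : ι → S → ℝ} (hf : ∀ i ∈ s, BddMeas m (f i)) :
  BddMeas m (fun w => ∑ i ∈ s, f i w) := by
  classical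
  induction s using Finset.induction_on with
  | empty => simpa using const 0
  | insert a s ha ih =>
    simp only [Finset.sum_insert ha]
    exact (hf a (by simp)).add (ih fun i hi => hf i (by simp [hi]))

lemma comp {F : ℝ → ℝ} (hf : BddMeas m f) (hF : Measurable F) {C : ℝ} (hC : ∀ x, |F x| ≤ C) :
  BddMeas m (fun w => F (f w)) := ⟨hF.comp hf.1, C, fun _ => hC _⟩

lemma indicator {A : Set S} (hA : MeasurableSet[m] A) : BddMeas m (A.indicator fun _ => 1) :=
  ⟨measurable_const.indicator hA, 1, fun w => by by_cases h : w ∈ A <;> simp [h]⟩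

lemma integrable {m0 : MeasurableSpace S} {P : Measure S} [IsFiniteMeasure P]
  (hf : BddMeas m f) (h : m ≤ m0) : Integrable f P := by
  obtain ⟨hf, C, hC⟩ := hf
  exact Integrable.of_bound (hf.mono h le_rfl).aestronglyMeasurable C
    (.of_forall fun w => by simpa using hC w)

lemma int {m0 : MeasurableSpace S} {P : Measure S} [IsFiniteMeasure P]
  (hf : BddMeas m0 f) : Integrable f P := hf.integrable le_rfl

end BddMeas

/-! ### Convergence in measure -/

section InMeasure

variable {S : Type*} [m0 : MeasurableSpace S] {P : Measure S}

lemma TendstoInMeasure.fun_add {f g : ℕ → S → ℝ} {f' g' : S → ℝ}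
  (hf : TendstoInMeasure P f atTop f') (hg : TendstoInMeasure P g atTop g') :
  TendstoInMeasure P (fun n w => f n w + g n w) atTop (fun w => f' w + g' w) := by
  rw [tendstoInMeasure_iff_norm] at *
  intro ε hε
  have h := (hf (ε / 2) (half_pos hε)).add (hg (ε / 2) (half_pos hε))
  rw [add_zero] at h
  refine tendsto_of_tendsto_of_tendsto_of_le_of_le tendsto_const_nhds h (fun _ => zero_le) fun n => ?_
  refine (measure_mono ?_).trans (measure_union_le _ _)
  intro w hω
  simp only [mem_ofPred_eq, mem_union] at *
  by_contra! hc
  have : ‖f n w + g n w - (f' w + g' w)‖ ≤ ‖f n w - f' w‖ + ‖g n w - g' w‖ := by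
    rw [add_sub_add_comm]; exact norm_add_le _ _
  linarith [hc.1, hc.2]

lemma tendstoInMeasure_const (f : S → ℝ) : TendstoInMeasure P (fun _ : ℕ => f) atTop f := by
  intro ε hε
  simp [not_le.2 hε]

lemma TendstoInMeasure.fun_const_mul {f : ℕ → S → ℝ} {f' : S → ℝ}
  (hf : TendstoInMeasure P f atTop f') (c : ℝ) :
  TendstoInMeasure P (fun n w => c * f n w) atTop (fun w => c * f' w) := by
  by_cases hc : c = 0
  · simpa [hc] using tendstoInMeasure_const (P := P) (fun _ => (0 : ℝ))
  rw [tendstoInMeasure_iff_norm] at *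
  intro ε hε
  have hc' : 0 < |c| := abs_pos.2 hc
  refine (hf (ε / |c|) (div_pos hε hc')).congr fun n => ?_
  congr 1
  ext w
  simp only [mem_ofPred_eq, ← mul_sub, norm_mul, norm_eq_abs]
  rw [div_le_iff₀' hc']

lemma TendstoInMeasure.fun_sum {ι : Type*} {s : Finset ι} {f : ι → ℕ → S → ℝ} {f' : ι → S → ℝ}
  (hf : ∀ i ∈ s, TendstoInMeasure P (f i) atTop (f' i)) :
  TendstoInMeasure P (fun n w => ∑ i ∈ s, f i n w) atTop (fun w => ∑ i ∈ s, f' i w) := by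
  classical
  induction s using Finset.induction_on with
  | empty => simpa using tendstoInMeasure_const (P := P) (fun _ => (0 : ℝ))
  | insert a s ha ih =>
    simp only [Finset.sum_insert ha]
    exact TendstoInMeasure.fun_add (hf a (by simp)) (ih fun i hi => hf i (by simp [hi]))

lemma measure_ge_le_of_integral_sq {f : S → ℝ} (hf : Integrable (fun w => f w ^ 2) P)
  [IsFiniteMeasure P] {ε c : ℝ} (hε : 0 < ε) (h : ∫ w, f w ^ 2 ∂P ≤ c) :
  P {w | ε ≤ ‖f w‖} ≤ ofReal (c / ε ^ 2) := by
  have h1 := mul_meas_ge_le_integral_of_nonneg (μ := P) (f := fun w => f w ^ 2)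
    (.of_forall fun w => sq_nonneg _) hf (ε ^ 2)
  have h2 : P {w | ε ≤ ‖f w‖} ≤ P {w | ε ^ 2 ≤ f w ^ 2} := measure_mono fun w hω => by
    simp only [mem_ofPred_eq, norm_eq_abs] at *
    rw [← sq_abs (f w)]
    exact pow_le_pow_left₀ hε.le hω 2
  refine h2.trans ?_
  rw [← ENNReal.ofReal_toReal (measure_ne_top P _)]
  refine ofReal_le_ofReal ?_
  rw [le_div_iff₀ (by positivity), mul_comm]
  exact h1.trans h

lemma tendstoInMeasure_of_integral_sq [IsFiniteMeasure P] {f : ℕ → S → ℝ} {g : S → ℝ}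
  (hf : ∀ n, Integrable (fun w => (f n w - g w) ^ 2) P)
  (h : Tendsto (fun n => ∫ w, (f n w - g w) ^ 2 ∂P) atTop (𝓝 0)) :
  TendstoInMeasure P f atTop g := by
  rw [tendstoInMeasure_iff_norm]
  intro ε hε
  have h1 : Tendsto (fun n => ofReal ((∫ w, (f n w - g w) ^ 2 ∂P) / ε ^ 2)) atTop (𝓝 0) := by
    simpa using ENNReal.tendsto_ofReal (h.div_const (ε ^ 2))
  exact tendsto_of_tendsto_of_tendsto_of_le_of_le tendsto_const_nhds h1 (fun _ => zero_le)
    fun n => measure_ge_le_of_integral_sq (hf n) hε le_rfl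

lemma tendstoInMeasure_of_localize [IsFiniteMeasure P] {f : ℕ → S → ℝ} {g : S → ℝ}
  {A : ℕ → Set S} (hA : Tendsto (fun m => P (A m)ᶜ) atTop (𝓝 0))
  {f' : ℕ → ℕ → S → ℝ} {g' : ℕ → S → ℝ}
  (hf : ∀ m, TendstoInMeasure P (f' m) atTop (g' m))
  (hff : ∀ m, ∀ᵐ w ∂P, w ∈ A m → (∀ n, f n w = f' m n w) ∧ g w = g' m w) :
  TendstoInMeasure P f atTop g := by
  rw [tendstoInMeasure_iff_norm]
  intro ε hε
  rw [ENNReal.tendsto_atTop_zero]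
  intro δ hδ
  obtain ⟨m, hm⟩ := (ENNReal.tendsto_atTop_zero.1 hA (δ / 2) (ENNReal.half_pos hδ.ne')).imp
    fun m h => h m le_rfl
  have h1 := hf m
  rw [tendstoInMeasure_iff_norm] at h1
  obtain ⟨N, hN⟩ := ENNReal.tendsto_atTop_zero.1 (h1 ε hε) (δ / 2) (ENNReal.half_pos hδ.ne')
  refine ⟨N, fun n hn => ?_⟩
  have h2 : {w | ε ≤ ‖f n w - g w‖} ≤ᵐ[P] ((A m)ᶜ ∪ {w | ε ≤ ‖f' m n w - g' m w‖} : Set S) := by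
    filter_upwards [hff m] with w hω h3
    by_cases hA : w ∈ A m
    · right
      have h4 := hω hA
      change ε ≤ _
      rw [← h4.1, ← h4.2]
      exact h3
    · exact Or.inl hA
  calc P {w | ε ≤ ‖f n w - g w‖} ≤ P ((A m)ᶜ ∪ {w | ε ≤ ‖f' m n w - g' m w‖}) :=
        measure_mono_ae h2
    _ ≤ P (A m)ᶜ + P {w | ε ≤ ‖f' m n w - g' m w‖} := measure_union_le _ _
    _ ≤ δ / 2 + δ / 2 := add_le_add hm (hN n hn)
    _ = δ := ENNReal.add_halves δ

lemma integral_sq_eq_norm_sq (f : Lp ℝ 2 P) : ∫ w, (f w) ^ 2 ∂P = ‖f‖ ^ 2 := by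
  rw [← real_inner_self_eq_norm_sq f, L2.inner_def]
  simp [sq]

/-- A Cauchy sequence in `L²` of bounded functions has a limit in `L²`. -/
lemma exists_L2_limit [IsFiniteMeasure P] {f : ℕ → S → ℝ} (hf : ∀ n, BddMeas m0 (f n))
  {c : ℕ → ℝ} (hc : Tendsto c atTop (𝓝 0))
  (h : ∀ n n', n ≤ n' → ∫ w, (f n' w - f n w) ^ 2 ∂P ≤ c n) :
  ∃ g : S → ℝ, Measurable g ∧ MemLp g 2 P ∧
    Tendsto (fun n => ∫ w, (f n w - g w) ^ 2 ∂P) atTop (𝓝 0) := by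
  have hm : ∀ n, MemLp (f n) 2 P := fun n => by
    obtain ⟨h1, C, hC⟩ := hf n
    exact MemLp.of_bound h1.aestronglyMeasurable C (.of_forall fun w => by simpa using hC w)
  set F : ℕ → Lp ℝ 2 P := fun n => (hm n).toLp with hF
  have hd : ∀ n n', ‖F n' - F n‖ ^ 2 = ∫ w, (f n' w - f n w) ^ 2 ∂P := fun n n' => by
    rw [← integral_sq_eq_norm_sq]
    refine integral_congr_ae ?_
    filter_upwards [Lp.coeFn_sub (F n') (F n), (hm n).coeFn_toLp, (hm n').coeFn_toLp]
      with w h1 h2 h3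
    rw [h1, Pi.sub_apply, show F n w = f n w from h2, show F n' w = f n' w from h3]
  have hcs : CauchySeq F := by
    rw [Metric.cauchySeq_iff']
    intro ε hε
    obtain ⟨N, hN⟩ := ((tendsto_order.1 hc).2 (ε ^ 2) (by positivity)).exists
    refine ⟨N, fun n hn => ?_⟩
    rw [dist_eq_norm]
    exact lt_of_pow_lt_pow_left₀ 2 hε.le (by rw [hd]; exact (h N n hn).trans_lt hN)
  obtain ⟨g, hg⟩ := cauchySeq_tendsto_of_complete hcs
  have hgm := (Lp.stronglyMeasurable g).measurable
  refine ⟨g, hgm, Lp.memLp g, ?_⟩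
  have h1 : ∀ n, ∫ w, (f n w - g w) ^ 2 ∂P = ‖F n - g‖ ^ 2 := fun n => by
    rw [← integral_sq_eq_norm_sq]
    refine integral_congr_ae ?_
    filter_upwards [Lp.coeFn_sub (F n) g, (hm n).coeFn_toLp] with w h1 h2
    rw [h1, Pi.sub_apply, show F n w = f n w from h2]
  simp_rw [h1]
  have h2 := (tendsto_iff_norm_sub_tendsto_zero.1 hg).pow 2
  simpa using h2

end InMeasure

/-! ### Bounded martingales with a modulus for the conditional variance -/

/-- A process adapted to `F`, bounded on bounded time intervals, with the martingale property and
with conditional variances of the increments over `[s, t]` bounded by `w (t - s)`. -/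
structure IsBddMart {S : Type*} [m0 : MeasurableSpace S] (P : Measure S)
  (F : ℝ≥0 → MeasurableSpace S) (N : ℝ≥0 → S → ℝ) (w : ℝ≥0 → ℝ) : Prop where
  mono : Monotone F
  le : ∀ t, F t ≤ m0
  adapted : ∀ t, BddMeas (F t) (N t)
  bdd : ∀ t, ∃ C, ∀ s ≤ t, ∀ o, |N s o| ≤ C
  orth : ∀ s t, s ≤ t → ∀ g, BddMeas (F s) g → ∫ o, g o * (N t o - N s o) ∂P = 0
  var : ∀ s t, s ≤ t → ∀ g, BddMeas (F s) g → (∀ o, 0 ≤ g o) →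
    ∫ o, g o * (N t o - N s o) ^ 2 ∂P ≤ w (t - s) * ∫ o, g o ∂P
  w_mono : Monotone w
  w_nonneg : ∀ h, 0 ≤ w h
  w_small : ∀ η > 0, ∃ δ : ℝ≥0, 0 < δ ∧ w δ ≤ η

/-- The running maximum of `|A 1|, ..., |A i|`. -/
def runMax (A : ℕ → ℝ) : ℕ → ℝ
  | 0 => 0
  | i + 1 => max (runMax A i) |A (i + 1)|

lemma runMax_nonneg (A : ℕ → ℝ) (i : ℕ) : 0 ≤ runMax A i := by
  cases i with
  | zero => exact le_rfl
  | succ i => exact le_max_of_le_right (abs_nonneg _)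

lemma runMax_le_succ (A : ℕ → ℝ) (i : ℕ) : runMax A i ≤ runMax A (i + 1) := le_max_left _ _

lemma abs_le_runMax {A : ℕ → ℝ} (h0 : A 0 = 0) (i : ℕ) : |A i| ≤ runMax A i := by
  cases i with
  | zero => simp [h0, runMax]
  | succ i => exact le_max_right _ _

lemma sum_runMax_mul_le (A : ℕ → ℝ) (m : ℕ) : ∑ i ∈ range m, runMax A i * (|A (i + 1)| - |A i|)
    ≤ runMax A m * |A m| - runMax A m ^ 2 / 2 := by
  induction m with
  | zero => simp [runMax]
  | succ m ih =>
    rw [sum_range_succ]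
    have h2 : runMax A (m + 1) = max (runMax A m) |A (m + 1)| := rfl
    rcases le_total (runMax A m) |A (m + 1)| with h | h
    · rw [h2, max_eq_right h]
      nlinarith [sq_nonneg (runMax A m - |A (m + 1)|)]
    · rw [h2, max_eq_left h]
      nlinarith

lemma sum_mul_sub_eq_sum_sub_mul (R G : ℕ → ℝ) (m : ℕ) : ∑ i ∈ range m, R i * (G i - G (i + 1))
    = ∑ i ∈ range m, (R (i + 1) - R i) * G (i + 1) + R 0 * G 0 - R m * G m := by
  induction m with
  | zero => simp
  | succ m ih => rw [sum_range_succ, sum_range_succ, ih]; ring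

namespace IsBddMart

variable {S : Type*} [m0 : MeasurableSpace S] {P : Measure S} [IsProbabilityMeasure P]
  {F : ℝ≥0 → MeasurableSpace S} {N : ℝ≥0 → S → ℝ} {w : ℝ≥0 → ℝ} (h : IsBddMart P F N w)

include h

lemma adapted' {s t : ℝ≥0} (hst : s ≤ t) : BddMeas (F t) (N s) := (h.adapted s).mono (h.mono hst)

lemma bddMeas (t : ℝ≥0) : BddMeas m0 (N t) := (h.adapted t).mono (h.le t)

omit h in
lemma _root_.integral_sum_sq_eq_sum {u : ℕ → MeasurableSpace S} (hu : ∀ i, u i ≤ m0)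
  (hmono : Monotone u) {D : ℕ → S → ℝ}
  (hD : ∀ i, BddMeas (u (i + 1)) (D i))
  (ho : ∀ i g, BddMeas (u i) g → ∫ w, g w * D i w ∂P = 0) (m : ℕ) :
  ∫ w, (∑ i ∈ range m, D i w) ^ 2 ∂P = ∑ i ∈ range m, ∫ w, D i w ^ 2 ∂P := by
  induction m with
  | zero => simp
  | succ m ih =>
    have hs : BddMeas (u m) (fun w => ∑ i ∈ range m, D i w) :=
      BddMeas.sum fun i hi => (hD i).mono (hmono (mem_range.1 hi))
    have hs' := hs.mono (hu m)
    have hD' := (hD m).mono (hu _)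
    rw [sum_range_succ, ← ih]
    have e : ∀ w, (∑ i ∈ range (m + 1), D i w) ^ 2
        = (∑ i ∈ range m, D i w) ^ 2 + 2 * ((∑ i ∈ range m, D i w) * D m w)
          + D m w ^ 2 := fun w => by rw [sum_range_succ]; ring
    simp_rw [e]
    rw [integral_add ((hs'.pow 2).add ((hs'.mul hD').const_mul 2)).int
      (hD'.pow 2).int, integral_add (hs'.pow 2).int
      ((hs'.mul hD').const_mul 2).int, integral_const_mul, ho m _ hs]
    ring

lemma integral_stochSum_sq {u : ℕ → ℝ≥0} (hu : Monotone u)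
  {H : ℕ → S → ℝ} (hH : ∀ i, BddMeas (F (u i)) (H i)) (m : ℕ) :
  ∫ o, (∑ i ∈ range m, H i o * (N (u (i + 1)) o - N (u i) o)) ^ 2 ∂P
    = ∑ i ∈ range m, ∫ o, H i o ^ 2 * (N (u (i + 1)) o - N (u i) o) ^ 2 ∂P := by
  have h1 := integral_sum_sq_eq_sum (P := P) (u := fun i => F (u i)) (fun i => h.le _)
    (fun i j hij => h.mono (hu hij)) (D := fun i o => H i o * (N (u (i + 1)) o - N (u i) o))
    (fun i => ((hH i).mono (h.mono (hu i.le_succ))).mul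
      ((h.adapted _).sub (h.adapted' (hu i.le_succ))))
    (fun i g hg => by
      simp_rw [← mul_assoc]
      exact h.orth _ _ (hu i.le_succ) _ (hg.mul (hH i))) m
  simpa only [mul_pow] using h1

lemma sum_integral_sq {u : ℕ → ℝ≥0} (hu : Monotone u) (m : ℕ) :
  ∑ i ∈ range m, ∫ o, (N (u (i + 1)) o - N (u i) o) ^ 2 ∂P
    = ∫ o, (N (u m) o - N (u 0) o) ^ 2 ∂P := by
  have h1 := h.integral_stochSum_sq hu (H := fun _ _ => 1) (fun i => BddMeas.const 1) m
  simp only [one_mul, one_pow] at h1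
  rw [← h1]
  congr 1
  ext o
  rw [sum_range_sub (fun i => N (u i) o)]

lemma bddMeas_runMax {u : ℕ → ℝ≥0} (hu : Monotone u) (i : ℕ) :
  BddMeas (F (u i)) (fun o => runMax (fun i => N (u i) o - N (u 0) o) i) := by
  induction i with
  | zero => exact BddMeas.const 0
  | succ i ih =>
    exact (ih.mono (h.mono (hu i.le_succ))).max
      ((h.adapted _).sub (h.adapted' (hu (Nat.zero_le _)))).abs

/-- Doob's `L²` inequality. -/
lemma integral_runMax_sq_le {u : ℕ → ℝ≥0} (hu : Monotone u) (m : ℕ) :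
  ∫ o, (runMax (fun i => N (u i) o - N (u 0) o) m) ^ 2 ∂P
    ≤ 4 * ∫ o, (N (u m) o - N (u 0) o) ^ 2 ∂P := by
  set A : S → ℕ → ℝ := fun o i => N (u i) o - N (u 0) o with hA
  have hAm : ∀ i, BddMeas (F (u i)) (fun o => A o i) := fun i =>
    (h.adapted _).sub (h.adapted' (hu (Nat.zero_le _)))
  have hAm' : ∀ i, BddMeas m0 (fun o => A o i) := fun i => (hAm i).mono (h.le _)
  have hR : ∀ i, BddMeas (F (u i)) (fun o => runMax (A o) i) := h.bddMeas_runMax hu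
  have hR' : ∀ i, BddMeas m0 (fun o => runMax (A o) i) := fun i => (hR i).mono (h.le _)
  have hpos : ∀ i, 0 ≤ ∫ o, runMax (A o) i * (|A o (i + 1)| - |A o i|) ∂P := fun i => by
    have h1 : ∫ o, (runMax (A o) i * Real.sign (A o i)) * (N (u (i + 1)) o - N (u i) o) ∂P = 0 := by
      have hsign : Measurable Real.sign := by
        exact .ite measurableSet_Iio measurable_const
          (.ite measurableSet_Ioi measurable_const measurable_const)
      refine h.orth _ _ (hu i.le_succ) _ ((hR i).mul ((hAm i).comp hsign (C := 1) fun x => ?_))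
      rcases Real.sign_apply_eq x with h | h | h <;> simp [h]
    rw [← h1]
    refine integral_mono ?_ ?_ fun o => ?_
    · have hsign : Measurable Real.sign := by
        exact .ite measurableSet_Iio measurable_const
          (.ite measurableSet_Ioi measurable_const measurable_const)
      refine (((hR' i).mul ((hAm' i).comp hsign (C := 1) fun x => ?_)).mul
        ((h.bddMeas _).sub (h.bddMeas _))).int
      rcases Real.sign_apply_eq x with h | h | h <;> simp [h]
    · exact ((hR' i).mul ((hAm' (i + 1)).abs.sub (hAm' i).abs)).int
    · rw [mul_assoc]
      refine mul_le_mul_of_nonneg_left ?_ (runMax_nonneg _ _)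
      have e : N (u (i + 1)) o - N (u i) o = A o (i + 1) - A o i := by simp [hA]
      rcases lt_trichotomy (A o i) 0 with h | h | h
      · rw [Real.sign_of_neg h, abs_of_neg h]
        linarith [neg_le_abs (A o (i + 1))]
      · rw [h]; simp
      · rw [Real.sign_of_pos h, abs_of_pos h]
        linarith [le_abs_self (A o (i + 1))]
  have h2 : 0 ≤ ∫ o, (runMax (A o) m * |A o m| - runMax (A o) m ^ 2 / 2) ∂P := by
    refine (sum_nonneg (s := range m) fun i _ => hpos i).trans ?_
    rw [← integral_finsetSum _ fun i _ =>
      ((hR' i).mul ((hAm' (i + 1)).abs.sub (hAm' i).abs)).int]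
    refine integral_mono (BddMeas.sum fun i _ =>
      ((hR' i).mul ((hAm' (i + 1)).abs.sub (hAm' i).abs))).int ?_ fun o => ?_
    · simpa only [div_eq_inv_mul] using
        (((hR' m).mul (hAm' m).abs).sub (((hR' m).pow 2).const_mul (2⁻¹))).int
    · exact sum_runMax_mul_le _ m
  have h3 : ∫ o, (runMax (A o) m * |A o m| - runMax (A o) m ^ 2 / 2) ∂P
      ≤ ∫ o, (A o m ^ 2 - (1 / 4) * runMax (A o) m ^ 2) ∂P := by
    refine integral_mono ?_ (((hAm' m).pow 2).sub (((hR' m).pow 2).const_mul (1 / 4))).int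
      fun o => ?_
    · simpa only [div_eq_inv_mul] using
        (((hR' m).mul (hAm' m).abs).sub (((hR' m).pow 2).const_mul (2⁻¹))).int
    · nlinarith [sq_nonneg (runMax (A o) m / 2 - |A o m|), sq_abs (A o m)]
  rw [integral_sub ((hAm' m).pow 2).int (((hR' m).pow 2).const_mul (1 / 4)).int,
    integral_const_mul] at h3
  linarith

lemma sum_integral_le {u : ℕ → ℝ≥0} (hu : Monotone u) (m : ℕ) :
  ∑ i ∈ range m, ∫ o, (N (u i) o - N (u 0) o) ^ 2 * (N (u (i + 1)) o - N (u i) o) ^ 2 ∂P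
    ≤ 4 * w (u m - u 0) * ∫ o, (N (u m) o - N (u 0) o) ^ 2 ∂P := by
  set A : S → ℕ → ℝ := fun o i => N (u i) o - N (u 0) o with hA
  set R : ℕ → S → ℝ := fun i o => runMax (A o) i ^ 2 with hR
  set G : ℕ → S → ℝ := fun i o => (N (u m) o - N (u i) o) ^ 2 with hG
  have hRm : ∀ i, BddMeas (F (u i)) (R i) := fun i => (h.bddMeas_runMax hu i).pow 2
  have hRm' : ∀ i, BddMeas m0 (R i) := fun i => (hRm i).mono (h.le _)
  have hN : ∀ i, BddMeas m0 (N (u i)) := fun i => h.bddMeas _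
  have hGm : ∀ i, BddMeas m0 (G i) := fun i => ((hN m).sub (hN i)).pow 2
  have hRR : ∀ i o, 0 ≤ R (i + 1) o - R i o := fun i o =>
    sub_nonneg.2 (pow_le_pow_left₀ (runMax_nonneg _ _) (runMax_le_succ _ _) 2)
  have h1 : ∀ i ∈ range m, ∫ o, (A o i) ^ 2 * (N (u (i + 1)) o - N (u i) o) ^ 2 ∂P
        ≤ ∫ o, R i o * (G i o - G (i + 1) o) ∂P := fun i hi => by
    have him : i + 1 ≤ m := mem_range.1 hi
    have e1 : ∫ o, (R i o * (N (u (i + 1)) o - N (u i) o)) * (N (u m) o - N (u (i + 1)) o) ∂P = 0 :=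
      h.orth _ _ (hu him) _ (((hRm i).mono (h.mono (hu i.le_succ))).mul
        ((h.adapted _).sub (h.adapted' (hu i.le_succ))))
    have e2 : ∫ o, R i o * (G i o - G (i + 1) o) ∂P
        = ∫ o, R i o * (N (u (i + 1)) o - N (u i) o) ^ 2 ∂P := by
      have : ∀ o, R i o * (G i o - G (i + 1) o) = R i o * (N (u (i + 1)) o - N (u i) o) ^ 2
          + 2 * ((R i o * (N (u (i + 1)) o - N (u i) o)) * (N (u m) o - N (u (i + 1)) o)) :=
        fun o => by ring
      simp_rw [this]
      rw [integral_add ((hRm' i).mul (((hN _).sub (hN _)).pow 2)).int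
        ((((hRm' i).mul ((hN _).sub (hN _))).mul ((hN _).sub (hN _))).const_mul 2).int,
        integral_const_mul, e1]
      simp
    rw [e2]
    refine integral_mono ((((hN _).sub (hN _)).pow 2).mul (((hN _).sub (hN _)).pow 2)).int
      ((hRm' i).mul (((hN _).sub (hN _)).pow 2)).int fun o => ?_
    refine mul_le_mul_of_nonneg_right ?_ (sq_nonneg _)
    rw [← sq_abs]
    exact pow_le_pow_left₀ (abs_nonneg _) (abs_le_runMax (by simp [hA]) i) 2
  have h2 : ∑ i ∈ range m, ∫ o, R i o * (G i o - G (i + 1) o) ∂P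
      = ∑ i ∈ range m, ∫ o, (R (i + 1) o - R i o) * G (i + 1) o ∂P := by
    rw [← integral_finsetSum _ fun i _ => ((hRm' i).mul ((hGm _).sub (hGm _))).int,
      ← integral_finsetSum _ fun i _ => (((hRm' _).sub (hRm' _)).mul (hGm _)).int]
    congr 1
    ext o
    rw [sum_mul_sub_eq_sum_sub_mul (fun i => R i o) (fun i => G i o)]
    simp [hR, hG, runMax]
  have h3 : ∀ i ∈ range m, ∫ o, (R (i + 1) o - R i o) * G (i + 1) o ∂P
      ≤ w (u m - u 0) * ∫ o, (R (i + 1) o - R i o) ∂P := fun i hi => by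
    have him : i + 1 ≤ m := mem_range.1 hi
    refine (h.var _ _ (hu him) _ ((hRm _).sub ((hRm i).mono (h.mono (hu i.le_succ))))
      (hRR i)).trans ?_
    exact mul_le_mul_of_nonneg_right (h.w_mono (tsub_le_tsub_left (hu (Nat.zero_le _)) _))
      (integral_nonneg (hRR i))
  calc _ ≤ ∑ i ∈ range m, ∫ o, R i o * (G i o - G (i + 1) o) ∂P := sum_le_sum h1
    _ = _ := h2
    _ ≤ _ := sum_le_sum h3
    _ = w (u m - u 0) * ∫ o, R m o ∂P := by
        rw [← mul_sum, ← integral_finsetSum _ fun i _ => ((hRm' _).sub (hRm' _)).int]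
        congr 2
        ext o
        rw [sum_range_sub (fun i => R i o)]
        simp [hR, runMax]
    _ ≤ w (u m - u 0) * (4 * ∫ o, (N (u m) o - N (u 0) o) ^ 2 ∂P) :=
        mul_le_mul_of_nonneg_left (h.integral_runMax_sq_le hu m) (h.w_nonneg _)
    _ = _ := by ring

end IsBddMart

/-! ### Dyadic approximations of the stochastic integral `∫ N₋ dN` -/

/-- The dyadic point `i / 2 ^ n`. -/
def dyad (n i : ℕ) : ℝ≥0 := i / 2 ^ n

lemma dyad_mono (n : ℕ) : Monotone (dyad n) := fun i j hij => by
  unfold dyad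
  gcongr

lemma dyad_zero (n : ℕ) : dyad n 0 = 0 := by simp [dyad]

lemma dyad_succ (n i : ℕ) : dyad n (i + 1) = dyad n i + 1 / 2 ^ n := by simp [dyad, add_div]

lemma dyad_refine {n n' : ℕ} (h : n ≤ n') (i : ℕ) : dyad n i = dyad n' (i * 2 ^ (n' - n)) := by
  unfold dyad
  obtain ⟨k, rfl⟩ := Nat.exists_eq_add_of_le h
  rw [Nat.add_sub_cancel_left, pow_add]
  push_cast
  rw [mul_div_mul_right _ _ (by positivity)]

lemma le_dyad_ceil (n : ℕ) (b : ℝ≥0) {J : ℕ} (hJ : 2 ^ n * ⌈b⌉₊ ≤ J) : b ≤ dyad n J := by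
  unfold dyad
  rw [le_div_iff₀ (by positivity)]
  have h1 : ((2 ^ n * ⌈b⌉₊ : ℕ) : ℝ≥0) ≤ J := by exact_mod_cast hJ
  refine le_trans ?_ h1
  push_cast
  rw [mul_comm]
  gcongr
  exact Nat.le_ceil b

lemma tendsto_inv_two_pow : Tendsto (fun n : ℕ => (1 / 2 ^ n : ℝ≥0)) atTop (𝓝 0) := by
  have := NNReal.tendsto_pow_atTop_nhds_zero_of_lt_one (r := (1 / 2 : ℝ≥0)) (by norm_num)
  simpa only [one_div, inv_pow] using this

/-- The Riemann sum for `∫₀ᵇ N₋ dN` along the first `J` dyadic intervals of level `n`. -/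
def stochInt {S : Type*} (N : ℝ≥0 → S → ℝ) (n J : ℕ) (b : ℝ≥0) (w : S) : ℝ :=
  ∑ i ∈ range J, N (min (dyad n i) b) w * (N (min (dyad n (i + 1)) b) w - N (min (dyad n i) b) w)

/-- The error made by replacing the dyadic Riemann sum on `[a, b]` by a single summand. -/
def cellErr {S : Type*} (N : ℝ≥0 → S → ℝ) (n J : ℕ) (a b : ℝ≥0) (w : S) : ℝ :=
  ∑ i ∈ range J, (N (min (dyad n i) b) w - N a w) *
    (N (max a (min (dyad n (i + 1)) b)) w - N (max a (min (dyad n i) b)) w)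

section

variable {S : Type*} {N : ℝ≥0 → S → ℝ}

lemma stochInt_zero (n J : ℕ) (w : S) : stochInt N n J 0 w = 0 := by simp [stochInt]

lemma stochInt_eq_of_le {n J J' : ℕ} {b : ℝ≥0} (hb : b ≤ dyad n J) (hJ : J ≤ J') (w : S) :
  stochInt N n J' b w = stochInt N n J b w := by
  refine (sum_subset (Finset.range_mono hJ) fun i _ hi => ?_).symm
  have h1 : J ≤ i := by simpa using hi
  have h2 : b ≤ dyad n i := hb.trans (dyad_mono n h1)
  rw [min_eq_right h2, min_eq_right (h2.trans (dyad_mono n i.le_succ))]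
  simp

lemma stochInt_sub (n J : ℕ) {a b : ℝ≥0} (hab : a ≤ b) (w : S) :
  stochInt N n J b w - stochInt N n J a w = ∑ i ∈ range J, N (min (dyad n i) b) w *
      (N (max a (min (dyad n (i + 1)) b)) w - N (max a (min (dyad n i) b)) w) := by
  unfold stochInt
  rw [← sum_sub_distrib]
  refine sum_congr rfl fun i _ => ?_
  have h1 := dyad_mono n i.le_succ
  grind

lemma clip_mono (n : ℕ) (a b : ℝ≥0) : Monotone fun i => max a (min (dyad n i) b) :=
  fun _ _ hij => max_le_max_left _ (min_le_min_right _ (dyad_mono n hij))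

lemma clip_zero (n : ℕ) (a b : ℝ≥0) : max a (min (dyad n 0) b) = a := by simp [dyad_zero]

lemma clip_last {n J : ℕ} {a b : ℝ≥0} (hab : a ≤ b) (hb : b ≤ dyad n J) :
  max a (min (dyad n J) b) = b := by
  rw [min_eq_right hb, max_eq_right hab]

lemma cellErr_eq {n J : ℕ} {a b : ℝ≥0} (hab : a ≤ b) (hb : b ≤ dyad n J) (w : S) :
  cellErr N n J a b w = stochInt N n J b w - stochInt N n J a w - N a w * (N b w - N a w) := by
  rw [stochInt_sub n J hab]
  have h1 : N b w - N a w = ∑ i ∈ range J,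
      (N (max a (min (dyad n (i + 1)) b)) w - N (max a (min (dyad n i) b)) w) := by
    rw [sum_range_sub (fun i => N (max a (min (dyad n i) b)) w), clip_last hab hb, clip_zero]
  rw [h1, mul_sum, ← sum_sub_distrib]
  exact sum_congr rfl fun i _ => by ring

end

namespace IsBddMart

variable {S : Type*} [m0 : MeasurableSpace S] {P : Measure S} [IsProbabilityMeasure P]
  {F : ℝ≥0 → MeasurableSpace S} {N : ℝ≥0 → S → ℝ} {w : ℝ≥0 → ℝ} (h : IsBddMart P F N w)

include h

lemma bddMeas_stochInt (n J : ℕ) (b : ℝ≥0) : BddMeas (F b) (stochInt N n J b) :=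
  BddMeas.sum fun _ _ => (h.adapted' (min_le_right _ _)).mul
    ((h.adapted' (min_le_right _ _)).sub (h.adapted' (min_le_right _ _)))

lemma bddMeas_cellErr (n J : ℕ) {a b : ℝ≥0} (hab : a ≤ b) : BddMeas (F b) (cellErr N n J a b) :=
  BddMeas.sum fun _ _ => ((h.adapted' (min_le_right _ _)).sub (h.adapted' hab)).mul
    ((h.adapted' (max_le hab (min_le_right _ _))).sub (h.adapted' (max_le hab (min_le_right _ _))))

lemma bddMeas_cellFactor (n i : ℕ) (a b : ℝ≥0) :
  BddMeas (F (max a (min (dyad n i) b))) (fun o => N (min (dyad n i) b) o - N a o) :=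
  (h.adapted' (le_max_right _ _)).sub (h.adapted' (le_max_left _ _))

lemma integral_mul_cellErr (n J : ℕ) {a b : ℝ≥0}
  {g : S → ℝ} (hg : BddMeas (F a) g) : ∫ o, g o * cellErr N n J a b o ∂P = 0 := by
  unfold cellErr
  simp_rw [mul_sum]
  rw [integral_finsetSum]
  · refine sum_eq_zero fun i _ => ?_
    simp_rw [← mul_assoc]
    exact h.orth _ _ (clip_mono n a b i.le_succ) _
      ((hg.mono (h.mono (le_max_left _ _))).mul (h.bddMeas_cellFactor n i a b))
  · intro i _
    exact ((hg.mono (h.le _)).mul (((h.bddMeas _).sub (h.bddMeas _)).mul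
      ((h.bddMeas _).sub (h.bddMeas _)))).int

lemma integral_cellErr_sq_le {n J : ℕ} {a b : ℝ≥0} (hab : a ≤ b) (hb : b ≤ dyad n J) :
  ∫ o, cellErr N n J a b o ^ 2 ∂P ≤ 8 * w (b - a) * ∫ o, (N b o - N a o) ^ 2 ∂P
    + 2 * ∑ i ∈ range J, ∫ o, (N (min (dyad n i) a) o - N a o) ^ 2 *
      (N (max a (min (dyad n (i + 1)) b)) o - N (max a (min (dyad n i) b)) o) ^ 2 ∂P := by
  have h1 := h.integral_stochSum_sq (clip_mono n a b)
    (H := fun i o => N (min (dyad n i) b) o - N a o) (fun i => h.bddMeas_cellFactor n i a b) J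
  have h2 := h.sum_integral_le (clip_mono n a b) J
  simp only [clip_zero, clip_last hab hb] at h2
  unfold cellErr
  rw [h1]
  have hB : ∀ s t, BddMeas m0 (fun o => (N s o - N t o) ^ 2) := fun s t =>
    ((h.bddMeas s).sub (h.bddMeas t)).pow 2
  have h3 : ∀ i ∈ range J, ∫ o, (N (min (dyad n i) b) o - N a o) ^ 2 *
        (N (max a (min (dyad n (i + 1)) b)) o - N (max a (min (dyad n i) b)) o) ^ 2 ∂P
      ≤ 2 * ∫ o, (N (max a (min (dyad n i) b)) o - N a o) ^ 2 *
        (N (max a (min (dyad n (i + 1)) b)) o - N (max a (min (dyad n i) b)) o) ^ 2 ∂P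
        + 2 * ∫ o, (N (min (dyad n i) a) o - N a o) ^ 2 *
        (N (max a (min (dyad n (i + 1)) b)) o - N (max a (min (dyad n i) b)) o) ^ 2 ∂P := by
    intro i _
    rw [← integral_const_mul, ← integral_const_mul, ← integral_add
      (((hB _ _).mul (hB _ _)).const_mul 2).int
      (((hB _ _).mul (hB _ _)).const_mul 2).int]
    refine integral_mono ((hB _ _).mul (hB _ _)).int ((((hB _ _).mul (hB _ _)).const_mul 2).add
        (((hB _ _).mul (hB _ _)).const_mul 2)).int fun o => ?_
    rw [← mul_assoc, ← mul_assoc, ← add_mul]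
    rcases le_total (dyad n i) a with h' | h'
    · rw [min_eq_left (h'.trans hab), min_eq_left h', max_eq_left h']
      nlinarith [sq_nonneg (N (dyad n i) o - N a o)]
    · rw [max_eq_right (le_min h' hab), min_eq_right h']
      nlinarith
  refine (sum_le_sum h3).trans ?_
  rw [Finset.sum_add_distrib, ← mul_sum, ← mul_sum]
  linarith

/-- Comparison of a dyadic Riemann sum with the Riemann sum along an arbitrary partition. -/
lemma integral_stochInt_sub_sq_le {n J K : ℕ} {p : ℕ → ℝ≥0}
  (hp : Monotone p) (hp0 : p 0 = 0) (hJ : p K ≤ dyad n J) {δ : ℝ≥0}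
  (hδ : ∀ j < K, p (j + 1) - p j ≤ δ) {κ : ℝ}
  (hκ : ∀ j < K, ∑ i ∈ range J, ∫ o, (N (min (dyad n i) (p j)) o - N (p j) o) ^ 2 *
      (N (max (p j) (min (dyad n (i + 1)) (p (j + 1)))) o
        - N (max (p j) (min (dyad n i) (p (j + 1)))) o) ^ 2 ∂P ≤ κ) :
  ∫ o, (stochInt N n J (p K) o - ∑ j ∈ range K, N (p j) o * (N (p (j + 1)) o - N (p j) o)) ^ 2 ∂P
    ≤ 8 * w δ * ∫ o, (N (p K) o - N 0 o) ^ 2 ∂P + 2 * (K * κ) := by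
  have hle : ∀ j < K, p (j + 1) ≤ dyad n J := fun j hj => (hp hj).trans hJ
  have e1 : ∀ o, stochInt N n J (p K) o - ∑ j ∈ range K, N (p j) o * (N (p (j + 1)) o - N (p j) o)
      = ∑ j ∈ range K, cellErr N n J (p j) (p (j + 1)) o := fun o => by
    rw [sum_congr rfl fun j hj =>
      cellErr_eq (hp j.le_succ) (hle j (mem_range.1 hj)) o, sum_sub_distrib,
      sum_range_sub (fun j => stochInt N n J (p j) o), hp0, stochInt_zero, sub_zero]
  simp_rw [e1]
  rw [integral_sum_sq_eq_sum (u := fun j => F (p j)) (fun j => h.le _)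
    (fun i j hij => h.mono (hp hij)) (fun j => h.bddMeas_cellErr n J (hp j.le_succ))
    (fun j g hg => h.integral_mul_cellErr n J hg)]
  have h2 : ∀ j ∈ range K, ∫ o, cellErr N n J (p j) (p (j + 1)) o ^ 2 ∂P
      ≤ 8 * w δ * ∫ o, (N (p (j + 1)) o - N (p j) o) ^ 2 ∂P + 2 * κ := fun j hj => by
    have hj' := mem_range.1 hj
    refine (h.integral_cellErr_sq_le (hp j.le_succ) (hle j hj')).trans ?_
    refine add_le_add ?_ (mul_le_mul_of_nonneg_left (hκ j hj') zero_le_two)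
    exact mul_le_mul_of_nonneg_right (mul_le_mul_of_nonneg_left (h.w_mono (hδ j hj')) (by norm_num))
      (integral_nonneg fun o => sq_nonneg _)
  refine (sum_le_sum h2).trans ?_
  rw [Finset.sum_add_distrib, ← mul_sum, h.sum_integral_sq hp, hp0]
  simp only [Finset.sum_const, card_range, nsmul_eq_mul]
  linarith

lemma gap_term_le (n i : ℕ) {a b : ℝ≥0} (hab : a ≤ b) : ∫ o, (N (min (dyad n i) a) o - N a o) ^ 2 *
      (N (max a (min (dyad n (i + 1)) b)) o - N (max a (min (dyad n i) b)) o) ^ 2 ∂P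
    ≤ w b * w (1 / 2 ^ n) := by
  rcases le_total a (dyad n i) with h1 | h1
  · simpa [min_eq_right h1] using mul_nonneg (h.w_nonneg _) (h.w_nonneg _)
  rcases le_total (dyad n (i + 1)) a with h2 | h2
  · simpa [min_eq_left (h2.trans hab), max_eq_left h2, min_eq_left (h1.trans hab), max_eq_left h1]
      using mul_nonneg (h.w_nonneg _) (h.w_nonneg _)
  have h3 := clip_mono n a b i.le_succ
  refine (h.var _ _ h3 _ ?_ (fun o => sq_nonneg _)).trans ?_
  · exact ((h.adapted' ((min_le_right _ _).trans (le_max_left _ _))).sub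
      (h.adapted' (le_max_left _ _))).pow 2
  refine mul_le_mul (h.w_mono ?_) ?_ (integral_nonneg fun o => sq_nonneg _) (h.w_nonneg _)
  · exact tsub_le_self.trans (max_le hab (min_le_right _ _))
  · have h4 := h.var (min (dyad n i) a) a (min_le_right _ _) (fun _ => 1) (BddMeas.const 1)
      (fun _ => zero_le_one)
    simp only [one_mul, integral_const, smul_eq_mul, mul_one, probReal_univ] at h4
    have e : ∀ o, (N (min (dyad n i) a) o - N a o) ^ 2 = (N a o - N (min (dyad n i) a) o) ^ 2 :=
      fun o => by ring
    simp_rw [e]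
    refine h4.trans (h.w_mono ?_)
    rw [min_eq_left h1, tsub_le_iff_left, ← dyad_succ]
    exact h2

lemma gap_sum_le (n J : ℕ) {a b : ℝ≥0} (hab : a ≤ b) :
  ∑ i ∈ range J, ∫ o, (N (min (dyad n i) a) o - N a o) ^ 2 *
      (N (max a (min (dyad n (i + 1)) b)) o - N (max a (min (dyad n i) b)) o) ^ 2 ∂P
    ≤ w b * w (1 / 2 ^ n) := by
  have key : ∀ i, ¬ (dyad n i < a ∧ a < dyad n (i + 1)) →
      ∫ o, (N (min (dyad n i) a) o - N a o) ^ 2 *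
        (N (max a (min (dyad n (i + 1)) b)) o - N (max a (min (dyad n i) b)) o) ^ 2 ∂P = 0 := by
    intro i hi
    rcases le_or_gt a (dyad n i) with h1 | h1
    · simp [min_eq_right h1]
    · have h2 : dyad n (i + 1) ≤ a := not_lt.1 fun h2 => hi ⟨h1, h2⟩
      simp [min_eq_left (h2.trans hab), max_eq_left h2, min_eq_left (h1.le.trans hab),
        max_eq_left h1.le]
  by_cases hc : ∃ i ∈ range J, dyad n i < a ∧ a < dyad n (i + 1)
  · obtain ⟨i, hi, h1, h2⟩ := hc
    rw [Finset.sum_eq_single_of_mem i hi]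
    · exact h.gap_term_le n i hab
    · intro j _ hj
      refine key j fun h3 => hj ?_
      by_contra hne
      rcases lt_or_gt_of_ne hne with hlt | hlt
      · exact absurd (h3.2.trans_le (dyad_mono n hlt)) (not_lt.2 h1.le)
      · exact absurd (h2.trans_le (dyad_mono n hlt)) (not_lt.2 h3.1.le)
  · push Not at hc
    rw [sum_eq_zero fun i hi => key i fun h1 => absurd h1.2 (not_lt.2 (hc i hi h1.1))]
    exact mul_nonneg (h.w_nonneg _) (h.w_nonneg _)

lemma w_inv_two_pow : Tendsto (fun n : ℕ => w (1 / 2 ^ n)) atTop (𝓝 0) := by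
  rw [Metric.tendsto_atTop']
  intro η hη
  obtain ⟨δ, hδ, hw⟩ := h.w_small (η / 2) (half_pos hη)
  obtain ⟨N, hN⟩ := eventually_atTop.1 ((tendsto_order.1 tendsto_inv_two_pow).2 δ hδ)
  refine ⟨N, fun n hn => ?_⟩
  rw [Real.dist_eq, sub_zero, abs_of_nonneg (h.w_nonneg _)]
  linarith [h.w_mono (hN n hn.le).le]

/-- The dyadic Riemann sum over `[0, b]`. -/
def _root_.dyadInt {S : Type*} (N : ℝ≥0 → S → ℝ) (n : ℕ) (b : ℝ≥0) : S → ℝ :=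
  stochInt N n (2 ^ n * ⌈b⌉₊) b

omit h in
lemma _root_.dyadInt_eq {n J : ℕ} {b : ℝ≥0} (hJ : 2 ^ n * ⌈b⌉₊ ≤ J) (w : S) :
  dyadInt N n b w = stochInt N n J b w :=
  (stochInt_eq_of_le (le_dyad_ceil n b le_rfl) hJ w).symm

lemma integral_dyadInt_sub_sq_le (b : ℝ≥0) {n n' : ℕ} (hn : n ≤ n') :
  ∫ o, (dyadInt N n' b o - dyadInt N n b o) ^ 2 ∂P
    ≤ 8 * w (1 / 2 ^ n) * ∫ o, (N b o - N 0 o) ^ 2 ∂P := by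
  set K := 2 ^ n * ⌈b⌉₊ with hK
  set p : ℕ → ℝ≥0 := fun j => min (dyad n j) b with hp
  have hpK : p K = b := min_eq_right (le_dyad_ceil n b le_rfl)
  have h1 := h.integral_stochInt_sub_sq_le (n := n') (J := 2 ^ n' * ⌈b⌉₊) (K := K) (p := p)
    (fun i j hij => min_le_min_right _ (dyad_mono n hij)) (by simp [hp, dyad_zero])
    (by rw [hpK]; exact le_dyad_ceil n' b le_rfl) (δ := 1 / 2 ^ n) (fun j _ => ?_) (κ := 0)
    (fun j _ => ?_)
  · rw [hpK] at h1
    simpa [hp, dyadInt, stochInt] using h1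
  · simp only [hp]
    rw [tsub_le_iff_left, dyad_succ]
    rcases le_total (dyad n j) b with hb | hb
    · rw [min_eq_left hb]
      exact min_le_left _ _
    · rw [min_eq_right hb]
      exact (min_le_right _ _).trans le_self_add
  · refine (sum_eq_zero fun i _ => ?_).le
    rcases le_total b (dyad n j) with hb | hb
    · have e1 : p j = b := min_eq_right hb
      have e2 : p (j + 1) = b := min_eq_right (hb.trans (dyad_mono n j.le_succ))
      simp [e1, e2]
    · have e1 : p j = dyad n j := min_eq_left hb
      rcases le_or_gt (p j) (dyad n' i) with h2 | h2
      · simp [min_eq_right h2]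
      · have h3 : dyad n' (i + 1) ≤ p j := by
          rw [e1, dyad_refine hn] at h2 ⊢
          exact dyad_mono n' (Nat.succ_le_of_lt ((dyad_mono n').reflect_lt h2))
        have h4 : p j ≤ p (j + 1) := min_le_min_right _ (dyad_mono n j.le_succ)
        simp [min_eq_left (h3.trans h4), max_eq_left h3, min_eq_left (h2.le.trans h4),
          max_eq_left h2.le]

end IsBddMart

/-! ### Partition sequences and covariation -/

/-- A sequence of partitions of `[0, t]` whose mesh tends to `0`. -/
structure IsPartitionSeq (t : ℝ≥0) (p : ℕ → ℕ → ℝ≥0) (K : ℕ → ℕ) : Prop where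
  mono : ∀ m, Monotone (p m)
  zero : ∀ m, p m 0 = 0
  last : ∀ m, p m (K m) = t
  mesh : ∀ δ : ℝ≥0, 0 < δ → ∀ᶠ m in atTop, ∀ j < K m, p m (j + 1) - p m j ≤ δ

/-- `R` is the limit in probability of the sums of products of increments of `A` and `B` along all
partitions of `[0, t]` whose mesh tends to `0`. -/
def HasCovAt {S : Type*} [MeasurableSpace S] (P : Measure S) (A B : ℝ≥0 → S → ℝ) (t : ℝ≥0)
  (R : S → ℝ) : Prop :=
  ∀ p K, IsPartitionSeq t p K → TendstoInMeasure P (fun m w => ∑ j ∈ range (K m),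
      (A (p m (j + 1)) w - A (p m j) w) * (B (p m (j + 1)) w - B (p m j) w)) atTop R

section Cov

variable {S : Type*} [m0 : MeasurableSpace S] {P : Measure S}

lemma HasCovAt.symm {A B : ℝ≥0 → S → ℝ} {t : ℝ≥0} {R : S → ℝ} (h : HasCovAt P A B t R) :
  HasCovAt P B A t R := fun p K hp => by
  simpa only [mul_comm] using h p K hp

lemma IsQuadraticVariation.hasCovAt {Z Q : ℝ≥0 → S → ℝ} (h : IsQuadraticVariation P Z Q)
  (t : ℝ≥0) : HasCovAt P Z Z t (Q t) := fun p K hp => by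
  simpa only [sq] using h.tendsto t p K hp.mono hp.zero hp.last hp.mesh

lemma IsQuadraticVariation.of_hasCovAt {Z Q : ℝ≥0 → S → ℝ} (hm : ∀ t, Measurable (Q t))
  (hp : ∀ᵐ w ∂P, Q 0 w = 0 ∧ Monotone (fun t => Q t w) ∧ IsCadlag (fun t => Q t w))
  (hc : ∀ t, HasCovAt P Z Z t (Q t)) : IsQuadraticVariation P Z Q where
  measurable := hm
  paths := hp
  tendsto t p K h1 h2 h3 h4 := by simpa only [sq] using hc t p K ⟨h1, h2, h3, h4⟩

lemma HasCovAt.sum_sum {ι κ : Type*} {s : Finset ι} {s' : Finset κ} {A : ι → ℝ≥0 → S → ℝ}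
  {B : κ → ℝ≥0 → S → ℝ} {t : ℝ≥0} {R : ι → κ → S → ℝ}
  (h : ∀ a ∈ s, ∀ b ∈ s', HasCovAt P (A a) (B b) t (R a b)) :
  HasCovAt P (fun u w => ∑ a ∈ s, A a u w) (fun u w => ∑ b ∈ s', B b u w) t
    (fun w => ∑ a ∈ s, ∑ b ∈ s', R a b w) := by
  intro p K hp
  have h1 := TendstoInMeasure.fun_sum fun a ha =>
    TendstoInMeasure.fun_sum fun b hb => h a ha b hb p K hp
  refine h1.congr_left fun m => .of_forall fun w => ?_
  simp only [← sum_sub_distrib, Finset.sum_mul_sum]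
  simp_rw [Finset.sum_comm (s := s')]
  rw [Finset.sum_comm]

lemma HasCovAt.const_mul {A B : ℝ≥0 → S → ℝ} {t : ℝ≥0} {R : S → ℝ} (h : HasCovAt P A B t R)
  (c d : ℝ) : HasCovAt P (fun u w => c * A u w) (fun u w => d * B u w) t
    (fun w => c * d * R w) := by
  intro p K hp
  refine (TendstoInMeasure.fun_const_mul (h p K hp) (c * d)).congr_left fun m =>
    .of_forall fun w => ?_
  simp only [mul_sum]
  exact sum_congr rfl fun j _ => by ring

lemma HasCovAt.sum_of_orthogonal {ι : Type*} {s : Finset ι} {A : ι → ℝ≥0 → S → ℝ}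
  {t : ℝ≥0} {R : ι → S → ℝ} (h : ∀ a ∈ s, HasCovAt P (A a) (A a) t (R a))
  (h0 : ∀ a ∈ s, ∀ b ∈ s, a ≠ b → HasCovAt P (A a) (A b) t 0) :
  HasCovAt P (fun u w => ∑ a ∈ s, A a u w) (fun u w => ∑ b ∈ s, A b u w) t
    (fun w => ∑ a ∈ s, R a w) := by
  classical
  have h1 := HasCovAt.sum_sum (P := P) (s := s) (s' := s) (A := A) (B := A) (t := t)
    (R := fun a b => if a = b then R a else 0) fun a ha b hb => by grind
  convert h1 using 2 with w
  refine sum_congr rfl fun a ha => ?_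
  rw [Finset.sum_eq_single_of_mem a ha]
  · simp
  · intro b _ hb
    simp [Ne.symm hb]

lemma IsPartitionSeq.le_of_le {t : ℝ≥0} {p : ℕ → ℕ → ℝ≥0} {K : ℕ → ℕ}
  (hp : IsPartitionSeq t p K) {m j : ℕ} (hj : j ≤ K m) : p m j ≤ t :=
  (hp.mono m hj).trans_eq (hp.last m)

lemma HasCovAt.congr_ae {A B A' B' : ℝ≥0 → S → ℝ} {t : ℝ≥0} {R R' : S → ℝ} (h : HasCovAt P A B t R)
  (hA : ∀ᵐ w ∂P, ∀ s ≤ t, A s w = A' s w) (hB : ∀ᵐ w ∂P, ∀ s ≤ t, B s w = B' s w)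
  (hR : R =ᵐ[P] R') : HasCovAt P A' B' t R' := by
  intro p K hp
  refine (h p K hp).congr (fun m => ?_) hR
  filter_upwards [hA, hB] with w h1 h2
  refine sum_congr rfl fun j hj => ?_
  have hj' : j + 1 ≤ K m := mem_range.1 hj
  have e1 := hp.le_of_le hj'
  have e2 := hp.le_of_le (j.le_succ.trans hj')
  rw [h1 _ e1, h1 _ e2, h2 _ e1, h2 _ e2]

lemma HasCovAt.of_localize [IsFiniteMeasure P] {A : ℝ≥0 → S → ℝ} {t : ℝ≥0} {R : S → ℝ}
  {E : ℕ → Set S} (hE : Tendsto (fun m => P (E m)ᶜ) atTop (𝓝 0))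
  {A' : ℕ → ℝ≥0 → S → ℝ} {R' : ℕ → S → ℝ} (h : ∀ m, HasCovAt P (A' m) (A' m) t (R' m))
  (hA : ∀ m, ∀ᵐ w ∂P, w ∈ E m → (∀ s ≤ t, A s w = A' m s w) ∧ R w = R' m w) :
  HasCovAt P A A t R := by
  intro p K hp
  refine tendstoInMeasure_of_localize hE (fun m => h m p K hp) fun m => ?_
  filter_upwards [hA m] with w h1 hω
  refine ⟨fun n => ?_, (h1 hω).2⟩
  refine sum_congr rfl fun j hj => ?_
  have hj' : j + 1 ≤ K n := mem_range.1 hj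
  rw [(h1 hω).1 _ (hp.le_of_le hj'), (h1 hω).1 _ (hp.le_of_le (j.le_succ.trans hj'))]

lemma tendstoInMeasure_zero_of_eventually_sq_le [IsFiniteMeasure P] {f : ℕ → S → ℝ}
  (hf : ∀ n, Integrable (fun w => f n w ^ 2) P)
  (h : ∀ η > 0, ∀ᶠ n in atTop, ∫ w, f n w ^ 2 ∂P ≤ η) :
  TendstoInMeasure P f atTop (0 : S → ℝ) := by
  refine tendstoInMeasure_of_integral_sq (by simpa using hf) ?_
  simp only [Pi.zero_apply, sub_zero]
  rw [Metric.tendsto_nhds]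
  intro ε hε
  filter_upwards [h (ε / 2) (half_pos hε)] with n hn
  rw [Real.dist_eq, sub_zero, abs_of_nonneg (integral_nonneg fun _ => sq_nonneg _)]
  linarith

end Cov

namespace IsBddMart

variable {S : Type*} [m0 : MeasurableSpace S] {P : Measure S} [IsProbabilityMeasure P]
  {F : ℝ≥0 → MeasurableSpace S} {N : ℝ≥0 → S → ℝ} {w : ℝ≥0 → ℝ} (h : IsBddMart P F N w)

include h

lemma eventually_mul_w_le {c : ℝ} (hc : 0 ≤ c) {t : ℝ≥0}
  {p : ℕ → ℕ → ℝ≥0} {K : ℕ → ℕ} (hp : IsPartitionSeq t p K) {η : ℝ} (hη : 0 < η) :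
  ∃ δ : ℝ≥0, c * w δ ≤ η ∧ ∀ᶠ m in atTop, ∀ j < K m, p m (j + 1) - p m j ≤ δ := by
  obtain ⟨δ, hδ, hw⟩ := h.w_small (η / (c + 1)) (by positivity)
  refine ⟨δ, ?_, hp.mesh δ hδ⟩
  calc c * w δ ≤ (c + 1) * (η / (c + 1)) :=
        mul_le_mul (by linarith) hw (h.w_nonneg _) (by linarith)
    _ = η := by field_simp

lemma hasCovAt_zero {B : ℝ≥0 → S → ℝ} (hB : ∀ t, BddMeas (F 0) (B t))
  (t : ℝ≥0) {c : ℝ} (hc : ∀ p : ℕ → ℝ≥0, Monotone p → p 0 = 0 → ∀ K, p K = t →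
    ∑ j ∈ range K, ∫ o, (B (p (j + 1)) o - B (p j) o) ^ 2 ∂P ≤ c) :
  HasCovAt P N B t 0 := by
  intro p K hp
  have hBm : ∀ s u, BddMeas (F u) (B s) := fun s u => (hB s).mono (h.mono zero_le)
  have hBm' : ∀ s, BddMeas m0 (B s) := fun s => (hB s).mono (h.le _)
  have e0 : ∀ m o, ∑ j ∈ range (K m),
      (N (p m (j + 1)) o - N (p m j) o) * (B (p m (j + 1)) o - B (p m j) o)
      = ∑ j ∈ range (K m),
      (B (p m (j + 1)) o - B (p m j) o) * (N (p m (j + 1)) o - N (p m j) o) :=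
    fun m o => sum_congr rfl fun j _ => mul_comm _ _
  simp_rw [e0]
  refine tendstoInMeasure_zero_of_eventually_sq_le (fun n => ?_) fun η hη => ?_
  · exact ((BddMeas.sum fun j _ => ((hBm' _).sub (hBm' _)).mul
      ((h.bddMeas _).sub (h.bddMeas _))).pow 2).int
  have hc0 : 0 ≤ c := (sum_nonneg fun _ _ => integral_nonneg fun _ => sq_nonneg _).trans
    (hc (p 0) (hp.mono 0) (hp.zero 0) (K 0) (hp.last 0))
  obtain ⟨δ, h1, h2⟩ := h.eventually_mul_w_le hc0 hp hη
  filter_upwards [h2] with m hm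
  rw [h.integral_stochSum_sq (hp.mono m) (fun i => (hBm _ _).sub (hBm _ _))]
  calc _ ≤ ∑ j ∈ range (K m), w δ * ∫ o, (B (p m (j + 1)) o - B (p m j) o) ^ 2 ∂P := by
        refine sum_le_sum fun j hj => ?_
        refine (h.var _ _ (hp.mono m j.le_succ) _ (((hBm _ _).sub (hBm _ _)).pow 2)
          fun o => sq_nonneg _).trans ?_
        exact mul_le_mul_of_nonneg_right (h.w_mono (hm j (mem_range.1 hj)))
          (integral_nonneg fun o => sq_nonneg _)
    _ ≤ w δ * c := by
        rw [← mul_sum]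
        exact mul_le_mul_of_nonneg_left (hc _ (hp.mono m) (hp.zero m) _ (hp.last m)) (h.w_nonneg _)
    _ ≤ η := by rw [mul_comm]; exact h1

/-- The process that jumps from `0` to `J` at time `τ`. -/
def _root_.jumpProc (τ : ℝ≥0) (J : S → ℝ) (t : ℝ≥0) (w : S) : ℝ := if τ ≤ t then J w else 0

omit h in
lemma _root_.jumpProc_sub (τ : ℝ≥0) (J : S → ℝ) (s t : ℝ≥0) (w : S) :
  jumpProc τ J t w - jumpProc τ J s w
    = ((if τ ≤ t then 1 else 0) - (if τ ≤ s then 1 else 0)) * J w := by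
  unfold jumpProc
  split_ifs <;> simp

omit h in
lemma _root_.jump_indicator_sq {τ s t : ℝ≥0} (h : s ≤ t) :
  (((if τ ≤ t then 1 else 0) - (if τ ≤ s then 1 else 0) : ℝ)) ^ 2
    = (if τ ≤ t then 1 else 0) - (if τ ≤ s then 1 else 0) := by
  grind

omit h in
lemma _root_.hasCovAt_jump_self {τ : ℝ≥0} (hτ : 0 < τ) (J : S → ℝ) (t : ℝ≥0) :
  HasCovAt P (jumpProc τ J) (jumpProc τ J) t (jumpProc τ (fun w => J w ^ 2) t) := by
  intro p K hp
  refine (tendstoInMeasure_const (P := P) _).congr_left fun m => .of_forall fun w => ?_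
  have : ∀ j ∈ range (K m), (jumpProc τ J (p m (j + 1)) w - jumpProc τ J (p m j) w) *
      (jumpProc τ J (p m (j + 1)) w - jumpProc τ J (p m j) w)
      = jumpProc τ (fun w => J w ^ 2) (p m (j + 1)) w
        - jumpProc τ (fun w => J w ^ 2) (p m j) w := fun j _ => by
    rw [jumpProc_sub τ (fun w => J w ^ 2), jumpProc_sub τ J]
    linear_combination J w ^ 2 * jump_indicator_sq (τ := τ) (hp.mono m j.le_succ)
  beta_reduce
  rw [sum_congr rfl this,
    sum_range_sub (fun j => jumpProc τ (fun w => J w ^ 2) (p m j) w), hp.last, hp.zero]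
  simp [jumpProc, hτ.ne']

omit h in
lemma _root_.hasCovAt_jump_jump {τ τ' : ℝ≥0} (hτ : τ < τ') (J J' : S → ℝ) (t : ℝ≥0) :
  HasCovAt P (jumpProc τ J) (jumpProc τ' J') t 0 := by
  intro p K hp
  have hpos : 0 < (τ' - τ) / 2 := by
    have := tsub_pos_of_lt hτ
    positivity
  have h1 : ∀ᶠ m in atTop, (fun w : S => (0 : S → ℝ) w) =ᵐ[P] fun w =>
      ∑ j ∈ range (K m), (jumpProc τ J (p m (j + 1)) w - jumpProc τ J (p m j) w) *
      (jumpProc τ' J' (p m (j + 1)) w - jumpProc τ' J' (p m j) w) := by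
    filter_upwards [hp.mesh _ hpos] with m hm
    refine .of_forall fun w => (sum_eq_zero fun j hj => ?_).symm
    have h2 := hm j (mem_range.1 hj)
    have h3 := hp.mono m j.le_succ
    rw [jumpProc_sub, jumpProc_sub]
    by_cases h4 : τ ≤ p m j
    · simp [h4, h4.trans h3]
    · by_cases h5 : τ' ≤ p m (j + 1)
      · exfalso
        rw [tsub_le_iff_left] at h2
        have h6 : τ' ≤ p m j + (τ' - τ) / 2 := h5.trans h2
        have h7 : τ' < τ + (τ' - τ) := by nlinarith
        rw [add_tsub_cancel_of_le hτ.le] at h7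
        exact lt_irrefl _ h7
      grind
  exact (tendstoInMeasure_const (P := P) (0 : S → ℝ)).congr' h1 (EventuallyEq.rfl)

lemma hasCovAt_jump (τ : ℝ≥0) {J : S → ℝ} (hJ : BddMeas m0 J)
  (t : ℝ≥0) : HasCovAt P N (jumpProc τ J) t 0 := by
  intro p K hp
  obtain ⟨C, hC⟩ := hJ.2
  have hC0 : ∀ o, J o ^ 2 ≤ C ^ 2 := fun o => by
    rw [← sq_abs]
    exact pow_le_pow_left₀ (abs_nonneg _) (hC o) 2
  have hjm : ∀ s, BddMeas m0 (jumpProc τ J s) := fun s => by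
    unfold jumpProc
    split_ifs
    · exact hJ
    · exact BddMeas.const 0
  refine tendstoInMeasure_zero_of_eventually_sq_le (fun n => ?_) fun η hη => ?_
  · exact ((BddMeas.sum fun j _ => ((h.bddMeas _).sub (h.bddMeas _)).mul
      ((hjm _).sub (hjm _))).pow 2).int
  obtain ⟨δ, h1, h2⟩ := h.eventually_mul_w_le (sq_nonneg C) hp hη
  filter_upwards [h2] with m hm
  set χ : ℕ → ℝ := fun j => (if τ ≤ p m (j + 1) then 1 else 0) - (if τ ≤ p m j then 1 else 0)
    with hχ
  have hχ2 : ∀ j, χ j ^ 2 = χ j := fun j => jump_indicator_sq (hp.mono m j.le_succ)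
  have hχ0 : ∀ j, 0 ≤ χ j := fun j => hχ2 j ▸ sq_nonneg _
  have hχs : ∑ j ∈ range (K m), χ j ≤ 1 := by
    rw [sum_range_sub (fun j => (if τ ≤ p m j then (1 : ℝ) else 0))]
    split_ifs <;> norm_num
  set D : ℕ → S → ℝ := fun j o => N (p m (j + 1)) o - N (p m j) o with hD
  have hDm : ∀ j, BddMeas m0 (D j) := fun j => (h.bddMeas _).sub (h.bddMeas _)
  have hpt : ∀ o, (∑ j ∈ range (K m), D j o *
      (jumpProc τ J (p m (j + 1)) o - jumpProc τ J (p m j) o)) ^ 2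
      ≤ C ^ 2 * ∑ j ∈ range (K m), χ j * D j o ^ 2 := fun o => by
    have e1 : ∑ j ∈ range (K m), D j o * (jumpProc τ J (p m (j + 1)) o - jumpProc τ J (p m j) o)
        = J o * ∑ j ∈ range (K m), χ j * (χ j * D j o) := by
      rw [mul_sum]
      refine sum_congr rfl fun j _ => ?_
      rw [jumpProc_sub, ← mul_assoc (χ j), ← sq, hχ2]
      ring
    have e2 := Finset.sum_mul_sq_le_sq_mul_sq (range (K m)) χ (fun j => χ j * D j o)
    simp only [mul_pow, hχ2] at e2
    rw [e1, mul_pow]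
    refine mul_le_mul (hC0 o) (e2.trans ?_) (sq_nonneg _) (sq_nonneg _)
    exact mul_le_of_le_one_left (sum_nonneg fun j _ => mul_nonneg (hχ0 j) (sq_nonneg _)) hχs
  calc _ ≤ ∫ o, C ^ 2 * ∑ j ∈ range (K m), χ j * D j o ^ 2 ∂P :=
        integral_mono ((BddMeas.sum fun j _ => (hDm j).mul
          ((hjm _).sub (hjm _))).pow 2).int ((BddMeas.sum fun j _ =>
            ((hDm j).pow 2).const_mul (χ j)).const_mul _).int hpt
    _ = C ^ 2 * ∑ j ∈ range (K m), χ j * ∫ o, D j o ^ 2 ∂P := by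
        rw [integral_const_mul, integral_finsetSum _ fun j _ =>
          (((hDm j).pow 2).const_mul (χ j)).int]
        simp_rw [integral_const_mul]
    _ ≤ C ^ 2 * ∑ j ∈ range (K m), χ j * w δ := by
        refine mul_le_mul_of_nonneg_left (sum_le_sum fun j hj => ?_) (sq_nonneg _)
        refine mul_le_mul_of_nonneg_left ?_ (hχ0 j)
        have h4 := h.var _ _ (hp.mono m j.le_succ) (fun _ => 1) (BddMeas.const 1)
          (fun _ => zero_le_one)
        simp only [one_mul, integral_const, smul_eq_mul, mul_one, probReal_univ] at h4
        exact h4.trans (h.w_mono (hm j (mem_range.1 hj)))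
    _ ≤ C ^ 2 * w δ := by
        rw [← Finset.sum_mul]
        exact mul_le_mul_of_nonneg_left (mul_le_of_le_one_left (h.w_nonneg _) hχs) (sq_nonneg _)
    _ ≤ η := h1

lemma hasCovAt_add_lipschitz {D : ℝ≥0 → S → ℝ} (hD : ∀ t, BddMeas m0 (D t)) {C : ℝ}
  (hC : ∀ s t, s ≤ t → ∀ o, |D t o - D s o| ≤ C * ((t : ℝ) - s)) {t : ℝ≥0} {R : S → ℝ}
  (hR : HasCovAt P N N t R) :
  HasCovAt P (fun t o => N t o + D t o) (fun t o => N t o + D t o) t R := by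
  have hdd : ∀ p : ℕ → ℝ≥0, Monotone p → p 0 = 0 → ∀ K, p K = t → ∀ δ : ℝ≥0,
      (∀ j < K, p (j + 1) - p j ≤ δ) → ∀ o,
      ∑ j ∈ range K, (D (p (j + 1)) o - D (p j) o) ^ 2 ≤ C ^ 2 * t * δ := by
    intro p hp h0 K hK δ hδ o
    have : ∀ j ∈ range K, (D (p (j + 1)) o - D (p j) o) ^ 2
        ≤ C ^ 2 * δ * ((p (j + 1) : ℝ) - p j) := fun j hj => by
      have h1 := hδ j (mem_range.1 hj)
      have h2 : (p j : ℝ) ≤ p (j + 1) := by exact_mod_cast hp j.le_succ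
      have h3 : (p (j + 1) : ℝ) - p j ≤ δ := by
        have h4 := tsub_le_iff_left.1 h1
        linarith
      rw [← sq_abs]
      calc |D (p (j + 1)) o - D (p j) o| ^ 2 ≤ (C * ((p (j + 1) : ℝ) - p j)) ^ 2 :=
            pow_le_pow_left₀ (abs_nonneg _) (hC _ _ (hp j.le_succ) o) 2
        _ = C ^ 2 * (((p (j + 1) : ℝ) - p j) * ((p (j + 1) : ℝ) - p j)) := by ring
        _ ≤ C ^ 2 * (δ * ((p (j + 1) : ℝ) - p j)) :=
            mul_le_mul_of_nonneg_left (mul_le_mul_of_nonneg_right h3 (by linarith)) (sq_nonneg _)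
        _ = _ := by ring
    refine (sum_le_sum this).trans ?_
    rw [← mul_sum, sum_range_sub (fun j => (p j : ℝ)), hK, h0]
    simp only [NNReal.coe_zero, sub_zero]
    exact le_of_eq (by ring)
  have hDm : ∀ s u, BddMeas m0 (fun o => D s o - D u o) := fun s u => (hD s).sub (hD u)
  have hNm : ∀ s u, BddMeas m0 (fun o => N s o - N u o) := fun s u =>
    (h.bddMeas s).sub (h.bddMeas u)
  have hDD : HasCovAt P D D t 0 := by
    intro p K hp
    refine tendstoInMeasure_zero_of_eventually_sq_le (fun n => ((BddMeas.sum fun j _ =>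
      (hDm _ _).mul (hDm _ _)).pow 2).int) fun η hη => ?_
    have hpos : 0 < √η / (C ^ 2 * t + 1) := by positivity
    filter_upwards [hp.mesh ⟨_, hpos.le⟩ hpos] with m hm
    have h1 := hdd (p m) (hp.mono m) (hp.zero m) (K m) (hp.last m) _ hm
    have h2 : ∀ o, (∑ j ∈ range (K m),
        (D (p m (j + 1)) o - D (p m j) o) * (D (p m (j + 1)) o - D (p m j) o)) ^ 2 ≤ η := by
      intro o
      simp_rw [← sq]
      have h3 : C ^ 2 * t * (√η / (C ^ 2 * t + 1)) ≤ √η := by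
        rw [mul_div_assoc', div_le_iff₀ (by positivity)]
        nlinarith [Real.sqrt_nonneg η]
      calc _ ≤ (√η) ^ 2 := pow_le_pow_left₀ (sum_nonneg fun _ _ => sq_nonneg _)
            ((h1 o).trans h3) 2
        _ = η := Real.sq_sqrt hη.le
    calc _ ≤ ∫ _, η ∂P := integral_mono ((BddMeas.sum fun j _ =>
          (hDm _ _).mul (hDm _ _)).pow 2).int (integrable_const _) h2
      _ = η := by simp
  have hND : HasCovAt P N D t 0 := by
    intro p K hp
    refine tendstoInMeasure_zero_of_eventually_sq_le (fun n => ((BddMeas.sum fun j _ =>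
      (hNm _ _).mul (hDm _ _)).pow 2).int) fun η hη => ?_
    set e := ∫ o, (N t o - N 0 o) ^ 2 ∂P with he
    have hpos : 0 < η / (C ^ 2 * t * e + 1) := by positivity
    filter_upwards [hp.mesh ⟨_, hpos.le⟩ hpos] with m hm
    have h1 := hdd (p m) (hp.mono m) (hp.zero m) (K m) (hp.last m) _ hm
    have h2 : ∀ o, (∑ j ∈ range (K m),
        (N (p m (j + 1)) o - N (p m j) o) * (D (p m (j + 1)) o - D (p m j) o)) ^ 2
        ≤ (C ^ 2 * t * (η / (C ^ 2 * t * e + 1))) * ∑ j ∈ range (K m),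
          (N (p m (j + 1)) o - N (p m j) o) ^ 2 := fun o => by
      refine (Finset.sum_mul_sq_le_sq_mul_sq _ _ _).trans ?_
      rw [mul_comm]
      exact mul_le_mul_of_nonneg_right (h1 o) (sum_nonneg fun _ _ => sq_nonneg _)
    calc _ ≤ ∫ o, (C ^ 2 * t * (η / (C ^ 2 * t * e + 1))) * ∑ j ∈ range (K m),
          (N (p m (j + 1)) o - N (p m j) o) ^ 2 ∂P := integral_mono ((BddMeas.sum fun j _ =>
          (hNm _ _).mul (hDm _ _)).pow 2).int ((BddMeas.sum fun j _ =>
            (hNm _ _).pow 2).const_mul _).int h2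
      _ = C ^ 2 * t * (η / (C ^ 2 * t * e + 1)) * e := by
          rw [integral_const_mul, integral_finsetSum _ fun j _ => ((hNm _ _).pow 2).int,
            h.sum_integral_sq (hp.mono m), hp.last, hp.zero]
      _ ≤ η := by
          rw [mul_div_assoc', div_mul_eq_mul_div, div_le_iff₀ (by positivity)]
          nlinarith
  have h4 := HasCovAt.sum_sum (P := P) (s := Finset.univ) (s' := Finset.univ) (t := t)
    (A := fun b : Bool => if b then N else D) (B := fun b : Bool => if b then N else D)
    (R := fun a b => if a && b then R else 0) (fun a _ b _ => by
      cases a <;> cases b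
      · simpa using hDD
      · simpa using hND.symm
      · simpa using hND
      · simpa using hR)
  simpa using h4

end IsBddMart

/-! ### Existence of the quadratic variation -/

section

variable {S : Type*} [m0 : MeasurableSpace S] {P : Measure S} [IsProbabilityMeasure P]

lemma integral_sq_le_integral_sq {f : S → ℝ} (hf : MemLp f 2 P) :
  (∫ w, f w ∂P) ^ 2 ≤ ∫ w, f w ^ 2 ∂P := by
  have h1 := variance_nonneg f P
  rw [variance_eq_sub hf] at h1
  simp only [Pi.pow_apply] at h1
  linarith

lemma BddMeas.memLp {f : S → ℝ} (hf : BddMeas m0 f) : MemLp f 2 P := by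
  obtain ⟨h1, C, hC⟩ := hf
  exact MemLp.of_bound h1.aestronglyMeasurable C (.of_forall fun w => by simpa using hC w)

/-- The dyadic points that approximate `t` strictly from above. -/
def dyadAbove (t : ℝ≥0) (k : ℕ) : ℝ≥0 := dyad k (⌊t * 2 ^ k⌋₊ + 1)

lemma lt_dyadAbove (t : ℝ≥0) (k : ℕ) : t < dyadAbove t k := by
  unfold dyadAbove dyad
  rw [lt_div_iff₀ (by positivity)]
  exact_mod_cast Nat.lt_floor_add_one (t * 2 ^ k)

lemma dyadAbove_le (t : ℝ≥0) (k : ℕ) : dyadAbove t k ≤ t + 1 / 2 ^ k := by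
  unfold dyadAbove
  rw [dyad_succ]
  gcongr
  unfold dyad
  rw [div_le_iff₀ (by positivity)]
  exact Nat.floor_le zero_le

lemma dyadAbove_mono_left (k : ℕ) : Monotone fun t => dyadAbove t k := fun s t hst => by
  exact dyad_mono k (Nat.succ_le_succ (Nat.floor_mono (by gcongr)))

lemma dyadAbove_anti (t : ℝ≥0) {k l : ℕ} (h : k ≤ l) : dyadAbove t l ≤ dyadAbove t k := by
  unfold dyadAbove
  rw [dyad_refine h]
  refine dyad_mono l (Nat.succ_le_of_lt ?_)
  rw [Nat.floor_lt zero_le]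
  have h1 := Nat.lt_floor_add_one (t * 2 ^ k)
  obtain ⟨d, rfl⟩ := Nat.exists_eq_add_of_le h
  rw [Nat.add_sub_cancel_left, pow_add, ← mul_assoc]
  push_cast
  gcongr

lemma dyadAbove_eq {s t : ℝ≥0} {k : ℕ} (hst : s ≤ t) (ht : t < dyadAbove s k) :
  dyadAbove t k = dyadAbove s k := by
  refine le_antisymm ?_ (dyadAbove_mono_left k hst)
  unfold dyadAbove at *
  refine dyad_mono k (Nat.succ_le_of_lt ?_)
  rw [Nat.floor_lt zero_le]
  unfold dyad at ht
  rwa [lt_div_iff₀ (by positivity)] at ht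

namespace IsBddMart

variable {F : ℝ≥0 → MeasurableSpace S} {N : ℝ≥0 → S → ℝ} {w : ℝ≥0 → ℝ} (h : IsBddMart P F N w)

include h

lemma bddMeas_dyadInt (n : ℕ) (b : ℝ≥0) :
  BddMeas m0 (dyadInt N n b) := (h.bddMeas_stochInt n _ b).mono (h.le b)

lemma exists_stochInt_limit (b : ℝ≥0) : ∃ I : S → ℝ, Measurable I ∧ MemLp I 2 P ∧
    Tendsto (fun n => ∫ o, (dyadInt N n b o - I o) ^ 2 ∂P) atTop (𝓝 0) := by
  refine exists_L2_limit (fun n => h.bddMeas_dyadInt n b)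
    (c := fun n => 8 * w (1 / 2 ^ n) * ∫ o, (N b o - N 0 o) ^ 2 ∂P) ?_ ?_
  · simpa using (h.w_inv_two_pow.const_mul 8).mul_const (∫ o, (N b o - N 0 o) ^ 2 ∂P)
  · intro n n' hn
    exact h.integral_dyadInt_sub_sq_le b hn

omit h in
lemma sum_sq_eq (N : ℝ≥0 → S → ℝ) (p : ℕ → ℝ≥0) (K : ℕ) (w : S) :
  ∑ j ∈ range K, (N (p (j + 1)) w - N (p j) w) ^ 2 = N (p K) w ^ 2 - N (p 0) w ^ 2
      - 2 * ∑ j ∈ range K, N (p j) w * (N (p (j + 1)) w - N (p j) w) := by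
  rw [← sum_range_sub (fun j => N (p j) w ^ 2), mul_sum, ← sum_sub_distrib]
  exact sum_congr rfl fun j _ => by ring

lemma integral_dyadInt (n : ℕ) (b : ℝ≥0) : ∫ o, dyadInt N n b o ∂P = 0 := by
  unfold dyadInt stochInt
  rw [integral_finsetSum]
  · exact sum_eq_zero fun i _ =>
      h.orth _ _ (min_le_min_right _ (dyad_mono n i.le_succ)) _ (h.adapted _)
  · intro i _
    exact ((h.bddMeas _).mul ((h.bddMeas _).sub (h.bddMeas _))).int

lemma integral_sub_sq_le {s t : ℝ≥0} (hst : s ≤ t) : ∫ o, (N t o - N s o) ^ 2 ∂P ≤ w (t - s) := by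
  have h4 := h.var _ _ hst (fun _ => 1) (BddMeas.const 1) (fun _ => zero_le_one)
  simpa only [one_mul, integral_const, smul_eq_mul, mul_one, probReal_univ] using h4

lemma integral_dyadInt_diff_sq_le {s t : ℝ≥0} (hst : s ≤ t) (n : ℕ)
  {C : ℝ} (hC : ∀ u ≤ t, ∀ o, |N u o| ≤ C) :
  ∫ o, (dyadInt N n t o - dyadInt N n s o) ^ 2 ∂P ≤ C ^ 2 * w (t - s) := by
  have hJ : 2 ^ n * ⌈s⌉₊ ≤ 2 ^ n * ⌈t⌉₊ := Nat.mul_le_mul_left _ (Nat.ceil_mono hst)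
  simp_rw [dyadInt_eq hJ, dyadInt, stochInt_sub n _ hst]
  rw [h.integral_stochSum_sq (clip_mono n s t) (fun i => h.adapted' (le_max_right _ _))]
  have h1 : ∀ i ∈ range (2 ^ n * ⌈t⌉₊), ∫ o, N (min (dyad n i) t) o ^ 2 *
      (N (max s (min (dyad n (i + 1)) t)) o - N (max s (min (dyad n i) t)) o) ^ 2 ∂P
      ≤ C ^ 2 * ∫ o,
      (N (max s (min (dyad n (i + 1)) t)) o - N (max s (min (dyad n i) t)) o) ^ 2 ∂P := by
    intro i _
    rw [← integral_const_mul]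
    refine integral_mono (((h.bddMeas _).pow 2).mul (((h.bddMeas _).sub (h.bddMeas _)).pow 2)).int
      ((((h.bddMeas _).sub (h.bddMeas _)).pow 2).const_mul _).int fun o => ?_
    refine mul_le_mul_of_nonneg_right ?_ (sq_nonneg _)
    rw [← sq_abs]
    exact pow_le_pow_left₀ (abs_nonneg _) (hC _ (min_le_right _ _) o) 2
  refine (sum_le_sum h1).trans ?_
  rw [← mul_sum, h.sum_integral_sq (clip_mono n s t), clip_zero,
    clip_last hst (le_dyad_ceil n t le_rfl)]
  exact mul_le_mul_of_nonneg_left (h.integral_sub_sq_le hst) (sq_nonneg _)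

/-- A square-integrable martingale with a deterministic modulus for its conditional variances has
a quadratic variation process. -/
lemma exists_quadraticVariation :
  ∃ Q : ℝ≥0 → S → ℝ, IsQuadraticVariation P N Q ∧ (∀ t, Integrable (Q t) P) ∧
    ∀ s t, s ≤ t → ∫ o, (Q t o - Q s o) ∂P = ∫ o, (N t o - N s o) ^ 2 ∂P := by
  choose I hIm hI2 hI using h.exists_stochInt_limit
  have hd2 : ∀ n t, MemLp (fun o => dyadInt N n t o - I t o) 2 P := fun n t =>
    (h.bddMeas_dyadInt n t).memLp.sub (hI2 t)
  have hI0 : ∀ t, ∫ o, I t o ∂P = 0 := by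
    intro t
    have h1 : ∀ n, (∫ o, I t o ∂P) ^ 2 ≤ ∫ o, (dyadInt N n t o - I t o) ^ 2 ∂P := fun n => by
      refine le_trans (le_of_eq ?_) (integral_sq_le_integral_sq (hd2 n t))
      rw [integral_sub (h.bddMeas_dyadInt n t).int ((hI2 t).integrable one_le_two),
        h.integral_dyadInt]
      ring
    have h2 := ge_of_tendsto' (hI t) h1
    nlinarith
  set Q₀ : ℝ≥0 → S → ℝ := fun t o => N t o ^ 2 - N 0 o ^ 2 - 2 * I t o with hQ₀
  have hQm : ∀ t, Measurable (Q₀ t) := fun t =>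
    (((h.bddMeas t).pow 2).1.sub ((h.bddMeas 0).pow 2).1).sub ((hIm t).const_mul 2)
  have hQi : ∀ t, Integrable (Q₀ t) P := fun t =>
    (((h.bddMeas t).pow 2).int.sub ((h.bddMeas 0).pow 2).int).sub
      (((hI2 t).integrable one_le_two).const_mul 2)
  have hQint : ∀ s t, s ≤ t → ∫ o, (Q₀ t o - Q₀ s o) ∂P = ∫ o, (N t o - N s o) ^ 2 ∂P := by
    intro s t hst
    have h1 : ∀ o, Q₀ t o - Q₀ s o = (N t o - N s o) ^ 2 + 2 * (N s o * (N t o - N s o))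
        - 2 * (I t o - I s o) := fun o => by ring
    simp_rw [h1]
    have i1 := (((h.bddMeas t).sub (h.bddMeas s)).pow 2).int (P := P)
    have i2 := ((((h.bddMeas s).mul ((h.bddMeas t).sub (h.bddMeas s)))).const_mul 2).int (P := P)
    have i3 : Integrable (fun o => I t o - I s o) P :=
      ((hI2 t).integrable one_le_two).sub ((hI2 s).integrable one_le_two)
    have i12 : Integrable (fun o => (N t o - N s o) ^ 2
      + 2 * (N s o * (N t o - N s o))) P := i1.add i2
    rw [integral_sub i12 (i3.const_mul 2), integral_add i1 i2, integral_const_mul,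
      integral_const_mul, h.orth s t hst _ (h.adapted s),
      integral_sub ((hI2 t).integrable one_le_two) ((hI2 s).integrable one_le_two), hI0, hI0]
    ring
  have hcov : ∀ t, HasCovAt P N N t (Q₀ t) := by
    intro t p K hp
    set f : ℕ → S → ℝ := fun m o =>
      ∑ j ∈ range (K m), N (p m j) o * (N (p m (j + 1)) o - N (p m j) o) with hf
    have hfm : ∀ m, BddMeas m0 (f m) := fun m => BddMeas.sum fun j _ =>
      (h.bddMeas _).mul ((h.bddMeas _).sub (h.bddMeas _))
    set e := ∫ o, (N t o - N 0 o) ^ 2 ∂P with he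
    have key : ∀ m (δ : ℝ≥0), (∀ j < K m, p m (j + 1) - p m j ≤ δ) →
        ∫ o, (f m o - I t o) ^ 2 ∂P ≤ 16 * e * w δ := by
      intro m δ hδ
      have h1 : ∀ n, ∫ o, (dyadInt N n t o - f m o) ^ 2 ∂P
          ≤ 8 * w δ * e + 2 * (K m * (w t * w (1 / 2 ^ n))) := fun n => by
        have h2 := h.integral_stochInt_sub_sq_le (n := n) (J := 2 ^ n * ⌈t⌉₊) (K := K m)
          (hp.mono m) (hp.zero m) (by rw [hp.last]; exact le_dyad_ceil n t le_rfl) hδ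
          (κ := w t * w (1 / 2 ^ n)) (fun j hj => (h.gap_sum_le n _ (hp.mono m j.le_succ)).trans
            (mul_le_mul_of_nonneg_right (h.w_mono (hp.le_of_le hj)) (h.w_nonneg _)))
        rwa [hp.last] at h2
      have h3 : ∀ n, ∫ o, (f m o - I t o) ^ 2 ∂P
          ≤ 2 * (8 * w δ * e + 2 * (K m * (w t * w (1 / 2 ^ n))))
            + 2 * ∫ o, (dyadInt N n t o - I t o) ^ 2 ∂P := fun n => by
        have i1 := (((h.bddMeas_dyadInt n t).sub (hfm m)).pow 2).int (P := P)
        have i2 := (hd2 n t).integrable_sq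
        calc _ ≤ ∫ o, (2 * (dyadInt N n t o - f m o) ^ 2
              + 2 * (dyadInt N n t o - I t o) ^ 2) ∂P := by
              refine integral_mono (((hfm m).memLp.sub (hI2 t)).integrable_sq)
                ((i1.const_mul 2).add (i2.const_mul 2)) fun o => ?_
              nlinarith [sq_nonneg (dyadInt N n t o - f m o + (dyadInt N n t o - I t o))]
          _ = 2 * ∫ o, (dyadInt N n t o - f m o) ^ 2 ∂P
              + 2 * ∫ o, (dyadInt N n t o - I t o) ^ 2 ∂P := by
              rw [integral_add (i1.const_mul 2) (i2.const_mul 2), integral_const_mul,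
                integral_const_mul]
          _ ≤ _ := by linarith [h1 n]
      have h4 : Tendsto (fun n => 2 * (8 * w δ * e + 2 * (K m * (w t * w (1 / 2 ^ n))))
            + 2 * ∫ o, (dyadInt N n t o - I t o) ^ 2 ∂P) atTop
          (𝓝 (2 * (8 * w δ * e + 2 * (K m * (w t * 0))) + 2 * 0)) :=
        ((((h.w_inv_two_pow.const_mul _).const_mul _).const_mul 2 |>.const_add _).const_mul 2).add
          ((hI t).const_mul 2)
      have h5 := ge_of_tendsto' h4 h3
      linarith
    have h1 : TendstoInMeasure P f atTop (I t) := by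
      refine tendstoInMeasure_of_integral_sq (fun m => ((hfm m).memLp.sub (hI2 t)).integrable_sq) ?_
      rw [Metric.tendsto_nhds]
      intro ε hε
      obtain ⟨δ, h1, h2⟩ := h.eventually_mul_w_le (c := 16 * e) (by positivity) hp (half_pos hε)
      filter_upwards [h2] with m hm
      rw [Real.dist_eq, sub_zero, abs_of_nonneg (integral_nonneg fun _ => sq_nonneg _)]
      linarith [key m δ hm]
    have h2 := TendstoInMeasure.fun_add
      (tendstoInMeasure_const (P := P) (fun o => N t o ^ 2 - N 0 o ^ 2))
      (TendstoInMeasure.fun_const_mul h1 (-2))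
    refine (h2.congr_left fun m => .of_forall fun o => ?_).congr_right (.of_forall fun o => ?_)
    · have h3 := sum_sq_eq N (p m) (K m) o
      rw [hp.last, hp.zero] at h3
      simp only [sq] at h3 ⊢
      linarith
    · ring
  have hQ00 : ∀ᵐ o ∂P, Q₀ 0 o = 0 := by
    have h1 : ∫ o, (I 0 o) ^ 2 ∂P = 0 := by
      refine tendsto_nhds_unique ?_ (hI 0)
      simp [dyadInt, stochInt]
    have h2 := (integral_eq_zero_iff_of_nonneg (fun o => sq_nonneg _) (hI2 0).integrable_sq).1 h1
    filter_upwards [h2] with o hω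
    have : I 0 o = 0 := by simpa using hω
    simp [hQ₀, this]
  have hmono : ∀ n i t, dyad n i ≤ t → ∀ᵐ o ∂P, Q₀ (dyad n i) o ≤ Q₀ t o := by
    intro n i t hst
    set s := dyad n i with hs
    have hin : ∀ u, TendstoInMeasure P (fun k o => dyadInt N (k + n) u o) atTop (I u) := fun u =>
      (tendstoInMeasure_of_integral_sq (fun k => (hd2 k u).integrable_sq) (hI u)).comp
        (tendsto_add_atTop_nat n)
    have h1 := TendstoInMeasure.fun_add
      (tendstoInMeasure_const (P := P) (fun o => N t o ^ 2 - N s o ^ 2))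
      (TendstoInMeasure.fun_add (TendstoInMeasure.fun_const_mul (hin t) (-2))
        (TendstoInMeasure.fun_const_mul (hin s) 2))
    obtain ⟨ns, -, h2⟩ := h1.exists_seq_tendsto_ae
    filter_upwards [h2] with o hω
    have h3 := ge_of_tendsto' hω (b := 0) fun k => by
      set l := ns k + n with hl
      have hJ : 2 ^ l * ⌈s⌉₊ ≤ 2 ^ l * ⌈t⌉₊ := Nat.mul_le_mul_left _ (Nat.ceil_mono hst)
      rw [dyadInt_eq hJ, dyadInt]
      have e1 := sum_sq_eq N (fun j => min (dyad l j) t) (2 ^ l * ⌈t⌉₊) o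
      have e2 := sum_sq_eq N (fun j => min (dyad l j) s) (2 ^ l * ⌈t⌉₊) o
      simp only [min_eq_right (le_dyad_ceil l t le_rfl), min_eq_right (le_dyad_ceil l s hJ),
        dyad_zero, zero_le, min_eq_left] at e1 e2
      have e3 : ∑ j ∈ range (2 ^ l * ⌈t⌉₊),
            (N (min (dyad l (j + 1)) s) o - N (min (dyad l j) s) o) ^ 2
          ≤ ∑ j ∈ range (2 ^ l * ⌈t⌉₊),
            (N (min (dyad l (j + 1)) t) o - N (min (dyad l j) t) o) ^ 2 := by
        refine sum_le_sum fun j _ => ?_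
        rcases le_or_gt s (dyad l j) with h4 | h4
        · rw [min_eq_right h4, min_eq_right (h4.trans (dyad_mono l j.le_succ))]
          nlinarith
        · have h5 : dyad l (j + 1) ≤ s := by
            rw [hs, dyad_refine (show n ≤ l by omega)] at h4 ⊢
            exact dyad_mono l (Nat.succ_le_of_lt ((dyad_mono l).reflect_lt h4))
          grind
      unfold stochInt
      linarith
    linarith
  have hgood : ∀ᵐ o ∂P, Q₀ 0 o = 0 ∧ ∀ n i n' i', dyad n i ≤ dyad n' i' →
      Q₀ (dyad n i) o ≤ Q₀ (dyad n' i') o := by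
    refine hQ00.and ?_
    rw [ae_all_iff]; intro n
    rw [ae_all_iff]; intro i
    rw [ae_all_iff]; intro n'
    rw [ae_all_iff]; intro i'
    by_cases hle : dyad n i ≤ dyad n' i'
    · simpa [hle] using hmono n i _ hle
    · simp [hle]
  set Q : ℝ≥0 → S → ℝ := fun t o => ⨅ k, max (Q₀ (dyadAbove t k) o) 0 with hQ
  have hbdd : ∀ t o, BddBelow (Set.range fun k => max (Q₀ (dyadAbove t k) o) 0) := fun t o =>
    ⟨0, by rintro _ ⟨k, rfl⟩; exact le_max_right _ _⟩
  have hrc : ∀ t, TendstoInMeasure P (fun k o => Q₀ (dyadAbove t k) o) atTop (Q₀ t) := by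
    intro t
    obtain ⟨C, hC⟩ := h.bdd (t + 1)
    have hle1 : ∀ k, dyadAbove t k ≤ t + 1 := fun k => (dyadAbove_le t k).trans (by
      gcongr
      rw [div_le_one (by positivity)]
      exact one_le_pow₀ one_le_two)
    have hlt := fun k => (lt_dyadAbove t k).le
    have hIle : ∀ k, ∫ o, (I (dyadAbove t k) o - I t o) ^ 2 ∂P ≤ 3 * (C ^ 2 * w (1 / 2 ^ k)) := by
      intro k
      set s := dyadAbove t k with hs
      have h1 : ∀ n, ∫ o, (I s o - I t o) ^ 2 ∂P ≤ 3 * ∫ o, (dyadInt N n s o - I s o) ^ 2 ∂P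
          + 3 * ∫ o, (dyadInt N n t o - I t o) ^ 2 ∂P + 3 * (C ^ 2 * w (1 / 2 ^ k)) := fun n => by
        have h2 : ∫ o, (dyadInt N n s o - dyadInt N n t o) ^ 2 ∂P ≤ C ^ 2 * w (1 / 2 ^ k) := by
          refine (h.integral_dyadInt_diff_sq_le (hlt k) n
            (fun u hu o => hC u (hu.trans (hle1 k)) o)).trans ?_
          refine mul_le_mul_of_nonneg_left (h.w_mono ?_) (sq_nonneg _)
          exact tsub_le_iff_left.2 (dyadAbove_le t k)
        have i1 := (hd2 n s).integrable_sq.const_mul 3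
        have i2 := (hd2 n t).integrable_sq.const_mul 3
        have i3 := ((((h.bddMeas_dyadInt n s).sub
          (h.bddMeas_dyadInt n t)).pow 2).int (P := P)).const_mul 3
        have h3 : ∫ o, (I s o - I t o) ^ 2 ∂P ≤ ∫ o, (3 * (dyadInt N n s o - I s o) ^ 2
            + 3 * (dyadInt N n t o - I t o) ^ 2
            + 3 * (dyadInt N n s o - dyadInt N n t o) ^ 2) ∂P := by
          refine integral_mono ((hI2 s).sub (hI2 t)).integrable_sq ((i1.add i2).add i3) fun o => ?_
          nlinarith [sq_nonneg ((dyadInt N n s o - I s o) + (dyadInt N n t o - I t o)),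
            sq_nonneg ((dyadInt N n s o - I s o) + (dyadInt N n s o - dyadInt N n t o)),
            sq_nonneg ((dyadInt N n t o - I t o) - (dyadInt N n s o - dyadInt N n t o))]
        have i12 : Integrable (fun o => 3 * (dyadInt N n s o - I s o) ^ 2
            + 3 * (dyadInt N n t o - I t o) ^ 2) P := i1.add i2
        rw [integral_add i12 i3, integral_add i1 i2, integral_const_mul,
          integral_const_mul, integral_const_mul] at h3
        linarith
      have h2 := ge_of_tendsto' ((((hI s).const_mul 3).add ((hI t).const_mul 3)).add_const
        (3 * (C ^ 2 * w (1 / 2 ^ k)))) h1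
      simpa using h2
    have hI' : TendstoInMeasure P (fun k o => I (dyadAbove t k) o) atTop (I t) := by
      refine tendstoInMeasure_of_integral_sq (fun k => ((hI2 _).sub (hI2 _)).integrable_sq) ?_
      refine tendsto_of_tendsto_of_tendsto_of_le_of_le tendsto_const_nhds ?_
        (fun k => integral_nonneg fun _ => sq_nonneg _) hIle
      simpa using (h.w_inv_two_pow.const_mul (C ^ 2)).const_mul 3
    have hN' : TendstoInMeasure P (fun k o => N (dyadAbove t k) o ^ 2) atTop
        (fun o => N t o ^ 2) := by
      refine tendstoInMeasure_of_integral_sq (fun k =>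
        ((((h.bddMeas _).pow 2).sub ((h.bddMeas _).pow 2)).pow 2).int) ?_
      refine tendsto_of_tendsto_of_tendsto_of_le_of_le tendsto_const_nhds
        (h := fun k => (2 * C) ^ 2 * w (1 / 2 ^ k)) ?_
        (fun k => integral_nonneg fun _ => sq_nonneg _) fun k => ?_
      · simpa using h.w_inv_two_pow.const_mul ((2 * C) ^ 2)
      · calc _ ≤ ∫ o, (2 * C) ^ 2 * (N (dyadAbove t k) o - N t o) ^ 2 ∂P := by
              refine integral_mono ((((h.bddMeas _).pow 2).sub ((h.bddMeas _).pow 2)).pow 2).int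
                ((((h.bddMeas _).sub (h.bddMeas _)).pow 2).const_mul _).int fun o => ?_
              simp only
              rw [sq_sub_sq, mul_pow]
              refine mul_le_mul_of_nonneg_right ?_ (sq_nonneg _)
              rw [← sq_abs]
              refine pow_le_pow_left₀ (abs_nonneg _) ((abs_add_le _ _).trans ?_) 2
              linarith [hC _ (hle1 k) o, hC t le_self_add o]
          _ ≤ _ := by
              rw [integral_const_mul]
              refine mul_le_mul_of_nonneg_left ((h.integral_sub_sq_le (hlt k)).trans
                (h.w_mono ?_)) (sq_nonneg _)
              exact tsub_le_iff_left.2 (dyadAbove_le t k)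
    have h2 := TendstoInMeasure.fun_add (TendstoInMeasure.fun_add hN'
      (tendstoInMeasure_const (P := P) (fun o => - N 0 o ^ 2)))
      (TendstoInMeasure.fun_const_mul hI' (-2))
    grind
  have hQQ : ∀ t, Q t =ᵐ[P] Q₀ t := by
    intro t
    obtain ⟨ns, hns, h1⟩ := (hrc t).exists_seq_tendsto_ae
    filter_upwards [h1, hgood] with o h2 h3
    have hanti : Antitone fun k => max (Q₀ (dyadAbove t k) o) 0 := fun k l hkl =>
      max_le_max_right _ (h3.2 _ _ _ _ (dyadAbove_anti t hkl))
    have h4 := (tendsto_atTop_ciInf hanti (hbdd t o)).comp hns.tendsto_atTop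
    have h5 : ∀ k, max (Q₀ (dyadAbove t k) o) 0 = Q₀ (dyadAbove t k) o := fun k => by
      refine max_eq_left ?_
      have h6 := h3.2 0 0 k (⌊t * 2 ^ k⌋₊ + 1) (by rw [dyad_zero]; exact zero_le)
      rwa [dyad_zero, h3.1] at h6
    simp only [Function.comp_def, h5] at h4
    simp only [hQ, h5]
    exact tendsto_nhds_unique h4 h2
  refine ⟨Q, IsQuadraticVariation.of_hasCovAt (fun t => ?_) ?_ fun t => ?_, fun t => ?_, ?_⟩
  · fun_prop
  · filter_upwards [hgood, hQQ 0] with o h3 h0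
    have hm : Monotone fun t => Q t o := fun s t hst =>
      ciInf_mono (hbdd s o) fun k => max_le_max_right _ (h3.2 _ _ _ _ (dyadAbove_mono_left k hst))
    refine ⟨h0.trans h3.1, hm, fun t => ⟨?_, ?_⟩⟩
    · rw [ContinuousWithinAt, tendsto_order]
      refine ⟨fun a ha => ?_, fun a ha => ?_⟩
      · filter_upwards [self_mem_nhdsWithin] with s hs
        exact ha.trans_le (hm hs)
      · obtain ⟨k, hk⟩ := exists_lt_of_ciInf_lt ha
        have h4 : Iio (dyadAbove t k) ∈ 𝓝[≥] t :=
          mem_nhdsWithin_of_mem_nhds (Iio_mem_nhds (lt_dyadAbove t k))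
        filter_upwards [self_mem_nhdsWithin, h4] with s hs hs'
        refine (ciInf_le (hbdd s o) k).trans_lt ?_
        rwa [dyadAbove_eq hs hs']
    · exact ⟨_, hm.tendsto_leftLim t⟩
  · exact (hcov t).congr_ae (by simp) (by simp) (hQQ t).symm
  · exact (hQi t).congr (hQQ t).symm
  · intro s t hst
    rw [← hQint s t hst]
    refine integral_congr_ae ?_
    filter_upwards [hQQ s, hQQ t] with o h1 h2
    rw [h1, h2]

end IsBddMart

end

/-! ### Densities of measures with integrable characteristic function -/

section Density

open scoped FourierTransform

variable {H : Type*} [NormedAddCommGroup H] [InnerProductSpace ℝ H] [FiniteDimensional ℝ H]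
  [MeasurableSpace H] [BorelSpace H] {ν : Measure H} [IsProbabilityMeasure ν]

/-- The density of the convolution of (a dilation of) `ν` with a Gaussian law. -/
def mollified (ν : Measure H) (b : ℝ) (w : H) : ℝ := (π / b) ^ (Module.finrank ℝ H / 2 : ℝ) *
    ∫ x, exp (-(π ^ 2 / b) * ‖(2 * π)⁻¹ • x - w‖ ^ 2) ∂ν

lemma fourier_charFun_mul_gaussian {b : ℝ} (hb : 0 < b) (w : H) :
  𝓕 (fun v => charFun ν v * Complex.exp (-b * ‖v‖ ^ 2)) w = (mollified ν b w : ℂ) := by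
  have hint : Integrable (uncurry fun (v x : H) =>
      Complex.exp ((-2 * π * ⟪v, w⟫ : ℝ) * Complex.I) *
        (Complex.exp (⟪x, v⟫ * Complex.I) * Complex.exp (-b * ‖v‖ ^ 2)))
      ((volume : Measure H).prod ν) := by
    have h1 : Integrable (fun v : H => Complex.exp (-b * ‖v‖ ^ 2)) := by
      simpa using GaussianFourier.integrable_cexp_neg_mul_sq_norm_add (V := H)
        (b := (b : ℂ)) (by simpa using hb) 0 0
    refine (h1.norm.comp_fst ν).mono' ?_ (.of_forall fun p => ?_)
    · fun_prop
    · simp only [uncurry]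
      rw [norm_mul, norm_mul, Complex.norm_exp_ofReal_mul_I, Complex.norm_exp_ofReal_mul_I]
      simp
  rw [fourier_eq']
  calc ∫ v, Complex.exp ((-2 * π * ⟪v, w⟫ : ℝ) * Complex.I) •
        (charFun ν v * Complex.exp (-b * ‖v‖ ^ 2))
      = ∫ v, ∫ x, Complex.exp ((-2 * π * ⟪v, w⟫ : ℝ) * Complex.I) *
        (Complex.exp (⟪x, v⟫ * Complex.I) * Complex.exp (-b * ‖v‖ ^ 2)) ∂ν := by
        congr 1
        ext v
        rw [integral_const_mul, integral_mul_const, charFun_apply, smul_eq_mul]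
    _ = ∫ x, (∫ v, Complex.exp ((-2 * π * ⟪v, w⟫ : ℝ) * Complex.I) *
        (Complex.exp (⟪x, v⟫ * Complex.I) * Complex.exp (-b * ‖v‖ ^ 2))) ∂ν :=
        integral_integral_swap hint
    _ = ∫ x, (((π / b) ^ (Module.finrank ℝ H / 2 : ℝ) *
          exp (-(π ^ 2 / b) * ‖(2 * π)⁻¹ • x - w‖ ^ 2) : ℝ) : ℂ) ∂ν := by
        congr 1
        ext x
        have h1 := fourier_gaussian_innerProductSpace' (V := H) (b := (b : ℂ))
          (by simpa using hb) ((2 * π)⁻¹ • x) w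
        rw [fourier_eq'] at h1
        have h2 : (((π / b) ^ (Module.finrank ℝ H / 2 : ℝ) *
          exp (-(π ^ 2 / b) * ‖(2 * π)⁻¹ • x - w‖ ^ 2) : ℝ) : ℂ)
          = (π / b : ℂ) ^ (Module.finrank ℝ H / 2 : ℂ) *
            Complex.exp (-π ^ 2 * ‖(2 * π)⁻¹ • x - w‖ ^ 2 / b) := by
          rw [Complex.ofReal_mul, Complex.ofReal_cpow (by positivity)]
          push_cast
          ring
        rw [h2, ← h1]
        congr 1
        ext v
        rw [smul_eq_mul, ← Complex.exp_add]
        rw [real_inner_smul_left]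
        push_cast
        field_simp
        ring
    _ = _ := by
        rw [integral_complex_ofReal, integral_const_mul]
        rfl

lemma mollified_nonneg {b : ℝ} (hb : 0 < b) (w : H) : 0 ≤ mollified ν b w :=
  mul_nonneg (by positivity) (integral_nonneg fun _ => (exp_pos _).le)

lemma lintegral_mollified_le {b : ℝ} (hb : 0 < b) : ∫⁻ w, ofReal (mollified ν b w) ≤ 1 := by
  have hpos : 0 < π ^ 2 / b := by positivity
  have hg : Integrable fun w : H => exp (-(π ^ 2 / b) * ‖w‖ ^ 2) := by
    by_contra hc
    have h1 := GaussianFourier.integral_rexp_neg_mul_sq_norm (V := H) hpos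
    rw [integral_undef hc] at h1
    have : 0 < (π / (π ^ 2 / b)) ^ (Module.finrank ℝ H / 2 : ℝ) := by positivity
    linarith
  have h1 : ∀ w : H, ofReal (mollified ν b w) = ofReal ((π / b) ^ (Module.finrank ℝ H / 2 : ℝ)) *
        ∫⁻ x, ofReal (exp (-(π ^ 2 / b) * ‖(2 * π)⁻¹ • x - w‖ ^ 2)) ∂ν := by
    intro w
    unfold mollified
    rw [ofReal_mul (by positivity), ofReal_integral_eq_lintegral_ofReal]
    · refine Integrable.of_bound (Continuous.aestronglyMeasurable (by fun_prop)) 1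
        (.of_forall fun x => ?_)
      rw [norm_eq_abs, abs_of_pos (exp_pos _), exp_le_one_iff]
      nlinarith
    · exact .of_forall fun _ => (exp_pos _).le
  simp_rw [h1]
  rw [lintegral_const_mul' _ _ ENNReal.ofReal_ne_top, lintegral_lintegral_swap]
  · have h2 : ∀ x : H, ∫⁻ w, ofReal (exp (-(π ^ 2 / b) * ‖(2 * π)⁻¹ • x - w‖ ^ 2))
        = ofReal ((π / (π ^ 2 / b)) ^ (Module.finrank ℝ H / 2 : ℝ)) := by
      intro x
      have h3 := lintegral_sub_left_eq_self (μ := (volume : Measure H))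
        (fun w => ofReal (exp (-(π ^ 2 / b) * ‖w‖ ^ 2))) ((2 * π)⁻¹ • x)
      rw [h3, ← ofReal_integral_eq_lintegral_ofReal hg (.of_forall fun _ => (exp_pos _).le),
        GaussianFourier.integral_rexp_neg_mul_sq_norm hpos]
    simp_rw [h2]
    rw [lintegral_const, measure_univ, mul_one, ← ofReal_mul (by positivity),
      ← mul_rpow (by positivity) (by positivity)]
    have : π / b * (π / (π ^ 2 / b)) = 1 := by field_simp
    rw [this, Real.one_rpow, ENNReal.ofReal_one]
  fun_prop

lemma tendsto_mollified (hc : Integrable (charFun ν) volume) (w : H) :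
  Tendsto (fun n : ℕ => (mollified ν (1 / (n + 1)) w : ℂ)) atTop (𝓝 (𝓕 (charFun ν) w)) := by
  have h1 : ∀ n : ℕ, (mollified ν (1 / (n + 1)) w : ℂ)
      = ∫ v, Complex.exp ((-2 * π * ⟪v, w⟫ : ℝ) * Complex.I) •
        (charFun ν v * Complex.exp (-((1 / (n + 1) : ℝ) : ℂ) * ‖v‖ ^ 2)) := fun n => by
    rw [← fourier_charFun_mul_gaussian (by positivity), fourier_eq']
  simp_rw [h1]
  rw [fourier_eq']
  refine tendsto_integral_of_dominated_convergence (fun v => ‖charFun ν v‖) (fun n => ?_)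
    hc.norm (fun n => .of_forall fun v => ?_) (.of_forall fun v => ?_)
  · fun_prop
  · rw [norm_smul, Complex.norm_exp_ofReal_mul_I, one_mul, norm_mul]
    refine mul_le_of_le_one_right (norm_nonneg _) ?_
    rw [Complex.norm_exp, exp_le_one_iff]
    have h2 : (-((1 / (n + 1) : ℝ) : ℂ) * ‖v‖ ^ 2) = ((-(1 / (n + 1)) * ‖v‖ ^ 2 : ℝ) : ℂ) := by
      push_cast; ring
    rw [h2, Complex.ofReal_re]
    have := mul_nonneg (show (0 : ℝ) ≤ 1 / (n + 1) by positivity) (sq_nonneg ‖v‖)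
    linarith
  · refine Tendsto.const_smul ?_ _
    have h2 : Tendsto (fun n : ℕ => -((1 / (n + 1) : ℝ) : ℂ) * ‖v‖ ^ 2) atTop (𝓝 0) := by
      have h3 := (Complex.continuous_ofReal.tendsto 0).comp tendsto_one_div_add_atTop_nhds_zero_nat
      simpa [Function.comp_def] using (h3.neg.mul_const ((‖v‖ : ℂ) ^ 2))
    simpa using ((Complex.continuous_exp.tendsto 0).comp h2).const_mul (charFun ν v)

/-- A probability measure with integrable characteristic function is a dilation of a measure with
a continuous integrable density. -/
lemma exists_continuous_density (hc : Integrable (charFun ν) volume) :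
  ∃ G : H → ℝ, Continuous G ∧ (∀ w, 0 ≤ G w) ∧ Integrable G ∧
    ν = ((volume : Measure H).withDensity fun w => ofReal (G w)).map (fun w => (2 * π) • w) := by
  have hre : ∀ w, Tendsto (fun n : ℕ => mollified ν (1 / (n + 1)) w) atTop
      (𝓝 (𝓕 (charFun ν) w).re) := fun w =>
    ((Complex.continuous_re.tendsto _).comp (tendsto_mollified hc w)).congr fun n => by simp
  have him : ∀ w, (𝓕 (charFun ν) w).im = 0 := fun w => by
    refine tendsto_nhds_unique ((Complex.continuous_im.tendsto _).comp (tendsto_mollified hc w)) ?_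
    simp [Function.comp_def]
  set G : H → ℝ := fun w => (𝓕 (charFun ν) w).re with hG
  have hGc : ∀ w, 𝓕 (charFun ν) w = (G w : ℂ) := fun w => Complex.ext rfl (by simp [him])
  have hcont : Continuous (𝓕 (charFun ν)) :=
    VectorFourier.fourierIntegral_continuous Real.continuous_fourierChar
      (by exact continuous_inner) hc
  have hGcont : Continuous G := Complex.continuous_re.comp hcont
  have hG0 : ∀ w, 0 ≤ G w := fun w =>
    ge_of_tendsto' (hre w) fun n => mollified_nonneg (by positivity) w
  have hmeas : ∀ n : ℕ, Measurable fun w => mollified ν (1 / (n + 1)) w := fun n => by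
    have h1 : (fun w => mollified ν (1 / (n + 1)) w)
        = fun w => (𝓕 (fun v => charFun ν v * Complex.exp (-((1 / (n + 1) : ℝ) : ℂ) * ‖v‖ ^ 2)) w).re := by
      ext w
      rw [fourier_charFun_mul_gaussian (by positivity), Complex.ofReal_re]
    rw [h1]
    have h2 : Integrable (fun v : H =>
        charFun ν v * Complex.exp (-((1 / (n + 1) : ℝ) : ℂ) * ‖v‖ ^ 2)) := by
      refine hc.norm.mono' (Continuous.aestronglyMeasurable (by fun_prop)) (.of_forall fun v => ?_)
      rw [norm_mul]
      refine mul_le_of_le_one_right (norm_nonneg _) ?_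
      rw [Complex.norm_exp, exp_le_one_iff]
      have h2 : (-((1 / (n + 1) : ℝ) : ℂ) * ‖v‖ ^ 2) = ((-(1 / (n + 1)) * ‖v‖ ^ 2 : ℝ) : ℂ) := by
        push_cast; ring
      rw [h2, Complex.ofReal_re]
      have := mul_nonneg (show (0 : ℝ) ≤ 1 / (n + 1) by positivity) (sq_nonneg ‖v‖)
      linarith
    exact (Complex.continuous_re.comp (VectorFourier.fourierIntegral_continuous
      Real.continuous_fourierChar (by exact continuous_inner) h2)).measurable
  have hlint : ∫⁻ w, ofReal (G w) ≤ 1 := by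
    calc ∫⁻ w, ofReal (G w)
        = ∫⁻ w, liminf (fun n : ℕ => ofReal (mollified ν (1 / (n + 1)) w)) atTop := by
          congr 1
          ext w
          exact (ENNReal.tendsto_ofReal (hre w)).liminf_eq.symm
      _ ≤ liminf (fun n : ℕ => ∫⁻ w, ofReal (mollified ν (1 / (n + 1)) w)) atTop :=
          lintegral_liminf_le fun n => measurable_ofReal.comp (hmeas n)
      _ ≤ 1 := by
          refine liminf_le_of_le ?_ fun b hb => ?_
          · isBoundedDefault
          · obtain ⟨n, hn⟩ := hb.exists
            exact hn.trans (lintegral_mollified_le (by positivity))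
  have hGi : Integrable G := by
    refine ⟨hGcont.aestronglyMeasurable, ?_⟩
    rw [hasFiniteIntegral_iff_ofReal (.of_forall hG0)]
    exact hlint.trans_lt ENNReal.one_lt_top
  refine ⟨G, hGcont, hG0, hGi, ?_⟩
  have hfin : IsFiniteMeasure ((volume : Measure H).withDensity fun w => ofReal (G w)) :=
    isFiniteMeasure_withDensity_ofReal hGi.2
  have hFi : Integrable (𝓕 (charFun ν)) := by
    rw [show 𝓕 (charFun ν) = fun w => (G w : ℂ) from funext hGc]
    exact hGi.ofReal
  have hm : Measurable fun w => ofReal (G w) := measurable_ofReal.comp hGcont.measurable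
  refine Measure.ext_of_charFun (funext fun t => ?_)
  rw [charFun_apply (μ := Measure.map _ _), integral_map (by fun_prop)
    (Continuous.aestronglyMeasurable (by fun_prop)),
    integral_withDensity_eq_integral_toReal_smul
    hm (by simp)]
  have hinv := (continuous_charFun (μ := ν)).fourierInv_fourier_eq hc hFi
  conv_lhs => rw [← hinv, Real.fourierInv_eq']
  congr 1
  ext w
  rw [hGc, ENNReal.toReal_ofReal (hG0 w), smul_eq_mul, Complex.real_smul, mul_comm,
    real_inner_smul_left]

/-- Translations of a measure with integrable characteristic function are continuous in total
variation. -/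
lemma exists_translation_modulus (hc : Integrable (charFun ν) volume) {ε : ℝ} (hε : 0 < ε) :
  ∃ δ > 0, ∀ y : H, ‖y‖ < δ → ∀ f : H → ℝ, Measurable f → ∀ C, (∀ x, |f x| ≤ C) →
    |∫ z, f (y + z) ∂ν - ∫ z, f z ∂ν| ≤ C * ε := by
  obtain ⟨G, hGc, hG0, hGi, hν⟩ := exists_continuous_density hc
  have hpi : (2 * π) ≠ 0 := by positivity
  have hm : Measurable fun w => ofReal (G w) := measurable_ofReal.comp hGc.measurable
  have hrep : ∀ f : H → ℝ, Measurable f → ∫ z, f z ∂ν = ∫ w, G w * f ((2 * π) • w) := fun f hf => by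
    rw [hν, integral_map (by fun_prop) hf.aestronglyMeasurable,
      integral_withDensity_eq_integral_toReal_smul
      hm (by simp)]
    congr 1
    ext w
    rw [ENNReal.toReal_ofReal (hG0 w), smul_eq_mul]
  have hlim : Tendsto (fun y : H => ∫ w, max (G w - G (w - (2 * π)⁻¹ • y)) 0) (𝓝 0) (𝓝 0) := by
    have h1 : Tendsto (fun y : H => ∫ w, max (G w - G (w - (2 * π)⁻¹ • y)) 0) (𝓝 0)
        (𝓝 (∫ _ : H, (0 : ℝ))) := by
      refine tendsto_integral_filter_of_dominated_convergence G (.of_forall fun y => ?_)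
        (.of_forall fun y => .of_forall fun w => ?_) hGi
        (.of_forall fun w => ?_)
      · fun_prop
      · rw [norm_eq_abs, abs_of_nonneg (le_max_right _ _)]
        grind
      · have : Continuous fun y : H => max (G w - G (w - (2 * π)⁻¹ • y)) 0 := by fun_prop
        simpa using this.tendsto 0
    simpa using h1
  obtain ⟨δ, hδ, h2⟩ := Metric.eventually_nhds_iff.1 ((tendsto_order.1 hlim).2 (ε / 2)
    (half_pos hε))
  refine ⟨δ, hδ, fun y hy f hf C hC => ?_⟩
  set a := (2 * π)⁻¹ • y with ha
  have hya : y = (2 * π) • a := by rw [ha, smul_inv_smul₀ hpi]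
  have hGa : Integrable fun w => G (w - a) := hGi.comp_sub_right a
  have hC0 : 0 ≤ C := (abs_nonneg _).trans (hC 0)
  have hfb : ∀ g : H → ℝ, Integrable g → Integrable fun w => g w * f ((2 * π) • w) := fun g hg => by
      refine (hg.norm.mul_const C).mono' (hg.aestronglyMeasurable.mul
        (hf.comp (measurable_const_smul _)).aestronglyMeasurable)
        (.of_forall fun w => ?_)
      rw [norm_mul]
      exact mul_le_mul_of_nonneg_left (hC _) (norm_nonneg _)
  have h3 : ∫ z, f (y + z) ∂ν = ∫ w, G (w - a) * f ((2 * π) • w) := by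
    rw [hrep (fun z => f (y + z)) (hf.comp (measurable_const_add y)),
      ← integral_add_right_eq_self (fun w => G (w - a) * f ((2 * π) • w)) a]
    congr 1
    ext w
    rw [add_sub_cancel_right, hya, smul_add, add_comm]
  rw [h3, hrep f hf, ← integral_sub (hfb _ hGa) (hfb _ hGi)]
  have h4 : Integrable fun w => |G (w - a) - G w| := (hGa.sub hGi).abs
  have h5 : ∫ w, |G (w - a) - G w| = 2 * ∫ w, max (G w - G (w - a)) 0 := by
    have e : ∀ w, |G (w - a) - G w| = 2 * max (G w - G (w - a)) 0 + (G (w - a) - G w) := fun w => by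
      grind
    have i1 : Integrable fun w => max (G w - G (w - a)) 0 := (hGi.sub hGa).pos_part
    have i2 : Integrable fun w => G (w - a) - G w := hGa.sub hGi
    simp_rw [e]
    rw [integral_add (i1.const_mul 2) i2, integral_const_mul, integral_sub hGa hGi,
      integral_sub_right_eq_self]
    ring
  calc |∫ w, (G (w - a) * f ((2 * π) • w) - G w * f ((2 * π) • w))|
      ≤ ∫ w, |G (w - a) * f ((2 * π) • w) - G w * f ((2 * π) • w)| := abs_integral_le_integral_abs
    _ ≤ ∫ w, C * |G (w - a) - G w| := by
        refine integral_mono ((hfb _ hGa).sub (hfb _ hGi)).abs (h4.const_mul C) fun w => ?_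
        rw [← sub_mul, abs_mul, mul_comm]
        exact mul_le_mul_of_nonneg_right (hC _) (abs_nonneg _)
    _ = C * (2 * ∫ w, max (G w - G (w - a)) 0) := by rw [integral_const_mul, h5]
    _ ≤ C * ε := by
        refine mul_le_mul_of_nonneg_left ?_ hC0
        have := h2 (show dist y 0 < δ by simpa using hy)
        linarith

end Density

/-! ### The stable exponent -/

section StableExponent

variable {d : ℕ} {α : ℝ} {Γ : Measure (sphere (0 : Vec d) 1)} [IsFiniteMeasure Γ]

lemma abs_inner_sphere_le (θ : Vec d) (z : sphere (0 : Vec d) 1) :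
  |⟪θ, (z : Vec d)⟫| ≤ ‖θ‖ := by
  have h := abs_real_inner_le_norm θ (z : Vec d)
  rwa [norm_eq_of_mem_sphere z, mul_one] at h

lemma integrable_abs_inner_rpow (hα : 0 < α) (θ : Vec d) :
  Integrable (fun z : sphere (0 : Vec d) 1 => |⟪θ, (z : Vec d)⟫| ^ α) Γ := by
  refine Integrable.of_bound (Measurable.aestronglyMeasurable ?_) (‖θ‖ ^ α) (.of_forall fun z => ?_)
  · fun_prop
  · rw [norm_eq_abs, abs_of_nonneg (by positivity)]
    exact rpow_le_rpow (abs_nonneg _) (abs_inner_sphere_le θ z) hα.le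

lemma measurable_real_sign : Measurable Real.sign := by
  exact .ite measurableSet_Iio measurable_const
    (.ite measurableSet_Ioi measurable_const measurable_const)

lemma abs_real_sign_le (x : ℝ) : |Real.sign x| ≤ 1 := by
  rcases Real.sign_apply_eq x with h | h | h <;> rw [h] <;> norm_num

lemma re_stableExponent (hα : 0 < α) (θ : Vec d) :
  (stableExponent α Γ θ).re = -∫ z : sphere (0 : Vec d) 1, |⟪θ, (z : Vec d)⟫| ^ α ∂Γ := by
  have hm : Measurable fun z : sphere (0 : Vec d) 1 => ⟪θ, (z : Vec d)⟫ := by fun_prop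
  have hs := measurable_real_sign.comp hm
  have key : ∀ (A B : sphere (0 : Vec d) 1 → ℝ), Integrable A Γ → Integrable B Γ →
      (∫ z, ((A z : ℂ) + Complex.I * (B z : ℂ)) ∂Γ).re = ∫ z, A z ∂Γ := fun A B hA hB => by
    have h1 : Integrable (fun z => (A z : ℂ)) Γ := hA.ofReal
    have h2 : Integrable (fun z => Complex.I * (B z : ℂ)) Γ := hB.ofReal.const_mul _
    rw [integral_add h1 h2, integral_const_mul, integral_complex_ofReal, integral_complex_ofReal]
    simp
  unfold stableExponent
  split_ifs with h1
  · subst h1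
    have hA := integrable_abs_inner_rpow (Γ := Γ) one_pos θ
    have hB : Integrable (fun z : sphere (0 : Vec d) 1 => 2 / π *
        (Real.sign ⟪θ, (z : Vec d)⟫ * (Real.log |⟪θ, (z : Vec d)⟫| * |⟪θ, (z : Vec d)⟫|))) Γ := by
      refine Integrable.const_mul (Integrable.of_bound (Measurable.aestronglyMeasurable ?_)
        (1 + ‖θ‖ ^ 2) (.of_forall fun z => ?_)) _
      · fun_prop
      · have h2 := abs_inner_sphere_le θ z
        set x := |⟪θ, (z : Vec d)⟫| with hx
        have hx0 : 0 ≤ x := abs_nonneg _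
        rw [norm_eq_abs, abs_mul]
        have h3 : |Real.log x * x| ≤ 1 + ‖θ‖ ^ 2 := by
          rcases le_or_gt x 1 with h | h
          · rcases hx0.eq_or_lt with h0 | h0
            · rw [← h0]; simp; positivity
            · have := (Real.abs_log_mul_self_lt x h0 h).le
              nlinarith [sq_nonneg ‖θ‖]
          · have h4 := Real.log_le_sub_one_of_pos (zero_lt_one.trans h)
            have h5 := Real.log_nonneg h.le
            rw [abs_of_nonneg (by positivity)]
            nlinarith
        calc _ ≤ 1 * (1 + ‖θ‖ ^ 2) :=
              mul_le_mul (abs_real_sign_le _) h3 (abs_nonneg _) zero_le_one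
          _ = _ := one_mul _
    rw [Complex.neg_re, ← key _ _ hA hB]
    congr 3
    ext z
    rw [rpow_one]
    push_cast
    ring
  · have hA := integrable_abs_inner_rpow (Γ := Γ) hα θ
    have hB : Integrable (fun z : sphere (0 : Vec d) 1 => -(Real.tan (α * π / 2) *
        (Real.sign ⟪θ, (z : Vec d)⟫ * |⟪θ, (z : Vec d)⟫| ^ α))) Γ := by
      refine ((hA.mono' (hs.mul (hm.abs.pow_const α)).aestronglyMeasurable
        (.of_forall fun z => ?_)).const_mul _).neg
      rw [norm_eq_abs]
      simp only [Pi.mul_apply, Function.comp_apply]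
      rw [abs_mul, abs_of_nonneg (rpow_nonneg (abs_nonneg _) α)]
      exact mul_le_of_le_one_left (rpow_nonneg (abs_nonneg _) α) (abs_real_sign_le _)
    rw [Complex.neg_re, ← key _ _ hA hB]
    congr 3
    ext z
    push_cast
    ring

/-- The directions on which the spectral measure does not act. -/
def stableKernel (Γ : Measure (sphere (0 : Vec d) 1)) : Submodule ℝ (Vec d) where
  carrier := {θ | ∀ᵐ z : sphere (0 : Vec d) 1 ∂Γ, ⟪θ, (z : Vec d)⟫ = 0}
  add_mem' := fun {a b} ha hb => by
    have ha' : ∀ᵐ z : sphere (0 : Vec d) 1 ∂Γ, ⟪a, (z : Vec d)⟫ = 0 := ha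
    have hb' : ∀ᵐ z : sphere (0 : Vec d) 1 ∂Γ, ⟪b, (z : Vec d)⟫ = 0 := hb
    filter_upwards [ha', hb'] with z h1 h2
    rw [inner_add_left, h1, h2, add_zero]
  zero_mem' := by simp
  smul_mem' := fun c a ha => by
    have ha' : ∀ᵐ z : sphere (0 : Vec d) 1 ∂Γ, ⟪a, (z : Vec d)⟫ = 0 := ha
    filter_upwards [ha'] with z h1
    rw [real_inner_smul_left, h1, mul_zero]

/-- The linear span of the possible increments. -/
abbrev stableSpan (Γ : Measure (sphere (0 : Vec d) 1)) : Submodule ℝ (Vec d) := (stableKernel Γ)ᗮ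

lemma stableExponent_proj (θ : Vec d) :
  stableExponent α Γ ((stableSpan Γ).orthogonalProjectionOnto θ : Vec d)
    = stableExponent α Γ θ := by
  have h1 : θ - (stableSpan Γ).orthogonalProjectionOnto θ ∈ stableKernel Γ := by simp
  have h2 : ∀ᵐ z : sphere (0 : Vec d) 1 ∂Γ, ⟪((stableSpan Γ).orthogonalProjectionOnto θ : Vec d), (z : Vec d)⟫
      = ⟪θ, (z : Vec d)⟫ := by
    have h3 : ∀ᵐ z : sphere (0 : Vec d) 1 ∂Γ, ⟪θ - (stableSpan Γ).orthogonalProjectionOnto θ, (z : Vec d)⟫ = 0 := h1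
    filter_upwards [h3] with z hz
    rw [inner_sub_left] at hz
    linarith
  unfold stableExponent
  split_ifs
  · congr 1
    refine integral_congr_ae ?_
    filter_upwards [h2] with z hz
    rw [hz]
  · congr 1
    refine integral_congr_ae ?_
    filter_upwards [h2] with z hz
    rw [hz]

lemma exists_stableExponent_lower_bound (hα : 0 < α) : ∃ c > 0, ∀ θ ∈ stableSpan Γ,
    c * ‖θ‖ ^ α ≤ ∫ z : sphere (0 : Vec d) 1, |⟪θ, (z : Vec d)⟫| ^ α ∂Γ := by
  set I : Vec d → ℝ := fun θ => ∫ z : sphere (0 : Vec d) 1, |⟪θ, (z : Vec d)⟫| ^ α ∂Γ with hI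
  have hcont : Continuous I := by
    rw [continuous_iff_continuousAt]
    intro θ₀
    refine tendsto_integral_filter_of_dominated_convergence (fun _ => (‖θ₀‖ + 1) ^ α) ?_ ?_
      (integrable_const _) ?_
    · exact .of_forall fun θ => (integrable_abs_inner_rpow hα θ).1
    · filter_upwards [Metric.ball_mem_nhds θ₀ one_pos] with θ hθ
      refine .of_forall fun z => ?_
      rw [norm_eq_abs, abs_of_nonneg (by positivity)]
      refine rpow_le_rpow (abs_nonneg _) ((abs_inner_sphere_le θ z).trans ?_) hα.le
      have h1 : ‖θ - θ₀‖ < 1 := by simpa [dist_eq_norm] using hθ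
      linarith [norm_le_norm_add_norm_sub' θ θ₀]
    · refine .of_forall fun z => ?_
      have : Continuous fun θ : Vec d => |⟪θ, (z : Vec d)⟫| ^ α :=
        (by fun_prop : Continuous fun θ : Vec d => |⟪θ, (z : Vec d)⟫|).rpow_const
          fun _ => Or.inr hα.le
      exact this.tendsto θ₀
  have hpos : ∀ θ ∈ stableSpan Γ, θ ≠ 0 → 0 < I θ := by
    intro θ hθ h0
    refine lt_of_le_of_ne (integral_nonneg fun z => by positivity) fun h => h0 ?_
    have h1 := (integral_eq_zero_iff_of_nonneg (fun z : sphere (0 : Vec d) 1 => by positivity)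
      (integrable_abs_inner_rpow (Γ := Γ) hα θ)).1 h.symm
    have h2 : θ ∈ stableKernel Γ := by
      filter_upwards [h1] with z hz
      have := (Real.rpow_eq_zero (abs_nonneg _) hα.ne').1 hz
      exact abs_eq_zero.1 this
    have := (stableKernel Γ).inner_right_of_mem_orthogonal h2 hθ
    exact inner_self_eq_zero.1 this
  set S : Set (Vec d) := sphere 0 1 ∩ (stableSpan Γ : Set (Vec d)) with hS
  have hScomp : IsCompact S := (isCompact_sphere 0 1).inter_right
    (Submodule.closed_of_finiteDimensional _)
  obtain ⟨c, hc, hcS⟩ : ∃ c > 0, ∀ θ ∈ S, c ≤ I θ := by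
    rcases S.eq_empty_or_nonempty with h | h
    · exact ⟨1, one_pos, fun θ hθ => by simp [h] at hθ⟩
    · obtain ⟨θ₁, h1, h2⟩ := hScomp.exists_isMinOn h hcont.continuousOn
      refine ⟨I θ₁, hpos θ₁ h1.2 fun h0 => ?_, fun θ hθ => h2 hθ⟩
      have := h1.1
      rw [h0] at this
      simp at this
  refine ⟨c, hc, fun θ hθ => ?_⟩
  rcases eq_or_ne θ 0 with rfl | h0
  · rw [norm_zero, zero_rpow hα.ne', mul_zero]
    exact integral_nonneg fun z => by positivity
  · have hn : 0 < ‖θ‖ := norm_pos_iff.2 h0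
    have h1 : ‖θ‖⁻¹ • θ ∈ S := by
      refine ⟨?_, (stableSpan Γ).smul_mem _ hθ⟩
      simp [norm_smul, hn.ne']
    have h2 : I (‖θ‖⁻¹ • θ) = (‖θ‖ ^ α)⁻¹ * I θ := by
      rw [hI]
      simp only
      rw [← integral_const_mul]
      congr 1
      ext z
      rw [real_inner_smul_left, abs_mul, abs_of_pos (inv_pos.2 hn),
        mul_rpow (by positivity) (abs_nonneg _), Real.inv_rpow hn.le]
    have h3 := hcS _ h1
    rw [h2] at h3
    have h4 : 0 < ‖θ‖ ^ α := Real.rpow_pos_of_pos hn α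
    rw [inv_mul_eq_div, le_div_iff₀ h4] at h3
    exact h3

end StableExponent

lemma integrable_exp_neg_mul_norm_rpow {H : Type*} [NormedAddCommGroup H]
  [InnerProductSpace ℝ H] [FiniteDimensional ℝ H] [MeasurableSpace H] [BorelSpace H] {α a : ℝ}
  (hα : 0 < α) (ha : 0 < a) :
  Integrable (fun θ : H => exp (-(a * ‖θ‖ ^ α))) := by
  set m : ℕ := Module.finrank ℝ H + 1 with hm
  obtain ⟨n, hn⟩ := exists_nat_ge ((m : ℝ) / α)
  have hn' : (m : ℝ) ≤ α * n := by rwa [div_le_iff₀' hα] at hn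
  have h1 : Integrable fun θ : H => (1 + ‖θ‖) ^ (-(m : ℝ)) :=
    integrable_one_add_norm (by rw [hm]; push_cast; linarith)
  refine (h1.const_mul (2 ^ m * (1 + n.factorial / a ^ n))).mono' ?_ (.of_forall fun θ => ?_)
  · refine Continuous.aestronglyMeasurable ?_
    have : Continuous fun θ : H => ‖θ‖ ^ α := continuous_norm.rpow_const fun _ => Or.inr hα.le
    fun_prop
  · have h0 : 0 ≤ ‖θ‖ := norm_nonneg θ
    rw [norm_eq_abs, abs_of_pos (exp_pos _), Real.rpow_neg (by positivity),
      rpow_natCast, ← div_eq_mul_inv, le_div_iff₀ (by positivity), Real.exp_neg]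
    have hf : 0 ≤ (n.factorial : ℝ) / a ^ n := by positivity
    rcases le_or_gt ‖θ‖ 1 with h | h
    · have e1 : (exp (a * ‖θ‖ ^ α))⁻¹ ≤ 1 := inv_le_one_of_one_le₀ (Real.one_le_exp (by positivity))
      have e2 : (1 + ‖θ‖) ^ m ≤ 2 ^ m := pow_le_pow_left₀ (by positivity) (by linarith) m
      calc _ ≤ 1 * 2 ^ m := mul_le_mul e1 e2 (by positivity) zero_le_one
        _ ≤ 2 ^ m * (1 + n.factorial / a ^ n) := by
            rw [one_mul]; exact le_mul_of_one_le_right (by positivity) (by linarith)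
    · have e1 : (a * ‖θ‖ ^ α) ^ n / n.factorial ≤ exp (a * ‖θ‖ ^ α) :=
        Real.pow_div_factorial_le_exp _ (by positivity) n
      have e2 : ‖θ‖ ^ m ≤ (‖θ‖ ^ α) ^ n := by
        rw [← rpow_natCast, ← Real.rpow_mul_natCast h0]
        exact rpow_le_rpow_of_exponent_le h.le hn'
      have e3 : (1 + ‖θ‖) ^ m ≤ 2 ^ m * ‖θ‖ ^ m := by
        rw [← mul_pow]; exact pow_le_pow_left₀ (by positivity) (by linarith) m
      have e4 : ‖θ‖ ^ m ≤ n.factorial / a ^ n * exp (a * ‖θ‖ ^ α) := by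
        rw [mul_pow, div_le_iff₀ (by positivity)] at e1
        rw [div_mul_eq_mul_div, le_div_iff₀ (by positivity)]
        nlinarith [pow_pos ha n]
      rw [inv_mul_le_iff₀ (exp_pos _)]
      have e5 := exp_pos (a * ‖θ‖ ^ α)
      calc (1 + ‖θ‖) ^ m ≤ 2 ^ m * ‖θ‖ ^ m := e3
        _ ≤ 2 ^ m * (n.factorial / a ^ n * exp (a * ‖θ‖ ^ α)) :=
            mul_le_mul_of_nonneg_left e4 (by positivity)
        _ ≤ _ := by
            have : 0 < (2 : ℝ) ^ m := by positivity
            nlinarith [mul_pos this e5]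

/-! ### Semigroups of stable laws -/

/-- A family of laws with the characteristic functions of the increments of a stable process, that
is weakly continuous at time `0`. -/
structure IsStableFamily {d : ℕ} (α : ℝ) (Γ : Measure (sphere (0 : Vec d) 1))
  (ν : ℝ≥0 → Measure (Vec d)) : Prop where
  prob : ∀ t, IsProbabilityMeasure (ν t)
  charFun : ∀ t θ, charFun (ν t) θ = Complex.exp (((t : ℝ) : ℂ) * stableExponent α Γ θ)
  small : ∀ δ > 0, ∀ η > 0, ∃ h : ℝ≥0, 0 < h ∧ ∀ u ≤ h, (ν u).real {y | δ ≤ ‖y‖} ≤ η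

lemma IsCadlag.rightCont {β : Type*} [TopologicalSpace β] {f : ℝ≥0 → β} (h : IsCadlag f)
  (t : ℝ≥0) : ContinuousWithinAt f (Ici t) t := (h t).1

section StableFamily

variable {d : ℕ} {α : ℝ} {Γ : Measure (sphere (0 : Vec d) 1)} {S : Type*}
  [MeasurableSpace S] {P : Measure S} [IsProbabilityMeasure P] {X : ℝ≥0 → S → Vec d}

lemma IsLevyStable.isStableFamily (hX : IsLevyStable P α Γ X) :
  IsStableFamily α Γ (fun t => P.map (fun w => X t w - X 0 w)) where
  prob t := Measure.isProbabilityMeasure_map ((hX.measurable t).sub (hX.measurable 0)).aemeasurable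
  charFun t θ := by simpa using hX.charFun_increment 0 t zero_le θ
  small := by
    intro δ hδ η hη
    have hlim : Tendsto (fun u : ℝ≥0 => ∫ w, min 1 (‖X u w - X 0 w‖ / δ) ∂P) (𝓝[≥] 0) (𝓝 0) := by
      have h1 : Tendsto (fun u : ℝ≥0 => ∫ w, min 1 (‖X u w - X 0 w‖ / δ) ∂P) (𝓝[≥] 0)
          (𝓝 (∫ _, (0 : ℝ) ∂P)) := by
        refine tendsto_integral_filter_of_dominated_convergence (fun _ => 1)
          (.of_forall fun u => ?_) (.of_forall fun u =>
          .of_forall fun w => ?_) (integrable_const _) (.of_forall fun w => ?_)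
        · exact (measurable_const.min
            (((hX.measurable u).sub (hX.measurable 0)).norm.div_const δ)).aestronglyMeasurable
        · rw [norm_eq_abs, abs_of_nonneg (by positivity)]
          exact min_le_left _ _
        · have h2 : Tendsto (fun u => X u w) (𝓝[≥] 0) (𝓝 (X 0 w)) := (hX.cadlag w).rightCont 0
          have h3 : Continuous fun x : Vec d => min 1 (‖x - X 0 w‖ / δ) := by fun_prop
          simpa [Function.comp_def] using (h3.tendsto (X 0 w)).comp h2
      simpa using h1
    have h1 := (tendsto_order.1 hlim).2 η hη
    obtain ⟨h, hh, h2⟩ : ∃ h : ℝ≥0, 0 < h ∧ ∀ u ≤ h, ∫ w, min 1 (‖X u w - X 0 w‖ / δ) ∂P < η := by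
      obtain ⟨e, he, h2⟩ := Metric.mem_nhdsWithin_iff.1 h1
      refine ⟨⟨e / 2, by positivity⟩, by exact_mod_cast half_pos he, fun u hu => ?_⟩
      refine h2 ⟨?_, mem_Ici.2 zero_le⟩
      have hu' : (u : ℝ) ≤ e / 2 := by exact_mod_cast hu
      rw [Metric.mem_ball, NNReal.dist_eq, NNReal.coe_zero, sub_zero, abs_of_nonneg u.coe_nonneg]
      exact lt_of_le_of_lt hu' (by linarith)
    refine ⟨h, hh, fun u hu => ?_⟩
    have hm : Measurable fun w => X u w - X 0 w := (hX.measurable u).sub (hX.measurable 0)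
    rw [map_measureReal_apply hm (measurableSet_le measurable_const measurable_norm)]
    set A : Set S := (fun w => X u w - X 0 w) ⁻¹' {y | δ ≤ ‖y‖} with hA
    have hAm : MeasurableSet A := hm (measurableSet_le measurable_const measurable_norm)
    refine le_trans ?_ (h2 u hu).le
    rw [← integral_indicator_one hAm]
    refine integral_mono ((integrable_const 1).indicator hAm) ?_ fun w => ?_
    · refine Integrable.of_bound (measurable_const.min (hm.norm.div_const δ)).aestronglyMeasurable
        1 (.of_forall fun w => ?_)
      rw [norm_eq_abs, abs_of_nonneg (by positivity)]
      exact min_le_left _ _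
    · by_cases hω : w ∈ A
      · have h3 : δ ≤ ‖X u w - X 0 w‖ := hω
        rw [indicator_of_mem hω]
        exact le_min le_rfl ((one_le_div hδ).2 h3)
      · rw [indicator_of_notMem hω]
        positivity

lemma IsStableFamily.map_sub {ν : ℝ≥0 → Measure (Vec d)} (hν : IsStableFamily α Γ ν)
  (hX : IsLevyStable P α Γ X) {s t : ℝ≥0} (hst : s ≤ t) :
  P.map (fun w => X t w - X s w) = ν (t - s) := by
  have := hν.prob (t - s)
  refine Measure.ext_of_charFun (funext fun θ => ?_)
  rw [hX.charFun_increment s t hst, hν.charFun, NNReal.coe_sub hst]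

namespace IsStableFamily

variable {ν : ℝ≥0 → Measure (Vec d)}

variable [IsFiniteMeasure Γ]

lemma map_proj (hν : IsStableFamily α Γ ν) (t : ℝ≥0) :
  ((ν t).map ((stableSpan Γ).orthogonalProjectionOnto)).map ((↑) : stableSpan Γ → Vec d) = ν t := by
  have := hν.prob t
  have h1 : IsProbabilityMeasure ((ν t).map ((stableSpan Γ).orthogonalProjectionOnto)) :=
    Measure.isProbabilityMeasure_map (by fun_prop)
  refine Measure.ext_of_charFun (funext fun θ => ?_)
  rw [hν.charFun, ← stableExponent_proj, ← hν.charFun, charFun_apply, charFun_apply,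
    integral_map (by fun_prop) (Continuous.aestronglyMeasurable (by fun_prop)),
    integral_map (by fun_prop) (Continuous.aestronglyMeasurable (by fun_prop))]
  congr 1
  ext y
  have e1 := (stableSpan Γ).inner_orthogonalProjectionOnto_eq_of_mem_left
    ((stableSpan Γ).orthogonalProjectionOnto θ) y
  have e2 := (stableSpan Γ).inner_orthogonalProjectionOnto_eq_of_mem_right
    ((stableSpan Γ).orthogonalProjectionOnto y) θ
  rw [real_inner_comm, ← e2, e1, real_inner_comm]

lemma ae_mem_span (hν : IsStableFamily α Γ ν) (t : ℝ≥0) : ∀ᵐ y ∂(ν t), y ∈ stableSpan Γ := by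
  have hm : MeasurableSet {y : Vec d | y ∈ stableSpan Γ} :=
    (Submodule.closed_of_finiteDimensional (stableSpan Γ)).measurableSet
  rw [← hν.map_proj t, ae_map_iff (by fun_prop) hm]
  exact .of_forall fun y => y.2

lemma exists_translation_modulus (hν : IsStableFamily α Γ ν) (hα : 0 < α) {t : ℝ≥0} (ht : 0 < t)
  {ε : ℝ} (hε : 0 < ε) :
  ∃ δ > 0, ∀ y ∈ stableSpan Γ, ‖y‖ < δ → ∀ f : Vec d → ℝ, Measurable f → ∀ C, (∀ x, |f x| ≤ C) →
    |∫ z, f (y + z) ∂(ν t) - ∫ z, f z ∂(ν t)| ≤ C * ε := by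
  have := hν.prob t
  have h1 : IsProbabilityMeasure ((ν t).map ((stableSpan Γ).orthogonalProjectionOnto)) :=
    Measure.isProbabilityMeasure_map (by fun_prop)
  obtain ⟨c, hc, hlow⟩ := exists_stableExponent_lower_bound (Γ := Γ) hα
  have ht' : (0 : ℝ) < t := by exact_mod_cast ht
  have hint : Integrable
      (MeasureTheory.charFun ((ν t).map ((stableSpan Γ).orthogonalProjectionOnto))) volume := by
    refine (integrable_exp_neg_mul_norm_rpow (H := stableSpan Γ) hα (mul_pos ht' hc)).mono'
      continuous_charFun.aestronglyMeasurable (.of_forall fun θ => ?_)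
    have e1 : MeasureTheory.charFun ((ν t).map ((stableSpan Γ).orthogonalProjectionOnto)) θ
        = MeasureTheory.charFun (ν t) (θ : Vec d) := by
      rw [charFun_apply, charFun_apply, integral_map (by fun_prop)
        (Continuous.aestronglyMeasurable (by fun_prop))]
      simp
    rw [e1, hν.charFun, Complex.norm_exp, Complex.re_ofReal_mul, re_stableExponent hα, exp_le_exp]
    have := mul_le_mul_of_nonneg_left (hlow θ θ.2) ht'.le
    have e2 : ‖(θ : Vec d)‖ = ‖θ‖ := rfl
    rw [e2] at this
    linarith
  obtain ⟨δ, hδ, h2⟩ := _root_.exists_translation_modulus hint hε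
  refine ⟨δ, hδ, fun y hy hyδ f hf C hC => ?_⟩
  have h3 := h2 ⟨y, hy⟩ hyδ (fun z => f z) (hf.comp measurable_subtype_coe) C fun x => hC x
  have e : ∀ g : Vec d → ℝ, Measurable g → ∫ z, g z ∂(ν t)
      = ∫ z : stableSpan Γ, g z ∂((ν t).map ((stableSpan Γ).orthogonalProjectionOnto)) :=
    fun g hg => by
      conv_lhs => rw [← hν.map_proj t]
      rw [integral_map (by fun_prop) hg.aestronglyMeasurable]
  rw [e f hf, e (fun z => f (y + z)) (hf.comp (measurable_const_add y))]
  exact h3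

end IsStableFamily

end StableFamily

/-! ### Functions in the domain of the generator -/

/-- `φ` belongs to the domain of the weak generator of the convolution semigroup `ν` and `g` is its
image, with all the relevant bounds equal to `C`. -/
structure IsGenPair {d : ℕ} (ν : ℝ≥0 → Measure (Vec d)) (φ g : Vec d → ℝ) (C : ℝ) : Prop where
  meas : Measurable φ
  bdd : ∀ x, |φ x| ≤ C
  meas_gen : Measurable g
  bdd_gen : ∀ x, |g x| ≤ C
  bdd_sub : ∀ (t : ℝ≥0) x, |∫ y, φ (x + y) ∂(ν t) - φ x| ≤ C * t
  tendsto : ∀ x, Tendsto (fun t : ℝ≥0 => (∫ y, φ (x + y) ∂(ν t) - φ x) / t) (𝓝[>] 0) (𝓝 (g x))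

section Generator

variable {d : ℕ} {α : ℝ} {Γ : Measure (sphere (0 : Vec d) 1)}

lemma HasGenerator.exists_isGeneratorPair {S : Type*} [MeasurableSpace S] {P : Measure S}
  [IsProbabilityMeasure P] {X : ℝ≥0 → S → Vec d} (hX : IsLevyStable P α Γ X) {φ g : Vec d → ℝ}
  (h : HasGenerator P X φ g) :
  ∃ C, IsGenPair (fun t => P.map (fun w => X t w - X 0 w)) φ g C := by
  obtain ⟨C₁, h1⟩ := h.bounded
  obtain ⟨C₂, h2⟩ := h.bounded_gen
  obtain ⟨C₃, h3⟩ := h.bounded_quotient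
  have ht : ∀ (t : ℝ≥0) x, ∫ y, φ (x + y) ∂(P.map (fun w => X t w - X 0 w))
      = transition P X t φ x := fun t x => by
    have := h.measurable
    have hm : Measurable fun w => X t w - X 0 w := (hX.measurable t).sub (hX.measurable 0)
    rw [integral_map hm.aemeasurable (Measurable.aestronglyMeasurable (by fun_prop))]
    rfl
  refine ⟨max C₁ (max C₂ C₃), h.measurable, fun x => (h1 x).trans (le_max_left _ _),
    h.measurable_gen, fun x => (h2 x).trans ((le_max_left _ _).trans (le_max_right _ _)),
    fun t x => ?_, fun x => ?_⟩
  · simp only [ht]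
    rcases eq_or_ne t 0 with rfl | h0
    · simp [transition]
    · have ht0 : (0 : ℝ) < t := by exact_mod_cast pos_iff_ne_zero.2 h0
      have h4 := h3 t x (pos_iff_ne_zero.2 h0)
      rw [abs_div, abs_of_pos ht0, div_le_iff₀ ht0] at h4
      exact h4.trans (mul_le_mul_of_nonneg_right
        ((le_max_right _ _).trans (le_max_right _ _)) ht0.le)
  · simp only [ht]
    exact h.tendsto x

namespace IsGenPair

variable {ν : ℝ≥0 → Measure (Vec d)} {φ g : Vec d → ℝ} {C : ℝ}

lemma C_nonneg (h : IsGenPair ν φ g C) : 0 ≤ C := (abs_nonneg _).trans (h.bdd 0)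

lemma measurable_semigroup (hν : IsStableFamily α Γ ν) (t : ℝ≥0) {f : Vec d → ℝ}
  (hf : Measurable f) : Measurable fun x => ∫ y, f (x + y) ∂(ν t) := by
  have := hν.prob t
  have h1 : StronglyMeasurable (uncurry fun x y : Vec d => f (x + y)) :=
    (hf.comp (measurable_fst.add measurable_snd)).stronglyMeasurable
  exact h1.integral_prod_right'.measurable

variable [IsFiniteMeasure Γ]

/-- Functions in the domain are uniformly continuous along the linear span of the increments. -/
lemma exists_modulus (h : IsGenPair ν φ g C) (hν : IsStableFamily α Γ ν) (hα : 0 < α)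
  {η : ℝ} (hη : 0 < η) :
  ∃ δ > 0, ∀ x, ∀ y ∈ stableSpan Γ, ‖y‖ < δ → |φ (x + y) - φ x| ≤ η := by
  have hC := h.C_nonneg
  set t : ℝ≥0 := ⟨η / (4 * (C + 1)), by positivity⟩ with ht
  have ht0 : 0 < t := by
    have : 0 < η / (4 * (C + 1)) := by positivity
    exact_mod_cast this
  have ht' : C * (t : ℝ) ≤ η / 4 := by
    have : (t : ℝ) = η / (4 * (C + 1)) := rfl
    rw [this, ← mul_div_assoc, div_le_div_iff₀ (by positivity) (by norm_num)]
    nlinarith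
  obtain ⟨δ, hδ, h1⟩ := hν.exists_translation_modulus hα ht0 (ε := η / (2 * (C + 1)))
    (by positivity)
  refine ⟨δ, hδ, fun x y hy hyδ => ?_⟩
  have h2 := h1 y hy hyδ (fun z => φ (x + z)) (h.meas.comp (measurable_const_add x)) C
    fun z => h.bdd _
  have h3 := h.bdd_sub t x
  have h4 := h.bdd_sub t (x + y)
  have h5 : C * (η / (2 * (C + 1))) ≤ η / 2 := by
    rw [← mul_div_assoc, div_le_div_iff₀ (by positivity) (by norm_num)]
    nlinarith
  have e : ∀ z, x + (y + z) = x + y + z := fun z => (add_assoc _ _ _).symm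
  simp only [e] at h2
  rw [abs_le] at *
  constructor <;> linarith [h2.1, h2.2, h3.1, h3.2, h4.1, h4.2]

lemma tendsto_comp (h : IsGenPair ν φ g C) (hν : IsStableFamily α Γ ν) (hα : 0 < α)
  {ι : Type*} {l : Filter ι} {z : ι → Vec d} {x : Vec d} (hz : Tendsto z l (𝓝 x))
  (hs : ∀ᶠ i in l, z i - x ∈ stableSpan Γ) : Tendsto (fun i => φ (z i)) l (𝓝 (φ x)) := by
  rw [Metric.tendsto_nhds]
  intro η hη
  obtain ⟨δ, hδ, h1⟩ := h.exists_modulus hν hα (half_pos hη)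
  filter_upwards [Metric.tendsto_nhds.1 hz δ hδ, hs] with i h2 h3
  have h4 := h1 x _ h3 (by rwa [← dist_eq_norm])
  rw [add_sub_cancel] at h4
  rw [Real.dist_eq]
  linarith

lemma exists_small_variance (h : IsGenPair ν φ g C) (hν : IsStableFamily α Γ ν)
  (hα : 0 < α) {η : ℝ} (hη : 0 < η) :
  ∃ δ : ℝ≥0, 0 < δ ∧ ∀ u ≤ δ, ∀ x, ∫ y, (φ (x + y) - φ x) ^ 2 ∂(ν u) ≤ η := by
  obtain ⟨δ, hδ, h1⟩ := h.exists_modulus hν hα (show 0 < min 1 (η / 2) by positivity)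
  obtain ⟨t, ht, h2⟩ := hν.small δ hδ (η / (8 * (C ^ 2 + 1))) (by positivity)
  refine ⟨t, ht, fun u hu x => ?_⟩
  have := hν.prob u
  have hA : MeasurableSet {y : Vec d | δ ≤ ‖y‖} := measurableSet_le measurable_const measurable_norm
  have hm : Measurable fun y => (φ (x + y) - φ x) ^ 2 :=
    ((h.meas.comp (measurable_const_add x)).sub_const _).pow_const 2
  have hb : ∀ y, (φ (x + y) - φ x) ^ 2 ≤ 4 * C ^ 2 := fun y => by
    have h3 := abs_le.1 (h.bdd (x + y))
    have h4 := abs_le.1 (h.bdd x)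
    nlinarith [h3.1, h3.2, h4.1, h4.2]
  calc ∫ y, (φ (x + y) - φ x) ^ 2 ∂(ν u)
      ≤ ∫ y, (η / 2 + 4 * C ^ 2 * ({y : Vec d | δ ≤ ‖y‖}.indicator 1 y)) ∂(ν u) := by
        refine integral_mono_ae ?_ ?_ ?_
        · refine Integrable.of_bound hm.aestronglyMeasurable (4 * C ^ 2) (.of_forall fun y => ?_)
          rw [norm_eq_abs, abs_of_nonneg (sq_nonneg _)]
          exact hb y
        · exact (integrable_const _).add (((integrable_const 1).indicator hA).const_mul _)
        · filter_upwards [hν.ae_mem_span u] with y hy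
          by_cases hyδ : δ ≤ ‖y‖
          · rw [indicator_of_mem (show y ∈ {y : Vec d | δ ≤ ‖y‖} from hyδ)]
            simp only [Pi.one_apply, mul_one]
            linarith [hb y]
          · rw [indicator_of_notMem (show y ∉ {y : Vec d | δ ≤ ‖y‖} from hyδ)]
            have h3 := h1 x y hy (not_le.1 hyδ)
            have h4 : |φ (x + y) - φ x| ^ 2 ≤ min 1 (η / 2) ^ 2 :=
              pow_le_pow_left₀ (abs_nonneg _) h3 2
            rw [sq_abs] at h4
            have h5 : min 1 (η / 2) ^ 2 ≤ η / 2 := by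
              rw [sq]
              calc _ ≤ 1 * (η / 2) := mul_le_mul (min_le_left _ _) (min_le_right _ _)
                    (by positivity) zero_le_one
                _ = _ := one_mul _
            linarith
    _ = η / 2 + 4 * C ^ 2 * (ν u).real {y | δ ≤ ‖y‖} := by
        rw [integral_add (integrable_const _) (((integrable_const 1).indicator hA).const_mul _),
          integral_const_mul, integral_indicator_one hA]
        simp
    _ ≤ η / 2 + 4 * C ^ 2 * (η / (8 * (C ^ 2 + 1))) := by
        have := mul_le_mul_of_nonneg_left (h2 u hu) (show 0 ≤ 4 * C ^ 2 by positivity)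
        linarith
    _ ≤ η := by
        have : 4 * C ^ 2 * (η / (8 * (C ^ 2 + 1))) ≤ η / 2 := by
          rw [← mul_div_assoc, div_le_div_iff₀ (by positivity) (by norm_num)]
          nlinarith
        linarith

end IsGenPair

end Generator

/-! ### Independence and measurability of right-continuous processes -/

section Tools

variable {S E F : Type*} {m : MeasurableSpace S} [m0 : MeasurableSpace S] [MeasurableSpace E] [MeasurableSpace F]

lemma integral_mul_comp_of_indep {P : Measure S} [IsProbabilityMeasure P] (hm : m ≤ m0) {G : S → ℝ}
  (hG : BddMeas m G) {Y : S → E} (hY : Measurable[m] Y) {R : S → F} (hR : Measurable R)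
  (hi : Indep m (comap R inferInstance) P) {f : E → F → ℝ}
  (hf : Measurable (uncurry f)) {C : ℝ} (hC : ∀ x y, |f x y| ≤ C) :
  ∫ w, G w * f (Y w) (R w) ∂P = ∫ w, G w * ∫ y, f (Y w) y ∂(P.map R) ∂P := by
  have hGm : Measurable G := hG.1.mono hm le_rfl
  have hYm : Measurable Y := hY.mono hm le_rfl
  obtain ⟨D, hD⟩ := hG.2
  have hpair : Measurable fun w => (G w, Y w) := hGm.prodMk hYm
  have hind : IndepFun (fun w => (G w, Y w)) R P := by
    refine indep_of_indep_of_le_left hi ?_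
    exact Measurable.comap_le (hG.1.prodMk hY)
  have hmap := (indepFun_iff_map_prod_eq_prod_map_map hpair.aemeasurable hR.aemeasurable).1 hind
  have := Measure.isProbabilityMeasure_map (μ := P) hR.aemeasurable
  have hF : Measurable fun q : (ℝ × E) × F => q.1.1 * f q.1.2 q.2 :=
    (measurable_fst.comp measurable_fst).mul
      (hf.comp ((measurable_snd.comp measurable_fst).prodMk measurable_snd))
  have hint : Integrable (fun w => G w * f (Y w) (R w)) P := by
    refine Integrable.of_bound (C := D * C)
      (hGm.mul (hf.comp (hYm.prodMk hR))).aestronglyMeasurable (.of_forall fun w => ?_)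
    rw [norm_eq_abs, abs_mul]
    exact mul_le_mul (hD w) (hC _ _) (abs_nonneg _) ((abs_nonneg _).trans (hD w))
  have hint' : Integrable (fun q : (ℝ × E) × F => q.1.1 * f q.1.2 q.2)
      ((P.map fun w => (G w, Y w)).prod (P.map R)) := by
    rw [← hmap, integrable_map_measure hF.aestronglyMeasurable (hpair.prodMk hR).aemeasurable]
    exact hint
  calc ∫ w, G w * f (Y w) (R w) ∂P
      = ∫ q : (ℝ × E) × F, q.1.1 * f q.1.2 q.2 ∂(P.map fun w => ((G w, Y w), R w)) := by
        rw [integral_map (hpair.prodMk hR).aemeasurable hF.aestronglyMeasurable]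
    _ = ∫ q : ℝ × E, ∫ y, q.1 * f q.2 y ∂(P.map R) ∂(P.map fun w => (G w, Y w)) := by
        rw [hmap, integral_prod _ hint']
    _ = ∫ w, G w * ∫ y, f (Y w) y ∂(P.map R) ∂P := by
        rw [integral_map hpair.aemeasurable]
        · simp_rw [integral_const_mul]
        · exact (StronglyMeasurable.integral_prod_right' (ν := P.map R)
            (f := fun q : (ℝ × E) × F => q.1.1 * f q.1.2 q.2) hF.stronglyMeasurable).aestronglyMeasurable

lemma tendsto_dyadAbove (u : ℝ≥0) : Tendsto (dyadAbove u) atTop (𝓝[≥] u) := by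
  refine tendsto_nhdsWithin_iff.2 ⟨?_, .of_forall fun n => mem_Ici.2 (lt_dyadAbove u n).le⟩
  refine tendsto_of_tendsto_of_tendsto_of_le_of_le tendsto_const_nhds
    (h := fun n => u + 1 / 2 ^ n) ?_ (fun n => (lt_dyadAbove u n).le) fun n => dyadAbove_le u n
  simpa using tendsto_const_nhds.add tendsto_inv_two_pow

lemma tendsto_min_dyadAbove (u τ : ℝ≥0) (hu : u ≤ τ) :
  Tendsto (fun n => min (dyadAbove u n) τ) atTop (𝓝[≥] u) := by
  refine tendsto_nhdsWithin_iff.2 ⟨?_, .of_forall fun n =>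
    mem_Ici.2 (le_min (lt_dyadAbove u n).le hu)⟩
  have := (tendsto_nhds_of_tendsto_nhdsWithin (tendsto_dyadAbove u)).min (tendsto_const_nhds (x := τ))
  rwa [min_eq_left hu] at this

/-- A right-continuous process, stopped at a deterministic time, is jointly measurable. -/
lemma measurable_uncurry_min {E : Type*} [TopologicalSpace E] [TopologicalSpace.PseudoMetrizableSpace E]
  [MeasurableSpace E] [BorelSpace E] {W : ℝ≥0 → S → E} {τ : ℝ≥0}
  (hW : ∀ u ≤ τ, Measurable (W u))
  (hc : ∀ w u, u < τ → ContinuousWithinAt (fun u => W u w) (Ici u) u) :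
  Measurable fun p : ℝ≥0 × S => W (min p.1 τ) p.2 := by
  refine measurable_of_tendsto_metrizable
    (f := fun n (p : ℝ≥0 × S) => W (min (dyadAbove (min p.1 τ) n) τ) p.2) (fun n => ?_) ?_
  · refine measurable_natIndex (f := fun i (p : ℝ≥0 × S) => W (min (dyad n i) τ) p.2)
      (fun i => (hW _ (min_le_right _ _)).comp measurable_snd)
      (N := fun p => ⌊min p.1 τ * 2 ^ n⌋₊ + 1) ?_
    fun_prop
  · rw [tendsto_pi_nhds]
    intro p
    rcases (min_le_right p.1 τ).eq_or_lt with h | h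
    · have : ∀ n, min (dyadAbove (min p.1 τ) n) τ = min p.1 τ := fun n => by
        rw [h]
        exact min_eq_right (lt_dyadAbove τ n).le
      simp_rw [this]
      exact tendsto_const_nhds
    · exact (hc p.2 _ h).tendsto.comp (tendsto_min_dyadAbove _ _ (min_le_right _ _))

end Tools

/-! ### Martingales along the path of a process with independent increments -/

/-- `W` is driven by a filtration `𝓔`: its increments are adapted, independent of the past, and
stationary with laws `ν`. -/
structure IsDriver {d : ℕ} {S : Type*} [m0 : MeasurableSpace S] (P : Measure S)
  (𝓔 : ℝ≥0 → MeasurableSpace S) (ν : ℝ≥0 → Measure (Vec d)) (W : ℝ≥0 → S → Vec d) : Prop where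
  mono : Monotone 𝓔
  le : ∀ t, 𝓔 t ≤ m0
  adapted : ∀ s t, s ≤ t → Measurable[𝓔 t] (fun w => W t w - W s w)
  cadlag : ∀ w, IsCadlag (fun t => W t w)
  indep : ∀ s t, s ≤ t → Indep (𝓔 s) (comap (fun w => W t w - W s w) inferInstance) P
  law : ∀ s t, s ≤ t → P.map (fun w => W t w - W s w) = ν (t - s)

/-- The time `t` clamped to the interval `[a, b]`. -/
def clamp (a b t : ℝ≥0) : ℝ≥0 := min (max t a) b

lemma clamp_mono (a b : ℝ≥0) : Monotone (clamp a b) := fun _ _ h =>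
  min_le_min_right _ (max_le_max_right _ h)

lemma le_clamp {a b : ℝ≥0} (h : a ≤ b) (t : ℝ≥0) : a ≤ clamp a b t := le_min (le_max_right _ _) h

lemma clamp_le (a b t : ℝ≥0) : clamp a b t ≤ b := min_le_right _ _

lemma clamp_le_max (a b t : ℝ≥0) : clamp a b t ≤ max t a := min_le_left _ _

lemma clamp_sub_le (a b : ℝ≥0) {s t : ℝ≥0} (h : s ≤ t) :
  (clamp a b t : ℝ) - clamp a b s ≤ t - s := by
  unfold clamp
  push_cast
  rcases le_total (t : ℝ) a with h1 | h1 <;> rcases le_total (s : ℝ) a with h2 | h2 <;>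
    simp only [max_eq_left, max_eq_right, h1, h2] <;>
    rcases le_total (t : ℝ) b with h3 | h3 <;> rcases le_total (s : ℝ) b with h4 | h4 <;>
    rcases le_total (a : ℝ) b with h5 | h5 <;>
    simp only [min_eq_left, min_eq_right, h3, h4, h5] <;> linarith

section Segment

variable {d : ℕ} {S : Type*} [m0 : MeasurableSpace S]

/-- The function `f` along the path that starts in `A` at time `a` and moves with the increments of
`W` up to time `b`, multiplied by `χ`. -/
def segVal (W : ℝ≥0 → S → Vec d) (f : Vec d → ℝ) (A : S → Vec d) (χ : S → ℝ) (a b t : ℝ≥0)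
  (w : S) : ℝ := χ w * f (A w + (W (clamp a b t) w - W a w))

/-- The integral of `g` along the path. -/
def segDrift (W : ℝ≥0 → S → Vec d) (g : Vec d → ℝ) (A : S → Vec d) (χ : S → ℝ) (a b t : ℝ≥0)
  (w : S) : ℝ :=
  ∫ u in (a : ℝ)..(clamp a b t), χ w * g (A w + (W u.toNNReal w - W a w))

/-- The compensated value process along the path. -/
def segMart (W : ℝ≥0 → S → Vec d) (φ g : Vec d → ℝ) (A : S → Vec d) (χ : S → ℝ) (a b t : ℝ≥0)
  (w : S) : ℝ := segVal W φ A χ a b t w - χ w * φ (A w) - segDrift W g A χ a b t w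

variable {W : ℝ≥0 → S → Vec d} {φ g : Vec d → ℝ} {C : ℝ} {A : S → Vec d} {χ : S → ℝ} {a b : ℝ≥0}

lemma measurable_path_uncurry {τ : ℝ≥0} (hA : Measurable A)
  (hW : ∀ u, a ≤ u → u ≤ τ → Measurable fun w => W u w - W a w)
  (hc : ∀ w, IsCadlag (fun t => W t w)) (haτ : a ≤ τ) :
  Measurable fun p : ℝ × S => A p.2 + (W (clamp a τ p.1.toNNReal) p.2 - W a p.2) := by
  have h1 : Measurable fun p : ℝ≥0 × S => W (max (min p.1 τ) a) p.2 - W a p.2 := by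
    refine measurable_uncurry_min (W := fun u w => W (max u a) w - W a w) (τ := τ)
      (fun u hu => hW _ (le_max_right _ _) (max_le hu haτ)) fun w u _ => ?_
    refine ContinuousWithinAt.sub ?_ continuousWithinAt_const
    have h2 := (hc w).rightCont (max u a)
    exact h2.comp (f := fun u => max u a) (by fun_prop)
      fun v hv => mem_Ici.2 (max_le_max_right _ hv)
  have h2 : ∀ t, clamp a τ t = max (min t τ) a := fun t => by
    unfold clamp
    grind
  simp only [h2]
  have h3 : Measurable fun p : ℝ × S => (p.1.toNNReal, p.2) := by fun_prop
  exact (hA.comp measurable_snd).add (h1.comp h3)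

lemma segDrift_eq (hab : a ≤ b) (t : ℝ≥0) (w : S) : segDrift W g A χ a b t w
  = ∫ u in (a : ℝ)..(clamp a b t),
    χ w * g (A w + (W (clamp a (clamp a b t) u.toNNReal) w - W a w)) := by
  refine intervalIntegral.integral_congr fun u hu => ?_
  have h1 := le_clamp hab t
  rw [uIcc_of_le (by exact_mod_cast h1)] at hu
  have h2 : clamp a (clamp a b t) u.toNNReal = u.toNNReal := by
    have h3 : a ≤ u.toNNReal := NNReal.le_toNNReal_of_coe_le hu.1
    have h4 : u.toNNReal ≤ clamp a b t := toNNReal_le_iff_le_coe.2 hu.2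
    conv_lhs => unfold clamp
    rw [max_eq_left h3]
    exact min_eq_left h4
  simp only [h2]

lemma measurable_segDrift (hA : Measurable A) (hχ : Measurable χ)
  (hg : Measurable g) (hab : a ≤ b) {t : ℝ≥0}
  (hW : ∀ u, a ≤ u → u ≤ clamp a b t → Measurable fun w => W u w - W a w)
  (hc : ∀ w, IsCadlag (fun t => W t w)) : Measurable (segDrift W g A χ a b t) := by
  have h0 := le_clamp hab t
  have h1 := measurable_path_uncurry hA hW hc h0
  have h2 : segDrift W g A χ a b t = fun w => ∫ u in Ioc (a : ℝ) (clamp a b t),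
      χ w * g (A w + (W (clamp a (clamp a b t) u.toNNReal) w - W a w)) := by
    ext w
    rw [segDrift_eq hab, intervalIntegral.integral_of_le (by exact_mod_cast h0)]
  rw [h2]
  have h3 : Measurable fun p : ℝ × S =>
      χ p.2 * g (A p.2 + (W (clamp a (clamp a b t) p.1.toNNReal) p.2 - W a p.2)) :=
    (hχ.comp measurable_snd).mul (hg.comp h1)
  exact (h3.stronglyMeasurable.integral_prod_left').measurable

lemma measurable_of_rightCont {E : Type*} [TopologicalSpace E]
  [TopologicalSpace.PseudoMetrizableSpace E] [MeasurableSpace E] [BorelSpace E] {f : ℝ≥0 → E}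
  (hf : ∀ u, ContinuousWithinAt f (Ici u) u) : Measurable f := by
  refine measurable_of_tendsto_metrizable (f := fun n u => f (dyadAbove u n)) (fun n => ?_) ?_
  · exact (measurable_from_nat (f := fun i => f (dyad n i))).comp
      ((Nat.measurable_floor.comp (measurable_id.mul_const _)).add_const 1)
  · rw [tendsto_pi_nhds]
    intro u
    exact (hf u).tendsto.comp (tendsto_dyadAbove u)

lemma measurable_path_time {w : S} (hc : IsCadlag (fun t => W t w)) (hg : Measurable g) :
  Measurable fun u : ℝ => χ w * g (A w + (W u.toNNReal w - W a w)) := by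
  have h1 := measurable_of_rightCont hc.rightCont
  fun_prop

lemma abs_segDrift_sub_le (hg : Measurable g) (hgC : ∀ x, |g x| ≤ C) (hχ1 : ∀ w, |χ w| ≤ 1)
  (hc : ∀ w, IsCadlag (fun t => W t w)) {s t : ℝ≥0} (hst : s ≤ t) (w : S) :
  |segDrift W g A χ a b t w - segDrift W g A χ a b s w| ≤ C * ((t : ℝ) - s) := by
  have hC : 0 ≤ C := (abs_nonneg _).trans (hgC 0)
  have hb : ∀ u : ℝ, |χ w * g (A w + (W u.toNNReal w - W a w))| ≤ C := fun u => by
    rw [abs_mul]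
    calc _ ≤ 1 * C := mul_le_mul (hχ1 w) (hgC _) (abs_nonneg _) zero_le_one
      _ = C := one_mul _
  have hi : ∀ x y : ℝ, IntervalIntegrable
      (fun u : ℝ => χ w * g (A w + (W u.toNNReal w - W a w))) volume x y := fun x y =>
    (intervalIntegrable_const (c := C)).mono_fun
      (measurable_path_time (hc w) hg).aestronglyMeasurable
      (.of_forall fun u => (hb u).trans (le_abs_self _))
  unfold segDrift
  rw [intervalIntegral.integral_interval_sub_left (hi _ _) (hi _ _)]
  refine (intervalIntegral.norm_integral_le_of_norm_le_const (C := C) fun u _ => by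
    rw [norm_eq_abs]; exact hb u).trans ?_
  have h1 : (clamp a b s : ℝ) ≤ clamp a b t := by exact_mod_cast clamp_mono a b hst
  rw [abs_of_nonneg (by linarith)]
  exact mul_le_mul_of_nonneg_left (clamp_sub_le a b hst) hC

end Segment

section SegmentMartingale

variable {d : ℕ} {S : Type*} [m0 : MeasurableSpace S] {P : Measure S} [IsProbabilityMeasure P]
  {𝓔 : ℝ≥0 → MeasurableSpace S} {ν : ℝ≥0 → Measure (Vec d)} {W : ℝ≥0 → S → Vec d}
  {α : ℝ} {Γ : Measure (sphere (0 : Vec d) 1)} {φ g : Vec d → ℝ} {C : ℝ} {A : S → Vec d} {χ : S → ℝ} {a b : ℝ≥0}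

lemma IsDriver.measurable_path (hW : IsDriver P 𝓔 ν W) (hA : Measurable[𝓔 a] A) {s : ℝ≥0}
  (has : a ≤ s) : Measurable[𝓔 s] fun w => A w + (W s w - W a w) :=
  (hA.mono (hW.mono has) le_rfl).add (hW.adapted a s has)

lemma IsDriver.measurable_path' (hW : IsDriver P 𝓔 ν W) (hA : Measurable[𝓔 a] A) {s : ℝ≥0}
  (has : a ≤ s) : Measurable fun w => A w + (W s w - W a w) :=
  (hW.measurable_path hA has).mono (hW.le s) le_rfl

/-- The Markov property. -/
lemma IsDriver.integral_mul_comp (hW : IsDriver P 𝓔 ν W) (hA : Measurable[𝓔 a] A) {s t : ℝ≥0}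
  (has : a ≤ s) (hst : s ≤ t) {G : S → ℝ} (hG : BddMeas (𝓔 s) G) {f : Vec d → Vec d → ℝ}
  (hf : Measurable (uncurry f)) {D : ℝ} (hD : ∀ x y, |f x y| ≤ D) :
  ∫ w, G w * f (A w + (W s w - W a w)) (A w + (W t w - W a w)) ∂P
    = ∫ w, G w * ∫ y, f (A w + (W s w - W a w)) (A w + (W s w - W a w) + y) ∂(ν (t - s)) ∂P := by
  have hR : Measurable fun w => W t w - W s w := (hW.adapted s t hst).mono (hW.le t) le_rfl
  have h1 := integral_mul_comp_of_indep (hW.le s) hG (hW.measurable_path hA has) hR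
    (hW.indep s t hst) (f := fun x y => f x (x + y))
    (hf.comp (measurable_fst.prodMk (measurable_fst.add measurable_snd))) fun x y => hD _ _
  rw [hW.law s t hst] at h1
  rw [← h1]
  congr 1
  abel

lemma IsDriver.continuous_integral_sub (hW : IsDriver P 𝓔 ν W) (h : IsGenPair ν φ g C)
  (hν : IsStableFamily α Γ ν) (hA : Measurable[𝓔 a] A) {s : ℝ≥0} (has : a ≤ s) {G : S → ℝ}
  (hG : BddMeas (𝓔 s) G) {u v : ℝ≥0} (hsu : s ≤ u) (huv : u ≤ v) :
  ∫ w, G w * φ (A w + (W v w - W a w)) ∂P - ∫ w, G w * φ (A w + (W u w - W a w)) ∂P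
    = ∫ w, G w * (∫ y, φ (A w + (W u w - W a w) + y) ∂(ν (v - u))
        - φ (A w + (W u w - W a w))) ∂P := by
  have hG' : BddMeas (𝓔 u) G := hG.mono (hW.mono hsu)
  obtain ⟨D, hD⟩ := hG.2
  have hGm : Measurable G := hG.1.mono (hW.le s) le_rfl
  have hYu := hW.measurable_path' hA (has.trans hsu)
  have := hν.prob (v - u)
  rw [hW.integral_mul_comp hA (has.trans hsu) huv hG' (f := fun _ y => φ y)
    (h.meas.comp measurable_snd) (fun _ y => h.bdd y), ← integral_sub]
  · simp only [mul_sub]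
  · refine Integrable.of_bound (C := D * C) (hGm.mul ((IsGenPair.measurable_semigroup hν
      (v - u) h.meas).comp hYu)).aestronglyMeasurable (.of_forall fun w => ?_)
    rw [norm_mul]
    refine mul_le_mul (hD w) ?_ (norm_nonneg _) ((abs_nonneg _).trans (hD w))
    refine (norm_integral_le_of_norm_le_const (.of_forall fun y => h.bdd _)).trans ?_
    simp
  · refine Integrable.of_bound (C := D * C) (hGm.mul (h.meas.comp hYu)).aestronglyMeasurable
      (.of_forall fun w => ?_)
    rw [norm_mul]
    exact mul_le_mul (hD w) (h.bdd _) (norm_nonneg _) ((abs_nonneg _).trans (hD w))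

/-- Dynkin's formula. -/
lemma IsDriver.dynkin (hW : IsDriver P 𝓔 ν W) (h : IsGenPair ν φ g C)
  (hν : IsStableFamily α Γ ν) (hA : Measurable[𝓔 a] A) {s t : ℝ≥0} (has : a ≤ s) (hst : s ≤ t)
  {G : S → ℝ} (hG : BddMeas (𝓔 s) G) :
  ∫ w, G w * φ (A w + (W t w - W a w)) ∂P - ∫ w, G w * φ (A w + (W s w - W a w)) ∂P
    = ∫ w, G w * (∫ u in (s : ℝ)..t, g (A w + (W u.toNNReal w - W a w))) ∂P := by
  have hC := h.C_nonneg
  obtain ⟨D, hD⟩ := hG.2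
  have hD0 : 0 ≤ D := (abs_nonneg _).trans (hD (Classical.choice (P.nonempty_of_neZero)))
  have hGm : Measurable G := hG.1.mono (hW.le s) le_rfl
  set F : ℝ → ℝ := fun u => ∫ w, G w * φ (A w + (W (max u s).toNNReal w - W a w)) ∂P with hF
  set f : ℝ → ℝ := fun u => ∫ w, G w * g (A w + (W (max u s).toNNReal w - W a w)) ∂P with hf
  have hmax : ∀ u : ℝ, s ≤ (max u s).toNNReal := fun u =>
    NNReal.le_toNNReal_of_coe_le (le_max_right _ _)
  have hFlip : ∀ x y : ℝ, |F y - F x| ≤ D * C * |y - x| := by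
    have aux : ∀ x y : ℝ, x ≤ y → |F y - F x| ≤ D * C * |y - x| := fun x y hxy => by
      have hxy' : (max x s).toNNReal ≤ (max y s).toNNReal :=
        Real.toNNReal_le_toNNReal (max_le_max_right _ hxy)
      rw [hF]
      rw [hW.continuous_integral_sub h hν hA has hG (hmax x) hxy', ← norm_eq_abs]
      refine (norm_integral_le_of_norm_le_const (C := D * (C * (y - x)))
        (.of_forall fun w => ?_)).trans ?_
      · rw [norm_mul]
        refine mul_le_mul (hD w) ((h.bdd_sub _ _).trans (mul_le_mul_of_nonneg_left ?_ hC))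
          (norm_nonneg _) hD0
        rw [NNReal.coe_sub hxy', coe_toNNReal _ (s.coe_nonneg.trans (le_max_right _ _)),
          coe_toNNReal _ (s.coe_nonneg.trans (le_max_right _ _))]
        grind
      · rw [abs_of_nonneg (sub_nonneg.2 hxy)]
        simp [mul_assoc]
    intro x y
    rcases le_total x y with hxy | hxy
    · exact aux x y hxy
    · rw [abs_sub_comm, abs_sub_comm y]
      exact aux y x hxy
  have hcont : Continuous F := by
    refine (LipschitzWith.of_dist_le_mul (K := ⟨D * C, mul_nonneg hD0 hC⟩) fun x y => ?_).continuous
    exact hFlip y x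
  have hder : ∀ u : ℝ, (s : ℝ) ≤ u →
      Tendsto (fun v : ℝ => (F v - F u) / (v - u)) (𝓝[>] u) (𝓝 (f u)) := by
    intro u hu
    have hsu : s ≤ u.toNNReal := NNReal.le_toNNReal_of_coe_le hu
    have hY := hW.measurable_path' hA (has.trans hsu)
    have h1 : Tendsto (fun r : ℝ≥0 => ∫ w, G w * ((∫ y, φ (A w + (W u.toNNReal w - W a w) + y) ∂(ν r)
          - φ (A w + (W u.toNNReal w - W a w))) / r) ∂P) (𝓝[>] 0) (𝓝 (f u)) := by
      rw [hf]
      simp only [max_eq_left hu]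
      refine tendsto_integral_filter_of_dominated_convergence (fun _ => D * C)
        (.of_forall fun r => ?_) ?_ (integrable_const _)
        (.of_forall fun w => (h.tendsto _).const_mul _)
      · exact (hGm.mul ((((IsGenPair.measurable_semigroup hν r h.meas).comp hY).sub
          (h.meas.comp hY)).div_const _)).aestronglyMeasurable
      · filter_upwards [self_mem_nhdsWithin] with r hr
        refine .of_forall fun w => ?_
        have hr' : (0 : ℝ) < r := by exact_mod_cast (mem_Ioi.1 hr)
        rw [norm_mul, norm_div, Real.norm_of_nonneg hr'.le]
        refine mul_le_mul (hD w) ?_ (by positivity) hD0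
        rw [div_le_iff₀ hr']
        exact h.bdd_sub r _
    have h2 : Tendsto (fun v : ℝ => (v - u).toNNReal) (𝓝[>] u) (𝓝[>] 0) := by
      refine tendsto_nhdsWithin_iff.2 ⟨?_, ?_⟩
      · have h3 : Continuous fun v : ℝ => (v - u).toNNReal := by fun_prop
        have h4 := h3.tendsto u
        simp only [sub_self, Real.toNNReal_zero] at h4
        exact h4.mono_left nhdsWithin_le_nhds
      · filter_upwards [self_mem_nhdsWithin] with v hv
        exact mem_Ioi.2 (Real.toNNReal_pos.2 (sub_pos.2 hv))
    refine (h1.comp h2).congr' ?_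
    filter_upwards [self_mem_nhdsWithin] with v hv
    have huv : u < v := hv
    have hv0 : 0 ≤ u := s.coe_nonneg.trans hu
    have e1 : v.toNNReal - u.toNNReal = (v - u).toNNReal := by
      refine tsub_eq_of_eq_add ?_
      rw [← Real.toNNReal_add (by linarith) hv0, sub_add_cancel]
    simp only [Function.comp_apply, hF, max_eq_left hu, max_eq_left (hu.trans huv.le)]
    rw [hW.continuous_integral_sub h hν hA has hG hsu (Real.toNNReal_le_toNNReal huv.le), e1,
      ← integral_div, coe_toNNReal (v - u) (by linarith)]
    simp only [mul_div_assoc]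
  have hprodm : Measurable fun p : ℝ × S =>
      G p.2 * g (A p.2 + (W (clamp s t p.1.toNNReal) p.2 - W a p.2)) := by
    have h1 := measurable_path_uncurry (a := s) (τ := t)
      (hW.measurable_path' hA has) (fun u hu _ => (hW.adapted s u hu).mono (hW.le u) le_rfl)
      hW.cadlag hst
    have h2 : ∀ p : ℝ × S, A p.2 + (W (clamp s t p.1.toNNReal) p.2 - W a p.2)
        = A p.2 + (W s p.2 - W a p.2) + (W (clamp s t p.1.toNNReal) p.2 - W s p.2) :=
      fun p => by abel
    simp only [h2]
    exact (hGm.comp measurable_snd).mul (h.meas_gen.comp h1)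
  have hst' : (s : ℝ) ≤ t := by exact_mod_cast hst
  have hclamp : ∀ u : ℝ, (s : ℝ) ≤ u → u ≤ t → clamp s t u.toNNReal = u.toNNReal :=
    fun u h1 h2 => by
      unfold clamp
      rw [max_eq_left (NNReal.le_toNNReal_of_coe_le h1), min_eq_left (toNNReal_le_iff_le_coe.2 h2)]
  have hbd : ∀ p : ℝ × S,
      ‖G p.2 * g (A p.2 + (W (clamp s t p.1.toNNReal) p.2 - W a p.2))‖ ≤ D * C := fun p => by
    rw [norm_mul]
    exact mul_le_mul (hD _) (h.bdd_gen _) (norm_nonneg _) hD0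
  have hswap : ∫ u in (s : ℝ)..t, f u
      = ∫ w, G w * (∫ u in (s : ℝ)..t, g (A w + (W u.toNNReal w - W a w))) ∂P := by
    have h1 : ∀ w, G w * ∫ u in (s : ℝ)..t, g (A w + (W u.toNNReal w - W a w))
        = ∫ u in Ioc (s : ℝ) t, G w * g (A w + (W (clamp s t u.toNNReal) w - W a w)) :=
      fun w => by
        rw [intervalIntegral.integral_of_le hst', integral_const_mul]
        congr 1
        refine setIntegral_congr_fun measurableSet_Ioc fun u hu => ?_
        simp only [hclamp u hu.1.le hu.2]
    have h2 : ∫ u in (s : ℝ)..t, f u = ∫ u in Ioc (s : ℝ) t,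
        ∫ w, G w * g (A w + (W (clamp s t u.toNNReal) w - W a w)) ∂P := by
      rw [intervalIntegral.integral_of_le hst']
      refine setIntegral_congr_fun measurableSet_Ioc fun u hu => ?_
      simp only [hf, hclamp u hu.1.le hu.2, max_eq_left hu.1.le]
    simp_rw [h1]
    rw [h2, integral_integral_swap]
    exact Integrable.of_bound hprodm.aestronglyMeasurable (D * C) (.of_forall hbd)
  rw [← hswap, intervalIntegral.integral_eq_sub_of_hasDeriv_right (f := F) hcont.continuousOn]
  · simp [hF, hst']
  · intro u hu
    rw [min_eq_left hst'] at hu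
    rw [hasDerivWithinAt_iff_tendsto_slope' (by simp)]
    refine (hder u hu.1.le).congr fun v => ?_
    rw [slope_def_field]
  · refine (intervalIntegrable_iff_integrableOn_Ioc_of_le hst').2 ?_
    have h3 : Integrable (fun u : ℝ => ∫ w, G w * g (A w + (W (clamp s t u.toNNReal) w - W a w)) ∂P)
        (volume.restrict (Ioc (s : ℝ) t)) :=
      (Integrable.of_bound (μ := (volume.restrict (Ioc (s : ℝ) t)).prod P)
        hprodm.aestronglyMeasurable (D * C) (.of_forall hbd)).integral_prod_left
    refine h3.congr ((ae_restrict_iff' measurableSet_Ioc).2 (.of_forall fun u hu => ?_))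
    simp only [hf, hclamp u hu.1.le hu.2, max_eq_left hu.1.le]

end SegmentMartingale

section SegmentBddMart

variable {d : ℕ} {S : Type*} [m0 : MeasurableSpace S] {P : Measure S} [IsProbabilityMeasure P]
  {𝓔 : ℝ≥0 → MeasurableSpace S} {ν : ℝ≥0 → Measure (Vec d)} {W : ℝ≥0 → S → Vec d}
  {α : ℝ} {Γ : Measure (sphere (0 : Vec d) 1)} {φ g : Vec d → ℝ} {C : ℝ} {A : S → Vec d} {χ : S → ℝ} {a b : ℝ≥0}

/-- A modulus for the conditional variances of the increments along a path. -/
def varModulus (ν : ℝ≥0 → Measure (Vec d)) (φ : Vec d → ℝ) (C : ℝ) (h : ℝ≥0) : ℝ :=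
  2 * (⨆ p : Iic h × Vec d, ∫ y, (φ (p.2 + y) - φ p.2) ^ 2 ∂(ν p.1)) + 2 * C ^ 2 * (h : ℝ) ^ 2

namespace IsGenPair

lemma integral_sq_le (h : IsGenPair ν φ g C) (hν : IsStableFamily α Γ ν) (u : ℝ≥0)
  (x : Vec d) : ∫ y, (φ (x + y) - φ x) ^ 2 ∂(ν u) ≤ 4 * C ^ 2 := by
  have := hν.prob u
  have h1 : ∀ y, ‖(φ (x + y) - φ x) ^ 2‖ ≤ 4 * C ^ 2 := fun y => by
    have h3 := abs_le.1 (h.bdd (x + y))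
    have h4 := abs_le.1 (h.bdd x)
    rw [norm_eq_abs, abs_of_nonneg (sq_nonneg _)]
    nlinarith [h3.1, h3.2, h4.1, h4.2]
  refine (le_abs_self _).trans ((norm_integral_le_of_norm_le_const (.of_forall h1)).trans ?_)
  simp

lemma bddAbove_sq (h : IsGenPair ν φ g C) (hν : IsStableFamily α Γ ν) (r : ℝ≥0) :
  BddAbove (range fun p : Iic r × Vec d => ∫ y, (φ (p.2 + y) - φ p.2) ^ 2 ∂(ν p.1)) :=
  ⟨4 * C ^ 2, by rintro _ ⟨p, rfl⟩; exact h.integral_sq_le hν _ _⟩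

lemma le_varModulus (h : IsGenPair ν φ g C) (hν : IsStableFamily α Γ ν) (u : ℝ≥0)
  (x : Vec d) : 2 * ∫ y, (φ (x + y) - φ x) ^ 2 ∂(ν u) + 2 * C ^ 2 * (u : ℝ) ^ 2
    ≤ varModulus ν φ C u := by
  have := le_ciSup (h.bddAbove_sq hν u) (⟨u, mem_Iic.2 le_rfl⟩, x)
  unfold varModulus
  linarith

lemma varModulus_mono (h : IsGenPair ν φ g C) (hν : IsStableFamily α Γ ν) :
  Monotone (varModulus ν φ C) := by
  intro r r' hr
  unfold varModulus
  have hr' : (r : ℝ) ≤ r' := by exact_mod_cast hr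
  have h1 : (⨆ p : Iic r × Vec d, ∫ y, (φ (p.2 + y) - φ p.2) ^ 2 ∂(ν p.1))
      ≤ ⨆ p : Iic r' × Vec d, ∫ y, (φ (p.2 + y) - φ p.2) ^ 2 ∂(ν p.1) := by
    refine ciSup_le fun p => ?_
    exact le_ciSup (h.bddAbove_sq hν r') (⟨p.1.1, mem_Iic.2 ((mem_Iic.1 p.1.2).trans hr)⟩, p.2)
  gcongr

lemma varModulus_nonneg (r : ℝ≥0) : 0 ≤ varModulus ν φ C r := by
  have : 0 ≤ ⨆ p : Iic r × Vec d, ∫ y, (φ (p.2 + y) - φ p.2) ^ 2 ∂(ν p.1) :=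
    Real.iSup_nonneg fun p => integral_nonneg fun y => sq_nonneg _
  unfold varModulus
  positivity

lemma varModulus_small [IsFiniteMeasure Γ] (h : IsGenPair ν φ g C)
  (hν : IsStableFamily α Γ ν) (hα : 0 < α) {η : ℝ} (hη : 0 < η) :
  ∃ δ : ℝ≥0, 0 < δ ∧ varModulus ν φ C δ ≤ η := by
  obtain ⟨δ, hδ, h1⟩ := h.exists_small_variance hν hα (show 0 < η / 4 by positivity)
  have hε : 0 < min 1 (η / (4 * (C ^ 2 + 1))) := by positivity
  refine ⟨min δ ⟨min 1 (η / (4 * (C ^ 2 + 1))), hε.le⟩, lt_min hδ (by exact_mod_cast hε), ?_⟩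
  set δ' := min δ ⟨min 1 (η / (4 * (C ^ 2 + 1))), hε.le⟩ with hδ'
  have h2 : (δ' : ℝ) ≤ min 1 (η / (4 * (C ^ 2 + 1))) := by
    have : δ' ≤ ⟨min 1 (η / (4 * (C ^ 2 + 1))), hε.le⟩ := min_le_right _ _
    exact_mod_cast this
  have h3 : (⨆ p : Iic δ' × Vec d, ∫ y, (φ (p.2 + y) - φ p.2) ^ 2 ∂(ν p.1)) ≤ η / 4 := by
    exact ciSup_le fun p => h1 _ ((mem_Iic.1 p.1.2).trans (min_le_left _ _)) _
  have h4 : (δ' : ℝ) ^ 2 ≤ η / (4 * (C ^ 2 + 1)) := by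
    have h5 := h2.trans (min_le_left _ _)
    have h6 := h2.trans (min_le_right _ _)
    nlinarith [δ'.coe_nonneg]
  have h5 : 2 * C ^ 2 * (δ' : ℝ) ^ 2 ≤ η / 2 := by
    refine (mul_le_mul_of_nonneg_left h4 (by positivity)).trans ?_
    rw [← mul_div_assoc, div_le_div_iff₀ (by positivity) (by norm_num)]
    nlinarith [sq_nonneg C]
  unfold varModulus
  linarith

end IsGenPair

lemma segMart_sub (hg : Measurable g) (hgC : ∀ x, |g x| ≤ C) (hc : ∀ w, IsCadlag (fun t => W t w))
  (s t : ℝ≥0) (w : S) : segMart W φ g A χ a b t w - segMart W φ g A χ a b s w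
    = χ w * (φ (A w + (W (clamp a b t) w - W a w)) - φ (A w + (W (clamp a b s) w - W a w))
      - ∫ u in (clamp a b s : ℝ)..(clamp a b t), g (A w + (W u.toNNReal w - W a w))) := by
  have hi : ∀ x y : ℝ, IntervalIntegrable
      (fun u : ℝ => g (A w + (W u.toNNReal w - W a w))) volume x y := fun x y => by
    have h1 := measurable_path_time (W := W) (A := A) (a := a) (χ := fun _ => 1) (hc w) hg
    simp only [one_mul] at h1
    exact (intervalIntegrable_const (c := C)).mono_fun h1.aestronglyMeasurable
      (.of_forall fun u => (hgC _).trans (le_abs_self _))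
  unfold segMart segVal segDrift
  rw [intervalIntegral.integral_const_mul, intervalIntegral.integral_const_mul,
    ← intervalIntegral.integral_interval_sub_left (hi (a : ℝ) (clamp a b t)) (hi (a : ℝ) (clamp a b s))]
  ring

lemma bddMeas_path_drift (hW : IsDriver P 𝓔 ν W) (hg : Measurable g) (hgC : ∀ x, |g x| ≤ C)
  (hA : Measurable[𝓔 a] A) {s t : ℝ≥0} (has : a ≤ s) (hst : s ≤ t) :
  BddMeas m0 (fun w => ∫ u in (s : ℝ)..t, g (A w + (W u.toNNReal w - W a w))) ∧
    ∀ w, |∫ u in (s : ℝ)..t, g (A w + (W u.toNNReal w - W a w))| ≤ C * ((t : ℝ) - s) := by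
  have hb : ∀ w, |∫ u in (s : ℝ)..t, g (A w + (W u.toNNReal w - W a w))| ≤ C * ((t : ℝ) - s) := by
    intro w
    have h1 := intervalIntegral.norm_integral_le_of_norm_le_const (a := (s : ℝ)) (b := t) (C := C)
      (f := fun u => g (A w + (W u.toNNReal w - W a w))) fun u _ => hgC _
    rwa [abs_of_nonneg (by linarith)] at h1
  refine ⟨⟨?_, _, hb⟩, hb⟩
  have h1 := measurable_segDrift (W := W) (g := g) (A := fun w => A w + (W s w - W a w))
    (χ := fun _ => 1) (a := s) (b := t) (t := t) (hW.measurable_path' hA has) measurable_const hg hst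
    (fun u hu _ => (hW.adapted s u hu).mono (hW.le u) le_rfl) hW.cadlag
  have h2 : segDrift W g (fun w => A w + (W s w - W a w)) (fun _ => 1) s t t
      = fun w => ∫ u in (s : ℝ)..t, g (A w + (W u.toNNReal w - W a w)) := by
    ext w
    unfold segDrift clamp
    rw [max_eq_left hst, min_self]
    simp only [one_mul]
    abel
  rwa [h2] at h1

lemma isBddMart_segMart [IsFiniteMeasure Γ] (hW : IsDriver P 𝓔 ν W) (h : IsGenPair ν φ g C)
  (hν : IsStableFamily α Γ ν) (hα : 0 < α) (hA : Measurable[𝓔 a] A) (hχ : Measurable[𝓔 a] χ)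
  (hχ1 : ∀ w, |χ w| ≤ 1) (hab : a ≤ b) :
  IsBddMart P (fun t => 𝓔 (max t a)) (segMart W φ g A χ a b) (varModulus ν φ C) where
  mono s t hst := hW.mono (max_le_max_right _ hst)
  le t := hW.le _
  adapted t := by
    have hle := clamp_le_max a b t
    have h0 := le_clamp hab t
    have hbd : ∀ x w, |χ w * φ x| ≤ C := fun x w => by
      rw [abs_mul]
      calc _ ≤ 1 * C := mul_le_mul (hχ1 w) (h.bdd _) (abs_nonneg _) zero_le_one
        _ = C := one_mul _
    have hχ' : Measurable[𝓔 (max t a)] χ := hχ.mono (hW.mono (le_max_right _ _)) le_rfl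
    have hA' : Measurable[𝓔 (max t a)] A := hA.mono (hW.mono (le_max_right _ _)) le_rfl
    refine (BddMeas.sub (BddMeas.sub ⟨?_, C, fun w => hbd _ w⟩ ⟨?_, C, fun w => hbd _ w⟩) ⟨?_,
      C * ((clamp a b t : ℝ) - a), fun w => ?_⟩)
    · exact hχ'.mul (h.meas.comp ((hW.measurable_path hA h0).mono (hW.mono hle) le_rfl))
    · exact hχ'.mul (h.meas.comp hA')
    · exact @measurable_segDrift _ _ (𝓔 (max t a)) _ _ _ _ _ _ hA' hχ' h.meas_gen hab _
        (fun u hu hut => (hW.adapted a u hu).mono (hW.mono (hut.trans hle)) le_rfl) hW.cadlag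
    · have h2 := intervalIntegral.norm_integral_le_of_norm_le_const (a := (a : ℝ))
        (b := clamp a b t) (C := C)
        (f := fun u => χ w * g (A w + (W u.toNNReal w - W a w))) fun u _ => by
          rw [norm_mul]
          calc _ ≤ 1 * C := mul_le_mul (hχ1 w) (h.bdd_gen _) (abs_nonneg _) zero_le_one
            _ = C := one_mul _
      rwa [abs_of_nonneg (by linarith)] at h2
  bdd t := by
    refine ⟨2 * C + C * ((b : ℝ) - a), fun s _ w => ?_⟩
    have h1 := segMart_sub (φ := φ) (A := A) (χ := χ) (a := a) (b := b) h.meas_gen h.bdd_gen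
      hW.cadlag 0 s w
    have hC := h.C_nonneg
    have hca : clamp a b 0 = a := by
      unfold clamp
      rw [max_eq_right zero_le, min_eq_left hab]
    have h0 : segMart W φ g A χ a b 0 w = 0 := by
      unfold segMart segVal segDrift
      rw [hca]
      simp
    rw [h0, sub_zero, hca] at h1
    rw [h1, abs_mul]
    have hle' : (clamp a b s : ℝ) ≤ b := by exact_mod_cast clamp_le a b s
    have h2 := (bddMeas_path_drift hW h.meas_gen h.bdd_gen hA le_rfl (le_clamp hab s)).2 w
    have h3 := abs_le.1 (h.bdd (A w + (W (clamp a b s) w - W a w)))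
    have h4 := abs_le.1 (h.bdd (A w + (W a w - W a w)))
    have h5 := abs_le.1 h2
    have h6 : C * ((clamp a b s : ℝ) - a) ≤ C * ((b : ℝ) - a) :=
      mul_le_mul_of_nonneg_left (by linarith) hC
    have h7 : |φ (A w + (W (clamp a b s) w - W a w)) - φ (A w + (W a w - W a w))
        - ∫ u in (a : ℝ)..(clamp a b s), g (A w + (W u.toNNReal w - W a w))|
        ≤ 2 * C + C * ((b : ℝ) - a) := abs_le.2 ⟨by linarith, by linarith⟩
    calc _ ≤ 1 * (2 * C + C * ((b : ℝ) - a)) :=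
          mul_le_mul (hχ1 w) h7 (abs_nonneg _) zero_le_one
      _ = _ := one_mul _
  orth s t hst G hG := by
    have hst' := clamp_mono a b hst
    simp only [segMart_sub h.meas_gen h.bdd_gen hW.cadlag]
    rcases le_or_gt b s with hbs | hsb
    · have e1 : clamp a b s = b := min_eq_right (hbs.trans (le_max_left _ _))
      have e2 : clamp a b t = b := min_eq_right ((hbs.trans hst).trans (le_max_left _ _))
      simp [e1, e2]
    · have e1 : clamp a b s = max s a := min_eq_left (max_le hsb.le hab)
      have has : a ≤ clamp a b s := le_clamp hab s
      have hG' : BddMeas (𝓔 (clamp a b s)) (fun w => G w * χ w) := by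
        rw [e1]
        exact hG.mul ⟨hχ.mono (hW.mono (le_max_right _ _)) le_rfl, 1, hχ1⟩
      have h1 := hW.dynkin h hν hA has hst' hG'
      have hGm := hG'.mono (hW.le _)
      have hφ : ∀ u, a ≤ u → BddMeas m0 (fun w => φ (A w + (W u w - W a w))) := fun u hu =>
        ⟨h.meas.comp (hW.measurable_path' hA hu), C, fun w => h.bdd _⟩
      have hd := (bddMeas_path_drift hW h.meas_gen h.bdd_gen hA has hst').1
      calc _ = ∫ w, ((G w * χ w) * φ (A w + (W (clamp a b t) w - W a w))
              - (G w * χ w) * φ (A w + (W (clamp a b s) w - W a w))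
              - (G w * χ w) * ∫ u in (clamp a b s : ℝ)..(clamp a b t),
                g (A w + (W u.toNNReal w - W a w))) ∂P := by
            congr 1
            ring
        _ = 0 := by
            rw [integral_sub, integral_sub, h1, sub_self]
            · exact (hGm.mul (hφ _ (has.trans hst'))).int
            · exact (hGm.mul (hφ _ has)).int
            · exact ((hGm.mul (hφ _ (has.trans hst'))).sub (hGm.mul (hφ _ has))).int
            · exact (hGm.mul hd).int
  var s t hst G hG hG0 := by
    have hst' := clamp_mono a b hst
    simp only [segMart_sub h.meas_gen h.bdd_gen hW.cadlag]
    rcases le_or_gt b s with hbs | hsb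
    · have e1 : clamp a b s = b := min_eq_right (hbs.trans (le_max_left _ _))
      have e2 : clamp a b t = b := min_eq_right ((hbs.trans hst).trans (le_max_left _ _))
      simp only [e1, e2, sub_self, intervalIntegral.integral_same, mul_zero, ne_eq,
        OfNat.ofNat_ne_zero, not_false_eq_true, zero_pow, integral_zero]
      exact mul_nonneg (IsGenPair.varModulus_nonneg _) (integral_nonneg hG0)
    · have e1 : clamp a b s = max s a := min_eq_left (max_le hsb.le hab)
      have has : a ≤ clamp a b s := le_clamp hab s
      have hG' : BddMeas (𝓔 (clamp a b s)) G := by rwa [e1]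
      have hGm := hG'.mono (hW.le _)
      have hχm : BddMeas m0 χ := ⟨hχ.mono (hW.le _) le_rfl, 1, hχ1⟩
      have hφ : ∀ u, a ≤ u → BddMeas m0 (fun w => φ (A w + (W u w - W a w))) := fun u hu =>
        ⟨h.meas.comp (hW.measurable_path' hA hu), C, fun w => h.bdd _⟩
      obtain ⟨hd, hdC⟩ := bddMeas_path_drift hW h.meas_gen h.bdd_gen hA has hst'
      set r := clamp a b t - clamp a b s with hr
      have hrr : (r : ℝ) = (clamp a b t : ℝ) - clamp a b s := NNReal.coe_sub hst'
      have hrts : r ≤ t - s := by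
        rw [← NNReal.coe_le_coe, hrr, NNReal.coe_sub hst]
        exact clamp_sub_le a b hst
      have hmk := hW.integral_mul_comp hA has hst' hG' (f := fun x y => (φ y - φ x) ^ 2)
        (((h.meas.comp measurable_snd).sub (h.meas.comp measurable_fst)).pow_const 2)
        (D := 4 * C ^ 2) (fun x y => by
          have h3 := abs_le.1 (h.bdd x)
          have h4 := abs_le.1 (h.bdd y)
          rw [abs_of_nonneg (sq_nonneg _)]
          nlinarith [h3.1, h3.2, h4.1, h4.2])
      have hVm : BddMeas m0 (fun w => ∫ y, (φ (A w + (W (clamp a b s) w - W a w) + y)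
          - φ (A w + (W (clamp a b s) w - W a w))) ^ 2 ∂(ν r)) := by
        have := hν.prob r
        refine ⟨?_, 4 * C ^ 2, fun w => ?_⟩
        · have h1 : Measurable fun x => ∫ y, (φ (x + y) - φ x) ^ 2 ∂(ν r) := by
            have h2 : StronglyMeasurable
                (uncurry fun x y : Vec d => (φ (x + y) - φ x) ^ 2) :=
              (((h.meas.comp (measurable_fst.add measurable_snd)).sub
                (h.meas.comp measurable_fst)).pow_const 2).stronglyMeasurable
            exact h2.integral_prod_right'.measurable
          exact h1.comp (hW.measurable_path' hA has)
        · rw [abs_of_nonneg (integral_nonneg fun y => sq_nonneg _)]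
          exact h.integral_sq_le hν _ _
      set Δ : S → ℝ := fun w => φ (A w + (W (clamp a b t) w - W a w))
        - φ (A w + (W (clamp a b s) w - W a w)) with hΔ
      have hΔm : BddMeas m0 Δ := (hφ _ (has.trans hst')).sub (hφ _ has)
      calc ∫ w, G w * (χ w * (Δ w - ∫ u in (clamp a b s : ℝ)..(clamp a b t),
                g (A w + (W u.toNNReal w - W a w)))) ^ 2 ∂P
          ≤ ∫ w, (2 * (G w * Δ w ^ 2) + G w * (2 * C ^ 2 * (r : ℝ) ^ 2)) ∂P := by
            refine integral_mono (hGm.mul ((hχm.mul (hΔm.sub hd)).pow 2)).int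
              (((hGm.mul (hΔm.pow 2)).const_mul 2).add (hGm.mul (BddMeas.const _))).int
              fun w => ?_
            set I := ∫ u in (clamp a b s : ℝ)..(clamp a b t),
                g (A w + (W u.toNNReal w - W a w)) with hI
            have h1 : χ w ^ 2 ≤ 1 := by
              rw [← sq_abs]
              exact pow_le_one₀ (abs_nonneg _) (hχ1 w)
            have h2 : I ^ 2 ≤ C ^ 2 * (r : ℝ) ^ 2 := by
              rw [← sq_abs, ← mul_pow, hrr]
              exact pow_le_pow_left₀ (abs_nonneg _) (hdC w) 2
            have h3 : (χ w * (Δ w - I)) ^ 2 ≤ 2 * Δ w ^ 2 + 2 * C ^ 2 * (r : ℝ) ^ 2 := by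
              calc (χ w * (Δ w - I)) ^ 2 = χ w ^ 2 * (Δ w - I) ^ 2 := mul_pow _ _ _
                _ ≤ 1 * (Δ w - I) ^ 2 := mul_le_mul_of_nonneg_right h1 (sq_nonneg _)
                _ ≤ _ := by nlinarith [sq_nonneg (Δ w + I)]
            calc _ ≤ G w * (2 * Δ w ^ 2 + 2 * C ^ 2 * (r : ℝ) ^ 2) :=
                  mul_le_mul_of_nonneg_left h3 (hG0 w)
              _ = _ := by ring
        _ = 2 * (∫ w, G w * Δ w ^ 2 ∂P) + ∫ w, G w * (2 * C ^ 2 * (r : ℝ) ^ 2) ∂P := by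
            rw [integral_add ((hGm.mul (hΔm.pow 2)).const_mul 2).int
              (hGm.mul (BddMeas.const _)).int, integral_const_mul]
        _ = ∫ w, G w * (2 * (∫ y, (φ (A w + (W (clamp a b s) w - W a w) + y)
              - φ (A w + (W (clamp a b s) w - W a w))) ^ 2 ∂(ν r))
              + 2 * C ^ 2 * (r : ℝ) ^ 2) ∂P := by
            rw [hmk, ← integral_const_mul, ← integral_add
              ((hGm.mul hVm).const_mul 2).int (hGm.mul (BddMeas.const _)).int]
            congr 1
            ext w
            ring
        _ ≤ ∫ w, G w * varModulus ν φ C r ∂P := by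
            refine integral_mono (hGm.mul ((hVm.const_mul 2).add (BddMeas.const _))).int
              (hGm.mul (BddMeas.const _)).int fun w => ?_
            exact mul_le_mul_of_nonneg_left (h.le_varModulus hν r _) (hG0 w)
        _ ≤ varModulus ν φ C (t - s) * ∫ w, G w ∂P := by
            rw [integral_mul_const, mul_comm]
            exact mul_le_mul_of_nonneg_right (h.varModulus_mono hν hrts) (integral_nonneg hG0)
  w_mono := h.varModulus_mono hν
  w_nonneg := IsGenPair.varModulus_nonneg
  w_small η hη := h.varModulus_small hν hα hη

end SegmentBddMart

/-! ### σ-algebras generated by the sources of randomness -/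

lemma Indep.sup_left_of_indep {S : Type*} {a b c : MeasurableSpace S} [m0 : MeasurableSpace S]
  {P : Measure S} [IsProbabilityMeasure P] (ha : a ≤ m0) (hb : b ≤ m0) (hc : c ≤ m0)
  (habc : Indep a (b ⊔ c) P) (hbc : Indep b c P) : Indep (a ⊔ b) c P := by
  set p : Set (Set S) := image2 (· ∩ ·) {A | MeasurableSet[a] A} {B | MeasurableSet[b] B} with hp
  have hgen : a ⊔ b = MeasurableSpace.generateFrom p := by
    refine le_antisymm (sup_le (fun A hA => ?_) fun B hB => ?_) (MeasurableSpace.generateFrom_le ?_)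
    · exact MeasurableSpace.measurableSet_generateFrom
        ⟨A, hA, univ, @MeasurableSet.univ _ b, inter_univ A⟩
    · exact MeasurableSpace.measurableSet_generateFrom
        ⟨univ, @MeasurableSet.univ _ a, B, hB, univ_inter B⟩
    · rintro _ ⟨A, hA, B, hB, rfl⟩
      have h1 : MeasurableSet[a ⊔ b] A := (le_sup_left : a ≤ a ⊔ b) _ hA
      have h2 : MeasurableSet[a ⊔ b] B := (le_sup_right : b ≤ a ⊔ b) _ hB
      exact @MeasurableSet.inter _ (a ⊔ b) _ _ h1 h2
  have hpi : IsPiSystem p := by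
    rintro _ ⟨A, hA, B, hB, rfl⟩ _ ⟨A', hA', B', hB', rfl⟩ -
    exact ⟨A ∩ A', @MeasurableSet.inter _ a _ _ hA hA', B ∩ B',
      @MeasurableSet.inter _ b _ _ hB hB', by simp only [inter_inter_inter_comm]⟩
  refine IndepSets.indep (sup_le ha hb) hc hpi (@MeasurableSpace.isPiSystem_measurableSet _ c) hgen
    (@MeasurableSpace.generateFrom_measurableSet _ c).symm ?_
  rw [IndepSets_iff]
  rintro _ D ⟨A, hA, B, hB, rfl⟩ hD
  have hBm : MeasurableSet[b ⊔ c] B := (le_sup_left : b ≤ b ⊔ c) _ hB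
  have hDm : MeasurableSet[b ⊔ c] D := (le_sup_right : c ≤ b ⊔ c) _ hD
  have h1 := (Indep_iff _ _ _).1 habc A (B ∩ D) hA (@MeasurableSet.inter _ (b ⊔ c) _ _ hBm hDm)
  have h2 := (Indep_iff _ _ _).1 habc A B hA hBm
  have h3 := (Indep_iff _ _ _).1 hbc B D hB hD
  simp only [inter_assoc]
  rw [h1, h2, h3, mul_assoc]

/-- The σ-algebra generated by the increments of a process up to time `s`. -/
@[reducible] def incrSigma {d : ℕ} {S : Type*} (X : ℝ≥0 → S → Vec d) (s : ℝ≥0) :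
    MeasurableSpace S :=
  ⨆ (u : ℝ≥0) (_ : u ≤ s), comap (fun w => X u w - X 0 w) inferInstance

lemma incrSigma_mono {d : ℕ} {S : Type*} (X : ℝ≥0 → S → Vec d) : Monotone (incrSigma X) :=
  fun _ _ h => iSup₂_le fun u hu => le_iSup₂_of_le u (hu.trans h) le_rfl

lemma measurable_incrSigma {d : ℕ} {S : Type*} (X : ℝ≥0 → S → Vec d) {u s : ℝ≥0} (h : u ≤ s) :
  Measurable[incrSigma X s] fun w => X u w - X 0 w :=
  (comap_measurable _).mono (le_iSup₂_of_le u h le_rfl) le_rfl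

lemma IsLevyStable.incrSigma_le {d : ℕ} {S : Type*} [m0 : MeasurableSpace S] {P : Measure S}
  {α : ℝ} {Γ : Measure (sphere (0 : Vec d) 1)} {X : ℝ≥0 → S → Vec d}
  (hX : IsLevyStable P α Γ X) (s : ℝ≥0) : incrSigma X s ≤ m0 :=
  iSup₂_le fun u _ => ((hX.measurable u).sub (hX.measurable 0)).comap_le

lemma IsLevyStable.indep_incrSigma {d : ℕ} {S : Type*} [m0 : MeasurableSpace S] {P : Measure S}
  [IsProbabilityMeasure P] {α : ℝ} {Γ : Measure (sphere (0 : Vec d) 1)}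
  {X : ℝ≥0 → S → Vec d} (hX : IsLevyStable P α Γ X) {s t : ℝ≥0} (hst : s ≤ t) :
  Indep (incrSigma X s) (comap (fun w => X t w - X s w) inferInstance) P := by
  set 𝓖 : ℕ → MeasurableSpace S := fun n =>
    ⨆ j : ℕ, comap (fun w => X (min (dyad n j) s) w - X 0 w) inferInstance with h𝓖
  have hle : ∀ n, 𝓖 n ≤ m0 := fun n => iSup_le fun j =>
    ((hX.measurable _).sub (hX.measurable 0)).comap_le
  have hmono : Monotone 𝓖 := fun n n' hn => iSup_le fun j => by
    rw [dyad_refine hn j]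
    exact le_iSup (fun j => comap (fun w => X (min (dyad n' j) s) w - X 0 w)
      inferInstance) (j * 2 ^ (n' - n))
  have hX' : Measurable fun w => X t w - X s w := (hX.measurable t).sub (hX.measurable s)
  have hgrid : ∀ n, Indep (𝓖 n) (comap (fun w => X t w - X s w) inferInstance) P := by
    intro n
    set N := 2 ^ n * ⌈s⌉₊ with hN
    have hNs : min (dyad n N) s = s := min_eq_right (le_dyad_ceil n s le_rfl)
    set τ : ℕ → ℝ≥0 := fun j => if j ≤ N then min (dyad n j) s else t with hτ
    have hτm : Monotone τ := by
      intro j k hjk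
      simp only [hτ]
      split_ifs with h1 h2 h2
      · exact min_le_min_right _ (dyad_mono n hjk)
      · exact (min_le_right _ _).trans hst
      · omega
      · exact le_rfl
    have hind := hX.indep.nat hτm
    have h2 := indep_iSup_of_disjoint (S := Iio N) (T := {N})
      (fun i => ((hX.measurable (τ (i + 1))).sub (hX.measurable (τ i))).comap_le)
      ((iIndepFun_iff_iIndep _ _ _).1 hind) (by simp)
    refine indep_of_indep_of_le_right (indep_of_indep_of_le_left h2 ?_) ?_
    · refine iSup_le fun j => ?_
      have key : ∀ j ≤ N, Measurable[⨆ i ∈ Iio N, comap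
          (fun w => X (τ (i + 1)) w - X (τ i) w) inferInstance] fun w => X (τ j) w - X 0 w := by
        intro j hj
        have e : (fun w => X (τ j) w - X 0 w)
            = fun w => ∑ i ∈ range j, (X (τ (i + 1)) w - X (τ i) w) := by
          ext1 w
          rw [sum_range_sub (fun i => X (τ i) w)]
          simp [hτ, dyad_zero]
        rw [e]
        refine measurable_fun_sum _ fun i hi => ?_
        have hi' : i < N := (mem_range.1 hi).trans_le hj
        exact (comap_measurable _).mono (le_iSup₂_of_le (f := fun i (_ : i ∈ Iio N) =>
          comap (fun w => X (τ (i + 1)) w - X (τ i) w) inferInstance) i hi' le_rfl)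
          le_rfl
      have h3 : min (dyad n j) s = τ (min j N) := by
        simp only [hτ, min_le_right, if_true]
        rcases le_total j N with h | h
        · rw [min_eq_left h]
        · rw [min_eq_right h, hNs, min_eq_right]
          exact (le_dyad_ceil n s le_rfl).trans (dyad_mono n h)
      rw [h3]
      exact (key _ (min_le_right _ _)).comap_le
    · refine le_iSup₂_of_le N rfl (le_of_eq ?_)
      simp only [hτ, le_refl, if_true, hNs]
      rw [if_neg (by omega)]
      rfl
  have hsup : Indep (⨆ n, 𝓖 n) (comap (fun w => X t w - X s w) inferInstance) P :=
    indep_iSup_of_monotone hgrid hle hX'.comap_le hmono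
  refine indep_of_indep_of_le_left hsup (iSup₂_le fun u hu => ?_)
  refine Measurable.comap_le ?_
  refine @measurable_of_tendsto_metrizable _ _ (⨆ n, 𝓖 n) _ _ _ _
    (fun n w => X (min (dyadAbove u n) s) w - X 0 w) _ (fun n => ?_) ?_
  · refine (comap_measurable _).mono (le_trans ?_ (le_iSup 𝓖 n)) le_rfl
    exact le_iSup (fun j => comap (fun w => X (min (dyad n j) s) w - X 0 w)
      inferInstance) (⌊u * 2 ^ n⌋₊ + 1)
  · rw [tendsto_pi_nhds]
    intro w
    exact (((hX.cadlag w).rightCont u).tendsto.comp (tendsto_min_dyadAbove u s hu)).sub_const _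

lemma comap_pi_eq {S ι : Type*} {E : ι → Type*} [∀ i, MeasurableSpace (E i)] (f : ∀ i, S → E i) :
  comap (fun w i => f i w) MeasurableSpace.pi = ⨆ i, comap (f i) inferInstance := by
  unfold MeasurableSpace.pi
  rw [MeasurableSpace.comap_iSup]
  congr 1
  ext1 i
  rw [comap_comp]
  rfl

section ProductIndep

variable {Ω Ω' : Type*} {m₁ m₂ : MeasurableSpace Ω'} [mΩ : MeasurableSpace Ω] [mΩ' : MeasurableSpace Ω'] {P : Measure Ω}
  {P' : Measure Ω'} [IsProbabilityMeasure P] [IsProbabilityMeasure P']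

lemma indep_fst_snd : Indep (comap (Prod.fst : Ω × Ω' → Ω) inferInstance)
  (comap (Prod.snd : Ω × Ω' → Ω') inferInstance) (P.prod P') := by
  rw [← IndepFun_iff_Indep, indepFun_iff_map_prod_eq_prod_map_map measurable_fst.aemeasurable
    measurable_snd.aemeasurable, Measure.map_fst_prod, Measure.map_snd_prod]
  simp

lemma prod_snd_preimage (A : Set Ω') : (P.prod P') (Prod.snd ⁻¹' A) = P' A := by
  have : Prod.snd ⁻¹' A = (univ : Set Ω) ×ˢ A := by ext; simp
  rw [this, Measure.prod_prod, measure_univ, one_mul]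

lemma Indep.fst_sup_snd (h₁ : m₁ ≤ mΩ') (h₂ : m₂ ≤ mΩ') (h : Indep m₁ m₂ P') :
  Indep (comap (Prod.fst : Ω × Ω' → Ω) mΩ ⊔ comap Prod.snd m₁) (comap Prod.snd m₂) (P.prod P') := by
  have hs : ∀ m ≤ mΩ', comap (Prod.snd : Ω × Ω' → Ω') m ≤ Prod.instMeasurableSpace := fun m hm =>
    (comap_mono hm).trans measurable_snd.comap_le
  refine Indep.sup_left_of_indep measurable_fst.comap_le (hs _ h₁) (hs _ h₂) ?_ ?_
  · refine indep_of_indep_of_le_right indep_fst_snd ?_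
    exact sup_le (comap_mono h₁) (comap_mono h₂)
  · rw [Indep_iff]
    rintro _ _ ⟨A, hA, rfl⟩ ⟨B, hB, rfl⟩
    rw [← preimage_inter, prod_snd_preimage, prod_snd_preimage, prod_snd_preimage]
    exact (Indep_iff _ _ _).1 h A B hA hB

end ProductIndep

variable {d₁ d₂ : ℕ} {Ω Ω' : Type*} [MeasurableSpace Ω] [MeasurableSpace Ω']
  {M : FilterModel d₁ d₂ Ω Ω'}

namespace FilterModel

variable (M)

instance : IsProbabilityMeasure M.P := M.probP

instance : IsProbabilityMeasure M.P' := M.probP'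

instance : IsFiniteMeasure M.Γ := M.finiteΓ

instance : IsProbabilityMeasure M.Phat := by
  unfold Phat
  infer_instance

/-- The σ-algebra of the initial positions. -/
@[reducible] def rhoSigma : MeasurableSpace Ω' := ⨆ i, comap (M.ρ i) inferInstance

/-- The σ-algebra of the process that moves the particle with label `j`. -/
@[reducible] def motionSigma (j : ℕ) : MeasurableSpace Ω' := ⨆ t, comap (M.Xp j t) inferInstance

/-- The σ-algebra of one uniform variable. -/
@[reducible] def branchSigma (q : ℕ × ℕ) : MeasurableSpace Ω' := comap (M.U q.1 q.2) inferInstance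

lemma rhoSigma_le : M.rhoSigma ≤ (inferInstance : MeasurableSpace Ω') :=
  iSup_le fun i => (M.measurableρ i).comap_le

lemma motionSigma_le (j : ℕ) : M.motionSigma j ≤ (inferInstance : MeasurableSpace Ω') :=
  iSup_le fun t => ((M.stableXp j).measurable t).comap_le

lemma branchSigma_le (q : ℕ × ℕ) : M.branchSigma q ≤ (inferInstance : MeasurableSpace Ω') :=
  (M.measurableU q.1 q.2).comap_le

lemma indep_motion_others (i : ℕ) :
  Indep (⨆ j ∈ ({i}ᶜ : Set ℕ), M.motionSigma j) (M.motionSigma i) M.P' := by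
  have h1 : iIndep M.motionSigma M.P' := by
    have := (iIndepFun_iff_iIndep _ _ _).1 M.indepXp
    simpa only [comap_pi_eq] using this
  have h2 := indep_iSup_of_disjoint (S := {i}ᶜ) (T := {i}) M.motionSigma_le h1 (by simp)
  simpa using h2

lemma indep_rho_motion : Indep M.rhoSigma (⨆ j, M.motionSigma j) M.P' := by
  have := (IndepFun_iff_Indep _ _ _).1 M.indepρXp
  simpa only [comap_pi_eq] using this

lemma indep_rho_motion_branch : Indep (M.rhoSigma ⊔ ⨆ j, M.motionSigma j)
  (⨆ q, M.branchSigma q) M.P' := by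
  have := (IndepFun_iff_Indep _ _ _).1 M.indepρXpU
  unfold Prod.instMeasurableSpace at this
  rw [MeasurableSpace.comap_prodMk, comap_pi_eq,
    comap_pi_eq (fun (i : ℕ) w (t : ℝ≥0) => M.Xp i t w),
    comap_pi_eq (fun (i : ℕ) w (k : ℕ) => M.U i k w)] at this
  simp only [comap_pi_eq] at this
  rwa [iSup_prod]

lemma indep_branch_others (q : ℕ × ℕ) :
  Indep (⨆ p ∈ ({q}ᶜ : Set (ℕ × ℕ)), M.branchSigma p) (M.branchSigma q) M.P' := by
  have h2 := indep_iSup_of_disjoint (S := {q}ᶜ) (T := {q}) M.branchSigma_le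
    ((iIndepFun_iff_iIndep _ _ _).1 M.indepU) (by simp)
  simpa using h2

/-- Everything on the auxiliary space except the increments of `Xp i` after time `s`. -/
@[reducible] def pastSigma (i : ℕ) (s : ℝ≥0) : MeasurableSpace Ω' := (⨆ q, M.branchSigma q) ⊔
    (M.rhoSigma ⊔ ((⨆ j ∈ ({i}ᶜ : Set ℕ), M.motionSigma j) ⊔ incrSigma (M.Xp i) s))

/-- Everything except the increments of `Xp i` after time `s`. -/
@[reducible] def driverSigma (i : ℕ) (s : ℝ≥0) : MeasurableSpace (Ω × Ω') :=
  comap Prod.fst inferInstance ⊔ comap Prod.snd (M.pastSigma i s)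

/-- Everything except the uniform variable `U i k`. -/
@[reducible] def butOneSigma (i k : ℕ) : MeasurableSpace (Ω × Ω') := comap Prod.fst inferInstance ⊔
    comap Prod.snd ((M.rhoSigma ⊔ ⨆ j, M.motionSigma j) ⊔
      ⨆ p ∈ ({(i, k)}ᶜ : Set (ℕ × ℕ)), M.branchSigma p)

lemma motions_le (I : Set ℕ) : (⨆ j ∈ I, M.motionSigma j) ≤ (inferInstance : MeasurableSpace Ω') :=
  iSup₂_le fun j _ => M.motionSigma_le j

lemma measurable_motion (i : ℕ) (t : ℝ≥0) : Measurable[M.motionSigma i] (M.Xp i t) :=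
  (comap_measurable _).mono (le_iSup (fun t => comap (M.Xp i t) inferInstance) t) le_rfl

lemma incrSigma_le_motion (i : ℕ) (s : ℝ≥0) : incrSigma (M.Xp i) s ≤ M.motionSigma i :=
  iSup₂_le fun u _ => ((M.measurable_motion i u).sub (M.measurable_motion i 0)).comap_le

lemma pastSigma_le (i : ℕ) (s : ℝ≥0) : M.pastSigma i s ≤ (inferInstance : MeasurableSpace Ω') :=
  sup_le (iSup_le M.branchSigma_le) (sup_le M.rhoSigma_le (sup_le (M.motions_le _)
    ((M.stableXp i).incrSigma_le s)))

lemma driverSigma_le (i : ℕ) (s : ℝ≥0) : M.driverSigma i s ≤ Prod.instMeasurableSpace :=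
  sup_le measurable_fst.comap_le ((comap_mono (M.pastSigma_le i s)).trans measurable_snd.comap_le)

lemma driverSigma_mono (i : ℕ) : Monotone (M.driverSigma i) := fun _ _ h =>
  sup_le_sup_left (comap_mono (sup_le_sup_left (sup_le_sup_left
    (sup_le_sup_left (incrSigma_mono _ h) _) _) _)) _

lemma indep_pastSigma (i : ℕ) {s t : ℝ≥0} (hst : s ≤ t) : Indep (M.pastSigma i s)
    (comap (fun w => M.Xp i t w - M.Xp i s w) inferInstance) M.P' := by
  have hc : comap (fun w => M.Xp i t w - M.Xp i s w) inferInstance ≤ M.motionSigma i :=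
    ((M.measurable_motion i t).sub (M.measurable_motion i s)).comap_le
  have hc' := hc.trans (M.motionSigma_le i)
  have hall : M.motionSigma i ≤ ⨆ j, M.motionSigma j := le_iSup _ i
  have hoth : (⨆ j ∈ ({i}ᶜ : Set ℕ), M.motionSigma j) ≤ ⨆ j, M.motionSigma j :=
    iSup₂_le fun j _ => le_iSup _ j
  have h1 := Indep.sup_left_of_indep (M.motions_le {i}ᶜ) ((M.stableXp i).incrSigma_le s) hc'
    (indep_of_indep_of_le_right (M.indep_motion_others i) (sup_le (M.incrSigma_le_motion i s) hc))
    ((M.stableXp i).indep_incrSigma hst)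
  have hle1 : (⨆ j ∈ ({i}ᶜ : Set ℕ), M.motionSigma j) ⊔ incrSigma (M.Xp i) s
      ≤ ⨆ j, M.motionSigma j := sup_le hoth ((M.incrSigma_le_motion i s).trans hall)
  have hle1' := hle1.trans (iSup_le M.motionSigma_le)
  have h2 := Indep.sup_left_of_indep M.rhoSigma_le hle1' hc'
    (indep_of_indep_of_le_right M.indep_rho_motion (sup_le hle1 (hc.trans hall))) h1
  refine Indep.sup_left_of_indep (iSup_le M.branchSigma_le) (sup_le M.rhoSigma_le hle1') hc'
    (indep_of_indep_of_le_right M.indep_rho_motion_branch.symm ?_) h2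
  exact sup_le (sup_le_sup_left hle1 _) ((hc.trans hall).trans le_sup_right)

/-- The laws of the increments of the signal. -/
def incrLaw (t : ℝ≥0) : Measure (Vec d₁) := M.P.map (fun w => M.X t w - M.X 0 w)

lemma isStableFamily : IsStableFamily M.α M.Γ M.incrLaw := M.stableX.isStableFamily

lemma measurable_driver_of_past (i : ℕ) (s : ℝ≥0) {E : Type*} [MeasurableSpace E] {f : Ω' → E}
  (hf : Measurable[M.pastSigma i s] f) : Measurable[M.driverSigma i s] fun w => f w.2 := by
  have h : Measurable[comap (Prod.snd : Ω × Ω' → Ω') (M.pastSigma i s)]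
      fun w => f w.2 := hf.comp (comap_measurable _)
  exact h.mono le_sup_right le_rfl

lemma measurable_past_incr (i : ℕ) {u v s : ℝ≥0} (hu : u ≤ s) (hv : v ≤ s) :
  Measurable[M.pastSigma i s] fun w => M.Xp i v w - M.Xp i u w := by
  have h1 : Measurable[incrSigma (M.Xp i) s] fun w => M.Xp i v w - M.Xp i u w := by
    have h2 := (measurable_incrSigma (M.Xp i) hv).sub (measurable_incrSigma (M.Xp i) hu)
    have e : (fun w => M.Xp i v w - M.Xp i u w)
        = fun w => M.Xp i v w - M.Xp i 0 w - (M.Xp i u w - M.Xp i 0 w) := by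
      abel
    rw [e]
    exact h2
  exact h1.mono (le_sup_of_le_right (le_sup_of_le_right le_sup_right)) le_rfl

lemma isDriver (i : ℕ) : IsDriver M.Phat (M.driverSigma i) M.incrLaw (fun t w => M.Xp i t w.2) where
  mono := M.driverSigma_mono i
  le := M.driverSigma_le i
  adapted s t hst := M.measurable_driver_of_past i t (M.measurable_past_incr i hst le_rfl)
  cadlag w := (M.stableXp i).cadlag w.2
  indep s t hst := by
    have hm : Measurable fun w => M.Xp i t w - M.Xp i s w :=
      ((M.stableXp i).measurable t).sub ((M.stableXp i).measurable s)
    have h1 := Indep.fst_sup_snd (P := M.P) (M.pastSigma_le i s) hm.comap_le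
      (M.indep_pastSigma i hst)
    rw [comap_comp] at h1
    exact h1
  law s t hst := by
    have hm : Measurable fun w => M.Xp i t w - M.Xp i s w :=
      ((M.stableXp i).measurable t).sub ((M.stableXp i).measurable s)
    have h1 : M.Phat.map (fun w => M.Xp i t w.2 - M.Xp i s w.2)
        = (M.Phat.map Prod.snd).map (fun w => M.Xp i t w - M.Xp i s w) := by
      rw [Measure.map_map hm measurable_snd]
      rfl
    rw [h1, Phat, Measure.map_snd_prod, measure_univ, one_smul]
    exact M.isStableFamily.map_sub (M.stableXp i) hst

lemma indep_butOne (i k : ℕ) : Indep (M.butOneSigma i k)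
  (comap (fun w => M.U i k w.2) inferInstance) M.Phat := by
  have hrm : M.rhoSigma ⊔ ⨆ j, M.motionSigma j ≤ (inferInstance : MeasurableSpace Ω') :=
    sup_le M.rhoSigma_le (iSup_le M.motionSigma_le)
  have hoth : (⨆ p ∈ ({(i, k)}ᶜ : Set (ℕ × ℕ)), M.branchSigma p)
      ≤ (inferInstance : MeasurableSpace Ω') := iSup₂_le fun p _ => M.branchSigma_le p
  have h1 := Indep.sup_left_of_indep hrm hoth (M.branchSigma_le (i, k))
    (indep_of_indep_of_le_right M.indep_rho_motion_branch
      (sup_le (iSup₂_le fun p _ => le_iSup _ p) (le_iSup M.branchSigma (i, k))))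
    (M.indep_branch_others (i, k))
  have h2 := Indep.fst_sup_snd (P := M.P) (sup_le hrm hoth) (M.branchSigma_le (i, k)) h1
  rw [comap_comp] at h2
  exact h2

end FilterModel

/-! ### Measurability of the particle system with respect to partial information -/

lemma measurable_leftLim_sub {d : ℕ} {S : Type*} [MeasurableSpace S] {Z : ℝ≥0 → S → Vec d}
  {c : S → Vec d} {a t : ℝ≥0} (hat : a < t)
  (hZ : ∀ u, a < u → u < t → Measurable fun w => Z u w - c w)
  (hc : ∀ w, IsCadlag (fun t => Z t w)) :
  Measurable (fun w => Function.leftLim (fun s => Z s w) t - c w) := by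
  obtain ⟨u, -, hu, hlim⟩ := exists_seq_strictMono_tendsto' hat
  have hu' : Tendsto u atTop (𝓝[<] t) :=
    tendsto_nhdsWithin_iff.2 ⟨hlim, .of_forall fun n => (hu n).2⟩
  have : (𝓝[<] t).NeBot := hu'.neBot
  refine measurable_of_tendsto_metrizable (f := fun n w => Z (u n) w - c w)
    (fun n => hZ (u n) (hu n).1 (hu n).2) ?_
  rw [tendsto_pi_nhds]
  intro w
  obtain ⟨l, hl⟩ := (hc w t).2
  rw [leftLim_eq_of_tendsto hl]
  exact (hl.comp hu').sub_const _

namespace FilterModel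

variable (M)

lemma tk_mono : Monotone M.tk := fun _ _ h => mul_le_mul_left (by exact_mod_cast h) _

lemma tk_strictMono : StrictMono M.tk := fun _ _ h =>
  mul_lt_mul_of_pos_right (by exact_mod_cast h) M.ε_pos

lemma tk_zero : M.tk 0 = 0 := by simp [tk]

lemma tk_floor_le (t : ℝ≥0) : M.tk ⌊t / M.ε⌋₊ ≤ t := by
  have h := Nat.floor_le (zero_le : 0 ≤ t / M.ε)
  rwa [le_div_iff₀ M.ε_pos] at h

lemma lt_tk_floor_succ (t : ℝ≥0) : t < M.tk (⌊t / M.ε⌋₊ + 1) := by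
  have h := Nat.lt_floor_add_one (t / M.ε)
  rw [div_lt_iff₀ M.ε_pos] at h
  unfold tk
  push_cast
  exact h

lemma le_floor_iff (k : ℕ) (t : ℝ≥0) : k ≤ ⌊t / M.ε⌋₊ ↔ M.tk k ≤ t := by
  rw [Nat.le_floor_iff zero_le, le_div_iff₀ M.ε_pos, tk]

lemma floor_eq {k : ℕ} {t : ℝ≥0} (h1 : M.tk k ≤ t) (h2 : t < M.tk (k + 1)) : ⌊t / M.ε⌋₊ = k := by
  refine le_antisymm ?_ ((M.le_floor_iff k t).2 h1)
  by_contra h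
  exact absurd ((M.le_floor_iff (k + 1) t).1 (not_le.1 h)) (not_le.2 h2)

lemma floor_tk (k : ℕ) : ⌊M.tk k / M.ε⌋₊ = k := M.floor_eq le_rfl (M.tk_strictMono k.lt_succ_self)

lemma measurable_weight_comp {S : Type*} [MeasurableSpace S] (k : ℕ) {x : S → Vec d₁} {w : S → Ω}
  (hx : Measurable x) (hY : ∀ j ≤ k, Measurable fun s => M.Y j (w s)) :
  Measurable (fun s => M.weight k (x s) (w s)) := by
  have h1 : Measurable fun s => M.h (x s) := M.h.continuous.measurable.comp hx
  have h2 : Measurable fun s => M.Y k (w s) - M.Y (k - 1) (w s) :=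
    (hY k le_rfl).sub (hY (k - 1) (Nat.sub_le _ _))
  exact ((measurable_exp.comp ((h2.inner h1).sub
    (((h1.inner h1).const_mul _).div_const 2))).sub_const 1)

lemma measurable_offspring_comp {S : Type*} [MeasurableSpace S] (k i : ℕ) {x : S → Vec d₁}
  {w : S → Ω × Ω'} (hx : Measurable x) (hY : ∀ j ≤ k, Measurable fun s => M.Y j (w s).1)
  (hU : Measurable fun s => M.U i k (w s).2) :
  Measurable fun s => M.offspring k i (x s) (w s) := by
  have hw := M.measurable_weight_comp k (w := fun s => (w s).1) hx hY
  have hfl : Measurable fun s => ((⌊M.weight k (x s) (w s).1⌋ : ℤ) : ℝ) :=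
    (measurable_from_top (f := fun z : ℤ => (z : ℝ))).comp (Int.measurable_floor.comp hw)
  refine .ite (measurableSet_le measurable_const hw) ?_ ?_
  · exact ((Nat.measurable_floor.comp hw).add_const 1).add
      (.ite (measurableSet_le hU (hw.sub hfl)) measurable_const measurable_const)
  · exact .ite (measurableSet_lt hw.abs hU) measurable_const measurable_const

/-- The σ-algebra `m` contains the first `k` observations, the initial positions, the increments of
the motions up to time `τ` and the uniform variables of the first `k` observation times. -/
structure Informed (m : MeasurableSpace (Ω × Ω')) (τ : ℝ≥0) (k : ℕ) : Prop where
  obs : ∀ j ≤ k, Measurable[m] fun w => M.Y j w.1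
  rho : ∀ i, Measurable[m] fun w => M.ρ i w.2
  incr : ∀ i u v, u ≤ τ → v ≤ τ → Measurable[m] fun w => M.Xp i u w.2 - M.Xp i v w.2
  unif : ∀ i j, 1 ≤ j → j ≤ k → Measurable[m] fun w => M.U i j w.2

namespace Informed

variable {M} {m : MeasurableSpace (Ω × Ω')} {τ : ℝ≥0} {k : ℕ}

lemma measurable_leftIncr (h : M.Informed m τ k) {l : ℕ} (hl : M.tk (l + 1) ≤ τ) (i : ℕ) :
  Measurable[m] fun w =>
    Function.leftLim (fun t => M.Xp i t w.2) (M.tk (l + 1)) - M.Xp i (M.tk l) w.2 := by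
  refine @measurable_leftLim_sub _ _ m (fun t w => M.Xp i t w.2) (fun w => M.Xp i (M.tk l) w.2)
    (M.tk l) _ (M.tk_strictMono l.lt_succ_self) (fun u _ hu => ?_)
    (fun w => (M.stableXp i).cadlag w.2)
  exact h.incr i u (M.tk l) (hu.le.trans hl) ((M.tk_mono l.le_succ).trans hl)

lemma measurableList_gen (h : M.Informed m τ k) : ∀ {l : ℕ}, l ≤ k → M.tk l ≤ τ →
  @MeasurableList d₁ _ m (M.gen l) := by
  intro l
  induction l with
  | zero =>
    intro _ _
    refine ⟨by simp [gen], fun i => ?_⟩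
    by_cases hi : i < M.n
    · have : (fun w => (M.gen 0 w).getD i 0) = fun w => M.ρ ⟨i, hi⟩ w.2 := by
        simp [gen, List.getD_eq_getElem?_getD, hi]
      rw [this]
      exact h.rho _
    · have : (fun w => (M.gen 0 w).getD i 0) = fun _ => 0 := by
        simp [gen, List.getD_eq_getElem?_getD, hi]
      rw [this]
      exact measurable_const
  | succ l ih =>
    intro hlk hlτ
    have ih' := ih (l.le_succ.trans hlk) ((M.tk_mono l.le_succ).trans hlτ)
    have hl : ∀ i, Measurable[m] fun w => M.evolveLeft l (M.gen l w) i w := fun i =>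
      (ih'.2 i).add (h.measurable_leftIncr hlτ i)
    exact @MeasurableList.flatMap_range _ _ m _ _ ih'.1 fun i =>
      @MeasurableList.replicate _ _ m _ _ (@measurable_offspring_comp _ _ _ _ _ _ M _ m (l + 1) i _
        (fun w => w) (hl i) (fun j hj => h.obs j (hj.trans hlk)) (h.unif i (l + 1) (by omega) hlk)) (hl i)

lemma measurable_evolveLeft (h : M.Informed m τ k) {l : ℕ} (hlk : l ≤ k)
  (hlτ : M.tk (l + 1) ≤ τ) (i : ℕ) :
  Measurable[m] fun w => M.evolveLeft l (M.gen l w) i w :=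
  ((h.measurableList_gen hlk ((M.tk_mono l.le_succ).trans hlτ)).2 i).add
    (h.measurable_leftIncr hlτ i)

lemma measurableList_particles (h : M.Informed m τ k) {u : ℝ≥0} (huτ : u ≤ τ)
  (huk : u < M.tk (k + 1)) : @MeasurableList d₁ _ m (M.particles u) := by
  have h1 : ⌊u / M.ε⌋₊ ≤ k := by
    by_contra hc
    exact absurd ((M.le_floor_iff (k + 1) u).1 (not_le.1 hc)) (not_le.2 huk)
  have h2 := h.measurableList_gen h1 ((M.tk_floor_le u).trans huτ)
  exact @MeasurableList.map_range _ _ m _ _ h2.1 fun i =>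
    (h2.2 i).add (h.incr i u _ huτ ((M.tk_floor_le u).trans huτ))

lemma filtG_le (h : M.Informed m τ k) (hf : Measurable[m] (Prod.fst : Ω × Ω' → Ω)) (T : ℝ≥0) {s : ℝ≥0} (hsτ : s < τ)
  (hsk : s < M.tk (k + 1)) : M.filtG T s ≤ m := by
  obtain ⟨r, hr1, hr2⟩ := exists_between (lt_min hsτ hsk)
  refine (iInf₂_le (r - s) (tsub_pos_of_lt hr1)).trans (sup_le (sup_le ?_ ?_) ?_)
  · refine iSup₂_le fun u hu => ?_
    rw [add_tsub_cancel_of_le hr1.le] at hu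
    have h1 := h.measurableList_particles (hu.trans (hr2.le.trans (min_le_left _ _)))
      (hu.trans_lt (hr2.trans_le (min_le_right _ _)))
    exact sup_le h1.1.comap_le (iSup_le fun i => (h1.2 i).comap_le)
  · exact (comap_mono (M.obsSigma_le _)).trans hf.comap_le
  · refine iSup_le fun i => iSup₂_le fun j hj => (h.unif i j hj.1 ?_).comap_le
    by_contra hc
    exact absurd ((M.tk_mono (not_le.1 hc)).trans hj.2) (not_le.2 hsk)

end Informed

lemma measurable_fst_driverSigma (i : ℕ) (s : ℝ≥0) :
  Measurable[M.driverSigma i s] (Prod.fst : Ω × Ω' → Ω) :=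
  (comap_measurable (Prod.fst : Ω × Ω' → Ω)).mono le_sup_left le_rfl

lemma measurable_fst_exceptU (k : ℕ) : Measurable[M.exceptU k] (Prod.fst : Ω × Ω' → Ω) :=
  (comap_measurable (Prod.fst : Ω × Ω' → Ω)).mono
    (le_sup_of_le_left (le_sup_of_le_left le_sup_left)) le_rfl

lemma informed_driverSigma (i : ℕ) (s : ℝ≥0) (k : ℕ) : M.Informed (M.driverSigma i s) s k where
  obs j _ := (M.measurable_Y j).comp (M.measurable_fst_driverSigma i s)
  rho j := M.measurable_driver_of_past i s ((comap_measurable _).mono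
    (le_sup_of_le_right (le_sup_of_le_left
      (le_iSup (fun j => comap (M.ρ j) inferInstance) j))) le_rfl)
  incr j u v hu hv := by
    refine M.measurable_driver_of_past i s (f := fun w => M.Xp j u w - M.Xp j v w) ?_
    by_cases hj : j = i
    · subst hj
      exact M.measurable_past_incr j hv hu
    · refine ((M.measurable_motion j u).sub (M.measurable_motion j v)).mono ?_ le_rfl
      exact le_sup_of_le_right (le_sup_of_le_right (le_sup_of_le_left
        (le_iSup₂_of_le (f := fun j (_ : j ∈ ({i}ᶜ : Set ℕ)) => M.motionSigma j) j hj le_rfl)))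
  unif j l _ _ := M.measurable_driver_of_past i s ((comap_measurable _).mono
    (le_sup_of_le_left (le_iSup M.branchSigma (j, l))) le_rfl)

lemma measurable_exceptU_motion (k i : ℕ) (t : ℝ≥0) :
  Measurable[M.exceptU k] fun w : Ω × Ω' => M.Xp i t w.2 :=
  (comap_measurable _).mono (le_sup_of_le_left (le_sup_of_le_right
    (le_iSup₂ (f := fun i t => comap (fun w : Ω × Ω' => M.Xp i t w.2) inferInstance) i t))) le_rfl

lemma informed_exceptU (τ : ℝ≥0) (k : ℕ) : M.Informed (M.exceptU (k + 1)) τ k where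
  obs j _ := (M.measurable_Y j).comp (M.measurable_fst_exceptU (k + 1))
  rho j := (comap_measurable _).mono (le_sup_of_le_left (le_sup_of_le_left (le_sup_of_le_right
      (le_iSup (fun j => comap (fun w : Ω × Ω' => M.ρ j w.2) inferInstance) j))))
    le_rfl
  incr j u v _ _ := (M.measurable_exceptU_motion _ j u).sub (M.measurable_exceptU_motion _ j v)
  unif j l _ hl := (comap_measurable _).mono (le_sup_of_le_right
    (le_iSup₂_of_le j l (le_iSup_of_le (Nat.lt_succ_of_le hl) le_rfl))) le_rfl

lemma exceptU_le_butOne (i k : ℕ) : M.exceptU k ≤ M.butOneSigma i k := by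
  have hs : ∀ (E : Type) (_ : MeasurableSpace E) (f : Ω' → E),
      comap f inferInstance ≤ (M.rhoSigma ⊔ ⨆ j, M.motionSigma j) ⊔
      ⨆ p ∈ ({(i, k)}ᶜ : Set (ℕ × ℕ)), M.branchSigma p →
      comap (fun w => f w.2) inferInstance ≤ M.butOneSigma i k := by
    intro E _ f hm
    refine le_sup_of_le_right ?_
    rw [show (fun w => f w.2) = f ∘ Prod.snd from rfl, ← comap_comp]
    exact comap_mono hm
  refine sup_le (sup_le (sup_le le_sup_left ?_) ?_) ?_
  · exact iSup_le fun j => hs _ _ (M.ρ j) (le_sup_of_le_left (le_sup_of_le_left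
      (le_iSup (fun j => comap (M.ρ j) inferInstance) j)))
  · exact iSup₂_le fun j t => hs _ _ (M.Xp j t) ((M.measurable_motion j t).comap_le.trans
      (le_sup_of_le_left (le_sup_of_le_right (le_iSup M.motionSigma j))))
  · refine iSup₂_le fun j l => iSup_le fun hl => hs _ _ (M.U j l) (le_sup_of_le_right ?_)
    refine le_iSup₂_of_le (f := fun p (_ : p ∈ ({(i, k)}ᶜ : Set (ℕ × ℕ))) => M.branchSigma p)
      (j, l) ?_ le_rfl
    grind

lemma exceptU_le (k : ℕ) : M.exceptU k ≤ Prod.instMeasurableSpace := by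
  refine (M.exceptU_le_butOne 0 k).trans (sup_le measurable_fst.comap_le ?_)
  refine (MeasurableSpace.comap_mono ?_).trans measurable_snd.comap_le
  exact sup_le (sup_le M.rhoSigma_le (iSup_le M.motionSigma_le))
    (iSup₂_le fun p _ => M.branchSigma_le p)

lemma exceptU_mono {k l : ℕ} (h : k ≤ l) : M.exceptU k ≤ M.exceptU l := by
  refine sup_le_sup le_rfl (iSup₂_le fun i j => iSup_le fun hj => ?_)
  exact le_iSup₂_of_le (f := fun i j => ⨆ (_ : j < l),
    comap (fun w : Ω × Ω' => M.U i j w.2) inferInstance) i j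
    (le_iSup_of_le (hj.trans_le h) le_rfl)

end FilterModel

/-! ### Moments of sums of martingale differences -/

/-- The constant in the expansion of `|a + b| ^ p`. -/
def expandConst (p : ℝ) : ℝ := p ^ 2 * exp p + 2 ^ p + p + 1

lemma one_le_expandConst {p : ℝ} (hp : 2 ≤ p) : 1 ≤ expandConst p := by
  unfold expandConst
  have : 0 ≤ p ^ 2 * exp p := by positivity
  have : (0 : ℝ) ≤ 2 ^ p := by positivity
  linarith

lemma abs_one_add_rpow_le {p : ℝ} (hp : 2 ≤ p) {t : ℝ} (ht : |t| < 1) :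
  |1 + t| ^ p ≤ 1 + p * t + p ^ 2 * exp p * t ^ 2 := by
  obtain ⟨h1, h2⟩ := abs_lt.1 ht
  have h3 : |1 + t| ^ p ≤ exp (p * t) := by
    rw [abs_of_pos (by linarith), mul_comm, Real.exp_mul]
    refine rpow_le_rpow (by linarith) ?_ (by linarith)
    have := Real.add_one_le_exp t
    linarith
  have h4 := Complex.norm_exp_sub_sum_le_norm_mul_exp ((p * t : ℝ) : ℂ) 2
  rw [sum_range_succ, Finset.sum_range_one] at h4
  have h5 : Complex.exp ((p * t : ℝ) : ℂ) - ((((p * t : ℝ) : ℂ) ^ 0 / ((Nat.factorial 0 : ℕ) : ℂ))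
      + ((p * t : ℝ) : ℂ) ^ 1 / ((Nat.factorial 1 : ℕ) : ℂ))
      = ((exp (p * t) - (1 + p * t) : ℝ) : ℂ) := by
    simp
  rw [h5, Complex.norm_real, Complex.norm_real, norm_eq_abs, norm_eq_abs] at h4
  have h6 : |p * t| ≤ p := by
    rw [abs_mul, abs_of_nonneg (by linarith : (0 : ℝ) ≤ p)]
    nlinarith
  have h7 : |p * t| ^ 2 * exp |p * t| ≤ p ^ 2 * exp p * t ^ 2 := by
    rw [sq_abs, mul_pow]
    have := exp_le_exp.2 h6
    nlinarith [mul_nonneg (sq_nonneg p) (sq_nonneg t), exp_pos p]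
  grind

lemma abs_add_rpow_le {p : ℝ} (hp : 2 ≤ p) (a b : ℝ) :
  |a + b| ^ p ≤ |a| ^ p + p * (|a| ^ (p - 2) * a * b)
    + expandConst p * (|a| ^ (p - 2) * b ^ 2 + |b| ^ p) := by
  have hp0 : 0 ≤ p := by linarith
  rcases lt_or_ge |b| |a| with h | h
  · have ha : 0 < |a| := (abs_nonneg b).trans_lt h
    have ha0 : a ≠ 0 := abs_pos.1 ha
    have h1 := abs_one_add_rpow_le hp (t := b / a) (by rw [abs_div, div_lt_one ha]; exact h)
    have e1 : |a + b| ^ p = |a| ^ p * |1 + b / a| ^ p := by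
      rw [← mul_rpow (abs_nonneg _) (abs_nonneg _), ← abs_mul]
      congr 2
      field_simp
    have e2 : |a| ^ p = |a| ^ (p - 2) * a ^ 2 := by
      rw [← sq_abs, ← rpow_natCast, ← rpow_add ha]
      norm_num
    have h2 := mul_le_mul_of_nonneg_left h1 (rpow_nonneg (abs_nonneg a) p)
    rw [← e1] at h2
    have e3 : |a| ^ p * (1 + p * (b / a) + p ^ 2 * exp p * (b / a) ^ 2)
        = |a| ^ p + p * (|a| ^ (p - 2) * a * b) + p ^ 2 * exp p * (|a| ^ (p - 2) * b ^ 2) := by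
      rw [e2]
      field_simp
    rw [e3] at h2
    have h3 : p ^ 2 * exp p * (|a| ^ (p - 2) * b ^ 2)
        ≤ expandConst p * (|a| ^ (p - 2) * b ^ 2) := by
      refine mul_le_mul_of_nonneg_right ?_ (by positivity)
      unfold expandConst
      have : (0 : ℝ) ≤ 2 ^ p := by positivity
      linarith
    have h4 : 0 ≤ expandConst p * |b| ^ p :=
      mul_nonneg (by linarith [one_le_expandConst hp]) (by positivity)
    linarith
  · have h1 : |a + b| ^ p ≤ 2 ^ p * |b| ^ p := by
      rw [← mul_rpow (by norm_num) (abs_nonneg _)]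
      exact rpow_le_rpow (abs_nonneg _) ((abs_add_le a b).trans (by linarith)) hp0
    have h2 : |(|a| ^ (p - 2) * a * b)| ≤ |b| ^ p := by
      rcases eq_or_ne b 0 with rfl | hb
      · simp [zero_rpow (show p ≠ 0 by linarith)]
      · have hb' : 0 < |b| := abs_pos.2 hb
        have e2 : |b| ^ p = |b| ^ (p - 2) * |b| * |b| := by
          rw [mul_assoc, ← sq, ← rpow_natCast, ← rpow_add hb']
          norm_num
        rw [e2, abs_mul, abs_mul, abs_of_nonneg (by positivity : 0 ≤ |a| ^ (p - 2))]
        gcongr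
    have h3 := (abs_le.1 h2).1
    have h4 : 0 ≤ |a| ^ p := by positivity
    have h5 : 0 ≤ expandConst p * (|a| ^ (p - 2) * b ^ 2) :=
      mul_nonneg (by linarith [one_le_expandConst hp]) (by positivity)
    have h6 : (2 ^ p + p) * |b| ^ p ≤ expandConst p * |b| ^ p := by
      refine mul_le_mul_of_nonneg_right ?_ (by positivity)
      unfold expandConst
      have : 0 ≤ p ^ 2 * exp p := by positivity
      linarith
    nlinarith

lemma rpow_add_mul_le {p : ℝ} (hp : 2 ≤ p) {s δ c : ℝ} (hs : 0 ≤ s) (hδ : 0 ≤ δ) (hc : 1 ≤ c) :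
  s ^ p + c * (s ^ (p - 2) * δ ^ (2 : ℝ) + δ ^ p)
    ≤ (s ^ (2 : ℝ) + 2 * c * δ ^ (2 : ℝ)) ^ (p / 2) := by
  have hq : 1 ≤ p / 2 := by linarith
  set A := s ^ (2 : ℝ) with hA
  set B := 2 * c * δ ^ (2 : ℝ) with hB
  have hA0 : 0 ≤ A := by positivity
  have hB0 : 0 ≤ B := by positivity
  have e1 : s ^ p = A ^ (p / 2) := by
    rw [hA, ← rpow_mul hs]
    ring
  have h1 : A ^ (p / 2) + B ^ (p / 2) ≤ (A + B) ^ (p / 2) := Real.add_rpow_le_rpow_add hA0 hB0 hq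
  have h2 : A ^ (p / 2) + A ^ (p / 2 - 1) * B ≤ (A + B) ^ (p / 2) := by
    rcases hA0.eq_or_lt with h0 | h0
    · rw [← h0, zero_add, zero_rpow (by linarith), zero_add]
      rcases hq.eq_or_lt with h | h
      · rw [← h]
        simp
      · rw [zero_rpow (by linarith), zero_mul]
        positivity
    · have h3 := one_add_mul_self_le_rpow_one_add (s := B / A) (by linarith [div_nonneg hB0 hA0]) hq
      have e2 : (A + B) ^ (p / 2) = A ^ (p / 2) * (1 + B / A) ^ (p / 2) := by
        rw [← mul_rpow hA0 (by positivity)]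
        field_simp
      have e3 : A ^ (p / 2 - 1) * B = A ^ (p / 2) * (B / A) := by
        rw [Real.rpow_sub h0, rpow_one]
        field_simp
      have h4 : 1 + B / A ≤ (1 + B / A) ^ (p / 2) := by
        have := div_nonneg hB0 hA0
        nlinarith
      nlinarith [rpow_nonneg hA0 (p / 2)]
  have h3 : c * δ ^ p ≤ B ^ (p / 2) / 2 := by
    have e2 : B ^ (p / 2) = (2 * c) ^ (p / 2) * δ ^ p := by
      rw [hB, mul_rpow (by positivity) (by positivity), ← rpow_mul hδ]
      ring
    have h4 : 2 * c ≤ (2 * c) ^ (p / 2) := by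
      conv_lhs => rw [← rpow_one (2 * c)]
      exact rpow_le_rpow_of_exponent_le (by linarith) hq
    have h5 : 0 ≤ δ ^ p := by positivity
    nlinarith
  have h4 : c * (s ^ (p - 2) * δ ^ (2 : ℝ)) = A ^ (p / 2 - 1) * B / 2 := by
    have e2 : s ^ (p - 2) = A ^ (p / 2 - 1) := by
      rw [hA, ← rpow_mul hs]
      ring
    rw [e2, hB]
    ring
  linarith

section Rio

variable {S : Type*} [m0 : MeasurableSpace S] {P : Measure S} [IsProbabilityMeasure P]

lemma BddMeas.abs_rpow {f : S → ℝ} {m : MeasurableSpace S} (hf : BddMeas m f) {p : ℝ}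
  (hp : 0 ≤ p) : BddMeas m (fun w => |f w| ^ p) := by
  obtain ⟨C, hC⟩ := hf.2
  refine ⟨hf.abs.1.pow_const p, C ^ p, fun w => ?_⟩
  rw [abs_of_nonneg (by positivity)]
  exact rpow_le_rpow (abs_nonneg _) (hC w) hp

lemma integral_abs_rpow_mul_sq_le {p : ℝ} (hp : 2 ≤ p) {f g : S → ℝ} (hf : BddMeas m0 f)
  (hg : BddMeas m0 g) :
  ∫ w, |f w| ^ (p - 2) * g w ^ 2 ∂P
    ≤ ((∫ w, |f w| ^ p ∂P) ^ (1 / p)) ^ (p - 2) * ((∫ w, |g w| ^ p ∂P) ^ (1 / p)) ^ (2 : ℝ) := by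
  have hI : 0 ≤ ∫ w, |f w| ^ p ∂P := integral_nonneg fun w => by positivity
  have hJ : 0 ≤ ∫ w, |g w| ^ p ∂P := integral_nonneg fun w => by positivity
  rw [← rpow_mul hI, ← rpow_mul hJ]
  rcases hp.eq_or_lt with rfl | hp'
  · simp
  · have hp0 : 0 < p := by linarith
    have hconj : (p / (p - 2)).HolderConjugate (p / 2) := by
      rw [Real.holderConjugate_iff]
      refine ⟨?_, ?_⟩
      · rw [lt_div_iff₀ (by linarith)]
        linarith
      · field_simp
        ring
    have h1 := integral_mul_le_Lp_mul_Lq_of_nonneg (μ := P) hconj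
      (f := fun w => |f w| ^ (p - 2)) (g := fun w => g w ^ 2)
      (.of_forall fun w => rpow_nonneg (abs_nonneg _) _)
      (.of_forall fun w => sq_nonneg _) ?_ ?_
    · refine h1.trans (le_of_eq ?_)
      congr 1
      · have e1 : ∀ w, (|f w| ^ (p - 2)) ^ (p / (p - 2)) = |f w| ^ p := fun w => by
          rw [← rpow_mul (abs_nonneg _)]
          field_simp [show p - 2 ≠ 0 by linarith]
        simp only [e1]
        field_simp
      · have e1 : ∀ w, (g w ^ 2) ^ (p / 2) = |g w| ^ p := fun w => by
          rw [← sq_abs, ← rpow_natCast, ← rpow_mul (abs_nonneg _)]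
          ring
        simp only [e1]
        field_simp
    · obtain ⟨C, hC⟩ := (hf.abs_rpow (show 0 ≤ p - 2 by linarith)).2
      exact MemLp.of_bound (hf.abs_rpow (by linarith)).1.aestronglyMeasurable C (.of_forall hC)
    · obtain ⟨C, hC⟩ := (hg.pow 2).2
      exact MemLp.of_bound (hg.pow 2).1.aestronglyMeasurable C (.of_forall hC)

lemma integral_abs_sum_rpow_le {p : ℝ} (hp : 2 ≤ p) {u : ℕ → MeasurableSpace S}
  (hu : ∀ i, u i ≤ m0) (hmono : Monotone u) {D : ℕ → S → ℝ}
  (hD : ∀ i, BddMeas (u (i + 1)) (D i))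
  (ho : ∀ i g, BddMeas (u i) g → ∫ w, g w * D i w ∂P = 0) (m : ℕ) :
  ∫ w, |∑ i ∈ range m, D i w| ^ p ∂P
    ≤ (2 * expandConst p * ∑ i ∈ range m, (∫ w, |D i w| ^ p ∂P) ^ (2 / p)) ^ (p / 2) := by
  have hp0 : 0 < p := by linarith
  induction m with
  | zero => simp [zero_rpow hp0.ne', zero_rpow (show p / 2 ≠ 0 by linarith)]
  | succ m ih =>
    have hs : BddMeas (u m) (fun w => ∑ i ∈ range m, D i w) :=
      BddMeas.sum fun i hi => (hD i).mono (hmono (mem_range.1 hi))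
    have hs' := hs.mono (hu m)
    have hD' := (hD m).mono (hu _)
    set F : S → ℝ := fun w => ∑ i ∈ range m, D i w with hF
    set s := (∫ w, |F w| ^ p ∂P) ^ (1 / p) with hsdef
    set δ := (∫ w, |D m w| ^ p ∂P) ^ (1 / p) with hδdef
    have hI : 0 ≤ ∫ w, |F w| ^ p ∂P := integral_nonneg fun w => by positivity
    have hJ : 0 ≤ ∫ w, |D m w| ^ p ∂P := integral_nonneg fun w => by positivity
    have hs0 : 0 ≤ s := by positivity
    have hδ0 : 0 ≤ δ := by positivity
    have hsp : s ^ p = ∫ w, |F w| ^ p ∂P := by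
      rw [hsdef, ← rpow_mul hI, one_div_mul_cancel hp0.ne', rpow_one]
    have hδp : δ ^ p = ∫ w, |D m w| ^ p ∂P := by
      rw [hδdef, ← rpow_mul hJ, one_div_mul_cancel hp0.ne', rpow_one]
    have hδ2 : δ ^ (2 : ℝ) = (∫ w, |D m w| ^ p ∂P) ^ (2 / p) := by
      rw [hδdef, ← rpow_mul hJ]
      ring
    have hs2 : s ^ (2 : ℝ) ≤ 2 * expandConst p *
        ∑ i ∈ range m, (∫ w, |D i w| ^ p ∂P) ^ (2 / p) := by
      have h0 : 0 ≤ 2 * expandConst p * ∑ i ∈ range m, (∫ w, |D i w| ^ p ∂P) ^ (2 / p) := by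
        refine mul_nonneg (by linarith [one_le_expandConst hp]) (sum_nonneg fun i _ => ?_)
        positivity
      rw [hsdef, ← rpow_mul hI]
      refine (rpow_le_rpow hI ih (by positivity)).trans (le_of_eq ?_)
      rw [← rpow_mul h0, show p / 2 * (1 / p * 2) = 1 by field_simp, rpow_one]
    have hg : BddMeas (u m) (fun w => |F w| ^ (p - 2) * F w) := (hs.abs_rpow (by linarith)).mul hs
    have hpt : ∀ w, |∑ i ∈ range (m + 1), D i w| ^ p
        ≤ |F w| ^ p + p * (|F w| ^ (p - 2) * F w * D m w)
          + expandConst p * (|F w| ^ (p - 2) * D m w ^ 2 + |D m w| ^ p) := fun w => by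
      rw [sum_range_succ]
      exact abs_add_rpow_le hp _ _
    have i1 := (hs'.abs_rpow hp0.le).int (P := P)
    have i2 := ((hg.mono (hu m)).mul hD').int (P := P)
    have i3 := ((hs'.abs_rpow (show 0 ≤ p - 2 by linarith)).mul (hD'.pow 2)).int (P := P)
    have i4 := (hD'.abs_rpow hp0.le).int (P := P)
    have hsum : BddMeas m0 (fun w => ∑ i ∈ range (m + 1), D i w) :=
      BddMeas.sum fun i _ => (hD i).mono (hu _)
    calc ∫ w, |∑ i ∈ range (m + 1), D i w| ^ p ∂P
        ≤ ∫ w, (|F w| ^ p + p * (|F w| ^ (p - 2) * F w * D m w)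
          + expandConst p * (|F w| ^ (p - 2) * D m w ^ 2 + |D m w| ^ p)) ∂P :=
          integral_mono (hsum.abs_rpow hp0.le).int
            ((i1.add (i2.const_mul p)).add ((i3.add i4).const_mul _)) hpt
      _ = s ^ p + expandConst p * ((∫ w, |F w| ^ (p - 2) * D m w ^ 2 ∂P) + δ ^ p) := by
          have j1 : Integrable (fun w => |F w| ^ p + p * (|F w| ^ (p - 2) * F w * D m w)) P :=
            i1.add (i2.const_mul p)
          have j2 : Integrable
              (fun w => expandConst p * (|F w| ^ (p - 2) * D m w ^ 2 + |D m w| ^ p)) P :=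
            (i3.add i4).const_mul _
          rw [integral_add j1 j2, integral_add i1 (i2.const_mul p), integral_const_mul,
            integral_const_mul, integral_add i3 i4, ho m _ hg, hsp, hδp]
          ring
      _ ≤ s ^ p + expandConst p * (s ^ (p - 2) * δ ^ (2 : ℝ) + δ ^ p) := by
          have := integral_abs_rpow_mul_sq_le (P := P) hp hs' hD'
          have h1 := one_le_expandConst hp
          gcongr
      _ ≤ (s ^ (2 : ℝ) + 2 * expandConst p * δ ^ (2 : ℝ)) ^ (p / 2) :=
          rpow_add_mul_le hp hs0 hδ0 (one_le_expandConst hp)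
      _ ≤ _ := by
          refine rpow_le_rpow ?_ ?_ (by linarith)
          · have := one_le_expandConst hp
            positivity
          · rw [sum_range_succ, mul_add, hδ2]
            linarith

end Rio

/-! ### Empirical measures -/

lemma integral_empirical {d : ℕ} (n : ℕ) (f : Vec d → ℝ) (L : List (Vec d)) :
  ∫ x, f x ∂(empirical n L) = (n : ℝ)⁻¹ * (L.map f).sum := by
  have h : ∀ L : List (Vec d), Integrable f (L.map Measure.dirac).sum ∧
      ∫ x, f x ∂(L.map Measure.dirac).sum = (L.map f).sum := by
    intro L
    induction L with
    | nil => simp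
    | cons a L ih =>
      have ha : Integrable f (Measure.dirac a) := integrable_dirac (by simp)
      simp only [List.map_cons, List.sum_cons]
      exact ⟨ha.add_measure ih.1, by rw [integral_add_measure ha ih.1, ih.2, integral_dirac]⟩
  rw [empirical, integral_smul_measure, (h L).2]
  simp

lemma empirical_univ {d : ℕ} (n : ℕ) (L : List (Vec d)) :
  empirical n L univ = (n : ℝ≥0∞)⁻¹ * L.length := by
  have h : (L.map Measure.dirac).sum (univ : Set (Vec d)) = L.length := by
    induction L with
    | nil => simp
    | cons a L ih =>
      simp only [List.map_cons, List.sum_cons, Measure.add_apply, ih, List.length_cons]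
      simp [add_comm]
  rw [empirical, Measure.smul_apply, h, smul_eq_mul]

lemma list_sum_range (f : ℕ → ℝ) (m : ℕ) : ((List.range m).map f).sum = ∑ i ∈ range m, f i := by
  induction m with
  | zero => simp
  | succ m ih => simp [List.range_succ, sum_range_succ, ih]

/-! ### The branching innovations -/

/-- The centred indicator of `u ≤ y`, for `y` in the unit interval. -/
def centredInd (y u : ℝ) : ℝ := (if u ≤ y then 1 else 0) - max 0 (min y 1)

lemma abs_centredInd_le (y u : ℝ) : |centredInd y u| ≤ 1 := by
  unfold centredInd
  grind

lemma measurable_centredInd : Measurable (uncurry centredInd) := by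
  exact (Measurable.ite (measurableSet_le measurable_snd measurable_fst) measurable_const
    measurable_const).sub (measurable_const.max (measurable_fst.min measurable_const))

lemma integral_uniform_ind {y : ℝ} (h0 : 0 ≤ y) (h1 : y ≤ 1) :
  ∫ u in Icc (0 : ℝ) 1, (if u ≤ y then (1 : ℝ) else 0) = y := by
  have e : (fun u : ℝ => if u ≤ y then (1 : ℝ) else 0) = (Iic y).indicator fun _ => 1 := by
    ext u
    simp [indicator_apply]
  rw [e, setIntegral_indicator measurableSet_Iic, setIntegral_const]
  have : Icc (0 : ℝ) 1 ∩ Iic y = Icc 0 y := by grind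
  rw [this]
  simp [h0]

lemma integrable_uniform_ind (y : ℝ) :
  Integrable (fun u => if u ≤ y then (1 : ℝ) else 0) (volume.restrict (Icc (0 : ℝ) 1)) := by
  refine Integrable.of_bound (C := 1) (Measurable.ite measurableSet_Iic measurable_const
    measurable_const).aestronglyMeasurable (.of_forall fun u => ?_)
  split_ifs <;> simp

lemma integral_centredInd {y : ℝ} (h0 : 0 ≤ y) (h1 : y ≤ 1) :
  ∫ u in Icc (0 : ℝ) 1, centredInd y u = 0 := by
  simp only [centredInd, min_eq_left h1, max_eq_right h0]
  rw [integral_sub (integrable_uniform_ind y) (integrable_const _), integral_uniform_ind h0 h1]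
  simp

lemma integral_centredInd_sq {y : ℝ} (h0 : 0 ≤ y) (h1 : y ≤ 1) :
  ∫ u in Icc (0 : ℝ) 1, centredInd y u ^ 2 = y - y ^ 2 := by
  simp only [centredInd, min_eq_left h1, max_eq_right h0]
  have e : ∀ u : ℝ, ((if u ≤ y then (1 : ℝ) else 0) - y) ^ 2
      = (1 - 2 * y) * (if u ≤ y then (1 : ℝ) else 0) + y ^ 2 := fun u => by
    split_ifs <;> ring
  simp_rw [e]
  rw [integral_add ((integrable_uniform_ind y).const_mul _) (integrable_const _),
    integral_const_mul, integral_uniform_ind h0 h1]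
  simp
  ring

namespace FilterModel

variable (M)

lemma neg_one_lt_weight (k : ℕ) (x : Vec d₁) (w : Ω) : -1 < M.weight k x w := by
  unfold weight
  linarith [exp_pos (⟪M.Y k w - M.Y (k - 1) w, M.h x⟫
    - ((M.tk k : ℝ) - (M.tk (k - 1) : ℝ)) * ⟪M.h x, M.h x⟫ / 2)]

lemma abs_xi_of_nonneg {k : ℕ} {x : Vec d₁} {w : Ω} (h : 0 ≤ M.weight k x w) :
  |M.xi k x w| = Int.fract (M.weight k x w) := by
  rw [xi, if_neg (not_lt.2 h)]
  exact abs_of_nonneg (Int.fract_nonneg _)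

lemma abs_xi_of_neg {k : ℕ} {x : Vec d₁} {w : Ω} (h : M.weight k x w < 0) :
  |M.xi k x w| = -M.weight k x w := by
  rw [xi, if_pos h, abs_of_neg h]

lemma abs_xi_le_one (k : ℕ) (x : Vec d₁) (w : Ω) : |M.xi k x w| ≤ 1 := by
  rcases lt_or_ge (M.weight k x w) 0 with h | h
  · rw [M.abs_xi_of_neg h]
    linarith [M.neg_one_lt_weight k x w]
  · rw [M.abs_xi_of_nonneg h]
    exact (Int.fract_lt_one _).le

lemma abs_xi_le_abs_weight (k : ℕ) (x : Vec d₁) (w : Ω) : |M.xi k x w| ≤ |M.weight k x w| := by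
  rcases lt_or_ge (M.weight k x w) 0 with h | h
  · rw [M.abs_xi_of_neg h]
    exact neg_le_abs _
  · rw [M.abs_xi_of_nonneg h, abs_of_nonneg h, Int.fract]
    have : (0 : ℝ) ≤ ⌊M.weight k x w⌋ := by exact_mod_cast Int.floor_nonneg.2 h
    linarith

lemma measurable_xi {S : Type*} [MeasurableSpace S] (k : ℕ) {x : S → Vec d₁} {w : S → Ω}
  (hx : Measurable x) (hw : Measurable w) : Measurable (fun s => M.xi k (x s) (w s)) := by
  have h := M.measurable_weight k hx hw
  refine .ite (measurableSet_lt h measurable_const) h ?_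
  exact measurable_fract.comp h

/-- The number of particles after the branching at time `t_k`. -/
def len (k : ℕ) (w : Ω × Ω') : ℕ := (M.gen k w).length

/-- The position just before time `t_{k+1}` of the particle with label `i`. -/
def pos (k i : ℕ) (w : Ω × Ω') : Vec d₁ := M.evolveLeft k (M.gen k w) i w

/-- The deviation of the number of offspring of the particle with label `i` at time `t_{k+1}` from
its conditional mean. -/
def innov (k i : ℕ) (w : Ω × Ω') : ℝ :=
  (M.offspring (k + 1) i (M.pos k i w) w : ℝ) - 1 - M.weight (k + 1) (M.pos k i w) w.1

/-- The probability of the less likely branching event. -/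
def branchProb (k i : ℕ) (w : Ω × Ω') : ℝ := |M.xi (k + 1) (M.pos k i w) w.1|

/-- The sign of the branching weight. -/
def branchSign (k i : ℕ) (w : Ω × Ω') : ℝ :=
  if 0 ≤ M.weight (k + 1) (M.pos k i w) w.1 then 1 else -1

lemma branchProb_nonneg (k i : ℕ) (w : Ω × Ω') : 0 ≤ M.branchProb k i w := abs_nonneg _

lemma branchProb_le_one (k i : ℕ) (w) : M.branchProb k i w ≤ 1 := M.abs_xi_le_one _ _ _

lemma abs_branchSign (k i : ℕ) (w) : |M.branchSign k i w| = 1 := by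
  unfold branchSign
  split_ifs <;> simp

lemma innov_eq (k i : ℕ) (w) : M.innov k i w
  = M.branchSign k i w * centredInd (M.branchProb k i w) (M.U i (k + 1) w.2) := by
  have h0 := M.branchProb_nonneg k i w
  have h1 := M.branchProb_le_one k i w
  rw [centredInd, min_eq_left h1, max_eq_right h0]
  unfold innov offspring branchSign
  rcases lt_or_ge (M.weight (k + 1) (M.pos k i w) w.1) 0 with hw | hw
  · have ha : M.branchProb k i w = _ := M.abs_xi_of_neg hw
    rw [if_neg (not_le.2 hw), if_neg (not_le.2 hw), abs_of_neg hw, ha]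
    by_cases hU : -M.weight (k + 1) (M.pos k i w) w.1 < M.U i (k + 1) w.2
    · rw [if_pos hU, if_neg (not_le.2 hU)]
      ring
    · rw [if_neg hU, if_pos (not_lt.1 hU)]
      ring
  · have ha : M.branchProb k i w = _ := M.abs_xi_of_nonneg hw
    rw [if_pos hw, if_pos hw, ha, Int.fract]
    push_cast
    rw [natCast_floor_eq_intCast_floor hw]
    ring

lemma abs_innov_le_one (k i : ℕ) (w) : |M.innov k i w| ≤ 1 := by
  rw [innov_eq, abs_mul, abs_branchSign, one_mul]
  exact abs_centredInd_le _ _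

variable {M} in
lemma Informed.measurable_pos {m : MeasurableSpace (Ω × Ω')} {τ : ℝ≥0} {k : ℕ}
  (h : M.Informed m τ k) {l : ℕ} (hlk : l ≤ k) (hlτ : M.tk (l + 1) ≤ τ) (i : ℕ) :
  Measurable[m] (M.pos l i) := h.measurable_evolveLeft hlk hlτ i

variable {M} in
lemma Informed.measurable_len {m : MeasurableSpace (Ω × Ω')} {τ : ℝ≥0} {k : ℕ}
  (h : M.Informed m τ k) {l : ℕ} (hlk : l ≤ k) (hlτ : M.tk l ≤ τ) :
  Measurable[m] (M.len l) := (h.measurableList_gen hlk hlτ).1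

lemma measurable_pos_exceptU (k i : ℕ) : Measurable[M.exceptU (k + 1)] (M.pos k i) :=
  (M.informed_exceptU (M.tk (k + 1)) k).measurable_pos le_rfl le_rfl i

lemma measurable_len_exceptU (k : ℕ) : Measurable[M.exceptU (k + 1)] (M.len k) :=
  (M.informed_exceptU (M.tk k) k).measurable_len le_rfl le_rfl

lemma measurable_branchProb (k i : ℕ) : Measurable[M.exceptU (k + 1)] (M.branchProb k i) :=
  _root_.measurable_abs.comp (@measurable_xi _ _ _ _ _ _ M _ (M.exceptU (k + 1)) (k + 1) _ _
    (M.measurable_pos_exceptU k i) (M.measurable_fst_exceptU (k + 1)))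

lemma measurable_branchSign (k i : ℕ) : Measurable[M.exceptU (k + 1)] (M.branchSign k i) := by
  have h := @measurable_weight _ _ _ _ _ _ M (k + 1) _ (M.exceptU (k + 1)) _ _
    (M.measurable_pos_exceptU k i) (M.measurable_fst_exceptU (k + 1))
  have hs : Measurable fun v : ℝ => if 0 ≤ v then (1 : ℝ) else -1 :=
    .ite measurableSet_Ici measurable_const measurable_const
  exact hs.comp h

lemma bddMeas_branchProb (k i : ℕ) : BddMeas (M.exceptU (k + 1)) (M.branchProb k i) :=
  ⟨M.measurable_branchProb k i, 1, fun w => by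
    rw [abs_of_nonneg (M.branchProb_nonneg _ _ _)]; exact M.branchProb_le_one _ _ _⟩

lemma bddMeas_branchSign (k i : ℕ) : BddMeas (M.exceptU (k + 1)) (M.branchSign k i) :=
  ⟨M.measurable_branchSign k i, 1, fun w => (M.abs_branchSign _ _ _).le⟩

/-- The information before time `t_{k+1}` together with the branching variables of the first `j`
particles at time `t_{k+1}`. -/
@[reducible] def stepSigma (k j : ℕ) : MeasurableSpace (Ω × Ω') :=
  M.exceptU (k + 1) ⊔ ⨆ (i : ℕ) (_ : i < j), comap (fun w => M.U i (k + 1) w.2) inferInstance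

lemma stepSigma_mono (k : ℕ) : Monotone (M.stepSigma k) := fun a b h => by
  refine sup_le le_sup_left (iSup₂_le fun i hi => le_sup_of_le_right ?_)
  exact le_iSup₂_of_le (f := fun i (_ : i < b) =>
    comap (fun w : Ω × Ω' => M.U i (k + 1) w.2) inferInstance) i
    (lt_of_lt_of_le hi h) le_rfl

lemma stepSigma_le_butOne (k j : ℕ) : M.stepSigma k j ≤ M.butOneSigma j (k + 1) := by
  refine sup_le (M.exceptU_le_butOne j (k + 1)) (iSup₂_le fun i hi => le_sup_of_le_right ?_)
  rw [show (fun w => M.U i (k + 1) w.2) = M.U i (k + 1) ∘ Prod.snd from rfl,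
    ← comap_comp]
  refine comap_mono (le_sup_of_le_right ?_)
  refine le_iSup₂_of_le
    (f := fun p (_ : p ∈ ({(j, k + 1)}ᶜ : Set (ℕ × ℕ))) => M.branchSigma p) (i, k + 1) ?_ le_rfl
  grind

lemma butOneSigma_le (i k : ℕ) : M.butOneSigma i k ≤ Prod.instMeasurableSpace := by
  refine sup_le measurable_fst.comap_le ((MeasurableSpace.comap_mono ?_).trans
    measurable_snd.comap_le)
  exact sup_le (sup_le M.rhoSigma_le (iSup_le M.motionSigma_le))
    (iSup₂_le fun p _ => M.branchSigma_le p)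

lemma stepSigma_le (k j : ℕ) : M.stepSigma k j ≤ Prod.instMeasurableSpace :=
  (M.stepSigma_le_butOne k j).trans (M.butOneSigma_le _ _)

lemma exceptU_le_stepSigma (k j : ℕ) : M.exceptU (k + 1) ≤ M.stepSigma k j := le_sup_left

lemma stepSigma_le_exceptU (k j : ℕ) : M.stepSigma k j ≤ M.exceptU (k + 2) := by
  refine sup_le (M.exceptU_mono (Nat.le_succ _)) (iSup₂_le fun i _ => le_sup_of_le_right ?_)
  exact le_iSup₂_of_le (f := fun i j => ⨆ (_ : j < k + 2),
    comap (fun w : Ω × Ω' => M.U i j w.2) inferInstance) i (k + 1)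
    (le_iSup_of_le (by omega) le_rfl)

lemma bddMeas_innov (k i : ℕ) : BddMeas (M.stepSigma k (i + 1)) (M.innov k i) := by
  refine ⟨?_, 1, M.abs_innov_le_one k i⟩
  rw [funext (M.innov_eq k i)]
  have hU : Measurable[M.stepSigma k (i + 1)] fun w : Ω × Ω' => M.U i (k + 1) w.2 :=
    (comap_measurable _).mono (le_sup_of_le_right (le_iSup₂_of_le (f := fun i' (_ : i' < i + 1) =>
        comap (fun w : Ω × Ω' => M.U i' (k + 1) w.2) inferInstance)
      i (Nat.lt_succ_self i) le_rfl)) le_rfl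
  have h := M.exceptU_le_stepSigma k (i + 1)
  exact ((M.measurable_branchSign k i).mono h le_rfl).mul (measurable_centredInd.comp
    (((M.measurable_branchProb k i).mono h le_rfl).prodMk hU))

lemma map_U (i k : ℕ) : M.Phat.map (fun w => M.U i k w.2)
  = (volume : Measure ℝ).restrict (Icc 0 1) := by
  have h1 : M.Phat.map (fun w => M.U i k w.2) = (M.Phat.map Prod.snd).map (M.U i k) := by
    rw [Measure.map_map (M.measurableU i k) measurable_snd]
    rfl
  rw [h1, Phat, Measure.map_snd_prod, measure_univ, one_smul, M.lawU]

lemma integral_mul_innov (k i : ℕ) {g : Ω × Ω' → ℝ} (hg : BddMeas (M.stepSigma k i) g) :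
  ∫ w, g w * M.innov k i w ∂M.Phat = 0 := by
  have hB := M.stepSigma_le_butOne k i
  have he := (M.exceptU_le_stepSigma k i).trans hB
  have hG := (hg.mono hB).mul ((M.bddMeas_branchSign k i).mono he)
  have h := integral_mul_comp_of_indep (P := M.Phat) (M.butOneSigma_le i (k + 1)) hG
    ((M.measurable_branchProb k i).mono he le_rfl)
    ((M.measurableU i (k + 1)).comp measurable_snd) (M.indep_butOne i (k + 1))
    measurable_centredInd (C := 1) abs_centredInd_le
  simp_rw [innov_eq, ← mul_assoc]
  refine h.trans ?_
  simp only [Function.comp_def]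
  rw [M.map_U]
  simp [integral_centredInd (M.branchProb_nonneg k i _) (M.branchProb_le_one k i _)]

lemma integral_mul_innov_sq (k i : ℕ) {g : Ω × Ω' → ℝ} (hg : BddMeas (M.stepSigma k i) g) :
  ∫ w, g w * M.innov k i w ^ 2 ∂M.Phat
    = ∫ w, g w * (M.branchProb k i w - M.branchProb k i w ^ 2) ∂M.Phat := by
  have hB := M.stepSigma_le_butOne k i
  have he := (M.exceptU_le_stepSigma k i).trans hB
  have h := integral_mul_comp_of_indep (P := M.Phat) (M.butOneSigma_le i (k + 1)) (hg.mono hB)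
    ((M.measurable_branchProb k i).mono he le_rfl)
    ((M.measurableU i (k + 1)).comp measurable_snd) (M.indep_butOne i (k + 1))
    (f := fun y u => centredInd y u ^ 2) (measurable_centredInd.pow_const 2) (C := 1)
    (fun y u => by
      rw [abs_pow]
      exact pow_le_one₀ (abs_nonneg _) (abs_centredInd_le y u))
  have e : ∀ w, M.innov k i w ^ 2
      = centredInd (M.branchProb k i w) (M.U i (k + 1) w.2) ^ 2 := fun w => by
    rw [innov_eq, mul_pow, ← sq_abs (M.branchSign k i w), abs_branchSign, one_pow, one_mul]
  simp_rw [e]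
  refine h.trans ?_
  simp only [Function.comp_def]
  rw [M.map_U]
  simp_rw [integral_centredInd_sq (M.branchProb_nonneg k i _) (M.branchProb_le_one k i _)]

end FilterModel

/-! ### The observation noise -/

lemma Indep.sup_sup {S : Type*} {a b c d : MeasurableSpace S} [m0 : MeasurableSpace S]
  {P : Measure S} [IsProbabilityMeasure P] (ha : a ≤ m0) (hb : b ≤ m0) (hc : c ≤ m0) (hd : d ≤ m0)
  (hab : Indep a b P) (hcd : Indep c d P) (h : Indep (a ⊔ b) (c ⊔ d) P) :
  Indep (a ⊔ c) (b ⊔ d) P := by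
  have h1 : Indep (b ⊔ d) c P := Indep.sup_left_of_indep hb hd hc
    (indep_of_indep_of_le_right (indep_of_indep_of_le_left h le_sup_right)
      (sup_le le_sup_right le_sup_left)) hcd.symm
  have h2 : Indep (c ⊔ d ⊔ b) a P := Indep.sup_left_of_indep (sup_le hc hd) hb ha
    (indep_of_indep_of_le_right h.symm (sup_le le_sup_right le_sup_left)) hab.symm
  refine Indep.sup_left_of_indep ha hc (sup_le hb hd)
    (indep_of_indep_of_le_right h2.symm ?_) h1.symm
  grind

lemma measurable_comap_apply {S ι : Type*} {E : ι → Type*} [∀ i, MeasurableSpace (E i)]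
  (f : S → ∀ i, E i) (t : ι) :
  Measurable[comap f MeasurableSpace.pi] fun w => f w t :=
  (measurable_pi_apply t).comp (comap_measurable f)

lemma prod_fst_preimage {Ω Ω' : Type*} [MeasurableSpace Ω] [MeasurableSpace Ω'] {P : Measure Ω}
  {P' : Measure Ω'} [IsProbabilityMeasure P] [IsProbabilityMeasure P'] (A : Set Ω) :
  (P.prod P') (Prod.fst ⁻¹' A) = P A := by
  have : Prod.fst ⁻¹' A = A ×ˢ (univ : Set Ω') := by ext; simp
  rw [this, Measure.prod_prod, measure_univ, mul_one]

namespace FilterModel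

variable (M)

/-- The σ-algebra of the past of one component of the noise. -/
@[reducible] def noisePastCoord (s : ℝ≥0) (i : Fin d₂) : MeasurableSpace Ω :=
  comap (fun w (t : Iic s) => M.V t w i) inferInstance

/-- The σ-algebra of an increment of one component of the noise. -/
@[reducible] def noiseIncrCoord (s t : ℝ≥0) (i : Fin d₂) : MeasurableSpace Ω :=
  comap (fun w => M.V t w i - M.V s w i) inferInstance

/-- The σ-algebra of the signal and of the noise up to time `s`. -/
@[reducible] def noisePast (s : ℝ≥0) : MeasurableSpace Ω :=
  comap (fun w (t : ℝ≥0) => M.X t w) inferInstance ⊔ ⨆ i, M.noisePastCoord s i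

/-- Everything except the noise after time `s`. -/
@[reducible] def observerSigma (s : ℝ≥0) : MeasurableSpace (Ω × Ω') :=
  comap Prod.snd inferInstance ⊔ comap Prod.fst (M.noisePast s)

lemma measurable_V_apply (t : ℝ≥0) (i : Fin d₂) : Measurable fun w => M.V t w i :=
  (EuclideanSpace.proj (𝕜 := ℝ) i).continuous.measurable.comp (M.brownianV.measurable t)

lemma noisePastCoord_le_path (s : ℝ≥0) (i : Fin d₂) : M.noisePastCoord s i
  ≤ comap (fun w (t : ℝ≥0) => M.V t w i) inferInstance := by
  refine Measurable.comap_le (@measurable_pi_lambda _ _ _ (_) _ _ fun t => ?_)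
  exact measurable_comap_apply (fun w (t : ℝ≥0) => M.V t w i) t

lemma noiseIncrCoord_le_path (s t : ℝ≥0) (i : Fin d₂) : M.noiseIncrCoord s t i
  ≤ comap (fun w (t : ℝ≥0) => M.V t w i) inferInstance :=
  ((measurable_comap_apply (fun w (t : ℝ≥0) => M.V t w i) t).sub
    (measurable_comap_apply (fun w (t : ℝ≥0) => M.V t w i) s)).comap_le

lemma noisePath_le (i : Fin d₂) : comap (fun w (t : ℝ≥0) => M.V t w i) inferInstance
    ≤ (inferInstance : MeasurableSpace Ω) :=
  (measurable_pi_lambda _ fun t => M.measurable_V_apply t i).comap_le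

lemma noisePast_le (s : ℝ≥0) : M.noisePast s ≤ (inferInstance : MeasurableSpace Ω) :=
  sup_le (measurable_pi_lambda _ fun t => M.stableX.measurable t).comap_le
    (iSup_le fun i => (M.noisePastCoord_le_path s i).trans (M.noisePath_le i))

lemma observerSigma_le (s : ℝ≥0) : M.observerSigma s ≤ Prod.instMeasurableSpace :=
  sup_le measurable_snd.comap_le ((comap_mono (M.noisePast_le s)).trans measurable_fst.comap_le)

lemma indep_noiseCoord {s t : ℝ≥0} (h : s ≤ t) (i : Fin d₂) :
  Indep (M.noisePastCoord s i) (M.noiseIncrCoord s t i) M.P := by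
  have h1 := (IndepFun_iff_Indep _ _ _).1
    ((M.brownianV.brownian i).toIsPreBrownianReal.indepFun_shift s)
  refine (indep_of_indep_of_le_left h1 ?_).symm
  refine Measurable.comap_le ?_
  have h2 := (measurable_pi_apply (X := fun _ : ℝ≥0 => ℝ) (t - s)).comp
    (comap_measurable (fun w t => M.V (s + t) w i - M.V s w i))
  simpa only [Function.comp_def, add_tsub_cancel_of_le h] using h2

lemma indep_noise {s t : ℝ≥0} (h : s ≤ t) :
  Indep (⨆ i, M.noisePastCoord s i) (⨆ i, M.noiseIncrCoord s t i) M.P := by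
  have hi : iIndep (fun i : Fin d₂ => comap (fun w (t : ℝ≥0) => M.V t w i) inferInstance) M.P :=
    (iIndepFun_iff_iIndep _ _ _).1 M.brownianV.indep
  have key : ∀ I : Finset (Fin d₂), Indep (⨆ i ∈ I, M.noisePastCoord s i)
      (⨆ i ∈ I, M.noiseIncrCoord s t i) M.P := by
    intro I
    induction I using Finset.induction_on with
    | empty => simpa using indep_bot_left _
    | insert a I ha ih =>
      rw [Finset.iSup_insert, Finset.iSup_insert]
      have hp := fun i => (M.noisePastCoord_le_path s i).trans (M.noisePath_le i)
      have hq := fun i => (M.noiseIncrCoord_le_path s t i).trans (M.noisePath_le i)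
      refine Indep.sup_sup (hp a) (hq a) (iSup₂_le fun i _ => hp i) (iSup₂_le fun i _ => hq i)
        (M.indep_noiseCoord h a) ih ?_
      have h2 := indep_iSup_of_disjoint (S := {a}) (T := (I : Set (Fin d₂))) M.noisePath_le hi
        (by simpa using ha)
      rw [iSup_singleton] at h2
      refine indep_of_indep_of_le_left (indep_of_indep_of_le_right h2 (sup_le ?_ ?_))
        (sup_le (M.noisePastCoord_le_path s a) (M.noiseIncrCoord_le_path s t a))
      · exact iSup₂_mono fun i _ => M.noisePastCoord_le_path s i
      · exact iSup₂_mono fun i _ => M.noiseIncrCoord_le_path s t i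
  simpa using key Finset.univ

lemma measurable_vec_of_coord {E : Type*} {mE : MeasurableSpace E} (f : E → Vec d₂)
  (hf : ∀ i, Measurable fun e => f e i) : Measurable f := by
  have h : Measurable fun e => WithLp.toLp 2 (fun i => f e i) :=
    (WithLp.measurable_toLp 2 _).comp (measurable_pi_lambda _ hf)
  exact h

lemma comap_noise_le (s t : ℝ≥0) : comap (fun w => M.V t w - M.V s w) inferInstance
  ≤ ⨆ i, M.noiseIncrCoord s t i := by
  refine Measurable.comap_le (measurable_vec_of_coord _ fun i => ?_)
  exact (comap_measurable (fun w => M.V t w i - M.V s w i)).mono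
    (le_iSup (M.noiseIncrCoord s t) i) le_rfl

lemma indep_noisePast {s t : ℝ≥0} (h : s ≤ t) : Indep (M.noisePast s)
  (comap (fun w => M.V t w - M.V s w) inferInstance) M.P := by
  have hp : (⨆ i, M.noisePastCoord s i) ≤ (inferInstance : MeasurableSpace Ω) :=
    iSup_le fun i => (M.noisePastCoord_le_path s i).trans (M.noisePath_le i)
  have hv : Measurable fun w => M.V t w - M.V s w :=
    (M.brownianV.measurable t).sub (M.brownianV.measurable s)
  refine Indep.sup_left_of_indep (measurable_pi_lambda _ fun t => M.stableX.measurable t).comap_le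
    hp hv.comap_le ?_ (indep_of_indep_of_le_right (M.indep_noise h) (M.comap_noise_le s t))
  refine indep_of_indep_of_le_right ((IndepFun_iff_Indep _ _ _).1 M.indepXV) (sup_le ?_ ?_)
  · refine iSup_le fun i => Measurable.comap_le (@measurable_pi_lambda _ _ _ (_) _ _ fun u => ?_)
    exact (EuclideanSpace.proj (𝕜 := ℝ) i).continuous.measurable.comp
      (measurable_comap_apply (fun w (t : ℝ≥0) => M.V t w) u)
  · exact ((measurable_comap_apply (fun w (t : ℝ≥0) => M.V t w) t).sub
      (measurable_comap_apply (fun w (t : ℝ≥0) => M.V t w) s)).comap_le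

lemma indep_observer {s t : ℝ≥0} (h : s ≤ t) : Indep (M.observerSigma s)
  (comap (fun w : Ω × Ω' => M.V t w.1 - M.V s w.1) inferInstance) M.Phat := by
  have hv : Measurable fun w => M.V t w - M.V s w :=
    (M.brownianV.measurable t).sub (M.brownianV.measurable s)
  have e : comap (fun w : Ω × Ω' => M.V t w.1 - M.V s w.1) inferInstance = comap Prod.fst
        (comap (fun w => M.V t w - M.V s w) inferInstance) := by
    rw [comap_comp]
    rfl
  rw [e]
  have h1 := comap_mono (g := (Prod.fst : Ω × Ω' → Ω)) (M.noisePast_le s)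
  have h2 := comap_mono (g := (Prod.fst : Ω × Ω' → Ω)) hv.comap_le
  refine Indep.sup_left_of_indep measurable_snd.comap_le (h1.trans measurable_fst.comap_le)
    (h2.trans measurable_fst.comap_le) ?_ ?_
  · exact indep_of_indep_of_le_right (indep_fst_snd (P := M.P) (P' := M.P')).symm (sup_le h1 h2)
  · rw [Indep_iff]
    rintro _ _ ⟨A, hA, rfl⟩ ⟨B, hB, rfl⟩
    rw [← preimage_inter, Phat, prod_fst_preimage, prod_fst_preimage, prod_fst_preimage]
    exact (Indep_iff _ _ _).1 (M.indep_noisePast h) A B hA hB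

lemma measurable_noisePast_V {s t : ℝ≥0} (h : t ≤ s) : Measurable[M.noisePast s] (M.V t) := by
  refine @measurable_vec_of_coord _ _ (M.noisePast s) _ fun i => ?_
  have h1 := measurable_comap_apply (fun w (t : Iic s) => M.V t w i) ⟨t, h⟩
  exact h1.mono (le_sup_of_le_right (le_iSup (M.noisePastCoord s) i)) le_rfl

lemma measurable_noisePast_X (s t : ℝ≥0) : Measurable[M.noisePast s] (M.X t) :=
  (measurable_comap_apply (fun w (t : ℝ≥0) => M.X t w) t).mono le_sup_left le_rfl

lemma measurable_noisePast_Y {k j : ℕ} (h : j ≤ k) : Measurable[M.noisePast (M.tk k)] (M.Y j) := by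
  induction j with
  | zero => exact measurable_const
  | succ j ih =>
    have h1 := M.h.continuous.measurable.comp (M.measurable_noisePast_X (M.tk k) (M.tk (j + 1)))
    have h2 := (M.measurable_noisePast_V (M.tk_mono h)).sub
      (M.measurable_noisePast_V (M.tk_mono (j.le_succ.trans h)))
    have h3 : Measurable[M.noisePast (M.tk k)] fun w =>
        ((M.tk (j + 1) : ℝ) - (M.tk j : ℝ)) • M.h (M.X (M.tk (j + 1)) w) :=
      (measurable_const_smul ((M.tk (j + 1) : ℝ) - (M.tk j : ℝ))).comp h1
    exact ((ih (j.le_succ.trans h)).add h3).add h2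

lemma measurable_observer_fst (s : ℝ≥0) {E : Type*} [MeasurableSpace E] {f : Ω → E}
  (hf : Measurable[M.noisePast s] f) : Measurable[M.observerSigma s] fun w => f w.1 := by
  have h : Measurable[comap (Prod.fst : Ω × Ω' → Ω) (M.noisePast s)]
      fun w => f w.1 := hf.comp (comap_measurable _)
  exact h.mono le_sup_right le_rfl

lemma measurable_observer_snd (s : ℝ≥0) {E : Type*} [MeasurableSpace E] {f : Ω' → E}
  (hf : Measurable f) : Measurable[M.observerSigma s] fun w => f w.2 := by
  have h : Measurable[comap (Prod.snd : Ω × Ω' → Ω') inferInstance]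
      fun w => f w.2 := hf.comp (comap_measurable _)
  exact h.mono le_sup_left le_rfl

lemma informed_observer (τ : ℝ≥0) (k : ℕ) : M.Informed (M.observerSigma (M.tk k)) τ k where
  obs j hj := M.measurable_observer_fst _ (M.measurable_noisePast_Y hj)
  rho j := M.measurable_observer_snd _ (M.measurableρ j)
  incr i u v _ _ := M.measurable_observer_snd _
    (((M.stableXp i).measurable u).sub ((M.stableXp i).measurable v))
  unif i j _ _ := M.measurable_observer_snd _ (M.measurableU i j)

/-! ### Second moments and exponential moments of the noise -/

lemma map_noise_coord {s t : ℝ≥0} (h : s ≤ t) (i : Fin d₂) :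
  M.P.map (fun w => M.V t w i - M.V s w i) = gaussianReal 0 (t - s) := by
  have h1 := ((M.brownianV.brownian i).toIsPreBrownianReal.hasLaw_sub t s).map_eq
  refine h1.trans (congrArg _ ?_)
  ext
  have h0 : (0 : ℝ) ≤ t - s := sub_nonneg.2 (NNReal.coe_le_coe.2 h)
  rw [coe_nndist, Real.dist_eq, NNReal.coe_sub h]
  exact abs_of_nonneg h0

lemma hasLaw_noise_coord {s t : ℝ≥0} (h : s ≤ t) (i : Fin d₂) :
  HasLaw (fun w => M.V t w i - M.V s w i) (gaussianReal 0 (t - s)) M.P where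
  aemeasurable := ((M.measurable_V_apply t i).sub (M.measurable_V_apply s i)).aemeasurable
  map_eq := M.map_noise_coord h i

lemma integral_abs_inner_noise_le {s t : ℝ≥0} (h : s ≤ t) (v : Vec d₂) :
  Integrable (fun w => |⟪v, M.V t w - M.V s w⟫|) M.P ∧
  ∫ w, |⟪v, M.V t w - M.V s w⟫| ∂M.P ≤ √((t - s : ℝ≥0) : ℝ) * ‖v‖ := by
  set Z : Fin d₂ → Ω → ℝ := fun i w => v i * (M.V t w i - M.V s w i) with hZ
  have hL2 : ∀ i, MemLp (fun w => M.V t w i - M.V s w i) 2 M.P := fun i => by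
    have h1 : MemLp id 2 (gaussianReal 0 (t - s)) := memLp_id_gaussianReal 2
    rw [← M.map_noise_coord h i] at h1
    exact h1.comp_of_map ((M.measurable_V_apply t i).sub (M.measurable_V_apply s i)).aemeasurable
  have hZL : ∀ i, MemLp (Z i) 2 M.P := fun i => (hL2 i).const_mul (v i)
  have hvar : ∀ i, Var[Z i; M.P] = v i ^ 2 * (t - s : ℝ≥0) := fun i => by
    rw [variance_const_mul, (M.hasLaw_noise_coord h i).variance_eq, variance_id_gaussianReal]
  have hmean : ∀ i, ∫ w, Z i w ∂M.P = 0 := fun i => by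
    rw [hZ]
    rw [integral_const_mul, (M.hasLaw_noise_coord h i).integral_eq, integral_id_gaussianReal,
      mul_zero]
  have hind : Pairwise fun i j => IndepFun (Z i) (Z j) M.P := fun i j hij => by
    have h1 := M.brownianV.indep.indepFun hij
    have hm : ∀ i, Measurable fun f : ℝ≥0 → ℝ => v i * (f t - f s) := fun i =>
      ((measurable_pi_apply t).sub (measurable_pi_apply s)).const_mul _
    exact h1.comp (hm i) (hm j)
  have hsum : ∀ w, ⟪v, M.V t w - M.V s w⟫ = ∑ i, Z i w := fun w => by
    simp only [PiLp.inner_apply, hZ]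
    simp [mul_comm]
  have hS : MemLp (fun w => ∑ i, Z i w) 2 M.P := memLp_finsetSum _ fun i _ => hZL i
  have hSvar : ∫ w, (∑ i, Z i w) ^ 2 ∂M.P = ((t - s : ℝ≥0) : ℝ) * ‖v‖ ^ 2 := by
    have h1 := IndepFun.variance_sum (s := Finset.univ) (fun i _ => hZL i)
      (fun i _ j _ hij => hind hij)
    have h2 : ∫ w, (∑ i, Z i) w ∂M.P = 0 := by
      simp only [Finset.sum_apply]
      rw [integral_finsetSum _ fun i _ => (hZL i).integrable one_le_two]
      simp [hmean]
    rw [variance_of_integral_eq_zero (by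
      simpa only [← Finset.sum_apply] using hS.aestronglyMeasurable.aemeasurable) h2] at h1
    simp only [Finset.sum_apply] at h1
    rw [h1, sum_congr rfl fun i _ => hvar i, ← Finset.sum_mul, EuclideanSpace.norm_sq_eq, mul_comm]
    simp
  simp_rw [hsum]
  have hI : Integrable (fun w => |∑ i, Z i w|) M.P := (hS.integrable one_le_two).abs
  refine ⟨hI, ?_⟩
  have hS' : MemLp (fun w => |∑ i, Z i w|) 2 M.P := hS.abs
  have h3 := integral_sq_le_integral_sq hS'
  simp only [sq_abs] at h3
  rw [hSvar] at h3
  refine Real.le_sqrt_of_sq_le h3 |>.trans (le_of_eq ?_)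
  simp

lemma lintegral_exp_norm_noise_lt_top {s t : ℝ≥0} (h : s ≤ t) (c : ℝ) (hc : 0 ≤ c) :
  ∫⁻ w, ofReal (exp (c * ‖M.V t w - M.V s w‖)) ∂M.P < ⊤ := by
  have hcoord : ∀ i : Fin d₂, ∀ a : ℝ,
      Integrable (fun w => exp (a * (M.V t w i - M.V s w i))) M.P := fun i a => by
    have h1 := integrable_exp_mul_gaussianReal (μ := 0) (v := t - s) a
    rw [← M.map_noise_coord h i] at h1
    exact h1.comp_measurable ((M.measurable_V_apply t i).sub (M.measurable_V_apply s i))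
  have hpt : ∀ w, exp (c * ‖M.V t w - M.V s w‖) ≤ 1 + ∑ i, (exp (c * d₂ * (M.V t w i - M.V s w i))
        + exp (-(c * d₂) * (M.V t w i - M.V s w i))) := fun w => by
    set x := M.V t w - M.V s w with hx
    have hxi : ∀ i, M.V t w i - M.V s w i = x i := fun i => by simp [hx]
    simp_rw [hxi]
    have hnorm : ‖x‖ ≤ ∑ i, |x i| := by
      have := norm_sum_le Finset.univ fun i => EuclideanSpace.single i (x i)
      have e : ∑ i, EuclideanSpace.single i (x i) = x := by
        ext j
        simp [Finset.sum_apply, Pi.single_apply]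
      rw [e] at this
      simpa using this
    have hpos : ∀ i ∈ (Finset.univ : Finset (Fin d₂)), 0 ≤ exp (c * d₂ * x i)
        + exp (-(c * d₂) * x i) := fun i _ => by positivity
    rcases isEmpty_or_nonempty (Fin d₂) with he | he
    · have : ‖x‖ ≤ 0 := hnorm.trans (by simp)
      have h0 : c * ‖x‖ ≤ 0 := mul_nonpos_of_nonneg_of_nonpos hc this
      have := exp_le_one_iff.2 h0
      simpa using this
    · obtain ⟨j, -, hj⟩ := Finset.exists_max_image Finset.univ (fun i => |x i|) Finset.univ_nonempty
      have h1 : ∑ i, |x i| ≤ d₂ * |x j| := by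
        refine (sum_le_card_nsmul _ _ _ fun i hi => hj i hi).trans ?_
        simp
      have h2 : exp (c * ‖x‖) ≤ exp (c * d₂ * |x j|) := by
        rw [exp_le_exp, mul_assoc]
        nlinarith
      have h3 : exp (c * d₂ * |x j|) ≤ exp (c * d₂ * x j) + exp (-(c * d₂) * x j) := by
        rcases abs_cases (x j) with ⟨h, _⟩ | ⟨h, _⟩
        · rw [h]; linarith [exp_pos (-(c * d₂) * x j)]
        · rw [h, mul_neg, ← neg_mul]; linarith [exp_pos (c * d₂ * x j)]
      have h4 := Finset.single_le_sum hpos (Finset.mem_univ j)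
      linarith
  have hint : Integrable (fun w => 1 + ∑ i, (exp (c * d₂ * (M.V t w i - M.V s w i))
        + exp (-(c * d₂) * (M.V t w i - M.V s w i)))) M.P :=
    (integrable_const 1).add (integrable_finsetSum _ fun i _ => (hcoord i _).add (hcoord i _))
  refine (lintegral_mono fun w => ofReal_le_ofReal (hpt w)).trans_lt ?_
  have := hint.lintegral_lt_top
  exact this

/-! ### The number of particles and the branching probabilities -/

/-- The supremum of `h'h`. -/
def hSup : ℝ := ⨆ x, ⟪M.h x, M.h x⟫

lemma inner_h_le (x : Vec d₁) : ⟪M.h x, M.h x⟫ ≤ M.hSup := by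
  refine le_ciSup (f := fun x => ⟪M.h x, M.h x⟫) ⟨(SchwartzMap.seminorm ℝ 0 0 M.h) ^ 2, ?_⟩ x
  rintro _ ⟨y, rfl⟩
  simp only [real_inner_self_eq_norm_sq]
  exact pow_le_pow_left₀ (norm_nonneg _) (SchwartzMap.norm_le_seminorm ℝ M.h y) 2

lemma hSup_nonneg : 0 ≤ M.hSup := real_inner_self_nonneg.trans (M.inner_h_le 0)

lemma norm_h_le (x : Vec d₁) : ‖M.h x‖ ≤ √M.hSup := by
  refine Real.le_sqrt_of_sq_le ?_
  rw [← real_inner_self_eq_norm_sq]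
  exact M.inner_h_le x

lemma tk_succ_sub (k : ℕ) : (M.tk (k + 1) : ℝ) - (M.tk k : ℝ) = M.ε := by
  simp only [tk]
  push_cast
  ring

lemma tk_succ_tsub (k : ℕ) : M.tk (k + 1) - M.tk k = M.ε := by
  apply NNReal.coe_injective
  rw [NNReal.coe_sub (M.tk_mono k.le_succ), tk_succ_sub]

/-- The logarithm of `1 + ϱ`. -/
def logWeight (k : ℕ) (x : Vec d₁) (w : Ω) : ℝ := ⟪M.h x, M.V (M.tk (k + 1)) w - M.V (M.tk k) w⟫
    + M.ε * (⟪M.h (M.X (M.tk (k + 1)) w), M.h x⟫ - ⟪M.h x, M.h x⟫ / 2)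

lemma weight_succ (k : ℕ) (x : Vec d₁) (w : Ω) :
  M.weight (k + 1) x w = exp (M.logWeight k x w) - 1 := by
  have h : M.Y (k + 1) w - M.Y k w = (M.ε : ℝ) • M.h (M.X (M.tk (k + 1)) w)
      + (M.V (M.tk (k + 1)) w - M.V (M.tk k) w) := by
    rw [Y, tk_succ_sub]
    abel
  rw [weight, Nat.add_sub_cancel, h, tk_succ_sub, inner_add_left, real_inner_smul_left, logWeight,
    real_inner_comm (M.h x) (M.V (M.tk (k + 1)) w - M.V (M.tk k) w)]
  ring

lemma abs_logWeight_le (k : ℕ) (x : Vec d₁) (w : Ω) : |M.logWeight k x w|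
  ≤ |⟪M.h x, M.V (M.tk (k + 1)) w - M.V (M.tk k) w⟫| + 3 / 2 * (M.ε * M.hSup) := by
  have h1 : |⟪M.h (M.X (M.tk (k + 1)) w), M.h x⟫| ≤ M.hSup := by
    refine (abs_real_inner_le_norm _ _).trans ?_
    calc _ ≤ √M.hSup * √M.hSup := mul_le_mul (M.norm_h_le _) (M.norm_h_le _) (norm_nonneg _)
          (Real.sqrt_nonneg _)
      _ = _ := Real.mul_self_sqrt M.hSup_nonneg
  have h2 := M.inner_h_le x
  have h3 : 0 ≤ ⟪M.h x, M.h x⟫ := real_inner_self_nonneg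
  have h4 : |⟪M.h (M.X (M.tk (k + 1)) w), M.h x⟫ - ⟪M.h x, M.h x⟫ / 2| ≤ 3 / 2 * M.hSup := by
    rw [abs_le] at *
    constructor <;> linarith [h1.1, h1.2]
  refine (abs_add_le _ _).trans (add_le_add_right ?_ _)
  rw [abs_mul, abs_of_nonneg (NNReal.coe_nonneg _)]
  nlinarith

lemma abs_xi_succ_le (k : ℕ) (x : Vec d₁) (w : Ω) : |M.xi (k + 1) x w|
  ≤ 2 * min 1 |⟪M.h x, M.V (M.tk (k + 1)) w - M.V (M.tk k) w⟫| + 3 * (M.ε * M.hSup) := by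
  have h1 := M.abs_xi_le_one (k + 1) x w
  have h2 := M.abs_xi_le_abs_weight (k + 1) x w
  have h3 := M.abs_logWeight_le k x w
  have h5 : 0 ≤ (M.ε : ℝ) * M.hSup := mul_nonneg (NNReal.coe_nonneg _) M.hSup_nonneg
  rw [weight_succ] at h2
  rcases le_total |M.logWeight k x w| 1 with h | h
  · have h4 := Real.abs_exp_sub_one_le h
    rcases min_cases 1 |⟪M.h x, M.V (M.tk (k + 1)) w - M.V (M.tk k) w⟫| with ⟨e, _⟩ | ⟨e, _⟩ <;>
      rw [e] <;> linarith
  · rcases min_cases 1 |⟪M.h x, M.V (M.tk (k + 1)) w - M.V (M.tk k) w⟫| with ⟨e, _⟩ | ⟨e, _⟩ <;>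
      rw [e] <;> linarith

/-- The mean branching probability given the past is at most of order `ε^(1/2)`. -/
lemma integral_mul_branchProb_le (k i : ℕ) {g : Ω × Ω' → ℝ}
  (hg : BddMeas (M.observerSigma (M.tk k)) g) (hg0 : ∀ w, 0 ≤ g w) :
  ∫ w, g w * M.branchProb k i w ∂M.Phat ≤ 5 * √(M.ε * max M.hSup 1) * ∫ w, g w ∂M.Phat := by
  have hle := M.observerSigma_le (M.tk k)
  have hB := (M.bddMeas_branchProb k i).mono (M.exceptU_le _)
  have hg' := hg.mono hle
  have hig : 0 ≤ ∫ w, g w ∂M.Phat := integral_nonneg hg0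
  set e := (M.ε : ℝ) * max M.hSup 1 with he
  have he0 : 0 ≤ e := by positivity
  have hHe : (M.ε : ℝ) * M.hSup ≤ e :=
    mul_le_mul_of_nonneg_left (le_max_left _ _) (NNReal.coe_nonneg _)
  rcases le_total 1 e with h1 | h1
  · have h2 : 1 ≤ √e := Real.one_le_sqrt.2 h1
    calc ∫ w, g w * M.branchProb k i w ∂M.Phat ≤ ∫ w, g w ∂M.Phat :=
          integral_mono (hg'.mul hB).int hg'.int fun w =>
            mul_le_of_le_one_right (hg0 w) (M.branchProb_le_one k i w)
      _ ≤ _ := le_mul_of_one_le_left hig (by linarith)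
  · have h2 : e ≤ √e := Real.le_sqrt_of_sq_le (by nlinarith)
    have hY : Measurable[M.observerSigma (M.tk k)] fun w => M.h (M.pos k i w) :=
      M.h.continuous.measurable.comp
        ((M.informed_observer (M.tk (k + 1)) k).measurable_pos le_rfl le_rfl i)
    have hV : Measurable fun w => M.V (M.tk (k + 1)) w - M.V (M.tk k) w :=
      (M.brownianV.measurable _).sub (M.brownianV.measurable _)
    have hV' : Measurable fun w : Ω × Ω' => M.V (M.tk (k + 1)) w.1 - M.V (M.tk k) w.1 :=
      hV.comp measurable_fst
    set f : Vec d₂ → Vec d₂ → ℝ := fun v y => min 1 |⟪v, y⟫| with hf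
    have hfm : Measurable (uncurry f) :=
      measurable_const.min (measurable_fst.inner measurable_snd).abs
    have hf1 : ∀ v y, |f v y| ≤ 1 := fun v y => by grind
    have hind := integral_mul_comp_of_indep (P := M.Phat) hle hg hY hV'
      (M.indep_observer (M.tk_mono k.le_succ)) hfm hf1
    have hmap : M.Phat.map (fun w : Ω × Ω' => M.V (M.tk (k + 1)) w.1 - M.V (M.tk k) w.1)
        = M.P.map fun w => M.V (M.tk (k + 1)) w - M.V (M.tk k) w := by
      have h3 : M.Phat.map (fun w : Ω × Ω' => M.V (M.tk (k + 1)) w.1 - M.V (M.tk k) w.1)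
          = (M.Phat.map Prod.fst).map fun w => M.V (M.tk (k + 1)) w - M.V (M.tk k) w := by
        rw [Measure.map_map hV measurable_fst]
        rfl
      rw [h3, Phat, Measure.map_fst_prod, measure_univ, one_smul]
    have hinner : ∀ v, ‖v‖ ≤ √M.hSup →
        ∫ y, f v y ∂(M.P.map fun w => M.V (M.tk (k + 1)) w - M.V (M.tk k) w) ≤ √e := by
      intro v hv
      have hfv : Measurable (f v) := hfm.comp (measurable_const.prodMk measurable_id)
      rw [integral_map hV.aemeasurable hfv.aestronglyMeasurable]
      obtain ⟨hI, hle'⟩ := M.integral_abs_inner_noise_le (M.tk_mono k.le_succ) v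
      refine (integral_mono ?_ hI fun w => min_le_right _ _).trans (hle'.trans ?_)
      · exact Integrable.of_bound (hfv.comp hV).aestronglyMeasurable 1 (.of_forall fun w => hf1 _ _)
      · rw [tk_succ_tsub]
        calc √(M.ε : ℝ) * ‖v‖ ≤ √(M.ε : ℝ) * √M.hSup := by gcongr
          _ = √(M.ε * M.hSup) := (Real.sqrt_mul (NNReal.coe_nonneg _) _).symm
          _ ≤ √e := Real.sqrt_le_sqrt hHe
    have hY' : Measurable fun w => M.h (M.pos k i w) := hY.mono hle le_rfl
    have hFm : BddMeas Prod.instMeasurableSpace fun w : Ω × Ω' =>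
        f (M.h (M.pos k i w)) (M.V (M.tk (k + 1)) w.1 - M.V (M.tk k) w.1) :=
      ⟨measurable_const.min (hY'.inner hV').abs, 1, fun w => hf1 _ _⟩
    have hbound : ∫ w : Ω × Ω', g w * f (M.h (M.pos k i w))
        (M.V (M.tk (k + 1)) w.1 - M.V (M.tk k) w.1) ∂M.Phat ≤ √e * ∫ w, g w ∂M.Phat := by
      refine hind.le.trans ?_
      rw [hmap, ← integral_const_mul]
      refine integral_mono_of_nonneg (.of_forall fun w =>
        mul_nonneg (hg0 w) (integral_nonneg fun y => le_min zero_le_one (abs_nonneg _)))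
        (hg'.int.const_mul _) (.of_forall fun w => ?_)
      simp only
      rw [mul_comm]
      exact mul_le_mul_of_nonneg_right (hinner _ (M.norm_h_le _)) (hg0 w)
    calc ∫ w, g w * M.branchProb k i w ∂M.Phat
        ≤ ∫ w : Ω × Ω', (2 * (g w * f (M.h (M.pos k i w))
            (M.V (M.tk (k + 1)) w.1 - M.V (M.tk k) w.1)) + 3 * √e * g w) ∂M.Phat := by
          refine integral_mono (hg'.mul hB).int
            (((hg'.mul hFm).const_mul 2).add (hg'.const_mul (3 * √e))).int fun w => ?_
          have h3 := M.abs_xi_succ_le k (M.pos k i w) w.1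
          have h4 : M.branchProb k i w ≤ 2 * f (M.h (M.pos k i w))
            (M.V (M.tk (k + 1)) w.1 - M.V (M.tk k) w.1) + 3 * √e := h3.trans (by linarith)
          have h5 := mul_le_mul_of_nonneg_left h4 (hg0 w)
          linarith
      _ = 2 * (∫ w : Ω × Ω', g w * f (M.h (M.pos k i w))
            (M.V (M.tk (k + 1)) w.1 - M.V (M.tk k) w.1) ∂M.Phat) + 3 * √e * ∫ w, g w ∂M.Phat := by
          rw [integral_add ((hg'.mul hFm).const_mul 2).int
            (hg'.const_mul (3 * √e)).int, integral_const_mul, integral_const_mul]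
      _ ≤ _ := by linarith

lemma len_succ (k : ℕ) (w) : M.len (k + 1) w
  = ∑ i ∈ range (M.len k w), M.offspring (k + 1) i (M.pos k i w) w := by
  have h : ∀ (f : ℕ → ℕ) (m : ℕ), ((List.range m).map f).sum = ∑ i ∈ range m, f i := by
    intro f m
    induction m with
    | zero => simp
    | succ m ih => simp [List.range_succ, sum_range_succ, ih]
  simp only [len, gen, List.length_flatMap, List.length_replicate]
  rfl

lemma offspring_le (k i : ℕ) (x : Vec d₁) (w) :
  (M.offspring k i x w : ℝ) ≤ M.weight k x w.1 + 2 := by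
  have h := M.neg_one_lt_weight k x w.1
  unfold offspring
  split_ifs with h1 h2 h2
  · have := Nat.floor_le h1
    push_cast
    linarith
  · have := Nat.floor_le h1
    push_cast
    linarith
  · push_cast
    linarith
  · push_cast
    linarith

/-- A bound of the mean number of offspring by the noise. -/
def growth (k : ℕ) (w : Ω) : ℝ :=
  1 + exp (√M.hSup * ‖M.V (M.tk (k + 1)) w - M.V (M.tk k) w‖ + 3 / 2 * (M.ε * M.hSup))

lemma len_succ_le (k : ℕ) (w) : (M.len (k + 1) w : ℝ) ≤ M.len k w * M.growth k w.1 := by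
  rw [len_succ, Nat.cast_sum, ← card_range (M.len k w), ← nsmul_eq_mul, card_range]
  conv_rhs => rw [← card_range (M.len k w)]
  refine sum_le_card_nsmul _ _ _ fun i _ => (M.offspring_le _ _ _ _).trans ?_
  rw [weight_succ, growth]
  have h := M.abs_logWeight_le k (M.pos k i w) w.1
  have h1 : |⟪M.h (M.pos k i w), M.V (M.tk (k + 1)) w.1 - M.V (M.tk k) w.1⟫|
      ≤ √M.hSup * ‖M.V (M.tk (k + 1)) w.1 - M.V (M.tk k) w.1‖ :=
    (abs_real_inner_le_norm _ _).trans (mul_le_mul_of_nonneg_right (M.norm_h_le _) (norm_nonneg _))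
  have h2 := exp_le_exp.2 ((le_abs_self _).trans (h.trans (add_le_add_left h1 _)))
  linarith

lemma measurable_len (k : ℕ) : Measurable (M.len k) := (M.measurableList_gen k).1

lemma measurable_len_observer {j k : ℕ} (h : j ≤ k) :
  Measurable[M.observerSigma (M.tk k)] (M.len j) :=
  (M.informed_observer (M.tk j) k).measurable_len h le_rfl

lemma lintegral_growth_sq_lt_top (k : ℕ) : ∫⁻ w, ofReal (M.growth k w ^ 2) ∂M.P < ⊤ := by
  set c := √M.hSup
  set b := 3 / 2 * ((M.ε : ℝ) * M.hSup)
  have hpt : ∀ w, M.growth k w ^ 2 ≤ 2 + 2 * exp (2 * b)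
      * exp (2 * c * ‖M.V (M.tk (k + 1)) w - M.V (M.tk k) w‖) := fun w => by
    have e : 2 * exp (2 * b) * exp (2 * c * ‖M.V (M.tk (k + 1)) w - M.V (M.tk k) w‖)
        = 2 * (exp (c * ‖M.V (M.tk (k + 1)) w - M.V (M.tk k) w‖ + b)) ^ 2 := by
      rw [← Real.exp_nat_mul, mul_assoc, ← Real.exp_add]
      ring
    change (1 + exp (c * ‖M.V (M.tk (k + 1)) w - M.V (M.tk k) w‖ + b)) ^ 2 ≤ _
    nlinarith [sq_nonneg (1 - exp (c * ‖M.V (M.tk (k + 1)) w - M.V (M.tk k) w‖ + b))]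
  have h1 := M.lintegral_exp_norm_noise_lt_top (M.tk_mono k.le_succ) (2 * c) (by positivity)
  calc ∫⁻ w, ofReal (M.growth k w ^ 2) ∂M.P
      ≤ ∫⁻ w, (2 + ofReal (2 * exp (2 * b)) * ofReal
          (exp (2 * c * ‖M.V (M.tk (k + 1)) w - M.V (M.tk k) w‖))) ∂M.P := by
        refine lintegral_mono fun w => (ofReal_le_ofReal (hpt w)).trans ?_
        rw [ENNReal.ofReal_add (by norm_num) (by positivity), ofReal_mul (by positivity)]
        simp
    _ < ⊤ := by
        rw [lintegral_add_left measurable_const, lintegral_const_mul' _ _ ENNReal.ofReal_ne_top]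
        simp only [lintegral_const, measure_univ, mul_one]
        exact ENNReal.add_lt_top.2 ⟨ENNReal.ofNat_lt_top,
          ENNReal.mul_lt_top ENNReal.ofReal_lt_top h1⟩

lemma lintegral_len_sq_lt_top (k : ℕ) : ∫⁻ w, ofReal ((M.len k w : ℝ) ^ 2) ∂M.Phat < ⊤ := by
  induction k with
  | zero => simp [len, gen]
  | succ k ih =>
    have hG : Measurable (M.growth k) := by
      exact measurable_const.add (measurable_exp.comp (((((M.brownianV.measurable _).sub
        (M.brownianV.measurable _)).norm).const_mul _).add_const _))
    set F : Vec d₂ → ℝ≥0∞ := fun y => ofReal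
      ((1 + exp (√M.hSup * ‖y‖ + 3 / 2 * (M.ε * M.hSup))) ^ 2) with hF
    have hFm : Measurable F := by fun_prop
    have hlen : Measurable[M.observerSigma (M.tk k)] fun w => ofReal ((M.len k w : ℝ) ^ 2) :=
      (measurable_from_top (f := fun m : ℕ => ofReal ((m : ℝ) ^ 2))).comp
        (M.measurable_len_observer le_rfl)
    have hV : Measurable fun w : Ω × Ω' => M.V (M.tk (k + 1)) w.1 - M.V (M.tk k) w.1 :=
      ((M.brownianV.measurable _).sub (M.brownianV.measurable _)).comp measurable_fst
    have hind := lintegral_mul_eq_lintegral_mul_lintegral_of_independent_measurableSpace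
      (M.observerSigma_le (M.tk k)) hV.comap_le (M.indep_observer (M.tk_mono k.le_succ)) hlen
      (hFm.comp (comap_measurable _))
    have hFg : ∀ w : Ω × Ω', F (M.V (M.tk (k + 1)) w.1 - M.V (M.tk k) w.1)
        = ofReal (M.growth k w.1 ^ 2) := fun w => rfl
    simp only [Function.comp_def, hFg] at hind
    calc ∫⁻ w, ofReal ((M.len (k + 1) w : ℝ) ^ 2) ∂M.Phat
        ≤ ∫⁻ w, ofReal ((M.len k w : ℝ) ^ 2) * ofReal (M.growth k w.1 ^ 2) ∂M.Phat := by
          refine lintegral_mono fun w => ?_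
          rw [← ofReal_mul (by positivity), ← mul_pow]
          exact ofReal_le_ofReal (pow_le_pow_left₀ (Nat.cast_nonneg _) (M.len_succ_le k w) 2)
      _ = _ := hind
      _ < ⊤ := by
          refine ENNReal.mul_lt_top ih ?_
          have h1 : ∫⁻ w : Ω × Ω', ofReal (M.growth k w.1 ^ 2) ∂M.Phat
              = ∫⁻ w, ofReal (M.growth k w ^ 2) ∂M.P := by
            have h2 := lintegral_map (μ := M.Phat) (g := (Prod.fst : Ω × Ω' → Ω))
              (measurable_ofReal.comp (hG.pow_const 2)) measurable_fst
            simp only [Function.comp_def] at h2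
            rw [← h2, Phat, Measure.map_fst_prod, measure_univ, one_smul]
          rw [h1]
          exact M.lintegral_growth_sq_lt_top k

lemma integrable_len_sq (k : ℕ) : Integrable (fun w => (M.len k w : ℝ) ^ 2) M.Phat := by
  have hm : Measurable fun w => (M.len k w : ℝ) ^ 2 :=
    (measurable_from_top (f := fun m : ℕ => (m : ℝ) ^ 2)).comp (M.measurable_len k)
  refine ⟨hm.aestronglyMeasurable, ?_⟩
  rw [hasFiniteIntegral_iff_ofReal (.of_forall fun w => by positivity)]
  exact M.lintegral_len_sq_lt_top k

lemma measurable_len_real (k : ℕ) : Measurable fun w => (M.len k w : ℝ) :=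
  (measurable_from_top (f := fun m : ℕ => (m : ℝ))).comp (M.measurable_len k)

lemma integrable_len (k : ℕ) : Integrable (fun w => (M.len k w : ℝ)) M.Phat := by
  refine ((M.integrable_len_sq k).add (integrable_const 1)).mono'
    (M.measurable_len_real k).aestronglyMeasurable (.of_forall fun w => ?_)
  rw [norm_eq_abs, abs_of_nonneg (Nat.cast_nonneg _)]
  simp only [Pi.add_apply]
  nlinarith [sq_nonneg ((M.len k w : ℝ) - 1)]

/-! ### Sums of branching innovations -/

section Innovations

variable {M} {k : ℕ} {c : ℕ → Ω × Ω' → ℝ}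

lemma bddMeas_coef_mul_innov (hc : ∀ i, BddMeas (M.exceptU (k + 1)) (c i)) (i : ℕ) :
  BddMeas (M.stepSigma k (i + 1)) fun w => c i w * M.innov k i w :=
  ((hc i).mono (M.exceptU_le_stepSigma k _)).mul (M.bddMeas_innov k i)

lemma integral_mul_coef_mul_innov (hc : ∀ i, BddMeas (M.exceptU (k + 1)) (c i)) (i : ℕ)
  {g : Ω × Ω' → ℝ} (hg : BddMeas (M.stepSigma k i) g) :
  ∫ w, g w * (c i w * M.innov k i w) ∂M.Phat = 0 := by
  simp_rw [← mul_assoc]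
  exact M.integral_mul_innov k i (hg.mul ((hc i).mono (M.exceptU_le_stepSigma k _)))

lemma integral_mul_innovSum (hc : ∀ i, BddMeas (M.exceptU (k + 1)) (c i)) (L : ℕ)
  {g : Ω × Ω' → ℝ} (hg : BddMeas (M.exceptU (k + 1)) g) :
  ∫ w, g w * ∑ i ∈ range L, c i w * M.innov k i w ∂M.Phat = 0 := by
  simp_rw [mul_sum]
  rw [integral_finsetSum _ fun i _ => ((hg.mono (M.exceptU_le _)).mul
    ((bddMeas_coef_mul_innov hc i).mono (M.stepSigma_le k _))).int]
  exact sum_eq_zero fun i _ =>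
    integral_mul_coef_mul_innov hc i (hg.mono (M.exceptU_le_stepSigma k _))

lemma integral_innovSum_sq (hc : ∀ i, BddMeas (M.exceptU (k + 1)) (c i)) (L : ℕ) :
  ∫ w, (∑ i ∈ range L, c i w * M.innov k i w) ^ 2 ∂M.Phat = ∫ w, ∑ i ∈ range L,
        c i w ^ 2 * (M.branchProb k i w - M.branchProb k i w ^ 2) ∂M.Phat := by
  have hb := fun i => M.bddMeas_branchProb k i
  rw [integral_sum_sq_eq_sum (fun i => M.stepSigma_le k i) (M.stepSigma_mono k)
    (bddMeas_coef_mul_innov hc) (fun i g hg => integral_mul_coef_mul_innov hc i hg) L,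
    integral_finsetSum _ fun i _ =>
      (((hc i).pow 2).mul ((hb i).sub ((hb i).pow 2))).integrable (M.exceptU_le _)]
  refine sum_congr rfl fun i _ => ?_
  simp_rw [mul_pow]
  exact M.integral_mul_innov_sq k i (((hc i).pow 2).mono (M.exceptU_le_stepSigma k _))

lemma integral_abs_coef_mul_innov_rpow_le (hc : ∀ i, BddMeas (M.exceptU (k + 1)) (c i)) {p : ℝ}
  (hp : 2 ≤ p) (i : ℕ) : ∫ w, |c i w * M.innov k i w| ^ p ∂M.Phat
    ≤ ∫ w, |c i w| ^ p * M.branchProb k i w ∂M.Phat := by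
  have h1 := (hc i).abs_rpow (show 0 ≤ p by linarith)
  have hI : BddMeas Prod.instMeasurableSpace (M.innov k i) :=
    (M.bddMeas_innov k i).mono (M.stepSigma_le k _)
  have hb := M.bddMeas_branchProb k i
  have hle := M.exceptU_le (k + 1)
  calc ∫ w, |c i w * M.innov k i w| ^ p ∂M.Phat
      ≤ ∫ w, |c i w| ^ p * M.innov k i w ^ 2 ∂M.Phat := by
        refine integral_mono ((((hc i).mono hle).mul hI).abs_rpow (by linarith)).int
          ((h1.mono hle).mul (hI.pow 2)).int fun w => ?_
        rw [abs_mul, mul_rpow (abs_nonneg _) (abs_nonneg _)]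
        refine mul_le_mul_of_nonneg_left ?_ (by positivity)
        rw [← sq_abs, ← rpow_natCast]
        exact Real.rpow_le_rpow_of_exponent_ge' (abs_nonneg _) (M.abs_innov_le_one k i w)
          (by norm_num) (by exact_mod_cast hp)
    _ = ∫ w, |c i w| ^ p * (M.branchProb k i w - M.branchProb k i w ^ 2) ∂M.Phat :=
        M.integral_mul_innov_sq k i (h1.mono (M.exceptU_le_stepSigma k _))
    _ ≤ _ := by
        refine integral_mono ((h1.mul (hb.sub (hb.pow 2))).integrable hle)
          ((h1.mul hb).integrable hle) fun w => ?_
        exact mul_le_mul_of_nonneg_left (by nlinarith [sq_nonneg (M.branchProb k i w)])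
          (by positivity)

lemma rpow_sum_range_le {r : ℝ} (hr : 1 ≤ r) (b : ℕ → ℝ) (hb : ∀ i, 0 ≤ b i) (m : ℕ) :
  (∑ i ∈ range m, b i) ^ r ≤ (m : ℝ) ^ (r - 1) * ∑ i ∈ range m, b i ^ r := by
  have h := Real.rpow_sum_le_const_mul_sum_rpow (s := range m) (f := b) hr
  grind

lemma integral_abs_innovSum_rpow_le (hc : ∀ i, BddMeas (M.exceptU (k + 1)) (c i)) {r : ℝ}
  (hr : 1 ≤ r) {K : ℝ} {A : Set (Ω × Ω')}
  (hA : MeasurableSet[M.observerSigma (M.tk k)] A)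
  (hcA : ∀ i w, |c i w| ^ (2 * r) ≤ K * A.indicator (fun _ => 1) w) (m : ℕ) :
  ∫ w, |∑ i ∈ range m, c i w * M.innov k i w| ^ (2 * r) ∂M.Phat ≤ (2 * expandConst (2 * r)) ^ r
      * ((m : ℝ) ^ r * (K * (5 * √(M.ε * max M.hSup 1) * M.Phat.real A))) := by
  have hr0 : 0 < r := by linarith
  have hp : (2 : ℝ) ≤ 2 * r := by linarith
  have hAm : MeasurableSet A := M.observerSigma_le _ _ hA
  have h1 := integral_abs_sum_rpow_le (P := M.Phat) hp (fun i => M.stepSigma_le k i)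
    (M.stepSigma_mono k) (bddMeas_coef_mul_innov hc)
    (fun i g hg => integral_mul_coef_mul_innov hc i hg) m
  rw [show 2 / (2 * r) = 1 / r by field_simp, show 2 * r / 2 = r by ring] at h1
  set I : ℕ → ℝ := fun i => ∫ w, |c i w * M.innov k i w| ^ (2 * r) ∂M.Phat with hI
  have hI0 : ∀ i, 0 ≤ I i := fun i => integral_nonneg fun w => by positivity
  have hIle : ∀ i, I i ≤ K * (5 * √(M.ε * max M.hSup 1) * M.Phat.real A) := fun i => by
    have hb := M.bddMeas_branchProb k i
    have hle := M.exceptU_le (k + 1)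
    have hind : BddMeas (M.observerSigma (M.tk k)) (A.indicator fun _ => 1) := BddMeas.indicator hA
    have hind' := hind.mono (M.observerSigma_le _)
    have hpos : ∀ w, 0 ≤ A.indicator (fun _ => (1 : ℝ)) w := fun w =>
      indicator_nonneg (fun _ _ => zero_le_one) w
    rcases isEmpty_or_nonempty (Ω × Ω') with he | ⟨⟨w₀⟩⟩
    · exact absurd (measure_univ (μ := M.Phat)) (by simp [univ_eq_empty_iff.2 he])
    have hKi : 0 ≤ K ∨ A = ∅ := by
      rcases A.eq_empty_or_nonempty with h | ⟨w, hω⟩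
      · exact Or.inr h
      · refine Or.inl ((show (0 : ℝ) ≤ |c i w| ^ (2 * r) by positivity).trans ?_)
        simpa [hω] using hcA i w
    refine (integral_abs_coef_mul_innov_rpow_le hc hp i).trans ?_
    have h2 : ∫ w, |c i w| ^ (2 * r) * M.branchProb k i w ∂M.Phat
        ≤ ∫ w, K * (A.indicator (fun _ => 1) w * M.branchProb k i w) ∂M.Phat := by
      refine integral_mono ((((hc i).abs_rpow (by linarith)).mul hb).integrable hle)
        ((hind'.mul (hb.mono hle)).const_mul K).int fun w => ?_
      rw [← mul_assoc]
      exact mul_le_mul_of_nonneg_right (hcA i w) (M.branchProb_nonneg k i w)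
    refine h2.trans ?_
    rw [integral_const_mul]
    rcases hKi with hK | rfl
    · refine mul_le_mul_of_nonneg_left ?_ hK
      refine (M.integral_mul_branchProb_le k i hind hpos).trans (le_of_eq ?_)
      rw [integral_indicator_const _ hAm]
      simp
    · simp
  have h3 : 0 ≤ ∑ i ∈ range m, I i ^ (1 / r) := sum_nonneg fun i _ => rpow_nonneg (hI0 i) _
  have h4 := one_le_expandConst hp
  refine h1.trans ?_
  rw [mul_rpow (by linarith) h3]
  refine mul_le_mul_of_nonneg_left ?_ (by positivity)
  refine (rpow_sum_range_le hr _ (fun i => rpow_nonneg (hI0 i) _) m).trans ?_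
  have h5 : ∀ i, (I i ^ (1 / r)) ^ r = I i := fun i => by
    rw [← rpow_mul (hI0 i), one_div_mul_cancel hr0.ne', rpow_one]
  simp_rw [h5]
  refine (mul_le_mul_of_nonneg_left (sum_le_card_nsmul _ _ _ fun i _ => hIle i)
    (by positivity)).trans (le_of_eq ?_)
  rw [card_range, nsmul_eq_mul, ← mul_assoc]
  rcases Nat.eq_zero_or_pos m with rfl | hm
  · simp [zero_rpow hr0.ne']
  · rw [← Real.rpow_add_one (by positivity)]
    ring_nf

end Innovations

/-! ### The branching martingale -/

/-- The contribution of the branching at time `t_{k+1}` to the martingale. -/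
def jump (φ : Vec d₁ → ℝ) (k : ℕ) (w : Ω × Ω') : ℝ :=
  (M.n : ℝ)⁻¹ * ∑ i ∈ range (M.len k w), φ (M.pos k i w) * M.innov k i w

/-- The conditional variance of the contribution of the branching at time `t_{k+1}`. -/
def jumpVar (φ : Vec d₁ → ℝ) (k : ℕ) (w : Ω × Ω') : ℝ :=
  ((M.n : ℝ)⁻¹) ^ 2 * ∑ i ∈ range (M.len k w),
    φ (M.pos k i w) ^ 2 * (M.branchProb k i w - M.branchProb k i w ^ 2)

/-- The coefficients of the innovations in `jump`, when the number of particles is in `B`. -/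
def jumpCoef (φ : Vec d₁ → ℝ) (k : ℕ) (B : Set ℕ) (i : ℕ) (w : Ω × Ω') : ℝ :=
  ({w | i < M.len k w} ∩ M.len k ⁻¹' B).indicator (fun w => (M.n : ℝ)⁻¹ * φ (M.pos k i w)) w

variable {φ : Vec d₁ → ℝ} {Φ : ℝ} (hφ : Measurable φ) (hΦ : ∀ x, |φ x| ≤ Φ)

lemma measurableSet_alive (k i : ℕ) : MeasurableSet[M.exceptU (k + 1)] {w | i < M.len k w} :=
  M.measurable_len_exceptU k (measurableSet_Ioi (a := i))

include hφ hΦ in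
lemma bddMeas_jumpCoef (k : ℕ) (B : Set ℕ) (i : ℕ) :
  BddMeas (M.exceptU (k + 1)) (M.jumpCoef φ k B i) := by
  refine ⟨?_, |(M.n : ℝ)⁻¹| * Φ, fun w => ?_⟩
  · refine Measurable.indicator (m := M.exceptU (k + 1))
      ((hφ.comp (M.measurable_pos_exceptU k i)).const_mul _) ?_
    exact @MeasurableSet.inter _ (M.exceptU (k + 1)) _ _ (M.measurableSet_alive k i)
      (M.measurable_len_exceptU k (MeasurableSet.of_discrete (s := B)))
  · unfold jumpCoef
    by_cases h : w ∈ {w | i < M.len k w} ∩ M.len k ⁻¹' B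
    · rw [indicator_of_mem h, abs_mul]
      exact mul_le_mul_of_nonneg_left (hΦ _) (abs_nonneg _)
    · rw [indicator_of_notMem h, abs_zero]
      exact mul_nonneg (abs_nonneg _) ((abs_nonneg _).trans (hΦ 0))

lemma sum_jumpCoef (f : ℕ → ℝ) (k : ℕ) {B : Set ℕ} {L : ℕ} (hB : ∀ m ∈ B, m ≤ L) (w)
  (p : ℕ) (hp : p ≠ 0) :
  ∑ i ∈ range L, M.jumpCoef φ k B i w ^ p * f i
    = (M.len k ⁻¹' B).indicator (fun _ => 1) w * (((M.n : ℝ)⁻¹) ^ p *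
        ∑ i ∈ range (M.len k w), φ (M.pos k i w) ^ p * f i) := by
  by_cases hω : M.len k w ∈ B
  · rw [indicator_of_mem (show w ∈ M.len k ⁻¹' B from hω), one_mul, mul_sum]
    have hsub : range (M.len k w) ⊆ range L := Finset.range_subset_range.2 (hB _ hω)
    rw [← sum_subset hsub]
    · refine sum_congr rfl fun i hi => ?_
      have hmem : w ∈ {w | i < M.len k w} ∩ M.len k ⁻¹' B := ⟨mem_range.1 hi, hω⟩
      rw [jumpCoef, indicator_of_mem hmem, mul_pow, mul_assoc]
    · intro i _ hi
      rw [jumpCoef, indicator_of_notMem fun h => hi (mem_range.2 h.1), zero_pow hp, zero_mul]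
  · rw [indicator_of_notMem (show w ∉ M.len k ⁻¹' B from hω), zero_mul]
    refine sum_eq_zero fun i _ => ?_
    rw [jumpCoef, indicator_of_notMem fun h => hω h.2, zero_pow hp, zero_mul]

lemma sum_jumpCoef_mul_innov (k : ℕ) {B : Set ℕ} {L : ℕ} (hB : ∀ m ∈ B, m ≤ L) (w) :
  ∑ i ∈ range L, M.jumpCoef φ k B i w * M.innov k i w
    = (M.len k ⁻¹' B).indicator (fun _ => 1) w * M.jump φ k w := by
  simpa [jump] using M.sum_jumpCoef (φ := φ) (fun i => M.innov k i w) k hB w 1 one_ne_zero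

lemma sum_jumpCoef_sq (k : ℕ) {B : Set ℕ} {L : ℕ} (hB : ∀ m ∈ B, m ≤ L) (w) :
  ∑ i ∈ range L, M.jumpCoef φ k B i w ^ 2 * (M.branchProb k i w - M.branchProb k i w ^ 2)
    = (M.len k ⁻¹' B).indicator (fun _ => 1) w * M.jumpVar φ k w :=
  M.sum_jumpCoef (φ := φ) (fun i => M.branchProb k i w - M.branchProb k i w ^ 2) k hB w 2
    two_ne_zero

include hΦ in
lemma abs_jump_le (k : ℕ) (w) :
  |M.jump φ k w| ≤ (M.n : ℝ)⁻¹ * (M.len k w * Φ) := by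
  rw [jump, abs_mul, abs_of_nonneg (by positivity : (0 : ℝ) ≤ (M.n : ℝ)⁻¹)]
  refine mul_le_mul_of_nonneg_left ?_ (by positivity)
  refine (Finset.abs_sum_le_sum_abs _ _).trans ?_
  refine (sum_le_card_nsmul _ _ Φ fun i _ => ?_).trans (by simp)
  rw [abs_mul]
  exact (mul_le_mul (hΦ _) (M.abs_innov_le_one k i w) (abs_nonneg _)
    ((abs_nonneg _).trans (hΦ 0))).trans (by simp)

lemma jumpVar_nonneg (k : ℕ) (w) : 0 ≤ M.jumpVar φ k w := by
  refine mul_nonneg (by positivity) (sum_nonneg fun i _ => mul_nonneg (sq_nonneg _) ?_)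
  nlinarith [M.branchProb_nonneg k i w, M.branchProb_le_one k i w]

include hΦ in
lemma jumpVar_le (k : ℕ) (w) : M.jumpVar φ k w
  ≤ (Φ / M.n) ^ 2 * ∑ i ∈ range (M.len k w), M.branchProb k i w := by
  have e : (Φ / M.n) ^ 2 = ((M.n : ℝ)⁻¹) ^ 2 * Φ ^ 2 := by ring
  rw [jumpVar, e, mul_assoc]
  refine mul_le_mul_of_nonneg_left ?_ (sq_nonneg ((M.n : ℝ)⁻¹))
  rw [mul_sum]
  refine sum_le_sum fun i _ => ?_
  have h1 : φ (M.pos k i w) ^ 2 ≤ Φ ^ 2 := sq_le_sq' (abs_le.1 (hΦ _)).1 (abs_le.1 (hΦ _)).2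
  have h2 := M.branchProb_nonneg k i w
  nlinarith

lemma measurable_sum_alive {m : MeasurableSpace (Ω × Ω')} {k : ℕ} {f : ℕ → Ω × Ω' → ℝ}
  (hl : Measurable[m] (M.len k)) (hf : ∀ i, Measurable[m] (f i)) :
  Measurable[m] fun w => ∑ i ∈ range (M.len k w), f i w :=
  @measurable_natIndex _ _ m _ (fun N w => ∑ i ∈ range N, f i w)
    (fun _ => measurable_fun_sum _ fun i _ => hf i) _ hl

include hφ in
lemma measurable_jump (k : ℕ) : Measurable[M.exceptU (k + 2)] (M.jump φ k) := by
  have h := M.exceptU_mono (Nat.le_succ (k + 1))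
  refine Measurable.const_mul (M.measurable_sum_alive ((M.measurable_len_exceptU k).mono h le_rfl)
    fun i => ?_) _
  exact (hφ.comp ((M.measurable_pos_exceptU k i).mono h le_rfl)).mul
    ((M.bddMeas_innov k i).mono (M.stepSigma_le_exceptU k _)).1

include hφ in
lemma measurable_jumpVar (k : ℕ) : Measurable[M.exceptU (k + 1)] (M.jumpVar φ k) := by
  refine Measurable.const_mul (M.measurable_sum_alive (M.measurable_len_exceptU k) fun i => ?_) _
  have hb := M.measurable_branchProb k i
  exact ((hφ.comp (M.measurable_pos_exceptU k i)).pow_const 2).mul (hb.sub (hb.pow_const 2))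

lemma integrable_of_sq_le {Z : Ω × Ω' → ℝ} (hZ : Measurable Z) {k : ℕ} {C : ℝ}
  (h : ∀ w, |Z w| ≤ C * (M.len k w : ℝ) ^ 2) : Integrable Z M.Phat :=
  ((M.integrable_len_sq k).const_mul C).mono' hZ.aestronglyMeasurable (.of_forall h)

include hΦ in
lemma jump_sq_le (k : ℕ) (w) :
  |M.jump φ k w ^ 2| ≤ ((M.n : ℝ)⁻¹ * Φ) ^ 2 * (M.len k w : ℝ) ^ 2 := by
  rw [abs_pow, ← mul_pow]
  refine pow_le_pow_left₀ (abs_nonneg _) ((M.abs_jump_le hΦ k w).trans (le_of_eq (by ring))) 2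

include hφ hΦ in
lemma integrable_jump_sq (k : ℕ) : Integrable (fun w => M.jump φ k w ^ 2) M.Phat :=
  M.integrable_of_sq_le (((M.measurable_jump hφ k).mono (M.exceptU_le _) le_rfl).pow_const 2)
    (M.jump_sq_le hΦ k)

include hφ hΦ in
lemma integrable_jump (k : ℕ) : Integrable (M.jump φ k) M.Phat := by
  refine (((M.integrable_len k).mul_const Φ).const_mul ((M.n : ℝ)⁻¹)).mono'
    ((M.measurable_jump hφ k).mono (M.exceptU_le _) le_rfl).aestronglyMeasurable
    (.of_forall fun w => M.abs_jump_le hΦ k w)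

include hφ hΦ in
lemma integrable_jumpVar (k : ℕ) : Integrable (M.jumpVar φ k) M.Phat := by
  refine ((M.integrable_len k).const_mul ((Φ / M.n) ^ 2)).mono'
    ((M.measurable_jumpVar hφ k).mono (M.exceptU_le _) le_rfl).aestronglyMeasurable
    (.of_forall fun w => ?_)
  rw [norm_eq_abs, abs_of_nonneg (M.jumpVar_nonneg k w)]
  refine (M.jumpVar_le hΦ k w).trans (mul_le_mul_of_nonneg_left ?_ (sq_nonneg _))
  exact (sum_le_card_nsmul _ _ 1 fun i _ => M.branchProb_le_one k i w).trans (by simp)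

lemma tendsto_integral_trunc {Z : Ω × Ω' → ℝ} (hZ : Integrable Z M.Phat) (k : ℕ) :
  Tendsto (fun L : ℕ => ∫ w, (M.len k ⁻¹' Iic L).indicator (fun _ => 1) w * Z w ∂M.Phat) atTop
    (𝓝 (∫ w, Z w ∂M.Phat)) := by
  refine tendsto_integral_of_dominated_convergence (fun w => |Z w|) (fun L => ?_) hZ.abs
    (fun L => .of_forall fun w => ?_) (.of_forall fun w => ?_)
  · exact ((measurable_const.indicator
      (M.measurable_len k MeasurableSet.of_discrete)).aestronglyMeasurable).mul hZ.1
  · rw [norm_eq_abs, abs_mul]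
    by_cases h : w ∈ M.len k ⁻¹' Iic L <;> simp [h]
  · refine tendsto_const_nhds.congr' ?_
    filter_upwards [eventually_ge_atTop (M.len k w)] with L hL
    rw [indicator_of_mem (show w ∈ M.len k ⁻¹' Iic L from hL), one_mul]

include hφ hΦ in
lemma condExp_jump_sq (k : ℕ) :
  M.Phat[fun w => M.jump φ k w ^ 2 | M.exceptU (k + 1)] =ᵐ[M.Phat] M.jumpVar φ k := by
  have hle := M.exceptU_le (k + 1)
  refine (ae_eq_condExp_of_forall_setIntegral_eq hle (M.integrable_jump_sq hφ hΦ k)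
    (fun A _ _ => (M.integrable_jumpVar hφ hΦ k).integrableOn) (fun A hA _ => ?_)
    (M.measurable_jumpVar hφ k).stronglyMeasurable.aestronglyMeasurable).symm
  have hA' : MeasurableSet A := hle _ hA
  rw [← integral_indicator hA', ← integral_indicator hA']
  refine tendsto_nhds_unique (M.tendsto_integral_trunc
    ((M.integrable_jumpVar hφ hΦ k).indicator hA') k) ?_
  refine (M.tendsto_integral_trunc ((M.integrable_jump_sq hφ hΦ k).indicator hA') k).congr
    fun L => ?_
  have hc : ∀ i, BddMeas (M.exceptU (k + 1)) fun w =>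
      A.indicator (fun _ => 1) w * M.jumpCoef φ k (Iic L) i w := fun i =>
    (BddMeas.indicator hA).mul (M.bddMeas_jumpCoef hφ hΦ k _ i)
  have h := integral_innovSum_sq hc L
  have hi : ∀ (B : Set (Ω × Ω')) w, B.indicator (fun _ => (1 : ℝ)) w ^ 2
      = B.indicator (fun _ => 1) w := fun B w => by by_cases hB : w ∈ B <;> simp [hB]
  have e1 : ∀ w, (∑ i ∈ range L, A.indicator (fun _ => 1) w * M.jumpCoef φ k (Iic L) i w
      * M.innov k i w) ^ 2 = (M.len k ⁻¹' Iic L).indicator (fun _ => 1) w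
        * A.indicator (fun w => M.jump φ k w ^ 2) w := fun w => by
    simp_rw [mul_assoc]
    rw [← mul_sum, M.sum_jumpCoef_mul_innov k (fun m (hm : m ∈ Iic L) => hm), mul_pow, mul_pow, hi, hi]
    by_cases hB : w ∈ A <;> simp [hB]
  have e2 : ∀ w, ∑ i ∈ range L, (A.indicator (fun _ => 1) w * M.jumpCoef φ k (Iic L) i w) ^ 2
      * (M.branchProb k i w - M.branchProb k i w ^ 2) = (M.len k ⁻¹' Iic L).indicator (fun _ => 1) w
        * A.indicator (M.jumpVar φ k) w := fun w => by
    simp_rw [mul_pow, mul_assoc]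
    rw [← mul_sum, M.sum_jumpCoef_sq k (fun m (hm : m ∈ Iic L) => hm), hi]
    by_cases hB : w ∈ A <;> simp [hB]
  simp_rw [e1, e2] at h
  exact h

include hφ hΦ in
lemma integral_mul_jump (k : ℕ) {g : Ω × Ω' → ℝ}
  (hg : BddMeas (M.exceptU (k + 1)) g) : ∫ w, g w * M.jump φ k w ∂M.Phat = 0 := by
  obtain ⟨C, hC⟩ := hg.2
  have hgm : Measurable g := hg.1.mono (M.exceptU_le _) le_rfl
  have hint : Integrable (fun w => g w * M.jump φ k w) M.Phat :=
    (M.integrable_jump hφ hΦ k).bdd_mul hgm.aestronglyMeasurable (.of_forall fun w => hC w)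
  refine tendsto_nhds_unique (M.tendsto_integral_trunc hint k) ?_
  refine tendsto_const_nhds.congr fun L => ?_
  have h := integral_mul_innovSum (fun i => M.bddMeas_jumpCoef hφ hΦ k (Iic L) i) L hg
  simp_rw [M.sum_jumpCoef_mul_innov k (fun m (hm : m ∈ Iic L) => hm)] at h
  rw [← h]
  congr 1
  ext1 w
  ring

/-! ### Moments of the compensated squared jumps -/

/-- The compensated square of the contribution of the branching at time `t_{k+1}`. -/
def jumpDev (φ : Vec d₁ → ℝ) (k : ℕ) (w : Ω × Ω') : ℝ := M.jump φ k w ^ 2 - M.jumpVar φ k w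

include hφ in
lemma measurable_jumpDev (k : ℕ) : Measurable[M.exceptU (k + 2)] (M.jumpDev φ k) :=
  ((M.measurable_jump hφ k).pow_const 2).sub
    ((M.measurable_jumpVar hφ k).mono (M.exceptU_mono (Nat.le_succ _)) le_rfl)

include hΦ in
lemma jumpVar_le_len (k : ℕ) (w) : M.jumpVar φ k w ≤ (Φ / M.n) ^ 2 * M.len k w := by
  refine (M.jumpVar_le hΦ k w).trans (mul_le_mul_of_nonneg_left ?_ (sq_nonneg _))
  exact (sum_le_card_nsmul _ _ 1 fun i _ => M.branchProb_le_one k i w).trans (by simp)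

/-- The compensated squared jumps, on the event of at most `L` particles. -/
def truncDev (φ : Vec d₁ → ℝ) (L k : ℕ) (w : Ω × Ω') : ℝ :=
  (M.len k ⁻¹' Iic L).indicator (M.jumpDev φ k) w

include hφ hΦ in
lemma bddMeas_truncDev (L k : ℕ) : BddMeas (M.exceptU (k + 2)) (M.truncDev φ L k) := by
  have hΦ0 : 0 ≤ Φ := (abs_nonneg _).trans (hΦ 0)
  refine ⟨Measurable.indicator (m := M.exceptU (k + 2)) (M.measurable_jumpDev hφ k)
    (((M.measurable_len_exceptU k).mono (M.exceptU_mono (Nat.le_succ _)) le_rfl)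
      MeasurableSet.of_discrete), ((M.n : ℝ)⁻¹ * Φ) ^ 2 * (L : ℝ) ^ 2 + (Φ / M.n) ^ 2 * L,
    fun w => ?_⟩
  unfold truncDev
  by_cases h : w ∈ M.len k ⁻¹' Iic L
  · rw [indicator_of_mem h]
    have hL : (M.len k w : ℝ) ≤ L := by exact_mod_cast h
    refine (abs_sub _ _).trans (add_le_add ((M.jump_sq_le hΦ k w).trans ?_) ?_)
    · gcongr
    · rw [abs_of_nonneg (M.jumpVar_nonneg k w)]
      exact (M.jumpVar_le_len hΦ k w).trans (by gcongr)
  · rw [indicator_of_notMem h, abs_zero]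
    positivity

include hφ hΦ in
lemma integral_mul_truncDev (L k : ℕ) {g : Ω × Ω' → ℝ} (hg : BddMeas (M.exceptU (k + 1)) g) :
  ∫ w, g w * M.truncDev φ L k w ∂M.Phat = 0 := by
  have hle := M.exceptU_le (k + 1)
  set g' : Ω × Ω' → ℝ := fun w => g w * (M.len k ⁻¹' Iic L).indicator (fun _ => 1) w with hg'
  have hgm : BddMeas (M.exceptU (k + 1)) g' :=
    hg.mul (BddMeas.indicator (M.measurable_len_exceptU k MeasurableSet.of_discrete))
  obtain ⟨C, hC⟩ := hgm.2
  have hgm' : Measurable g' := hgm.1.mono hle le_rfl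
  have hb : ∀ Z, Integrable Z M.Phat → Integrable (fun w => g' w * Z w) M.Phat := fun Z hZ =>
    hZ.bdd_mul hgm'.aestronglyMeasurable (.of_forall fun w => hC w)
  have h1 := hb _ (M.integrable_jump_sq hφ hΦ k)
  have h2 := condExp_mul_of_stronglyMeasurable_left (μ := M.Phat) (m := M.exceptU (k + 1))
    (Measurable.stronglyMeasurable hgm.1) h1 (M.integrable_jump_sq hφ hΦ k)
  have h3 : ∫ w, g' w * M.jump φ k w ^ 2 ∂M.Phat = ∫ w, g' w * M.jumpVar φ k w ∂M.Phat := by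
    refine (integral_condExp hle).symm.trans (integral_congr_ae (h2.trans ?_))
    filter_upwards [M.condExp_jump_sq hφ hΦ k] with w hω
    rw [Pi.mul_apply, hω]
  have e : ∀ w, g w * M.truncDev φ L k w = g' w * M.jump φ k w ^ 2 - g' w * M.jumpVar φ k w :=
    fun w => by
      simp only [truncDev, jumpDev, hg']
      by_cases h : w ∈ M.len k ⁻¹' Iic L
      · simp only [indicator_of_mem h, jumpDev]; ring
      · simp only [indicator_of_notMem h]; ring
  simp_rw [e]
  rw [integral_sub h1 (hb _ (M.integrable_jumpVar hφ hΦ k)), h3, sub_self]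

/-- The constant in the moment bound for one compensated squared jump. -/
def devConst (r : ℝ) : ℝ := 2 ^ (r - 1) * (((2 * expandConst (2 * r)) ^ r + 1) * 5)

lemma devConst_pos {r : ℝ} (hr : 1 ≤ r) : 0 < devConst r := by
  have := one_le_expandConst (show 2 ≤ 2 * r by linarith)
  unfold devConst
  positivity

lemma measurableSet_len_eq (k m : ℕ) : MeasurableSet[M.observerSigma (M.tk k)] (M.len k ⁻¹' {m}) :=
  M.measurable_len_observer le_rfl MeasurableSet.of_discrete

include hφ hΦ in
lemma integral_jump_rpow_le {r : ℝ} (hr : 1 ≤ r)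
  (k m : ℕ) : ∫ w, (M.len k ⁻¹' {m}).indicator (fun _ => 1) w * (M.jump φ k w ^ 2) ^ r ∂M.Phat
    ≤ (2 * expandConst (2 * r)) ^ r * ((m : ℝ) ^ r * ((Φ / M.n) ^ (2 * r)
      * (5 * √(M.ε * max M.hSup 1) * M.Phat.real (M.len k ⁻¹' {m})))) := by
  have hΦ0 : 0 ≤ Φ := (abs_nonneg _).trans (hΦ 0)
  have h := integral_abs_innovSum_rpow_le (fun i => M.bddMeas_jumpCoef hφ hΦ k {m} i) hr
    (K := (Φ / M.n) ^ (2 * r)) (M.measurableSet_len_eq k m) (fun i w => ?_) m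
  · refine le_trans (le_of_eq (integral_congr_ae (.of_forall fun w => ?_))) h
    simp only
    rw [M.sum_jumpCoef_mul_innov k (fun m' (hm : m' ∈ ({m} : Set ℕ)) => (le_of_eq hm))]
    by_cases hω : w ∈ M.len k ⁻¹' {m}
    · rw [indicator_of_mem hω, one_mul, one_mul, ← sq_abs, ← rpow_natCast,
        ← rpow_mul (abs_nonneg _)]
      norm_num
    · rw [indicator_of_notMem hω, zero_mul, zero_mul, abs_zero, zero_rpow (by linarith)]
  · unfold jumpCoef
    by_cases hω : w ∈ {w | i < M.len k w} ∩ M.len k ⁻¹' {m}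
    · rw [indicator_of_mem hω, indicator_of_mem hω.2, mul_one, abs_mul,
        abs_of_nonneg (by positivity : (0 : ℝ) ≤ (M.n : ℝ)⁻¹), div_eq_inv_mul]
      have := hΦ (M.pos k i w)
      gcongr
    · rw [indicator_of_notMem hω, abs_zero, zero_rpow (by linarith)]
      exact mul_nonneg (by positivity) (indicator_nonneg (fun _ _ => zero_le_one) w)

include hφ hΦ in
lemma integral_jumpVar_rpow_le {r : ℝ} (hr : 1 ≤ r)
  (k m : ℕ) : ∫ w, (M.len k ⁻¹' {m}).indicator (fun _ => 1) w * M.jumpVar φ k w ^ r ∂M.Phat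
    ≤ (m : ℝ) ^ r * ((Φ / M.n) ^ (2 * r)
      * (5 * √(M.ε * max M.hSup 1) * M.Phat.real (M.len k ⁻¹' {m}))) := by
  have hΦ0 : 0 ≤ Φ := (abs_nonneg _).trans (hΦ 0)
  set I : Ω × Ω' → ℝ := (M.len k ⁻¹' {m}).indicator fun _ => 1 with hI
  have hIm : BddMeas (M.observerSigma (M.tk k)) I := BddMeas.indicator (M.measurableSet_len_eq k m)
  have hI0 : ∀ w, 0 ≤ I w := fun w => indicator_nonneg (fun _ _ => zero_le_one) w
  have hIm' := hIm.mono (M.observerSigma_le _)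
  have hb : ∀ i, BddMeas Prod.instMeasurableSpace (M.branchProb k i) := fun i =>
    (M.bddMeas_branchProb k i).mono (M.exceptU_le _)
  have hpt : ∀ w, I w * M.jumpVar φ k w ^ r ≤ (Φ / M.n) ^ (2 * r) * (m : ℝ) ^ (r - 1)
      * ∑ i ∈ range m, I w * M.branchProb k i w := fun w => by
    by_cases hω : w ∈ M.len k ⁻¹' {m}
    · have hm : M.len k w = m := hω
      simp only [hI, indicator_of_mem hω, one_mul]
      have h1 := M.jumpVar_le hΦ k w
      rw [hm] at h1
      refine (rpow_le_rpow (M.jumpVar_nonneg k w) h1 (by linarith)).trans ?_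
      have h2 : 0 ≤ ∑ i ∈ range m, M.branchProb k i w :=
        sum_nonneg fun i _ => M.branchProb_nonneg k i w
      rw [mul_rpow (sq_nonneg _) h2, ← rpow_natCast, ← rpow_mul (by positivity)]
      rw [mul_assoc]
      refine mul_le_mul_of_nonneg_left ?_ (by positivity)
      refine (rpow_sum_range_le hr _ (fun i => M.branchProb_nonneg k i w) m).trans ?_
      refine mul_le_mul_of_nonneg_left (sum_le_sum fun i _ => ?_) (by positivity)
      exact Real.rpow_le_self_of_le_one (M.branchProb_nonneg k i w) (M.branchProb_le_one k i w) hr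
    · simp [hI, indicator_of_notMem hω]
  have hsum : BddMeas Prod.instMeasurableSpace fun w => ∑ i ∈ range m, I w * M.branchProb k i w :=
    BddMeas.sum fun i _ => hIm'.mul (hb i)
  calc ∫ w, I w * M.jumpVar φ k w ^ r ∂M.Phat
      ≤ ∫ w, (Φ / M.n) ^ (2 * r) * (m : ℝ) ^ (r - 1)
        * ∑ i ∈ range m, I w * M.branchProb k i w ∂M.Phat :=
        integral_mono_of_nonneg (.of_forall fun w =>
          mul_nonneg (hI0 w) (rpow_nonneg (M.jumpVar_nonneg k w) _))
          (hsum.const_mul _).int (.of_forall hpt)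
    _ = (Φ / M.n) ^ (2 * r) * (m : ℝ) ^ (r - 1)
        * ∑ i ∈ range m, ∫ w, I w * M.branchProb k i w ∂M.Phat := by
        rw [integral_const_mul, integral_finsetSum _ fun i _ => (hIm'.mul (hb i)).int]
    _ ≤ (Φ / M.n) ^ (2 * r) * (m : ℝ) ^ (r - 1)
        * (m • (5 * √(M.ε * max M.hSup 1) * M.Phat.real (M.len k ⁻¹' {m}))) := by
        refine mul_le_mul_of_nonneg_left ?_ (by positivity)
        refine (sum_le_card_nsmul _ _ _ fun i _ => ?_).trans (by rw [card_range])
        refine (M.integral_mul_branchProb_le k i hIm hI0).trans (le_of_eq ?_)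
        rw [hI, integral_indicator_const _ (M.measurable_len k MeasurableSet.of_discrete)]
        simp
    _ = _ := by
        rw [nsmul_eq_mul]
        rcases Nat.eq_zero_or_pos m with rfl | hm
        · simp [zero_rpow (show r ≠ 0 by linarith)]
        · have : (m : ℝ) ^ r = (m : ℝ) ^ (r - 1) * m := by
            rw [← Real.rpow_add_one (by positivity)]
            ring_nf
          rw [this]
          ring

include hφ hΦ in
lemma lintegral_jumpDev_rpow_le {r : ℝ} (hr : 1 ≤ r)
  (k : ℕ) : ∫⁻ w, ofReal (|M.jumpDev φ k w| ^ r) ∂M.Phat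
    ≤ ofReal (devConst r * (√(M.ε * max M.hSup 1) * (Φ / M.n) ^ (2 * r)))
      * ∫⁻ w, ofReal ((M.len k w : ℝ) ^ r) ∂M.Phat := by
  have hΦ0 : 0 ≤ Φ := (abs_nonneg _).trans (hΦ 0)
  set A : ℕ → Set (Ω × Ω') := fun m => M.len k ⁻¹' {m} with hA
  have hAm : ∀ m, MeasurableSet (A m) := fun m => M.measurable_len k MeasurableSet.of_discrete
  have hU : (⋃ m, A m) = univ := by
    ext w
    simp [hA]
  have hdis : Pairwise (Function.onFun Disjoint A) := fun i j hij =>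
    Disjoint.preimage _ (by simpa using hij)
  have hdec : ∀ f : Ω × Ω' → ℝ≥0∞, ∫⁻ w, f w ∂M.Phat = ∑' m, ∫⁻ w in A m, f w ∂M.Phat := fun f => by
    rw [← lintegral_iUnion hAm hdis, hU, Measure.restrict_univ]
  rw [hdec, hdec, ← ENNReal.tsum_mul_left]
  refine ENNReal.tsum_le_tsum fun m => ?_
  have hJm : Measurable fun w => M.jump φ k w :=
    (M.measurable_jump hφ k).mono (M.exceptU_le _) le_rfl
  have hVm : Measurable fun w => M.jumpVar φ k w :=
    (M.measurable_jumpVar hφ k).mono (M.exceptU_le _) le_rfl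
  set I : Ω × Ω' → ℝ := (A m).indicator fun _ => 1 with hI
  have hIm : Measurable I := measurable_const.indicator (hAm m)
  have hI0 : ∀ w, 0 ≤ I w := fun w => indicator_nonneg (fun _ _ => zero_le_one) w
  have hJb : BddMeas Prod.instMeasurableSpace fun w => I w * (M.jump φ k w ^ 2) ^ r := by
    refine ⟨hIm.mul ((hJm.pow_const 2).pow_const r), (((M.n : ℝ)⁻¹ * Φ) ^ 2 * (m : ℝ) ^ 2) ^ r,
      fun w => ?_⟩
    by_cases hω : w ∈ A m
    · have h1 := M.jump_sq_le hΦ k w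
      rw [show M.len k w = m from hω, abs_of_nonneg (sq_nonneg _)] at h1
      simp only [hI]
      rw [indicator_of_mem hω, one_mul, abs_of_nonneg (by positivity)]
      exact rpow_le_rpow (sq_nonneg _) h1 (by linarith)
    · simp only [hI]
      rw [indicator_of_notMem hω, zero_mul, abs_zero]
      positivity
  have hVb : BddMeas Prod.instMeasurableSpace fun w => I w * M.jumpVar φ k w ^ r := by
    refine ⟨hIm.mul (hVm.pow_const r), ((Φ / M.n) ^ 2 * m) ^ r, fun w => ?_⟩
    by_cases hω : w ∈ A m
    · have h1 := M.jumpVar_le_len hΦ k w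
      rw [show M.len k w = m from hω] at h1
      simp only [hI]
      rw [indicator_of_mem hω, one_mul, abs_of_nonneg (rpow_nonneg (M.jumpVar_nonneg k w) r)]
      exact rpow_le_rpow (M.jumpVar_nonneg k w) h1 (by linarith)
    · simp only [hI]
      rw [indicator_of_notMem hω, zero_mul, abs_zero]
      positivity
  have hpt : ∀ w, I w * |M.jumpDev φ k w| ^ r
      ≤ 2 ^ (r - 1) * (I w * (M.jump φ k w ^ 2) ^ r + I w * M.jumpVar φ k w ^ r) := fun w => by
    rw [← mul_add, mul_left_comm]
    refine mul_le_mul_of_nonneg_left ?_ (hI0 w)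
    refine (rpow_le_rpow (abs_nonneg _) (abs_sub _ _) (by linarith)).trans ?_
    rw [abs_of_nonneg (sq_nonneg _), abs_of_nonneg (M.jumpVar_nonneg k w)]
    have h := NNReal.rpow_add_le_mul_rpow_add_rpow ⟨_, sq_nonneg (M.jump φ k w)⟩
      ⟨_, M.jumpVar_nonneg (φ := φ) k w⟩ hr
    exact_mod_cast h
  have h1 : ∫⁻ w in A m, ofReal (|M.jumpDev φ k w| ^ r) ∂M.Phat
      ≤ ofReal (∫ w, 2 ^ (r - 1) * (I w * (M.jump φ k w ^ 2) ^ r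
        + I w * M.jumpVar φ k w ^ r) ∂M.Phat) := by
    rw [ofReal_integral_eq_lintegral_ofReal ((hJb.add hVb).const_mul _).int
      (.of_forall fun w => (mul_nonneg (hI0 w)
        (rpow_nonneg (abs_nonneg _) r)).trans (hpt w)), ← lintegral_indicator (hAm m)]
    refine lintegral_mono fun w => ?_
    refine le_trans (le_of_eq ?_) (ofReal_le_ofReal (hpt w))
    by_cases hω : w ∈ A m
    · simp [hI, hω]
    · simp [hI, hω]
  refine h1.trans ?_
  have h2 := M.integral_jump_rpow_le hφ hΦ hr k m
  have h3 := M.integral_jumpVar_rpow_le hφ hΦ hr k m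
  have h4 : ∫⁻ w in A m, ofReal ((M.len k w : ℝ) ^ r) ∂M.Phat
      = ofReal ((m : ℝ) ^ r * M.Phat.real (A m)) := by
    have h5 : ∫⁻ w in A m, ofReal ((M.len k w : ℝ) ^ r) ∂M.Phat
        = ∫⁻ w in A m, ofReal ((m : ℝ) ^ r) ∂M.Phat :=
      setLIntegral_congr_fun (hAm m) fun w hω => by rw [show M.len k w = m from hω]
    rw [h5, setLIntegral_const, ofReal_mul (by positivity), ofReal_measureReal]
  rw [h4, ← ofReal_mul (mul_nonneg (devConst_pos hr).le (by positivity)),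
    integral_const_mul, integral_add hJb.int hVb.int]
  refine ofReal_le_ofReal ?_
  refine (mul_le_mul_of_nonneg_left (add_le_add h2 h3) (by positivity)).trans (le_of_eq ?_)
  rw [devConst]
  ring

include hφ hΦ in
lemma lintegral_sum_jumpDev_rpow_le {r : ℝ} (hr : 2 ≤ r) (a m : ℕ) (f : ℕ → ℝ) {B : ℝ} (hB : 0 ≤ B)
  (h : ∀ j < m, ∫⁻ w, ofReal (|M.jumpDev φ (a + j) w| ^ r) ∂M.Phat ≤ ofReal B) :
  ∫⁻ w, ofReal (|∑ j ∈ range m, f j * M.jumpDev φ (a + j) w| ^ r) ∂M.Phat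
    ≤ ofReal ((2 * expandConst r) ^ (r / 2) * (∑ j ∈ range m, f j ^ 2) ^ (r / 2) * B) := by
  have hr0 : 0 < r := by linarith
  have hK := one_le_expandConst hr
  set D : ℕ → ℕ → Ω × Ω' → ℝ := fun L j w => f j * M.truncDev φ L (a + j) w with hD
  have hDm : ∀ L j, BddMeas (M.exceptU (a + j + 2)) (D L j) := fun L j =>
    (M.bddMeas_truncDev hφ hΦ L (a + j)).const_mul _
  have htr : ∀ L k w, |M.truncDev φ L k w| ≤ |M.jumpDev φ k w| := fun L k w => by
    unfold truncDev
    by_cases hω : w ∈ M.len k ⁻¹' Iic L <;> simp [hω]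
  have hmono : Monotone fun j => M.exceptU (a + j + 1) := fun i j hij => M.exceptU_mono (by omega)
  have hDi : ∀ L, ∀ j < m, (∫ w, |D L j w| ^ r ∂M.Phat) ^ (2 / r) ≤ B ^ (2 / r) * f j ^ 2 :=
    fun L j hj => by
      have h1 : ∫ w, |M.truncDev φ L (a + j) w| ^ r ∂M.Phat ≤ B := by
        have hb := ((M.bddMeas_truncDev hφ hΦ L (a + j)).mono (M.exceptU_le _)).abs_rpow hr0.le
        refine (ENNReal.ofReal_le_ofReal_iff hB).1 ?_
        rw [ofReal_integral_eq_lintegral_ofReal hb.int (.of_forall fun w => by positivity)]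
        refine (lintegral_mono fun w => ofReal_le_ofReal ?_).trans (h j hj)
        exact rpow_le_rpow (abs_nonneg _) (htr _ _ _) hr0.le
      have e : ∫ w, |D L j w| ^ r ∂M.Phat
          = |f j| ^ r * ∫ w, |M.truncDev φ L (a + j) w| ^ r ∂M.Phat := by
        rw [← integral_const_mul]
        simp only [hD, abs_mul, mul_rpow (abs_nonneg _) (abs_nonneg _)]
      have h2 : 0 ≤ ∫ w, |M.truncDev φ L (a + j) w| ^ r ∂M.Phat :=
        integral_nonneg fun w => by positivity
      rw [e, mul_rpow (by positivity) h2, ← rpow_mul (abs_nonneg _),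
        mul_div_cancel₀ _ hr0.ne', Real.rpow_two, sq_abs, mul_comm]
      gcongr
  have hbound : ∀ L, ∫⁻ w, ofReal (|∑ j ∈ range m, D L j w| ^ r) ∂M.Phat
      ≤ ofReal ((2 * expandConst r) ^ (r / 2)
        * (∑ j ∈ range m, f j ^ 2) ^ (r / 2) * B) := fun L => by
    have hsum : BddMeas Prod.instMeasurableSpace fun w => ∑ j ∈ range m, D L j w :=
      BddMeas.sum fun j _ => (hDm L j).mono (M.exceptU_le _)
    rw [← ofReal_integral_eq_lintegral_ofReal (hsum.abs_rpow hr0.le).int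
      (.of_forall fun w => by positivity)]
    refine ofReal_le_ofReal ?_
    have h1 := integral_abs_sum_rpow_le (P := M.Phat) hr (fun j => M.exceptU_le (a + j + 1)) hmono
      (hDm L) (fun j g hg => by
        simp only [hD]
        simp_rw [← mul_assoc]
        exact M.integral_mul_truncDev hφ hΦ L (a + j) (hg.mul (BddMeas.const _))) m
    refine h1.trans ?_
    have hS : 0 ≤ ∑ j ∈ range m, f j ^ 2 := sum_nonneg fun j _ => sq_nonneg _
    have e : (2 * expandConst r) ^ (r / 2) * (∑ j ∈ range m, f j ^ 2) ^ (r / 2) * B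
        = (2 * expandConst r * ∑ j ∈ range m, B ^ (2 / r) * f j ^ 2) ^ (r / 2) := by
      have hK2 : 0 ≤ 2 * expandConst r := by linarith
      have hB2 : (B ^ (2 / r)) ^ (r / 2) = B := by
        rw [← rpow_mul hB, show 2 / r * (r / 2) = 1 by field_simp, rpow_one]
      rw [← mul_sum, mul_rpow hK2 (mul_nonneg (rpow_nonneg hB _) hS),
        mul_rpow (rpow_nonneg hB _) hS, hB2]
      ring
    rw [e]
    refine rpow_le_rpow ?_ ?_ (by linarith)
    · positivity
    · exact mul_le_mul_of_nonneg_left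
        (sum_le_sum fun j hj => hDi L j (mem_range.1 hj)) (by linarith)
  have hlim : ∀ w, ∀ᶠ L in atTop, ∑ j ∈ range m, D L j w
      = ∑ j ∈ range m, f j * M.jumpDev φ (a + j) w := fun w => by
    have h1 : ∀ j ∈ range m, ∀ᶠ L in atTop, M.len (a + j) w ≤ L := fun j _ => eventually_ge_atTop _
    filter_upwards [(Finset.eventually_all _).2 h1] with L hL
    refine sum_congr rfl fun j hj => ?_
    rw [hD]
    simp only
    rw [truncDev, indicator_of_mem (show w ∈ M.len (a + j) ⁻¹' Iic L from hL j hj)]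
  have e : ∀ w, ofReal (|∑ j ∈ range m, f j * M.jumpDev φ (a + j) w| ^ r)
      = liminf (fun L => ofReal (|∑ j ∈ range m, D L j w| ^ r)) atTop := fun w => by
    refine (Tendsto.liminf_eq ?_).symm
    refine tendsto_const_nhds.congr' ?_
    filter_upwards [hlim w] with L hL
    rw [hL]
  simp_rw [e]
  refine (lintegral_liminf_le fun L => ?_).trans ?_
  · refine measurable_ofReal.comp (Measurable.pow_const (Measurable.abs ?_) r)
    exact measurable_fun_sum _ fun j _ => ((hDm L j).mono (M.exceptU_le _)).1
  · refine (liminf_le_liminf (.of_forall hbound)).trans (le_of_eq ?_)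
    exact tendsto_const_nhds.liminf_eq

/-! ### Regularity of the particle paths -/

lemma measurable_Xp (i : ℕ) (t : ℝ≥0) : Measurable fun w : Ω × Ω' => M.Xp i t w.2 :=
  ((M.stableXp i).measurable t).comp measurable_snd

lemma ae_sub_mem_span : ∀ᵐ w ∂M.Phat, ∀ i s t, M.Xp i t w.2 - M.Xp i s w.2 ∈ stableSpan M.Γ := by
  have h1 : ∀ᵐ w ∂M.Phat, ∀ i n j, M.Xp i (dyad n j) w.2 - M.Xp i 0 w.2 ∈ stableSpan M.Γ := by
    simp only [ae_all_iff]
    intro i n j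
    have h2 := M.isStableFamily.ae_mem_span (dyad n j - 0)
    rw [← (M.isDriver i).law 0 _ zero_le] at h2
    exact ae_of_ae_map ((M.measurable_Xp i _).sub (M.measurable_Xp i 0)).aemeasurable h2
  filter_upwards [h1] with w h1
  have h2 : ∀ i t, M.Xp i t w.2 - M.Xp i 0 w.2 ∈ stableSpan M.Γ := fun i t =>
    (Submodule.closed_of_finiteDimensional (stableSpan M.Γ)).mem_of_tendsto
      (((((M.stableXp i).cadlag w.2).rightCont t).tendsto.comp (tendsto_dyadAbove t)).sub_const _)
      (.of_forall fun n => h1 i n _)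
  intro i s t
  simpa using (stableSpan M.Γ).sub_mem (h2 i t) (h2 i s)

lemma ae_leftLim_eq (i : ℕ) {τ : ℝ≥0} (hτ : 0 < τ) :
  ∀ᵐ w ∂M.Phat, Function.leftLim (fun t => M.Xp i t w.2) τ = M.Xp i τ w.2 := by
  obtain ⟨u, -, hu, hlim⟩ := exists_seq_strictMono_tendsto' hτ
  have hu' : Tendsto u atTop (𝓝[<] τ) :=
    tendsto_nhdsWithin_iff.2 ⟨hlim, .of_forall fun n => (hu n).2⟩
  have : (𝓝[<] τ).NeBot := hu'.neBot
  have h1 : TendstoInMeasure M.Phat (fun n w => M.Xp i (u n) w.2) atTop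
      (fun w => Function.leftLim (fun t => M.Xp i t w.2) τ) := by
    refine tendstoInMeasure_of_tendsto_ae (fun n => (M.measurable_Xp i _).aestronglyMeasurable)
      (.of_forall fun w => ?_)
    obtain ⟨l, hl⟩ := ((M.stableXp i).cadlag w.2 τ).2
    rw [leftLim_eq_of_tendsto hl]
    exact hl.comp hu'
  have h2 : TendstoInMeasure M.Phat (fun n w => M.Xp i (u n) w.2) atTop
      (fun w => M.Xp i τ w.2) := by
    rw [tendstoInMeasure_iff_measureReal_norm]
    intro δ hδ
    rw [Metric.tendsto_nhds]
    intro η hη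
    obtain ⟨h, hh, hs⟩ := M.isStableFamily.small δ hδ (η / 2) (half_pos hη)
    have h3 : ∀ᶠ n in atTop, τ - u n < h := by
      have h4 : Tendsto (fun n => τ - u n) atTop (𝓝 (τ - τ)) := tendsto_const_nhds.sub hlim
      rw [tsub_self] at h4
      exact h4.eventually (gt_mem_nhds hh)
    filter_upwards [h3] with n hn
    have h5 := hs _ hn.le
    rw [← (M.isDriver i).law _ _ (hu n).2.le, map_measureReal_apply
      (f := fun w : Ω × Ω' => M.Xp i τ w.2 - M.Xp i (u n) w.2)
      ((M.measurable_Xp i _).sub (M.measurable_Xp i _)) (measurableSet_le measurable_const measurable_norm)] at h5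
    simp only [preimage_ofPred_eq] at h5
    simp only [norm_sub_rev (M.Xp i (u n) _)]
    rw [Real.dist_0_eq_abs, abs_of_nonneg measureReal_nonneg]
    linarith
  exact tendstoInMeasure_ae_unique h1 h2

/-- The motions have their increments in the subspace that carries the stable laws, and they do not
jump at the observation times. -/
def RegularPaths (w : Ω × Ω') : Prop := (∀ i s t, M.Xp i t w.2 - M.Xp i s w.2 ∈ stableSpan M.Γ) ∧
    ∀ i k, Function.leftLim (fun t => M.Xp i t w.2) (M.tk (k + 1)) = M.Xp i (M.tk (k + 1)) w.2

lemma ae_regularPaths : ∀ᵐ w ∂M.Phat, M.RegularPaths w :=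
  M.ae_sub_mem_span.and (ae_all_iff.2 fun i => ae_all_iff.2 fun k =>
    M.ae_leftLim_eq i (M.tk_succ_pos k))

/-- The initial position of the particle with label `i` at time `t_k`. -/
def start (k i : ℕ) (w : Ω × Ω') : Vec d₁ := (M.gen k w).getD i 0

/-- The indicator of the event that there is a particle with label `i` at time `t_k`. -/
def alive (k i : ℕ) (w : Ω × Ω') : ℝ := if i < M.len k w then 1 else 0

/-- The compensated process `φ` along the path of the particle with label `i` at time `t_k`. -/
def segN (φ g : Vec d₁ → ℝ) (k i : ℕ) : ℝ≥0 → Ω × Ω' → ℝ :=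
  segMart (fun t w => M.Xp i t w.2) φ g (M.start k i) (M.alive k i) (M.tk k) (M.tk (k + 1))

/-- The integral of `g` along the path of the particle with label `i` at time `t_k`. -/
def segD (g : Vec d₁ → ℝ) (k i : ℕ) : ℝ≥0 → Ω × Ω' → ℝ :=
  segDrift (fun t w => M.Xp i t w.2) g (M.start k i) (M.alive k i) (M.tk k) (M.tk (k + 1))

lemma abs_alive_le (k i : ℕ) (w) : |M.alive k i w| ≤ 1 := by
  unfold alive
  split_ifs <;> simp

lemma alive_of_lt {k i : ℕ} {w : Ω × Ω'} (h : i < M.len k w) : M.alive k i w = 1 := if_pos h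

lemma alive_of_not_lt {k i : ℕ} {w : Ω × Ω'} (h : ¬ i < M.len k w) : M.alive k i w = 0 := if_neg h

lemma segment_eq (φ : Vec d₁ → ℝ) (k i : ℕ) (t : ℝ≥0) (w) : M.segment φ k i t w
  = M.alive k i w * φ (M.evolve k (M.gen k w) i (clamp (M.tk k) (M.tk (k + 1)) t) w) := by
  unfold segment alive len clamp
  split_ifs <;> simp

lemma segN_eq (φ g : Vec d₁ → ℝ) (k i : ℕ) (t : ℝ≥0) (w) : M.segN φ g k i t w
  = M.segment φ k i t w - M.alive k i w * φ (M.start k i w) - M.segD g k i t w := by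
  rw [segment_eq]
  rfl

variable {M} {φ g : Vec d₁ → ℝ} {C : ℝ} (h : IsGenPair M.incrLaw φ g C)

lemma segD_of_not_alive {k i : ℕ} {w : Ω × Ω'} (h : ¬ i < M.len k w) (t : ℝ≥0) :
  M.segD g k i t w = 0 := by
  simp [segD, segDrift, alive, h]

lemma segN_of_not_alive {k i : ℕ} {w : Ω × Ω'} (h : ¬ i < M.len k w) (t : ℝ≥0) :
  M.segN φ g k i t w = 0 := by
  rw [segN_eq, segD_of_not_alive h, segment_eq, alive_of_not_lt _ h]
  simp

lemma segN_clamp (k i : ℕ) (t : ℝ≥0) (w) :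
  M.segN φ g k i t w = M.segN φ g k i (clamp (M.tk k) (M.tk (k + 1)) t) w := by
  have h : clamp (M.tk k) (M.tk (k + 1)) (clamp (M.tk k) (M.tk (k + 1)) t)
      = clamp (M.tk k) (M.tk (k + 1)) t := by
    have h1 : M.tk k ≤ clamp (M.tk k) (M.tk (k + 1)) t := le_clamp (M.tk_mono k.le_succ) t
    rw [clamp, max_eq_left h1, min_eq_left (clamp_le _ _ _)]
  unfold segN segMart segVal segDrift
  rw [h]

lemma segN_of_le {k i : ℕ} {t : ℝ≥0} (h : t ≤ M.tk k) (w) : M.segN φ g k i t w = 0 := by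
  have h1 : clamp (M.tk k) (M.tk (k + 1)) t = M.tk k := by
    rw [clamp, max_eq_right h, min_eq_left (M.tk_mono k.le_succ)]
  simp [segN, segMart, segVal, segDrift, h1]

lemma segN_of_ge {k i : ℕ} {t : ℝ≥0} (h : M.tk (k + 1) ≤ t) (w) :
  M.segN φ g k i t w = M.segN φ g k i (M.tk (k + 1)) w := by
  rw [segN_clamp, clamp, min_eq_right (h.trans (le_max_left _ _))]

include h in
lemma isBddMart_segN (k i : ℕ) :
  IsBddMart M.Phat (fun t => M.driverSigma i (max t (M.tk k))) (M.segN φ g k i)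
    (varModulus M.incrLaw φ C) := by
  have h1 := (M.informed_driverSigma i (M.tk k) k).measurableList_gen le_rfl le_rfl
  exact isBddMart_segMart (M.isDriver i) h M.isStableFamily M.α_pos (h1.2 i)
    (.ite (h1.1 (measurableSet_Ioi (a := i))) measurable_const measurable_const)
    (M.abs_alive_le k i) (M.tk_mono k.le_succ)

include h in
lemma abs_segN_le (k i : ℕ) (t : ℝ≥0) (w) :
  |M.segN φ g k i t w| ≤ 3 * C * M.alive k i w := by
  by_cases hi : i < M.len k w
  · have h1 := abs_segDrift_sub_le (W := fun t w => M.Xp i t w.2) (A := M.start k i)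
      (a := M.tk k) (b := M.tk (k + 1)) h.meas_gen h.bdd_gen (M.abs_alive_le k i)
      (fun w => (M.stableXp i).cadlag w.2) (le_clamp (M.tk_mono k.le_succ) t) w
    have h2 : (clamp (M.tk k) (M.tk (k + 1)) t : ℝ) - M.tk k ≤ 1 := by
      have h3 : (clamp (M.tk k) (M.tk (k + 1)) t : ℝ) ≤ M.tk (k + 1) := by
        exact_mod_cast clamp_le _ _ t
      have h4 : (M.ε : ℝ) ≤ 1 := by exact_mod_cast M.ε_le
      linarith [M.tk_succ_sub k]
    have h5 : segDrift (fun t w => M.Xp i t w.2) g (M.start k i) (M.alive k i) (M.tk k)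
        (M.tk (k + 1)) (M.tk k) w = 0 := by
      have : clamp (M.tk k) (M.tk (k + 1)) (M.tk k) = M.tk k := by
        rw [clamp, max_self, min_eq_left (M.tk_mono k.le_succ)]
      simp [segDrift, this]
    rw [segN_clamp, segN_eq, segment_eq, alive_of_lt _ hi, one_mul, one_mul]
    have hC := h.C_nonneg
    have h6 := h1.trans (mul_le_of_le_one_right hC h2)
    have h7 := abs_le.1 (h.bdd (M.start k i w))
    have h8 := abs_le.1 (h.bdd (M.evolve k (M.gen k w) i (clamp (M.tk k) (M.tk (k + 1))
      (clamp (M.tk k) (M.tk (k + 1)) t)) w))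
    have h9 := abs_le.1 h6
    rw [abs_le]
    unfold segD
    constructor <;> linarith
  · simp [segN_of_not_alive hi, alive_of_not_lt _ hi]

lemma RegularPaths.isCadlag_comp {w : Ω × Ω'} (hω : M.RegularPaths w)
  (h : IsGenPair M.incrLaw φ g C) (x : Vec d₁) (i : ℕ) :
  IsCadlag fun t => φ (x + M.Xp i t w.2) := by
  have hc := (M.stableXp i).cadlag w.2
  refine fun t => ⟨?_, ?_⟩
  · refine h.tendsto_comp M.isStableFamily M.α_pos (((hc t).1.tendsto).const_add x)
      (.of_forall fun s => ?_)
    simpa using hω.1 i t s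
  · obtain ⟨l, hl⟩ := (hc t).2
    rcases (𝓝[<] t).eq_or_neBot with hb | hb
    · exact ⟨0, by rw [hb]; exact tendsto_bot⟩
    refine ⟨φ (x + l), h.tendsto_comp M.isStableFamily M.α_pos (hl.const_add x)
      (.of_forall fun s => ?_)⟩
    have h1 := (Submodule.closed_of_finiteDimensional (stableSpan M.Γ)).mem_of_tendsto
      (hl.const_sub (M.Xp i s w.2)) (.of_forall fun u => hω.1 i u s)
    simpa using h1

lemma RegularPaths.pos_eq {w : Ω × Ω'} (hω : M.RegularPaths w) (k i : ℕ) :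
  M.pos k i w = M.evolve k (M.gen k w) i (M.tk (k + 1)) w := by
  rw [pos, evolveLeft, hω.2, evolve]

end FilterModel

/-! ### The decomposition of the particle system -/

lemma list_sum_map_eq {d : ℕ} (f : Vec d → ℝ) (L : List (Vec d)) :
  (L.map f).sum = ∑ i ∈ range L.length, f (L.getD i 0) := by
  induction L with
  | nil => simp
  | cons a L ih =>
    rw [List.map_cons, List.sum_cons, ih, List.length_cons, Finset.sum_range_succ', add_comm]
    simp

namespace FilterModel

variable (M)

lemma integral_μn (f : Vec d₁ → ℝ) {k : ℕ} {t : ℝ≥0} (h1 : M.tk k ≤ t) (h2 : t < M.tk (k + 1))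
  (w) : ∫ x, f x ∂(M.μn t w) = (M.n : ℝ)⁻¹ * ∑ i ∈ range (M.len k w),
    f (M.evolve k (M.gen k w) i t w) := by
  rw [μn, integral_empirical, particles, M.floor_eq h1 h2, List.map_map, ← list_sum_range]
  rfl

lemma integral_μnLeft (f : Vec d₁ → ℝ) (k : ℕ) (w) :
  ∫ x, f x ∂(M.μnLeft (k + 1) w) = (M.n : ℝ)⁻¹ * ∑ i ∈ range (M.len k w), f (M.pos k i w) := by
  rw [μnLeft, integral_empirical, particlesLeft, List.map_map, ← list_sum_range]
  rfl

lemma sum_start_succ (f : Vec d₁ → ℝ) (k : ℕ) (w) :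
  ∑ i ∈ range (M.len (k + 1) w), f (M.start (k + 1) i w) = ∑ i ∈ range (M.len k w),
        (M.offspring (k + 1) i (M.pos k i w) w : ℝ) * f (M.pos k i w) := by
  have h : ∀ m : ℕ, (((List.range m).flatMap fun i => List.replicate
      (M.offspring (k + 1) i (M.pos k i w) w) (M.pos k i w)).map f).sum
      = ∑ i ∈ range m, (M.offspring (k + 1) i (M.pos k i w) w : ℝ) * f (M.pos k i w) := by
    intro m
    induction m with
    | zero => simp
    | succ m ih =>
      rw [List.range_succ, List.flatMap_append, List.map_append, List.sum_append, ih,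
        sum_range_succ]
      simp
  exact (list_sum_map_eq f (M.gen (k + 1) w)).symm.trans (h _)

lemma jump_eq (φ : Vec d₁ → ℝ) (k : ℕ) (w) : M.jump φ k w
  = (M.n : ℝ)⁻¹ * (∑ i ∈ range (M.len (k + 1) w), φ (M.start (k + 1) i w)
      - ∑ i ∈ range (M.len k w), φ (M.pos k i w))
    - ∫ x, M.weight (k + 1) x w.1 * φ x ∂(M.μnLeft (k + 1) w) := by
  rw [integral_μnLeft, sum_start_succ, jump, ← sum_sub_distrib, ← mul_sub, ← sum_sub_distrib]
  congr 1
  exact sum_congr rfl fun i _ => by rw [innov]; ring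

variable {M} {φ g : Vec d₁ → ℝ} {C : ℝ} (h : IsGenPair M.incrLaw φ g C)

lemma intervalIntegrable_path (hg : Measurable g) (hgC : ∀ x, |g x| ≤ C) (k i : ℕ) (a b : ℝ)
  (w) : IntervalIntegrable (fun s : ℝ =>
    g (M.start k i w + (M.Xp i s.toNNReal w.2 - M.Xp i (M.tk k) w.2))) volume a b := by
  have h1 := measurable_path_time (W := fun t w => M.Xp i t w.2) (A := M.start k i)
    (a := M.tk k) (χ := fun _ => 1) ((M.stableXp i).cadlag w.2) hg
  simp only [one_mul] at h1
  exact (intervalIntegrable_const (c := C)).mono_fun h1.aestronglyMeasurable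
    (.of_forall fun u => (hgC _).trans (le_abs_self _))

lemma integral_μn_interval (hg : Measurable g) (hgC : ∀ x, |g x| ≤ C) {k : ℕ} {u : ℝ≥0}
  (h1 : M.tk k ≤ u) (h2 : u ≤ M.tk (k + 1)) (w) :
  IntervalIntegrable (fun s : ℝ => ∫ x, g x ∂(M.μn s.toNNReal w)) volume (M.tk k) u ∧
  ∫ s in (M.tk k : ℝ)..u, ∫ x, g x ∂(M.μn s.toNNReal w)
    = (M.n : ℝ)⁻¹ * ∑ i ∈ range (M.len k w), M.segD g k i u w := by
  have h1' : (M.tk k : ℝ) ≤ u := by exact_mod_cast h1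
  have hi := fun i => intervalIntegrable_path (M := M) hg hgC k i (M.tk k) u w
  have hs : IntervalIntegrable (fun s : ℝ => (M.n : ℝ)⁻¹ * ∑ i ∈ range (M.len k w),
      g (M.start k i w + (M.Xp i s.toNNReal w.2 - M.Xp i (M.tk k) w.2))) volume (M.tk k) u := by
    refine IntervalIntegrable.const_mul ?_ _
    simpa only [Finset.sum_fn] using IntervalIntegrable.sum (range (M.len k w)) fun i _ => hi i
  have hae : (fun s : ℝ => (M.n : ℝ)⁻¹ * ∑ i ∈ range (M.len k w),
      g (M.start k i w + (M.Xp i s.toNNReal w.2 - M.Xp i (M.tk k) w.2)))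
      =ᵐ[volume.restrict (uIoc (M.tk k : ℝ) u)] fun s : ℝ => ∫ x, g x ∂(M.μn s.toNNReal w) := by
    rw [uIoc_of_le h1', ← restrict_Ioo_eq_restrict_Ioc]
    filter_upwards [ae_restrict_mem measurableSet_Ioo] with s hs
    rw [M.integral_μn g (NNReal.le_toNNReal_of_coe_le hs.1.le)
      (((Real.toNNReal_lt_iff_lt_coe ((M.tk k).coe_nonneg.trans hs.1.le)).2 hs.2).trans_le h2)]
    rfl
  refine ⟨hs.congr_ae hae, ?_⟩
  rw [← intervalIntegral.integral_congr_ae_restrict hae, intervalIntegral.integral_const_mul,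
    intervalIntegral.integral_finsetSum fun i _ => hi i]
  congr 1
  refine sum_congr rfl fun i hi => ?_
  have hc : clamp (M.tk k) (M.tk (k + 1)) u = u := by rw [clamp, max_eq_left h1, min_eq_left h2]
  rw [segD, segDrift, hc, M.alive_of_lt (mem_range.1 hi)]
  simp only [one_mul]

lemma segD_of_ge {k i : ℕ} {t : ℝ≥0} (h : M.tk (k + 1) ≤ t) (w) :
  M.segD g k i t w = M.segD g k i (M.tk (k + 1)) w := by
  have h1 := M.tk_mono k.le_succ
  unfold segD segDrift clamp
  grind

lemma integral_integral_μn (hg : Measurable g) (hgC : ∀ x, |g x| ≤ C) (t : ℝ≥0) (w) :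
  ∫ s in (0 : ℝ)..t, ∫ x, g x ∂(M.μn s.toNNReal w) = (M.n : ℝ)⁻¹ * ∑ k ∈ range (⌊t / M.ε⌋₊ + 1),
        ∑ i ∈ range (M.len k w), M.segD g k i t w := by
  have key : ∀ K : ℕ, IntervalIntegrable (fun s : ℝ => ∫ x, g x ∂(M.μn s.toNNReal w)) volume 0
      (M.tk K) ∧ ∫ s in (0 : ℝ)..M.tk K, ∫ x, g x ∂(M.μn s.toNNReal w)
      = (M.n : ℝ)⁻¹ * ∑ k ∈ range K, ∑ i ∈ range (M.len k w), M.segD g k i (M.tk (k + 1)) w := by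
    intro K
    induction K with
    | zero => simp [tk_zero]
    | succ K ih =>
      have h := integral_μn_interval (M := M) hg hgC (M.tk_mono K.le_succ) le_rfl w
      exact ⟨ih.1.trans h.1, by rw [← intervalIntegral.integral_add_adjacent_intervals ih.1 h.1,
        ih.2, h.2, sum_range_succ, mul_add]⟩
  have h := integral_μn_interval (M := M) hg hgC (M.tk_floor_le t) (M.lt_tk_floor_succ t).le w
  rw [← intervalIntegral.integral_add_adjacent_intervals (key _).1 h.1, (key _).2, h.2,
    sum_range_succ, mul_add]
  congr 2
  refine sum_congr rfl fun k hk => sum_congr rfl fun i _ => (segD_of_ge ?_ w).symm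
  exact (M.le_floor_iff (k + 1) t).1 (mem_range.1 hk)

variable (M) in
/-- The martingale part of the particle system. -/
def mart (φ g : Vec d₁ → ℝ) (t : ℝ≥0) (w : Ω × Ω') : ℝ :=
  (∫ x, φ x ∂(M.μn t w)) - (∫ x, φ x ∂(M.μn 0 w))
    - (∫ s in (0 : ℝ)..t, (∫ x, g x ∂(M.μn s.toNNReal w)))
    - ∑ k ∈ Finset.Icc 1 ⌊t / M.ε⌋₊, ∫ x, M.weight k x w.1 * φ x ∂(M.μnLeft k w)

lemma sum_Icc_one (f : ℕ → ℝ) (K : ℕ) : ∑ k ∈ Finset.Icc 1 K, f k = ∑ k ∈ range K, f (k + 1) := by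
  rw [Finset.range_eq_Ico, Finset.sum_Ico_add' f 0 K 1]
  rfl

lemma RegularPaths.mart_eq {w : Ω × Ω'} (hω : M.RegularPaths w)
  (h : IsGenPair M.incrLaw φ g C) (t : ℝ≥0) : M.mart φ g t w
    = (M.n : ℝ)⁻¹ * (∑ k ∈ range (⌊t / M.ε⌋₊ + 1), ∑ i ∈ range (M.len k w), M.segN φ g k i t w)
      + ∑ k ∈ range ⌊t / M.ε⌋₊, M.jump φ k w := by
  set K := ⌊t / M.ε⌋₊ with hK
  have hN : ∀ k, ∑ i ∈ range (M.len k w), M.segN φ g k i t w = ∑ i ∈ range (M.len k w),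
          φ (M.evolve k (M.gen k w) i (clamp (M.tk k) (M.tk (k + 1)) t) w)
        - ∑ i ∈ range (M.len k w), φ (M.start k i w)
        - ∑ i ∈ range (M.len k w), M.segD g k i t w := fun k => by
    rw [← sum_sub_distrib, ← sum_sub_distrib]
    refine sum_congr rfl fun i hi => ?_
    rw [segN_eq, segment_eq, M.alive_of_lt (mem_range.1 hi), one_mul, one_mul]
  have hlt : ∀ k ∈ range K, (M.n : ℝ)⁻¹ * ∑ i ∈ range (M.len k w), M.segN φ g k i t w
      = (M.n : ℝ)⁻¹ * (∑ i ∈ range (M.len (k + 1) w), φ (M.start (k + 1) i w)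
        - ∑ i ∈ range (M.len k w), φ (M.start k i w))
        - ∫ x, M.weight (k + 1) x w.1 * φ x ∂(M.μnLeft (k + 1) w) - M.jump φ k w
        - (M.n : ℝ)⁻¹ * ∑ i ∈ range (M.len k w), M.segD g k i t w := fun k hk => by
    have hc : clamp (M.tk k) (M.tk (k + 1)) t = M.tk (k + 1) :=
      min_eq_right (((M.le_floor_iff (k + 1) t).1 (mem_range.1 hk)).trans (le_max_left _ _))
    rw [hN, jump_eq, hc]
    simp only [hω.pos_eq]
    ring
  have hc : clamp (M.tk K) (M.tk (K + 1)) t = t := by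
    rw [clamp, max_eq_left (M.tk_floor_le t), min_eq_left (M.lt_tk_floor_succ t).le]
  have h0 : ∫ x, φ x ∂(M.μn 0 w) = (M.n : ℝ)⁻¹ * ∑ i ∈ range (M.len 0 w), φ (M.start 0 i w) := by
    rw [M.integral_μn φ (k := 0) (M.tk_zero.le) (M.tk_succ_pos 0)]
    simp [evolve, start, tk_zero]
  rw [mart, integral_integral_μn h.meas_gen h.bdd_gen, sum_Icc_one, h0,
    M.integral_μn φ (M.tk_floor_le t) (M.lt_tk_floor_succ t), ← hK, sum_range_succ,
    sum_range_succ, mul_add, mul_add, hN K, hc, mul_sum (range K),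
    mul_sum (range K), sum_congr rfl hlt]
  have htel := sum_range_sub (fun k => ∑ i ∈ range (M.len k w), φ (M.start k i w)) K
  simp only [sum_sub_distrib, ← mul_sum] at htel ⊢
  linear_combination (-(M.n : ℝ)⁻¹) * htel

end FilterModel

/-! ### The martingale property -/

lemma IsCadlag.comp_mono {β : Type*} [TopologicalSpace β] {f : ℝ≥0 → β} (hf : IsCadlag f)
  {c : ℝ≥0 → ℝ≥0} (hc : Continuous c) (hm : Monotone c) : IsCadlag fun t => f (c t) := by
  refine fun t => ⟨((hf (c t)).1).comp hc.continuousWithinAt fun s hs => mem_Ici.2 (hm hs), ?_⟩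
  by_cases h : ∃ s < t, c s = c t
  · obtain ⟨s, hs, he⟩ := h
    refine ⟨f (c t), tendsto_const_nhds.congr' ?_⟩
    filter_upwards [Ioo_mem_nhdsLT hs] with u hu
    rw [le_antisymm (hm hu.2.le) (he ▸ hm hu.1.le)]
  · obtain ⟨l, hl⟩ := (hf (c t)).2
    refine ⟨l, hl.comp (tendsto_nhdsWithin_iff.2 ⟨hc.continuousWithinAt.tendsto, ?_⟩)⟩
    filter_upwards [self_mem_nhdsWithin] with s hs
    exact lt_of_le_of_ne (hm (le_of_lt hs)) fun he => h ⟨s, hs, he⟩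

lemma IsCadlag.add {f g : ℝ≥0 → ℝ} (hf : IsCadlag f) (hg : IsCadlag g) :
  IsCadlag fun t => f t + g t := fun t => by
  obtain ⟨l, hl⟩ := (hf t).2
  obtain ⟨m, hm⟩ := (hg t).2
  exact ⟨(hf t).1.add (hg t).1, l + m, hl.add hm⟩

lemma Continuous.isCadlag {f : ℝ≥0 → ℝ} (hf : Continuous f) : IsCadlag f := fun t =>
  ⟨hf.continuousWithinAt, f t, hf.continuousAt.tendsto.mono_left nhdsWithin_le_nhds⟩

lemma IsCadlag.const_mul {f : ℝ≥0 → ℝ} (hf : IsCadlag f) (c : ℝ) :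
  IsCadlag fun t => c * f t := fun t => by
  obtain ⟨l, hl⟩ := (hf t).2
  exact ⟨continuousWithinAt_const.mul (hf t).1, c * l, hl.const_mul c⟩

lemma IsCadlag.sum {ι : Type*} {s : Finset ι} {f : ι → ℝ≥0 → ℝ} (hf : ∀ i, IsCadlag (f i)) :
  IsCadlag fun t => ∑ i ∈ s, f i t := by
  choose l hl using fun i t => (hf i t).2
  exact fun t => ⟨tendsto_finsetSum _ fun i _ => (hf i t).1.tendsto,
    _, tendsto_finsetSum _ fun i _ => hl i t⟩

lemma isCadlag_jumpProc {S : Type*} (τ : ℝ≥0) (J : S → ℝ) (w : S) :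
  IsCadlag fun t => jumpProc τ J t w := by
  refine fun t => ⟨?_, ?_⟩
  · rcases le_or_gt τ t with h | h
    · exact (continuousWithinAt_const (b := J w)).congr (fun s hs => if_pos (h.trans hs)) (if_pos h)
    · exact (continuousAt_const (y := (0 : ℝ))).congr
        ((gt_mem_nhds h).mono fun s hs => (if_neg (not_le.2 hs)).symm) |>.continuousWithinAt
  · rcases lt_or_ge τ t with h | h
    · refine ⟨J w, tendsto_const_nhds.congr' ?_⟩
      filter_upwards [Ioo_mem_nhdsLT h] with s hs using (if_pos hs.1.le).symm
    · refine ⟨0, tendsto_const_nhds.congr' ?_⟩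
      filter_upwards [self_mem_nhdsWithin] with s hs
      exact (if_neg (not_le.2 (lt_of_lt_of_le hs h))).symm

lemma isCadlag_of_local {f : ℝ≥0 → ℝ}
  (h : ∀ t, ∃ b > t, ∃ f', IsCadlag f' ∧ ∀ s < b, f s = f' s) : IsCadlag f := fun t => by
  obtain ⟨b, hb, f', hf', he⟩ := h t
  have h1 : ∀ᶠ s in 𝓝 t, f' s = f s := (gt_mem_nhds hb).mono fun s hs => (he s hs).symm
  obtain ⟨l, hl⟩ := (hf' t).2
  exact ⟨(hf' t).1.congr_of_eventuallyEq (nhdsWithin_le_nhds (h1.mono fun _ h => h.symm)) (he t hb),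
    l, hl.congr' (nhdsWithin_le_nhds h1)⟩

lemma measurable_integral_empirical {d : ℕ} {S : Type*} [MeasurableSpace S] {n : ℕ}
  {L : S → List (Vec d)} (hL : MeasurableList L) {g : Vec d → ℝ} (hg : Measurable g) :
  Measurable fun w => ∫ x, g x ∂(empirical n (L w)) := by
  simp only [integral_empirical, list_sum_map_eq]
  exact (measurable_natIndex (f := fun N w => ∑ i ∈ range N, g ((L w).getD i 0))
    (fun N => measurable_fun_sum _ fun i _ => hg.comp (hL.2 i)) hL.1).const_mul _

lemma measurable_integral_integral_empirical {d : ℕ} {S : Type*} [MeasurableSpace S] {n : ℕ}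
  {L : ℝ≥0 → S → List (Vec d)} {τ : ℝ≥0} (hL : ∀ u ≤ τ, MeasurableList (L u))
  (hl : ∀ w u, ContinuousWithinAt (fun u => (L u w).length) (Ici u) u)
  (hp : ∀ i w u, ContinuousWithinAt (fun u => (L u w).getD i 0) (Ici u) u) {g : Vec d → ℝ}
  (hg : Measurable g) :
  Measurable fun w => ∫ s in (0 : ℝ)..τ, (∫ x, g x ∂(empirical n (L s.toNNReal w))) := by
  have h1 : MeasurableList fun p : ℝ≥0 × S => L (min p.1 τ) p.2 :=
    ⟨measurable_uncurry_min (W := fun u w => (L u w).length) (fun u hu => (hL u hu).1)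
      fun w u _ => hl w u, fun i => measurable_uncurry_min (W := fun u w => (L u w).getD i 0)
      (fun u hu => (hL u hu).2 i) fun w u _ => hp i w u⟩
  have h2 : Measurable fun p : ℝ × S => ∫ x, g x ∂(empirical n (L (min p.1.toNNReal τ) p.2)) :=
    (measurable_integral_empirical h1 hg).comp
      (measurable_real_toNNReal.comp measurable_fst |>.prodMk measurable_snd)
  have h3 : (fun w => ∫ s in (0 : ℝ)..τ, (∫ x, g x ∂(empirical n (L s.toNNReal w))))
      = fun w => ∫ s in Ioc (0 : ℝ) τ, (∫ x, g x ∂(empirical n (L (min s.toNNReal τ) w))) := by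
    ext w
    rw [intervalIntegral.integral_of_le τ.coe_nonneg]
    refine setIntegral_congr_fun measurableSet_Ioc fun s hs => ?_
    rw [min_eq_left (toNNReal_le_iff_le_coe.2 hs.2)]
  rw [h3]
  exact h2.stronglyMeasurable.integral_prod_left'.measurable

lemma IsBddMart.integral_mul_sub_of_right {S : Type*} [m0 : MeasurableSpace S] {P : Measure S}
  [IsProbabilityMeasure P] {F : ℝ≥0 → MeasurableSpace S} {N : ℝ≥0 → S → ℝ} {w : ℝ≥0 → ℝ}
  (h : IsBddMart P F N w) {s t : ℝ≥0} (hst : s ≤ t) {G : S → ℝ}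
  (hG : ∀ u, s < u → BddMeas (F u) G) : ∫ o, G o * (N t o - N s o) ∂P = 0 := by
  rcases hst.eq_or_lt with rfl | hst
  · simp
  have hG0 : BddMeas m0 G := (hG t hst).mono (h.le t)
  obtain ⟨C, hC⟩ := hG0.2
  have hC0 : 0 ≤ C := by
    obtain ⟨o⟩ : Nonempty S := P.nonempty_of_neZero
    exact (abs_nonneg _).trans (hC o)
  refine abs_eq_zero.1 (le_antisymm (le_of_forall_pos_le_add fun η hη => ?_) (abs_nonneg _))
  set κ := η / (C + 1) with hκ
  have hκ0 : 0 < κ := by positivity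
  obtain ⟨δ, hδ, hw⟩ := h.w_small (κ ^ 2) (by positivity)
  set u := min t (s + δ) with hu
  have hsu : s < u := lt_min hst (lt_add_of_pos_right s hδ)
  have hN := fun t => h.bddMeas t
  have h1 := h.orth u t (min_le_left _ _) G (hG u hsu)
  have h2 : ∫ o, G o * (N t o - N s o) ∂P = ∫ o, G o * (N u o - N s o) ∂P := by
    rw [← sub_eq_zero, ← integral_sub (hG0.mul ((hN t).sub (hN s))).int
      (hG0.mul ((hN u).sub (hN s))).int, ← h1]
    ring
  have h3 : ∫ o, (N u o - N s o) ^ 2 ∂P ≤ κ ^ 2 :=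
    (h.integral_sub_sq_le hsu.le).trans ((h.w_mono (tsub_le_iff_left.2 (min_le_right _ _))).trans hw)
  rw [h2, zero_add]
  have hi : Integrable (fun o => C * ((κ + κ⁻¹ * (N u o - N s o) ^ 2) / 2)) P :=
    ((((integrable_const κ).add ((((hN u).sub (hN s)).pow 2).int.const_mul κ⁻¹)).div_const
      2).const_mul C)
  calc |∫ o, G o * (N u o - N s o) ∂P| ≤ ∫ o, |G o * (N u o - N s o)| ∂P :=
        abs_integral_le_integral_abs
    _ ≤ ∫ o, C * ((κ + κ⁻¹ * (N u o - N s o) ^ 2) / 2) ∂P := by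
        refine integral_mono (hG0.mul ((hN u).sub (hN s))).abs.int hi fun o => ?_
        simp only [abs_mul]
        refine mul_le_mul (hC o) ?_ (abs_nonneg _) hC0
        have h4 : 0 ≤ κ⁻¹ * (|N u o - N s o| - κ) ^ 2 := by positivity
        have h5 : κ⁻¹ * (|N u o - N s o| - κ) ^ 2
            = κ⁻¹ * (N u o - N s o) ^ 2 - 2 * |N u o - N s o| + κ := by
          grind
        linarith
    _ = C * ((κ + κ⁻¹ * ∫ o, (N u o - N s o) ^ 2 ∂P) / 2) := by
        rw [integral_const_mul, integral_div, integral_add (integrable_const κ)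
          ((((hN u).sub (hN s)).pow 2).int.const_mul κ⁻¹), integral_const_mul]
        simp
    _ ≤ C * κ := by
        refine mul_le_mul_of_nonneg_left ?_ hC0
        have : κ⁻¹ * ∫ o, (N u o - N s o) ^ 2 ∂P ≤ κ⁻¹ * κ ^ 2 :=
          mul_le_mul_of_nonneg_left h3 (by positivity)
        have h6 : κ⁻¹ * κ ^ 2 = κ := by field_simp
        linarith
    _ ≤ η := by
        rw [hκ, mul_div_assoc', div_le_iff₀ (by linarith)]
        nlinarith

namespace FilterModel

variable {φ g : Vec d₁ → ℝ} {C : ℝ} (h : IsGenPair M.incrLaw φ g C)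

lemma sum_range_floor {t : ℝ≥0} {R : ℕ} (hR : t < M.tk R) {f : ℕ → ℝ}
  (hf : ∀ k, t < M.tk k → f k = 0) :
  ∑ k ∈ range (⌊t / M.ε⌋₊ + 1), f k = ∑ k ∈ range R, f k := by
  have h1 : ⌊t / M.ε⌋₊ < R := by
    by_contra h
    exact absurd ((M.le_floor_iff R t).1 (not_lt.1 h)) (not_le.2 hR)
  refine sum_subset (Finset.range_subset_range.2 h1) fun k _ hk => hf k ?_
  by_contra h
  exact hk (mem_range.2 (Nat.lt_succ_of_le ((M.le_floor_iff k t).2 (not_lt.1 h))))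

lemma sum_jump_floor {t : ℝ≥0} {R : ℕ} (hR : t < M.tk R) (J : ℕ → Ω × Ω' → ℝ) (w) :
  ∑ k ∈ range ⌊t / M.ε⌋₊, J k w = ∑ k ∈ range R, jumpProc (M.tk (k + 1)) (J k) t w := by
  rw [← sum_range_floor (M := M) hR (f := fun k => jumpProc (M.tk (k + 1)) (J k) t w) fun k hk =>
    if_neg (not_le.2 (hk.trans (M.tk_strictMono k.lt_succ_self))), sum_range_succ, jumpProc,
    if_neg (not_le.2 (M.lt_tk_floor_succ t)), add_zero]
  exact sum_congr rfl fun k hk => (if_pos ((M.le_floor_iff (k + 1) t).1 (mem_range.1 hk))).symm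

variable (M) in
lemma exists_lt_tk (t : ℝ≥0) : ∃ R, t < M.tk R := ⟨_, M.lt_tk_floor_succ t⟩

lemma RegularPaths.mart_eq_of_lt {w : Ω × Ω'} (hω : M.RegularPaths w)
  (h : IsGenPair M.incrLaw φ g C) {t : ℝ≥0} {R : ℕ} (hR : t < M.tk R) : M.mart φ g t w
    = (M.n : ℝ)⁻¹ * (∑ k ∈ range R, ∑ i ∈ range (M.len k w), M.segN φ g k i t w)
      + ∑ k ∈ range R, jumpProc (M.tk (k + 1)) (M.jump φ k) t w := by
  rw [hω.mart_eq h, sum_jump_floor hR, sum_range_floor hR]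
  exact fun k hk => sum_eq_zero fun i _ => segN_of_le hk.le w

lemma RegularPaths.isCadlag_segN {w : Ω × Ω'} (hω : M.RegularPaths w)
  (h : IsGenPair M.incrLaw φ g C) (k i : ℕ) : IsCadlag fun t => M.segN φ g k i t w := by
  have hc : Continuous (clamp (M.tk k) (M.tk (k + 1))) := by
    unfold clamp
    fun_prop
  have hd : Continuous fun t => M.segD g k i t w := by
    have hL := fun s t hst => abs_segDrift_sub_le (W := fun t w => M.Xp i t w.2) (A := M.start k i)
      (a := M.tk k) (b := M.tk (k + 1)) (s := s) (t := t) h.meas_gen h.bdd_gen (M.abs_alive_le k i)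
      (fun w => (M.stableXp i).cadlag w.2) hst w
    refine (LipschitzWith.of_dist_le_mul (K := ⟨C, h.C_nonneg⟩) fun s t => ?_).continuous
    rw [Real.dist_eq, NNReal.dist_eq]
    rcases le_total s t with hst | hst
    · rw [abs_sub_comm, abs_sub_comm (s : ℝ),
        abs_of_nonneg (a := (t : ℝ) - s) (sub_nonneg.2 (by exact_mod_cast hst))]
      exact hL s t hst
    · rw [abs_of_nonneg (a := (s : ℝ) - t) (sub_nonneg.2 (by exact_mod_cast hst))]
      exact hL t s hst
  have h1 := ((hω.isCadlag_comp h (M.start k i w - M.Xp i (M.tk k) w.2) i).comp_mono hc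
    (clamp_mono _ _)).const_mul (M.alive k i w)
  have h2 : (fun t => M.segN φ g k i t w) = fun t => M.alive k i w * φ (M.start k i w
      - M.Xp i (M.tk k) w.2 + M.Xp i (clamp (M.tk k) (M.tk (k + 1)) t) w.2)
      + (-(M.alive k i w * φ (M.start k i w)) - M.segD g k i t w) := by
    ext t
    rw [segN_eq, segment_eq, evolve, ← add_sub_assoc, sub_add_eq_add_sub, start]
    ring
  rw [h2]
  exact h1.add (by fun_prop : Continuous _).isCadlag

lemma RegularPaths.isCadlag_mart {w : Ω × Ω'} (hω : M.RegularPaths w)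
  (h : IsGenPair M.incrLaw φ g C) : IsCadlag fun t => M.mart φ g t w :=
  isCadlag_of_local fun t => by
    obtain ⟨R, hR⟩ := M.exists_lt_tk t
    exact ⟨_, hR, _, (IsCadlag.const_mul (IsCadlag.sum fun k => IsCadlag.sum fun i =>
      hω.isCadlag_segN h k i) _).add (IsCadlag.sum fun k => isCadlag_jumpProc _ _ w),
      fun s hs => hω.mart_eq_of_lt h hs⟩

/-! #### Adaptedness -/

lemma measurableList_particleSigma {s t : ℝ≥0} (hst : s ≤ t) :
  @MeasurableList d₁ _ (M.particleSigma t) (M.particles s) := by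
  have h := le_iSup₂ (f := fun (s : ℝ≥0) (_ : s ≤ t) =>
    (MeasurableSpace.comap (fun w => (M.particles s w).length) ⊤ ⊔
      ⨆ i : ℕ, MeasurableSpace.comap (fun w => (M.particles s w).getD i 0) inferInstance)) s hst
  exact ⟨(comap_measurable _).mono (le_sup_left.trans h) le_rfl, fun i => (comap_measurable _).mono
    ((le_iSup (fun i => MeasurableSpace.comap (fun w => (M.particles s w).getD i 0) inferInstance)
      i).trans (le_sup_right.trans h)) le_rfl⟩

lemma length_particles {k : ℕ} {t : ℝ≥0} (h1 : M.tk k ≤ t) (h2 : t < M.tk (k + 1)) (w) :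
  (M.particles t w).length = M.len k w := by
  simp [particles, M.floor_eq h1 h2, len]

lemma getD_particles {k : ℕ} {t : ℝ≥0} (h1 : M.tk k ≤ t) (h2 : t < M.tk (k + 1)) (i : ℕ)
  (w) : (M.particles t w).getD i 0 = if i < M.len k w then M.evolve k (M.gen k w) i t w else 0 := by
  rw [particles, M.floor_eq h1 h2, len, List.getD_eq_getElem?_getD]
  split_ifs with hi
  · simp [hi]
  · simp [hi]

lemma eventually_floor (u : ℝ≥0) : ∀ᶠ s in 𝓝[≥] u, M.tk ⌊u / M.ε⌋₊ ≤ s ∧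
  s < M.tk (⌊u / M.ε⌋₊ + 1) := by
  filter_upwards [self_mem_nhdsWithin, mem_nhdsWithin_of_mem_nhds
    (gt_mem_nhds (M.lt_tk_floor_succ u))] with s h1 h2
  exact ⟨(M.tk_floor_le u).trans h1, h2⟩

lemma measurable_weightTerm (hφ : Measurable φ) {m : MeasurableSpace (Ω × Ω')} {t : ℝ≥0} {k : ℕ}
  (hk : M.tk (k + 1) ≤ t) (hp : M.particleSigma t ≤ m)
  (ho : comap Prod.fst (M.obsSigma t) ≤ m) : Measurable[m] fun w =>
    ∫ x, M.weight (k + 1) x w.1 * φ x ∂(M.μnLeft (k + 1) w) := by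
  have hL := fun s (hs : s ≤ t) => measurableList_particleSigma (M := M) hs
  have hkk := M.tk_strictMono k.lt_succ_self
  have hlen : Measurable[m] (M.len k) := by
    rw [← funext fun w => length_particles (M := M) le_rfl hkk w]
    exact (hL (M.tk k) (hkk.le.trans hk)).1.mono hp le_rfl
  have hpos : ∀ i, Measurable[m] fun w => if i < M.len k w then M.pos k i w else 0 := fun i => by
    obtain ⟨u, -, hu, hlim⟩ := exists_seq_strictMono_tendsto' hkk
    have hu' : Tendsto u atTop (𝓝[<] (M.tk (k + 1))) :=
      tendsto_nhdsWithin_iff.2 ⟨hlim, .of_forall fun n => (hu n).2⟩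
    have : (𝓝[<] (M.tk (k + 1))).NeBot := hu'.neBot
    refine @measurable_of_tendsto_metrizable _ _ m _ _ _ _ (fun n w => (M.particles (u n) w).getD i 0)
      _ (fun n => ((hL _ ((hu n).2.le.trans hk)).2 i).mono hp le_rfl) ?_
    rw [tendsto_pi_nhds]
    intro w
    simp only [fun n => getD_particles (M := M) (hu n).1.le (hu n).2 i w]
    split_ifs
    · obtain ⟨l, hl⟩ := ((M.stableXp i).cadlag w.2 (M.tk (k + 1))).2
      rw [pos, evolveLeft, leftLim_eq_of_tendsto hl]
      exact ((hl.comp hu').sub_const _).const_add _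
    · exact tendsto_const_nhds
  have hY : ∀ j ≤ k + 1, Measurable[m] fun w => M.Y j w.1 := fun j hj => by
    have h1 : Measurable[M.obsSigma t] (M.Y j) := (comap_measurable _).mono (le_sup_of_le_left
      (le_iSup₂ (f := fun (k : ℕ) (_ : M.tk k ≤ t) => comap (M.Y k) inferInstance)
        j ((M.tk_mono hj).trans hk))) le_rfl
    exact (h1.comp (comap_measurable Prod.fst)).mono ho le_rfl
  have he : (fun w => ∫ x, M.weight (k + 1) x w.1 * φ x ∂(M.μnLeft (k + 1) w))
      = fun w => (M.n : ℝ)⁻¹ * ∑ i ∈ range (M.len k w),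
        M.weight (k + 1) (if i < M.len k w then M.pos k i w else 0) w.1
          * φ (if i < M.len k w then M.pos k i w else 0) := by
    ext w
    rw [integral_μnLeft]
    congr 1
    exact sum_congr rfl fun i hi => by rw [if_pos (mem_range.1 hi)]
  rw [he]
  exact Measurable.const_mul (M.measurable_sum_alive hlen fun i =>
    (@measurable_weight_comp _ _ _ _ _ _ M _ m (k + 1) _ (fun w => w.1) (hpos i) hY).mul
      (hφ.comp (hpos i))) _

lemma measurable_mart (hφ : Measurable φ) (hg : Measurable g) (T t : ℝ≥0) :
  Measurable[M.filtG T t] (M.mart φ g t) := by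
  refine measurable_iff_comap_le.2 (le_iInf₂ fun δ _ => measurable_iff_comap_le.1 ?_)
  set m := M.particleSigma (t + δ) ⊔ comap Prod.fst (M.obsSigma (max T t)) ⊔
      M.uniformSigma t with hm
  have hp : M.particleSigma t ≤ m := (M.particleSigma_mono le_self_add).trans
    (le_sup_left.trans le_sup_left)
  have ho : comap Prod.fst (M.obsSigma t) ≤ m :=
    (comap_mono (M.obsSigma_mono (le_max_right _ _))).trans (le_sup_right.trans le_sup_left)
  have hL : ∀ u ≤ t, @MeasurableList d₁ _ m (M.particles u) := fun u hu =>
    ⟨(measurableList_particleSigma hu).1.mono hp le_rfl,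
      fun i => ((measurableList_particleSigma hu).2 i).mono hp le_rfl⟩
  have h1 := @measurable_integral_empirical _ _ m M.n _ (hL t le_rfl) _ hφ
  have h2 := @measurable_integral_empirical _ _ m M.n _ (hL 0 zero_le) _ hφ
  have h3 := @measurable_integral_integral_empirical _ _ m M.n _ t hL (fun w u => by
      exact (continuousWithinAt_const (b := M.len ⌊u / M.ε⌋₊ w)).congr_of_eventuallyEq
        ((eventually_floor u).mono fun s hs => length_particles hs.1 hs.2 w)
        (length_particles (M.tk_floor_le u) (M.lt_tk_floor_succ u) w)) (fun i w u => by
      refine ContinuousWithinAt.congr_of_eventuallyEq (f := fun s => if i < M.len ⌊u / M.ε⌋₊ w then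
        M.evolve ⌊u / M.ε⌋₊ (M.gen ⌊u / M.ε⌋₊ w) i s w else 0) ?_
        ((eventually_floor u).mono fun s hs => getD_particles hs.1 hs.2 i w)
        (getD_particles (M.tk_floor_le u) (M.lt_tk_floor_succ u) i w)
      split_ifs
      · exact ((((M.stableXp i).cadlag w.2 u).1).sub_const _).const_add _
      · exact continuousWithinAt_const) _ hg
  have h4 : Measurable[m] fun w => ∑ k ∈ Finset.Icc 1 ⌊t / M.ε⌋₊,
      ∫ x, M.weight k x w.1 * φ x ∂(M.μnLeft k w) := by
    simp only [sum_Icc_one]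
    exact measurable_fun_sum _ fun k hk => measurable_weightTerm hφ
      ((M.le_floor_iff (k + 1) t).1 (mem_range.1 hk)) hp ho
  exact ((h1.sub h2).sub h3).sub h4

variable {D : ℝ}

lemma abs_sum_alive_le {f : ℕ → Ω × Ω' → ℝ} (hb : ∀ i w, |f i w| ≤ D) (k : ℕ) (w) :
  |∑ i ∈ range (M.len k w), f i w| ≤ D * M.len k w :=
  (Finset.abs_sum_le_sum_abs _ _).trans ((sum_le_card_nsmul _ _ D fun i _ => hb i w).trans
    (by simp [mul_comm]))

lemma integrable_sum_alive {f : ℕ → Ω × Ω' → ℝ} (hf : ∀ i, Measurable (f i))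
  (hb : ∀ i w, |f i w| ≤ D) (k : ℕ) :
  Integrable (fun w => ∑ i ∈ range (M.len k w), f i w) M.Phat :=
  ((M.integrable_len k).const_mul D).mono'
    (M.measurable_sum_alive (M.measurable_len k) hf).aestronglyMeasurable
    (.of_forall fun w => abs_sum_alive_le hb k w)

lemma integral_sum_alive_eq_zero {f : ℕ → Ω × Ω' → ℝ} (hf : ∀ i, Measurable (f i))
  (hb : ∀ i w, |f i w| ≤ D) (k : ℕ) (hz : ∀ i w, ¬ i < M.len k w → f i w = 0)
  (h0 : ∀ i, ∫ w, f i w ∂M.Phat = 0) :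
  ∫ w, ∑ i ∈ range (M.len k w), f i w ∂M.Phat = 0 := by
  have hi : ∀ i, Integrable (f i) M.Phat := fun i => BddMeas.int ⟨hf i, D, hb i⟩
  have hs : ∀ (m : ℕ) w, ∑ i ∈ range m, f i w
      = ∑ i ∈ range (min m (M.len k w)), f i w := fun m w => by
    refine (sum_subset (Finset.range_subset_range.2 (min_le_left _ _)) fun i hm hi => ?_).symm
    grind
  have hD : ∀ w : Ω × Ω', 0 ≤ D := fun w => (abs_nonneg _).trans (hb 0 w)
  have h1 : Tendsto (fun m : ℕ => ∫ w, ∑ i ∈ range m, f i w ∂M.Phat) atTop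
      (𝓝 (∫ w, ∑ i ∈ range (M.len k w), f i w ∂M.Phat)) := by
    refine tendsto_integral_of_dominated_convergence (fun w => D * M.len k w) (fun m =>
      (measurable_fun_sum _ fun i _ => hf i).aestronglyMeasurable)
      ((M.integrable_len k).const_mul D) (fun m => .of_forall fun w => ?_)
      (.of_forall fun w => ?_)
    · rw [hs]
      refine (Finset.abs_sum_le_sum_abs _ _).trans ((sum_le_card_nsmul _ _ D fun i _ =>
        hb i w).trans ?_)
      rw [card_range, nsmul_eq_mul, mul_comm]
      exact mul_le_mul_of_nonneg_left (by exact_mod_cast min_le_right _ _) (hD w)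
    · refine tendsto_const_nhds.congr' ?_
      filter_upwards [eventually_ge_atTop (M.len k w)] with m hm
      rw [hs m, min_eq_right hm]
  refine tendsto_nhds_unique h1 ?_
  simp_rw [integral_finsetSum _ fun i _ => hi i, h0]
  simp

include h in
lemma abs_segN_le' (k i : ℕ) (t : ℝ≥0) (w) :
  |M.segN φ g k i t w| ≤ 3 * C :=
  (abs_segN_le h k i t w).trans (mul_le_of_le_one_right (by linarith [h.C_nonneg])
    ((le_abs_self _).trans (M.abs_alive_le k i w)))

include h in
lemma measurable_segN (k i : ℕ) (t : ℝ≥0) :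
  Measurable (M.segN φ g k i t) := ((isBddMart_segN h k i).bddMeas t).1

include h in
lemma integrable_jumpProc (k : ℕ) (t : ℝ≥0) :
  Integrable (jumpProc (M.tk (k + 1)) (M.jump φ k) t) M.Phat := by
  unfold jumpProc
  split_ifs
  · exact M.integrable_jump h.meas h.bdd k
  · exact integrable_zero _ _ _

lemma filtG_le_driverSigma (T : ℝ≥0) (i : ℕ) {s u : ℝ≥0} (h : s < u) :
  M.filtG T s ≤ M.driverSigma i u :=
  (M.informed_driverSigma i u ⌊s / M.ε⌋₊).filtG_le (M.measurable_fst_driverSigma i u) T h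
    (M.lt_tk_floor_succ s)

include h in
lemma integrable_mart (t : ℝ≥0) : Integrable (M.mart φ g t) M.Phat := by
  obtain ⟨R, hR⟩ := M.exists_lt_tk t
  have h1 : Integrable (fun w => (M.n : ℝ)⁻¹ * (∑ k ∈ range R,
      ∑ i ∈ range (M.len k w), M.segN φ g k i t w)
      + ∑ k ∈ range R, jumpProc (M.tk (k + 1)) (M.jump φ k) t w) M.Phat :=
    ((integrable_finsetSum _ fun k _ => integrable_sum_alive (fun i => measurable_segN h k i t)
      (fun i w => abs_segN_le' h k i t w) k).const_mul _).add
      (integrable_finsetSum _ fun k _ => integrable_jumpProc h k t)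
  exact h1.congr (M.ae_regularPaths.mono fun w hω => (hω.mart_eq_of_lt h hR).symm)

include h in
lemma integral_mul_mart_sub {T s t : ℝ≥0} (hst : s ≤ t)
  {G : Ω × Ω' → ℝ} (hG : BddMeas (M.filtG T s) G) :
  ∫ w, G w * (M.mart φ g t w - M.mart φ g s w) ∂M.Phat = 0 := by
  obtain ⟨R, hR⟩ := M.exists_lt_tk t
  have hG0 := hG.mono ((M.filtG T).le s)
  obtain ⟨D, hD⟩ := hG0.2
  have hf : ∀ k i, Measurable fun w => G w * (M.segN φ g k i t w - M.segN φ g k i s w) :=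
    fun k i => hG0.1.mul ((measurable_segN h k i t).sub (measurable_segN h k i s))
  have hb : ∀ k i w, |G w * (M.segN φ g k i t w - M.segN φ g k i s w)| ≤ D * (3 * C + 3 * C) :=
    fun k i w => by
      rw [abs_mul]
      exact mul_le_mul (hD w) ((abs_sub _ _).trans (add_le_add (abs_segN_le' h k i t w)
        (abs_segN_le' h k i s w))) (abs_nonneg _) ((abs_nonneg _).trans (hD w))
  have h1 : ∀ k, ∫ w, ∑ i ∈ range (M.len k w),
      G w * (M.segN φ g k i t w - M.segN φ g k i s w) ∂M.Phat = 0 := fun k => by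
    refine integral_sum_alive_eq_zero (hf k) (hb k) k (fun i w hi => ?_) fun i => ?_
    · rw [segN_of_not_alive hi, segN_of_not_alive hi, sub_self, mul_zero]
    · exact (isBddMart_segN h k i).integral_mul_sub_of_right hst fun u hu =>
        hG.mono (filtG_le_driverSigma T i (lt_max_of_lt_left hu))
  have h2 : ∀ k, Integrable (fun w => G w * (jumpProc (M.tk (k + 1)) (M.jump φ k) t w
      - jumpProc (M.tk (k + 1)) (M.jump φ k) s w)) M.Phat := fun k =>
    ((integrable_jumpProc h k t).sub (integrable_jumpProc h k s)).bdd_mul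
      hG0.1.aestronglyMeasurable (.of_forall hD)
  have h3 : ∀ k, ∫ w, G w * (jumpProc (M.tk (k + 1)) (M.jump φ k) t w
      - jumpProc (M.tk (k + 1)) (M.jump φ k) s w) ∂M.Phat = 0 := fun k => by
    simp only [jumpProc_sub]
    rcases le_or_gt (M.tk (k + 1)) s with hs | hs
    · simp [hs, hs.trans hst]
    · have h4 := M.integral_mul_jump h.meas h.bdd k (hG.mono
        ((M.informed_exceptU (M.tk (k + 1)) k).filtG_le (M.measurable_fst_exceptU _) T hs hs))
      by_cases ht : M.tk (k + 1) ≤ t <;> simp [ht, not_le.2 hs, h4]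
  have e : ∀ᵐ w ∂M.Phat, G w * (M.mart φ g t w - M.mart φ g s w)
      = (M.n : ℝ)⁻¹ * (∑ k ∈ range R, ∑ i ∈ range (M.len k w),
          G w * (M.segN φ g k i t w - M.segN φ g k i s w))
        + ∑ k ∈ range R, G w * (jumpProc (M.tk (k + 1)) (M.jump φ k) t w
          - jumpProc (M.tk (k + 1)) (M.jump φ k) s w) := by
    filter_upwards [M.ae_regularPaths] with w hω
    rw [hω.mart_eq_of_lt h hR, hω.mart_eq_of_lt h (hst.trans_lt hR)]
    simp only [← mul_sum, sum_sub_distrib]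
    ring
  rw [integral_congr_ae e, integral_add ((integrable_finsetSum _ fun k _ =>
    integrable_sum_alive (hf k) (hb k) k).const_mul _) (integrable_finsetSum _ fun k _ => h2 k),
    integral_const_mul, integral_finsetSum _ fun k _ => integrable_sum_alive (hf k) (hb k) k,
    integral_finsetSum _ fun k _ => h2 k]
  simp [h1, h3]

include h in
lemma martingale_mart (T : ℝ≥0) : Martingale (M.mart φ g) (M.filtG T) M.Phat := by
  refine ⟨fun t => (measurable_mart h.meas h.meas_gen T t).stronglyMeasurable, fun s t hst => ?_⟩
  have hi := integrable_mart (M := M) h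
  refine (ae_eq_condExp_of_forall_setIntegral_eq ((M.filtG T).le s) (hi t)
    (fun A _ _ => (hi s).integrableOn) (fun A hA _ => ?_)
    (measurable_mart h.meas h.meas_gen T s).stronglyMeasurable.aestronglyMeasurable).symm
  have hA' : MeasurableSet A := (M.filtG T).le s _ hA
  have h1 := integral_mul_mart_sub h hst (BddMeas.indicator hA)
  have e : ∀ w, A.indicator (fun _ => 1) w * (M.mart φ g t w - M.mart φ g s w)
      = A.indicator (fun w => M.mart φ g t w - M.mart φ g s w) w := fun w => by
    by_cases hω : w ∈ A <;> simp [hω]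
  simp_rw [e] at h1
  rw [integral_indicator hA', integral_sub (hi t).integrableOn (hi s).integrableOn] at h1
  linarith

end FilterModel

/-! ### Quadratic variation -/

lemma exists_isPartitionSeq (t : ℝ≥0) : ∃ p K, IsPartitionSeq t p K := by
  refine ⟨fun m j => min (dyad m j) t, fun m => 2 ^ m * ⌈t⌉₊, ⟨fun m i j h =>
    min_le_min_right _ (dyad_mono m h), fun m => by simp [dyad_zero],
    fun m => min_eq_right (le_dyad_ceil m t le_rfl), fun δ hδ => ?_⟩⟩
  filter_upwards [tendsto_inv_two_pow.eventually (ge_mem_nhds hδ)] with m hm j _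
  rw [tsub_le_iff_left, dyad_succ, min_le_iff, ← min_add_add_right]
  grind

lemma HasCovAt.exists_tendsto_ae {S : Type*} [MeasurableSpace S] {P : Measure S}
  {A B : ℝ≥0 → S → ℝ} {t : ℝ≥0} {R : S → ℝ} (h : HasCovAt P A B t R) :
  ∃ (p : ℕ → ℕ → ℝ≥0) (K : ℕ → ℕ), ∀ᵐ w ∂P, Tendsto (fun m => ∑ j ∈ range (K m),
    (A (p m (j + 1)) w - A (p m j) w) * (B (p m (j + 1)) w - B (p m j) w)) atTop (𝓝 (R w)) := by
  obtain ⟨p, K, hp⟩ := exists_isPartitionSeq t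
  obtain ⟨ns, -, hns⟩ := (h p K hp).exists_seq_tendsto_ae
  exact ⟨fun m => p (ns m), fun m => K (ns m), hns⟩

namespace FilterModel

variable {φ g : Vec d₁ → ℝ} {C : ℝ} (h : IsGenPair M.incrLaw φ g C)

lemma measurable_segment_of {m : MeasurableSpace (Ω × Ω')} (hφ : Measurable φ) {k i : ℕ}
  (hgen : @MeasurableList d₁ _ m (M.gen k)) (hinc : ∀ u, M.tk k ≤ u → u ≤ M.tk (k + 1) →
    Measurable[m] fun w => M.Xp i u w.2 - M.Xp i (M.tk k) w.2) (t : ℝ≥0) :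
  Measurable[m] (M.segment φ k i t) := by
  refine .ite (hgen.1 (measurableSet_Ioi (a := i))) (hφ.comp ?_) measurable_const
  exact (hgen.2 i).add (hinc _ (le_clamp (M.tk_mono k.le_succ) t) (clamp_le _ _ t))

lemma measurable_segN_of {m : MeasurableSpace (Ω × Ω')} (hφ : Measurable φ) (hg : Measurable g)
  {k i : ℕ} (hgen : @MeasurableList d₁ _ m (M.gen k))
  (hinc : ∀ u, M.tk k ≤ u → u ≤ M.tk (k + 1) →
    Measurable[m] fun w => M.Xp i u w.2 - M.Xp i (M.tk k) w.2) (t : ℝ≥0) :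
  Measurable[m] (M.segN φ g k i t) := by
  have hχ : Measurable[m] (M.alive k i) :=
    .ite (hgen.1 (measurableSet_Ioi (a := i))) measurable_const measurable_const
  have hA : Measurable[m] (M.start k i) := hgen.2 i
  have h1 : Measurable[m] (M.segD g k i t) := @measurable_segDrift _ _ m _ _ _ _ _ _ hA hχ hg
    (M.tk_mono k.le_succ) t (fun u h1 h2 => hinc u h1 (h2.trans (clamp_le _ _ t)))
    fun w => (M.stableXp i).cadlag w.2
  rw [funext (M.segN_eq φ g k i t)]
  exact ((measurable_segment_of hφ hgen hinc t).sub (hχ.mul (hφ.comp hA))).sub h1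

lemma measurable_motion_driverSigma {i j : ℕ} (hj : j ≠ i) (s u v : ℝ≥0) :
  Measurable[M.driverSigma i s] fun w => M.Xp j u w.2 - M.Xp j v w.2 := by
  refine M.measurable_driver_of_past i s (f := fun w => M.Xp j u w - M.Xp j v w) ?_
  refine ((M.measurable_motion j u).sub (M.measurable_motion j v)).mono ?_ le_rfl
  exact le_sup_of_le_right (le_sup_of_le_right (le_sup_of_le_left
    (le_iSup₂_of_le (f := fun j (_ : j ∈ ({i}ᶜ : Set ℕ)) => M.motionSigma j) j hj le_rfl)))

include h in
lemma hasCovAt_segN_segN {k i k' i' : ℕ} (hk : k < k' ∨ k = k' ∧ i ≠ i') (t : ℝ≥0) :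
  HasCovAt M.Phat (M.segN φ g k' i') (M.segN φ g k i) t 0 := by
  have hkk : k ≤ k' := by omega
  have hI := M.informed_driverSigma i' (M.tk k') k'
  refine (isBddMart_segN h k' i').hasCovAt_zero (fun u => ⟨?_, 3 * C, abs_segN_le' h k i u⟩) t
    (c := ∫ w, (M.segN φ g k i t w - M.segN φ g k i 0 w) ^ 2 ∂M.Phat) fun p hp h0 K hK => ?_
  · rw [zero_max]
    refine measurable_segN_of h.meas h.meas_gen (hI.measurableList_gen hkk (M.tk_mono hkk))
      (fun v _ hv => ?_) u
    rcases hk with hk | ⟨-, hi⟩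
    · exact hI.incr i v _ (hv.trans (M.tk_mono hk)) (M.tk_mono hkk)
    · exact measurable_motion_driverSigma hi _ _ _
  · rw [(isBddMart_segN h k i).sum_integral_sq hp, h0, hK]

/-- The quadratic variation of `φ` along the path of the particle with label `i` at time `t_k`. -/
def segQ (k i : ℕ) : ℝ≥0 → Ω × Ω' → ℝ := (isBddMart_segN h k i).exists_quadraticVariation.choose

lemma segQ_spec (k i : ℕ) : IsQuadraticVariation M.Phat (M.segN φ g k i) (segQ h k i) ∧
  (∀ t, Integrable (segQ h k i t) M.Phat) ∧
  ∀ s t, s ≤ t → ∫ w, (segQ h k i t w - segQ h k i s w) ∂M.Phat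
    = ∫ w, (M.segN φ g k i t w - M.segN φ g k i s w) ^ 2 ∂M.Phat :=
  (isBddMart_segN h k i).exists_quadraticVariation.choose_spec

lemma isQuadraticVariation_segment (k i : ℕ) :
  IsQuadraticVariation M.Phat (M.segment φ k i) (segQ h k i) := by
  have hQ := (segQ_spec h k i).1
  refine IsQuadraticVariation.of_hasCovAt hQ.measurable hQ.paths fun t => ?_
  have hseg : ∀ t, BddMeas inferInstance (M.segment φ k i t) := fun t =>
    ⟨measurable_segment_of h.meas (M.measurableList_gen k)
      (fun u _ _ => (M.measurable_Xp i u).sub (M.measurable_Xp i _)) t, C, fun w => by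
      unfold segment
      split_ifs
      · exact h.bdd _
      · simpa using h.C_nonneg⟩
  have h1 := (isBddMart_segN h k i).hasCovAt_add_lipschitz
    (D := fun t w => M.segment φ k i t w - M.segN φ g k i t w)
    (fun t => (hseg t).sub ((isBddMart_segN h k i).bddMeas t)) (C := C) (fun s t hst w => by
      have h2 := abs_segDrift_sub_le (W := fun t w => M.Xp i t w.2) (A := M.start k i)
        (a := M.tk k) (b := M.tk (k + 1)) h.meas_gen h.bdd_gen (M.abs_alive_le k i)
        (fun w => (M.stableXp i).cadlag w.2) hst w
      simp only [segN_eq, segD]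
      convert h2 using 2
      ring) (hQ.hasCovAt t)
  simpa using h1

lemma ae_segQ_of_not_alive (k i : ℕ) (t : ℝ≥0) :
  ∀ᵐ w ∂M.Phat, ¬ i < M.len k w → segQ h k i t w = 0 := by
  obtain ⟨p, K, hpK⟩ := ((segQ_spec h k i).1.hasCovAt t).exists_tendsto_ae
  filter_upwards [hpK] with w hω hi
  refine tendsto_nhds_unique hω ?_
  simp [segN_of_not_alive hi]

/-- The regularity of the quadratic variations along the paths of the particles. -/
def RegularQ (w : Ω × Ω') : Prop :=
  ∀ k i, Monotone (fun t => segQ h k i t w) ∧ IsCadlag (fun t => segQ h k i t w) ∧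
    (∀ t ≤ M.tk k, segQ h k i t w = 0) ∧
    (∀ t, M.tk (k + 1) ≤ t → segQ h k i t w = segQ h k i (M.tk (k + 1)) w) ∧
    (¬ i < M.len k w → ∀ t, segQ h k i t w = 0)

lemma ae_segQ_eq (k i : ℕ) {s t : ℝ≥0} (hst : s ≤ t)
  (hN : ∀ w, M.segN φ g k i t w = M.segN φ g k i s w) :
  ∀ᵐ w ∂M.Phat, segQ h k i t w = segQ h k i s w := by
  obtain ⟨hQ, hi, h2⟩ := segQ_spec h k i
  have h3 := h2 s t hst
  simp only [hN, sub_self, ne_eq, OfNat.ofNat_ne_zero, not_false_eq_true, zero_pow,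
    integral_zero] at h3
  rw [integral_eq_zero_iff_of_nonneg_ae (hQ.paths.mono fun w hω => sub_nonneg.2 (hω.2.1 hst))
    ((hi t).sub (hi s))] at h3
  filter_upwards [h3] with w hω using sub_eq_zero.1 hω

lemma ae_regularQ : ∀ᵐ w ∂M.Phat, RegularQ h w := by
  unfold RegularQ
  simp only [ae_all_iff]
  intro k i
  have h0 := ae_segQ_eq h k i (zero_le : 0 ≤ M.tk k) fun w => by
    rw [segN_of_le le_rfl, segN_of_le zero_le]
  have h1 : ∀ᵐ w ∂M.Phat, ∀ l : ℕ, k + 1 ≤ l →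
      segQ h k i (M.tk l) w = segQ h k i (M.tk (k + 1)) w := by
    simp only [ae_all_iff]
    exact fun l hl => ae_segQ_eq h k i (M.tk_mono hl) fun w => segN_of_ge (M.tk_mono hl) w
  filter_upwards [(segQ_spec h k i).1.paths, h0, h1, ae_segQ_of_not_alive h k i (M.tk (k + 1))]
    with w ⟨hz, hm, hc⟩ h0 h1 h2
  have hge : ∀ t, M.tk (k + 1) ≤ t → segQ h k i t w = segQ h k i (M.tk (k + 1)) w := fun t ht => by
    obtain ⟨R, hR⟩ := M.exists_lt_tk t
    have hkR : k + 1 ≤ R := (M.tk_strictMono.le_iff_le).1 (ht.trans hR.le)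
    exact le_antisymm ((hm hR.le).trans (h1 R hkR).le) (hm ht)
  have hpos : ∀ t, 0 ≤ segQ h k i t w := fun t => hz ▸ hm (zero_le : 0 ≤ t)
  refine ⟨hm, hc, fun t ht => le_antisymm ((hm ht).trans (h0.trans hz).le) (hpos t), hge,
    fun hi t => le_antisymm ?_ (hpos t)⟩
  rcases le_total t (M.tk (k + 1)) with ht | ht
  · exact (hm ht).trans (h2 hi).le
  · exact ((hge t ht).trans (h2 hi)).le

/-- The quadratic variation of the martingale part of the particle system. -/
def quadVar (t : ℝ≥0) (w : Ω × Ω') : ℝ :=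
  ((M.n : ℝ)⁻¹ * (M.n : ℝ)⁻¹) * (∑ k ∈ range (⌊t / M.ε⌋₊ + 1),
      ∑ i ∈ range (M.len k w), segQ h k i t w)
    + ∑ k ∈ range ⌊t / M.ε⌋₊, M.jump φ k w ^ 2

lemma RegularQ.quadVar_eq_of_lt {h : IsGenPair M.incrLaw φ g C} {w : Ω × Ω'}
  (hω : RegularQ h w) {t : ℝ≥0} {R : ℕ} (hR : t < M.tk R) : quadVar h t w
    = ((M.n : ℝ)⁻¹ * (M.n : ℝ)⁻¹) * (∑ k ∈ range R, ∑ i ∈ range (M.len k w), segQ h k i t w)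
      + ∑ k ∈ range R, jumpProc (M.tk (k + 1)) (fun w => M.jump φ k w ^ 2) t w := by
  rw [quadVar, sum_jump_floor hR fun k w => M.jump φ k w ^ 2, sum_range_floor hR]
  exact fun k hk => sum_eq_zero fun i _ => (hω k i).2.2.1 t hk.le

lemma RegularQ.paths {h : IsGenPair M.incrLaw φ g C} {w : Ω × Ω'} (hω : RegularQ h w) :
  quadVar h 0 w = 0 ∧ Monotone (fun t => quadVar h t w) ∧ IsCadlag (fun t => quadVar h t w) := by
  refine ⟨?_, fun s t hst => ?_, isCadlag_of_local fun t => ?_⟩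
  · simp [quadVar, (hω 0 _).2.2.1 0 zero_le]
  · obtain ⟨R, hR⟩ := M.exists_lt_tk t
    simp only [hω.quadVar_eq_of_lt hR, hω.quadVar_eq_of_lt (hst.trans_lt hR)]
    refine add_le_add (mul_le_mul_of_nonneg_left (sum_le_sum fun k _ =>
      sum_le_sum fun i _ => (hω k i).1 hst) (by positivity)) (sum_le_sum fun k _ => ?_)
    unfold jumpProc
    split_ifs with h1 h2
    · exact le_rfl
    · exact absurd (h1.trans hst) h2
    · positivity
    · exact le_rfl
  · obtain ⟨R, hR⟩ := M.exists_lt_tk t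
    exact ⟨_, hR, _, (IsCadlag.const_mul (IsCadlag.sum fun k => IsCadlag.sum fun i =>
      (hω k i).2.1) _).add (IsCadlag.sum fun k => isCadlag_jumpProc _ _ w),
      fun s hs => hω.quadVar_eq_of_lt hs⟩

lemma sum_alive_eq {f : ℕ → ℝ} {k m : ℕ} {w : Ω × Ω'} (hm : M.len k w ≤ m)
  (hz : ∀ i, ¬ i < M.len k w → f i = 0) :
  ∑ i ∈ range (M.len k w), f i = ∑ i ∈ range m, f i :=
  sum_subset (Finset.range_subset_range.2 hm) fun i _ hi => hz i fun h => hi (mem_range.2 h)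

/-- The branching at time `t_{k+1}`, when there are at most `m` particles. -/
def truncJump (φ : Vec d₁ → ℝ) (M : FilterModel d₁ d₂ Ω Ω') (m k : ℕ) (w : Ω × Ω') : ℝ :=
  if M.len k w ≤ m then M.jump φ k w else 0

include h in
lemma bddMeas_truncJump (m k : ℕ) : BddMeas inferInstance (truncJump φ M m k) := by
  refine ⟨.ite (M.measurable_len k (measurableSet_Iic (a := m)))
    ((M.measurable_jump h.meas k).mono (M.exceptU_le _) le_rfl) measurable_const,
    (M.n : ℝ)⁻¹ * (m * C), fun w => ?_⟩
  have hC := h.C_nonneg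
  unfold truncJump
  split_ifs with hm
  · refine (M.abs_jump_le h.bdd k w).trans (mul_le_mul_of_nonneg_left ?_ (by positivity))
    gcongr
  · rw [abs_zero]
    positivity

/-- The building blocks of the martingale part of the particle system. -/
def block (φ g : Vec d₁ → ℝ) (M : FilterModel d₁ d₂ Ω Ω') (m : ℕ) : (ℕ × ℕ) ⊕ ℕ → ℝ≥0 → Ω × Ω' → ℝ
  | .inl q => fun t w => (M.n : ℝ)⁻¹ * M.segN φ g q.1 q.2 t w
  | .inr k => jumpProc (M.tk (k + 1)) (truncJump φ M m k)

/-- The quadratic variations of the building blocks. -/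
def blockQ (h : IsGenPair M.incrLaw φ g C) (m : ℕ) (t : ℝ≥0) : (ℕ × ℕ) ⊕ ℕ → Ω × Ω' → ℝ
  | .inl q => fun w => ((M.n : ℝ)⁻¹ * (M.n : ℝ)⁻¹) * segQ h q.1 q.2 t w
  | .inr k => jumpProc (M.tk (k + 1)) (fun w => truncJump φ M m k w ^ 2) t

lemma hasCovAt_block_self (m : ℕ) (t : ℝ≥0)
  (a : (ℕ × ℕ) ⊕ ℕ) : HasCovAt M.Phat (block φ g M m a) (block φ g M m a) t (blockQ h m t a) := by
  rcases a with q | k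
  · exact ((segQ_spec h q.1 q.2).1.hasCovAt t).const_mul _ _
  · exact hasCovAt_jump_self (M.tk_succ_pos k) _ t

include h in
lemma hasCovAt_block (m : ℕ) (t : ℝ≥0)
  {a b : (ℕ × ℕ) ⊕ ℕ} (hab : a ≠ b) : HasCovAt M.Phat (block φ g M m a) (block φ g M m b) t 0 := by
  have h1 : ∀ (q : ℕ × ℕ) (k : ℕ),
      HasCovAt M.Phat (block φ g M m (.inl q)) (block φ g M m (.inr k)) t 0 := fun q k => by
    have := ((isBddMart_segN h q.1 q.2).hasCovAt_jump (M.tk (k + 1)) (bddMeas_truncJump h m k)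
      t).const_mul (M.n : ℝ)⁻¹ 1
    simp only [one_mul, Pi.zero_apply, mul_zero] at this
    exact this
  have h2 : ∀ q q' : ℕ × ℕ, q.1 < q'.1 ∨ q.1 = q'.1 ∧ q.2 ≠ q'.2 →
      HasCovAt M.Phat (block φ g M m (.inl q')) (block φ g M m (.inl q)) t 0 := fun q q' hq => by
    have := (hasCovAt_segN_segN h hq t).const_mul (M.n : ℝ)⁻¹ (M.n : ℝ)⁻¹
    simp only [Pi.zero_apply, mul_zero] at this
    exact this
  rcases a with ⟨k, i⟩ | k <;> rcases b with ⟨l, j⟩ | l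
  · rcases lt_trichotomy k l with hk | rfl | hk
    · exact (h2 (k, i) (l, j) (Or.inl hk)).symm
    · exact (h2 (k, i) (k, j) (Or.inr ⟨rfl, fun hi => hab (by simp only at hi; rw [hi])⟩)).symm
    · exact h2 (l, j) (k, i) (Or.inl hk)
  · exact h1 _ _
  · exact (h1 _ _).symm
  · rcases lt_trichotomy k l with hk | rfl | hk
    · exact hasCovAt_jump_jump (M.tk_strictMono (Nat.succ_lt_succ hk)) _ _ t
    · exact absurd rfl hab
    · exact (hasCovAt_jump_jump (M.tk_strictMono (Nat.succ_lt_succ hk)) _ _ t).symm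

lemma hasCovAt_mart (t : ℝ≥0) : HasCovAt M.Phat (M.mart φ g) (M.mart φ g) t (quadVar h t) := by
  obtain ⟨R, hR⟩ := M.exists_lt_tk t
  set s : ℕ → Finset ((ℕ × ℕ) ⊕ ℕ) := fun m => (range R ×ˢ range m).disjSum (range R) with hs
  refine HasCovAt.of_localize (E := fun m => {w | ∀ k < R, M.len k w ≤ m}) ?_
    (fun m => HasCovAt.sum_of_orthogonal (s := s m) (fun a _ => hasCovAt_block_self h m t a)
      fun a _ b _ hab => hasCovAt_block h m t hab) fun m => ?_
  · have hmeas : ∀ m : ℕ, MeasurableSet {w | ∀ k < R, M.len k w ≤ m} := fun m => by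
      simp only [ofPred_forall]
      exact MeasurableSet.iInter fun k => MeasurableSet.iInter fun _ =>
        M.measurable_len k (measurableSet_Iic (a := m))
    have h1 := tendsto_measure_iInter_atTop (μ := M.Phat)
      (s := fun m => {w | ∀ k < R, M.len k w ≤ m}ᶜ) (fun m => (hmeas m).compl.nullMeasurableSet)
      (fun a b hab w hω hc => hω fun k hk => (hc k hk).trans hab) ⟨0, measure_ne_top _ _⟩
    have h2 : ⋂ m : ℕ, {w | ∀ k < R, M.len k w ≤ m}ᶜ = ∅ := by
      refine eq_empty_of_forall_notMem fun w hω => ?_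
      refine mem_iInter.1 hω (∑ k ∈ range R, M.len k w) fun k hk => ?_
      exact Finset.single_le_sum (f := fun k => M.len k w) (fun _ _ => Nat.zero_le _)
        (mem_range.2 hk)
    rwa [h2, measure_empty] at h1
  · filter_upwards [M.ae_regularPaths, ae_regularQ h] with w hω hq hE
    have hJ : ∀ k ∈ range R, truncJump φ M m k w = M.jump φ k w := fun k hk =>
      if_pos (hE k (mem_range.1 hk))
    refine ⟨fun u hu => ?_, ?_⟩
    · rw [hω.mart_eq_of_lt h (hu.trans_lt hR), hs, Finset.sum_disjSum, Finset.sum_product, mul_sum]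
      congr 1
      · refine sum_congr rfl fun k hk => ?_
        rw [sum_alive_eq (hE k (mem_range.1 hk)) fun i hi => segN_of_not_alive hi u, mul_sum]
        rfl
      · refine sum_congr rfl fun k hk => ?_
        simp only [block, jumpProc, hJ k hk]
    · rw [hq.quadVar_eq_of_lt hR, hs, Finset.sum_disjSum, Finset.sum_product, mul_sum]
      congr 1
      · refine sum_congr rfl fun k hk => ?_
        rw [sum_alive_eq (hE k (mem_range.1 hk)) fun i hi => (hq k i).2.2.2.2 hi t, mul_sum]
        rfl
      · refine sum_congr rfl fun k hk => ?_
        simp only [blockQ, jumpProc, hJ k hk]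

lemma isQuadraticVariation_mart : IsQuadraticVariation M.Phat (M.mart φ g) (quadVar h) := by
  refine IsQuadraticVariation.of_hasCovAt (fun t => ?_)
    ((ae_regularQ h).mono fun w hω => hω.paths) (hasCovAt_mart h)
  refine ((Finset.measurable_fun_sum _ fun k _ => M.measurable_sum_alive (M.measurable_len k)
    fun i => (segQ_spec h k i).1.measurable t).const_mul _).add
    (Finset.measurable_fun_sum _ fun k _ =>
      ((M.measurable_jump h.meas k).mono (M.exceptU_le _) le_rfl).pow_const 2)

lemma integrable_sum_segQ (k : ℕ) (t : ℝ≥0) :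
  Integrable (fun w => ∑ i ∈ range (M.len k w), segQ h k i t w) M.Phat := by
  have hQm : ∀ i, Measurable (segQ h k i t) := fun i => (segQ_spec h k i).1.measurable t
  have hpos : ∀ᵐ w ∂M.Phat, ∀ i, 0 ≤ segQ h k i t w := (ae_regularQ h).mono fun w hω i =>
    (hω k i).2.2.1 0 zero_le ▸ (hω k i).1 (zero_le : 0 ≤ t)
  refine ⟨(M.measurable_sum_alive (M.measurable_len k) hQm).aestronglyMeasurable, ?_⟩
  rw [hasFiniteIntegral_iff_ofReal (hpos.mono fun w hω => sum_nonneg fun i _ => hω i)]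
  have hlen : ∀ w, ∑' i, ofReal (M.alive k i w) = M.len k w := fun w => by
    rw [tsum_eq_sum (s := range (M.len k w)) fun i hi => by
      rw [M.alive_of_not_lt (by simpa using hi), ENNReal.ofReal_zero],
      sum_congr rfl fun i hi => by rw [M.alive_of_lt (mem_range.1 hi)]]
    simp
  have hal : ∀ i, Measurable (M.alive k i) := fun i =>
    .ite (M.measurable_len k (measurableSet_Ioi (a := i))) measurable_const measurable_const
  have hone : ∀ i, ∫⁻ w, ofReal (segQ h k i t w) ∂M.Phat
      ≤ ofReal ((3 * C) ^ 2) * ∫⁻ w, ofReal (M.alive k i w) ∂M.Phat := fun i => by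
    have hN := (isBddMart_segN h k i).bddMeas t
    have h0 : ∀ᵐ w ∂M.Phat, segQ h k i 0 w = 0 := (ae_regularQ h).mono fun w hω =>
      (hω k i).2.2.1 0 zero_le
    have h1 : ∫ w, segQ h k i t w ∂M.Phat = ∫ w, M.segN φ g k i t w ^ 2 ∂M.Phat := by
      have := (segQ_spec h k i).2.2 0 t zero_le
      simp only [segN_of_le (zero_le : 0 ≤ M.tk k), sub_zero] at this
      rw [← this]
      refine integral_congr_ae (h0.mono fun w hω => ?_)
      simp only [hω, sub_zero]
    rw [← ofReal_integral_eq_lintegral_ofReal ((segQ_spec h k i).2.1 t)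
      (hpos.mono fun w hω => hω i), h1, ofReal_integral_eq_lintegral_ofReal
      (hN.pow 2).int (.of_forall fun w => sq_nonneg _),
      ← lintegral_const_mul _ (hal i).ennreal_ofReal]
    refine lintegral_mono fun w => ?_
    rw [← ofReal_mul (by positivity)]
    refine ofReal_le_ofReal ?_
    have h2 := abs_segN_le h k i t w
    rw [← sq_abs]
    by_cases hi : i < M.len k w
    · rw [M.alive_of_lt hi, mul_one] at h2 ⊢
      exact pow_le_pow_left₀ (abs_nonneg _) h2 2
    · rw [segN_of_not_alive hi, M.alive_of_not_lt hi]
      simp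
  calc ∫⁻ w, ofReal (∑ i ∈ range (M.len k w), segQ h k i t w) ∂M.Phat
      ≤ ∫⁻ w, ∑' i, ofReal (segQ h k i t w) ∂M.Phat := by
        refine lintegral_mono_ae (hpos.mono fun w hω => ?_)
        rw [ENNReal.ofReal_sum_of_nonneg fun i _ => hω i]
        exact ENNReal.sum_le_tsum _
    _ = ∑' i, ∫⁻ w, ofReal (segQ h k i t w) ∂M.Phat :=
        lintegral_tsum fun i => (hQm i).ennreal_ofReal.aemeasurable
    _ ≤ ∑' i, ofReal ((3 * C) ^ 2) * ∫⁻ w, ofReal (M.alive k i w) ∂M.Phat :=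
        ENNReal.tsum_le_tsum hone
    _ = ofReal ((3 * C) ^ 2) * ∫⁻ w, ofReal (M.len k w) ∂M.Phat := by
        rw [ENNReal.tsum_mul_left, ← lintegral_tsum fun i => (hal i).ennreal_ofReal.aemeasurable]
        simp only [hlen, ENNReal.ofReal_natCast]
    _ < ⊤ := ENNReal.mul_lt_top ENNReal.ofReal_lt_top
        ((hasFiniteIntegral_iff_ofReal (.of_forall fun w => by positivity)).1
          (M.integrable_len k).2)

lemma integrable_quadVar (t : ℝ≥0) : Integrable (quadVar h t) M.Phat :=
  ((integrable_finsetSum _ fun k _ => integrable_sum_segQ h k t).const_mul _).add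
    (integrable_finsetSum _ fun k _ => M.integrable_jump_sq h.meas h.bdd k)

/-! ### The conditional mean of the quadratic variation -/

lemma exists_measurable_segQ (k i : ℕ) (t : ℝ≥0) :
  ∃ q, Measurable[M.exceptU (k + 1)] q ∧ segQ h k i t =ᵐ[M.Phat] q := by
  obtain ⟨p, K, hpK⟩ := ((isQuadraticVariation_segment h k i).hasCovAt t).exists_tendsto_ae
  have hI := M.informed_exceptU (M.tk (k + 1)) k
  have hm : ∀ t, Measurable[M.exceptU (k + 1)] (M.segment φ k i t) := fun t =>
    measurable_segment_of h.meas (hI.measurableList_gen le_rfl (M.tk_mono k.le_succ))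
      (fun u _ hu => hI.incr i u _ hu (M.tk_mono k.le_succ)) t
  have hf : ∀ m, Measurable[M.exceptU (k + 1)] fun w => ∑ j ∈ range (K m),
      (M.segment φ k i (p m (j + 1)) w - M.segment φ k i (p m j) w)
        * (M.segment φ k i (p m (j + 1)) w - M.segment φ k i (p m j) w) := fun m =>
    measurable_fun_sum (range (K m)) fun j _ =>
      ((hm (p m (j + 1))).sub (hm (p m j))).mul ((hm (p m (j + 1))).sub (hm (p m j)))
  exact ⟨_, Measurable.limsup hf, hpK.mono fun w hω => hω.limsup_eq.symm⟩

lemma condExp_sum_segQ (k : ℕ) (t : ℝ≥0) (c : ℝ) :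
  M.Phat[fun w => c * ∑ i ∈ range (M.len k w), segQ h k i t w | M.exceptU (k + 1)]
    =ᵐ[M.Phat] fun w => c * ∑ i ∈ range (M.len k w), segQ h k i t w := by
  choose q hq he using fun i => exists_measurable_segQ h k i t
  refine condExp_of_aestronglyMeasurable' (M.exceptU_le (k + 1)) ⟨_, ((M.measurable_sum_alive
    (M.measurable_len_exceptU k) hq).const_mul c).stronglyMeasurable, ?_⟩
    ((integrable_sum_segQ h k t).const_mul c)
  filter_upwards [ae_all_iff.2 he] with w hω
  simp only [hω]

lemma RegularQ.quadVar_sub {h : IsGenPair M.incrLaw φ g C} {w : Ω × Ω'}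
  (hω : RegularQ h w) {k : ℕ} {t : ℝ≥0} (hk : M.tk k ≤ t) :
  quadVar h (min (M.tk (k + 1)) t) w - quadVar h (min (M.tk k) t) w
    = (M.n : ℝ)⁻¹ * (M.n : ℝ)⁻¹ * ∑ i ∈ range (M.len k w), segQ h k i t w
      + jumpProc (M.tk (k + 1)) (fun w => M.jump φ k w ^ 2) t w := by
  have hlt := M.tk_strictMono (show k + 1 < k + 2 by omega)
  rw [min_eq_left hk, hω.quadVar_eq_of_lt (R := k + 2) ((min_le_left _ _).trans_lt hlt),
    hω.quadVar_eq_of_lt (R := k + 2) (M.tk_strictMono (by omega)), add_sub_add_comm, ← mul_sub,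
    ← sum_sub_distrib, ← sum_sub_distrib]
  have hku : M.tk k ≤ min (M.tk (k + 1)) t := le_min (M.tk_mono k.le_succ) hk
  have hcase : ∀ l ∈ range (k + 2), l ≠ k → M.tk (l + 1) ≤ M.tk k ∨ l = k + 1 := fun l hl hlk => by
      have := mem_range.1 hl
      by_cases h1 : l < k
      · exact Or.inl (M.tk_mono h1)
      · exact Or.inr (by omega)
  congr 1
  · congr 1
    rw [Finset.sum_eq_single k (fun l hl hlk => ?_) (fun hk' => absurd (Finset.mem_range.2
      (by omega)) hk'), ← sum_sub_distrib]
    · refine sum_congr rfl fun i _ => ?_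
      rw [(hω k i).2.2.1 _ le_rfl, sub_zero]
      rcases le_total t (M.tk (k + 1)) with ht | ht
      · rw [min_eq_right ht]
      · rw [min_eq_left ht, (hω k i).2.2.2.1 t ht]
    · rw [← sum_sub_distrib]
      refine sum_eq_zero fun i _ => ?_
      rcases hcase l hl hlk with hl' | rfl
      · rw [(hω l i).2.2.2.1 _ (hl'.trans hku), (hω l i).2.2.2.1 _ hl', sub_self]
      · rw [(hω _ i).2.2.1 _ (min_le_left _ _), (hω _ i).2.2.1 _ (M.tk_mono k.le_succ), sub_self]
  · rw [Finset.sum_eq_single k (fun l hl hlk => ?_) (fun hk' => absurd (Finset.mem_range.2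
      (by omega)) hk')]
    · simp [jumpProc, not_le.2 (M.tk_strictMono k.lt_succ_self)]
    · rcases hcase l hl hlk with hl' | rfl
      · rw [jumpProc, if_pos (hl'.trans hku), jumpProc, if_pos hl', sub_self]
      · rw [jumpProc, if_neg (not_le.2 ((min_le_left _ _).trans_lt hlt)), jumpProc,
          if_neg (not_le.2 (M.tk_strictMono (by omega))), sub_self]

lemma expU_quadVar (t : ℝ≥0) : ∀ᵐ w ∂M.Phat, M.expU (quadVar h) t w
    = (M.n : ℝ)⁻¹ * (M.n : ℝ)⁻¹ * (∑ k ∈ range (⌊t / M.ε⌋₊ + 1),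
        ∑ i ∈ range (M.len k w), segQ h k i t w)
      + ∑ k ∈ range ⌊t / M.ε⌋₊, M.jumpVar φ k w := by
  set c := (M.n : ℝ)⁻¹ * (M.n : ℝ)⁻¹
  have h1 : ∀ k, M.tk k ≤ t → ∀ᵐ w ∂M.Phat,
      (M.Phat[fun w => quadVar h (min (M.tk (k + 1)) t) w - quadVar h (min (M.tk k) t) w |
        M.exceptU (k + 1)]) w = c * ∑ i ∈ range (M.len k w), segQ h k i t w
        + jumpProc (M.tk (k + 1)) (M.jumpVar φ k) t w := fun k hk => by
    have h2 : (fun w => quadVar h (min (M.tk (k + 1)) t) w - quadVar h (min (M.tk k) t) w)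
        =ᵐ[M.Phat] (fun w => c * ∑ i ∈ range (M.len k w), segQ h k i t w)
          + jumpProc (M.tk (k + 1)) (fun w => M.jump φ k w ^ 2) t :=
      (ae_regularQ h).mono fun w hω => hω.quadVar_sub hk
    have hJ : Integrable (jumpProc (M.tk (k + 1)) (fun w => M.jump φ k w ^ 2) t) M.Phat ∧
        M.Phat[jumpProc (M.tk (k + 1)) (fun w => M.jump φ k w ^ 2) t | M.exceptU (k + 1)]
          =ᵐ[M.Phat] jumpProc (M.tk (k + 1)) (M.jumpVar φ k) t := by
      unfold jumpProc
      split_ifs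
      · exact ⟨M.integrable_jump_sq h.meas h.bdd k, M.condExp_jump_sq h.meas h.bdd k⟩
      · exact ⟨integrable_zero _ _ _, by rw [condExp_const (M.exceptU_le _)]⟩
    filter_upwards [condExp_congr_ae (m := M.exceptU (k + 1)) h2, condExp_add (m := M.exceptU (k + 1))
      ((integrable_sum_segQ h k t).const_mul c) hJ.1, condExp_sum_segQ h k t c, hJ.2]
      with w e1 e2 e3 e4
    rw [e1, e2, Pi.add_apply, e3, e4]
  have h3 : ∀ᵐ w ∂M.Phat, ∀ k, M.tk k ≤ t →
      (M.Phat[fun w => quadVar h (min (M.tk (k + 1)) t) w - quadVar h (min (M.tk k) t) w |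
        M.exceptU (k + 1)]) w = c * ∑ i ∈ range (M.len k w), segQ h k i t w
        + jumpProc (M.tk (k + 1)) (M.jumpVar φ k) t w := by
    rw [ae_all_iff]
    intro k
    by_cases hk : M.tk k ≤ t
    · exact (h1 k hk).mono fun w hω _ => hω
    · exact .of_forall fun w hk' => absurd hk' hk
  filter_upwards [h3] with w hω
  rw [expU, sum_Icc_one, sum_jump_floor (M.lt_tk_floor_succ t), mul_sum, ← Finset.sum_add_distrib]
  exact sum_congr rfl fun k hk => hω k ((M.le_floor_iff k t).1 (Nat.lt_succ_iff.1 (mem_range.1 hk)))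

lemma quadVar_sub_expU (t : ℝ≥0) : ∀ᵐ w ∂M.Phat, quadVar h t w - M.expU (quadVar h) t w
    = ∑ k ∈ range ⌊t / M.ε⌋₊, M.jumpDev φ k w := by
  filter_upwards [expU_quadVar h t] with w hω
  simp only [hω, quadVar, jumpDev, sum_sub_distrib]
  ring

lemma jumpVar_eq_integral (φ : Vec d₁ → ℝ) (k : ℕ) (w) : M.jumpVar φ k w
  = 1 / (M.n : ℝ) * ∫ x, (|M.xi (k + 1) x w.1| - M.xi (k + 1) x w.1 ^ 2) * φ x ^ 2
      ∂(M.μnLeft (k + 1) w) := by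
  rw [integral_μnLeft, jumpVar, sq, mul_assoc, one_div]
  congr 2
  refine sum_congr rfl fun i _ => ?_
  rw [branchProb, sq_abs, mul_comm]

lemma expU_quadVar_eq (t : ℝ≥0) : ∀ᵐ w ∂M.Phat, M.expU (quadVar h) t w =
    1 / (M.n : ℝ) ^ 2 * (∑ k ∈ range (⌊t / M.ε⌋₊ + 1), ∑ i ∈ range (M.gen k w).length,
          (segQ h k i (min (M.tk (k + 1)) t) w - segQ h k i (M.tk k) w))
    + 1 / (M.n : ℝ) * (∑ k ∈ Finset.Icc 1 ⌊t / M.ε⌋₊,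
        ∫ x, (|M.xi k x w.1| - M.xi k x w.1 ^ 2) * φ x ^ 2 ∂(M.μnLeft k w)) := by
  filter_upwards [expU_quadVar h t, ae_regularQ h] with w h1 hω
  rw [h1, sum_Icc_one, mul_sum (range ⌊t / M.ε⌋₊)]
  simp only [jumpVar_eq_integral]
  congr 1
  rw [show (M.n : ℝ)⁻¹ * (M.n : ℝ)⁻¹ = 1 / (M.n : ℝ) ^ 2 by rw [one_div, sq, mul_inv]]
  congr 1
  refine sum_congr rfl fun k _ => sum_congr rfl fun i _ => ?_
  rw [(hω k i).2.2.1 _ le_rfl, sub_zero]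
  rcases le_total t (M.tk (k + 1)) with ht | ht
  · rw [min_eq_right ht]
  · rw [min_eq_left ht, (hω k i).2.2.2.1 t ht]

/-! ### The moment bound -/

lemma lintegral_len_rpow_le {r : ℝ} (hr : 0 ≤ r) {k : ℕ} {T : ℝ≥0} (hk : M.tk k ≤ T) :
  ∫⁻ w, ofReal ((M.len k w : ℝ) ^ r) ∂M.Phat ≤ ofReal ((M.n : ℝ) ^ r)
    * ⨆ (τ : ℝ≥0) (_ : τ ≤ T), ∫⁻ w, (M.μn τ w univ) ^ r ∂M.Phat := by
  have hn : (M.n : ℝ≥0∞) ≠ 0 := by exact_mod_cast M.n_pos.ne'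
  have e : ∀ w, ofReal ((M.len k w : ℝ) ^ r)
      = ofReal ((M.n : ℝ) ^ r) * (M.μn (M.tk k) w univ) ^ r := fun w => by
    rw [μn, empirical_univ, length_particles le_rfl (M.tk_strictMono k.lt_succ_self),
      ← ENNReal.ofReal_rpow_of_nonneg (Nat.cast_nonneg _) hr,
      ← ENNReal.ofReal_rpow_of_nonneg (Nat.cast_nonneg _) hr, ENNReal.ofReal_natCast,
      ENNReal.ofReal_natCast, ← ENNReal.mul_rpow_of_nonneg _ _ hr, ← mul_assoc,
      ENNReal.mul_inv_cancel hn (ENNReal.natCast_ne_top _), one_mul]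
  simp_rw [e]
  rw [lintegral_const_mul' _ _ ENNReal.ofReal_ne_top]
  exact mul_le_mul_right (le_iSup₂ (f := fun (τ : ℝ≥0) (_ : τ ≤ T) =>
    ∫⁻ w, (M.μn τ w univ) ^ r ∂M.Phat) (M.tk k) hk) _

/-- The constant in the moment bound. -/
def _root_.momentConst (r : ℝ) : ℝ := (2 * expandConst r) ^ (r / 2) * devConst r

lemma _root_.momentConst_pos {r : ℝ} (hr : 2 ≤ r) : 0 < momentConst r := by
  have h1 := one_le_expandConst hr
  have h2 := devConst_pos (show 1 ≤ r by linarith)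
  unfold momentConst
  positivity

lemma moment_bound {r : ℝ} (hr : 2 ≤ r) (f : ℕ → ℝ) {T t : ℝ≥0} (htT : t ≤ T) (a : ℕ) :
  (∫⁻ w, ofReal (|∑ k ∈ Finset.Icc (a + 1) ⌊t / M.ε⌋₊,
      f k * ((quadVar h (M.tk k) w - M.expU (quadVar h) (M.tk k) w)
        - (quadVar h (M.tk (k - 1)) w - M.expU (quadVar h) (M.tk (k - 1)) w))| ^ r) ∂M.Phat)
    ≤ ofReal (momentConst r * (max (⨆ x, ⟪M.h x, M.h x⟫) 1) ^ (r / 2)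
          * |∑ k ∈ Finset.Icc (a + 1) ⌊t / M.ε⌋₊, f k ^ 2| ^ (r / 2)
          * ((M.ε : ℝ) ^ (1 / 2 : ℝ) / (M.n : ℝ) ^ r)
          * (⨆ x, |φ x|) ^ (2 * r))
      * ⨆ (τ : ℝ≥0) (_ : τ ≤ T), ∫⁻ w, (M.μn τ w univ) ^ r ∂M.Phat := by
  have hr0 : 0 < r := by linarith
  set b := ⌊t / M.ε⌋₊ with hb
  set H := max (⨆ x, ⟪M.h x, M.h x⟫) 1 with hH
  set Φ := ⨆ x, |φ x| with hΦ
  set I := ⨆ (τ : ℝ≥0) (_ : τ ≤ T), ∫⁻ w, (M.μn τ w univ) ^ r ∂M.Phat with hI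
  have hΦb : ∀ x, |φ x| ≤ Φ := fun x => le_ciSup (f := fun x => |φ x|)
    ⟨C, by rintro _ ⟨y, rfl⟩; exact h.bdd y⟩ x
  have hΦ0 : 0 ≤ Φ := (abs_nonneg _).trans (hΦb 0)
  have hre : ∀ F : ℕ → ℝ, ∑ k ∈ Finset.Icc (a + 1) b, F k
      = ∑ j ∈ range (b - a), F (a + 1 + j) := fun F => by
    rw [← Finset.Ico_add_one_right_eq_Icc, Finset.sum_Ico_eq_sum_range]
    congr 2
    omega
  have hD : ∀ᵐ w ∂M.Phat, ∀ k, quadVar h (M.tk k) w - M.expU (quadVar h) (M.tk k) w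
      = ∑ j ∈ range k, M.jumpDev φ j w := by
    rw [ae_all_iff]
    intro k
    simpa only [M.floor_tk] using quadVar_sub_expU h (M.tk k)
  have hlhs : ∀ᵐ w ∂M.Phat, ∑ k ∈ Finset.Icc (a + 1) b,
        f k * ((quadVar h (M.tk k) w - M.expU (quadVar h) (M.tk k) w)
          - (quadVar h (M.tk (k - 1)) w - M.expU (quadVar h) (M.tk (k - 1)) w))
      = ∑ j ∈ range (b - a), f (a + 1 + j) * M.jumpDev φ (a + j) w := by
    filter_upwards [hD] with w hω
    rw [hre]
    refine sum_congr rfl fun j _ => ?_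
    rw [hω, hω, show a + 1 + j = a + j + 1 by ring, Nat.add_sub_cancel, sum_range_succ,
      add_sub_cancel_left]
  refine (lintegral_congr_ae (g := fun w => ofReal
    (|∑ j ∈ range (b - a), f (a + 1 + j) * M.jumpDev φ (a + j) w| ^ r))
    (hlhs.mono fun w hω => by simp only [hω])).trans_le ?_
  rw [hre fun k => f k ^ 2]
  set S := ∑ j ∈ range (b - a), f (a + 1 + j) ^ 2 with hS
  have hS0 : 0 ≤ S := sum_nonneg fun _ _ => sq_nonneg _
  rw [abs_of_nonneg hS0]
  have hc := momentConst_pos hr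
  have hn : (0 : ℝ) < M.n := by exact_mod_cast M.n_pos
  have hε : (0 : ℝ) < M.ε := by exact_mod_cast M.ε_pos
  have hH1 : 1 ≤ H := le_max_right _ _
  have hzero : ∀ c : ℝ≥0∞, (∀ w, ∑ j ∈ range (b - a), f (a + 1 + j)
      * M.jumpDev φ (a + j) w = 0) → ∫⁻ w, ofReal (|∑ j ∈ range (b - a),
      f (a + 1 + j) * M.jumpDev φ (a + j) w| ^ r) ∂M.Phat ≤ c := fun c hz => by
    simp [hz, zero_rpow hr0.ne']
  rcases hS0.eq_or_lt with hS1 | hS1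
  · refine hzero _ fun w => sum_eq_zero fun j hj => ?_
    have := (Finset.sum_eq_zero_iff_of_nonneg fun _ _ => sq_nonneg _).1 hS1.symm j hj
    grind
  rcases hΦ0.eq_or_lt with hΦ1 | hΦ1
  · have hφ0 : ∀ x, φ x = 0 := fun x => abs_eq_zero.1 (le_antisymm (hΦ1 ▸ hΦb x) (abs_nonneg _))
    exact hzero _ fun w => sum_eq_zero fun j hj => by simp [jumpDev, jump, jumpVar, hφ0]
  rcases eq_or_ne I ⊤ with hIt | hIt
  · rw [hIt, ENNReal.mul_top (by positivity)]
    exact le_top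
  have hdc := devConst_pos (show 1 ≤ r by linarith)
  set B := devConst r * (√(M.ε * H) * (Φ / M.n) ^ (2 * r)) * ((M.n : ℝ) ^ r * I.toReal) with hB
  refine (M.lintegral_sum_jumpDev_rpow_le h.meas hΦb hr a (b - a) (fun j => f (a + 1 + j)) (B := B)
    (by positivity) fun j hj => ?_).trans ?_
  · refine (M.lintegral_jumpDev_rpow_le h.meas hΦb (by linarith) _).trans ?_
    rw [hB, ofReal_mul (p := devConst r * (√(M.ε * H) * (Φ / M.n) ^ (2 * r)))
      (by positivity), ofReal_mul (p := (M.n : ℝ) ^ r)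
      (by positivity), ENNReal.ofReal_toReal hIt]
    refine mul_le_mul_right (lintegral_len_rpow_le hr0.le ?_) _
    exact ((M.le_floor_iff (a + j) t).1 (by omega)).trans htT
  · rw [← ENNReal.ofReal_toReal hIt, ← ofReal_mul (by positivity)]
    refine ofReal_le_ofReal ?_
    have e1 : (Φ / M.n) ^ (2 * r) * (M.n : ℝ) ^ r = Φ ^ (2 * r) / (M.n : ℝ) ^ r := by
      rw [Real.div_rpow hΦ0 hn.le, two_mul, rpow_add hn]
      field_simp
    have e2 : √(M.ε * H) ≤ (M.ε : ℝ) ^ (1 / 2 : ℝ) * H ^ (r / 2) := by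
      rw [Real.sqrt_eq_rpow, mul_rpow hε.le (by linarith)]
      exact mul_le_mul_of_nonneg_left (rpow_le_rpow_of_exponent_le hH1 (by linarith))
        (by positivity)
    calc (2 * expandConst r) ^ (r / 2) * S ^ (r / 2) * B
        = momentConst r * S ^ (r / 2) * I.toReal * √(M.ε * H)
          * ((Φ / M.n) ^ (2 * r) * (M.n : ℝ) ^ r) := by rw [hB, momentConst]; ring
      _ ≤ momentConst r * S ^ (r / 2) * I.toReal * ((M.ε : ℝ) ^ (1 / 2 : ℝ) * H ^ (r / 2))
          * ((Φ / M.n) ^ (2 * r) * (M.n : ℝ) ^ r) :=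
          mul_le_mul_of_nonneg_right (mul_le_mul_of_nonneg_left e2 (by positivity)) (by positivity)
      _ = _ := by rw [e1]; ring

end FilterModel

end

theorem proposition2 :
    ∃ c : ℝ → ℝ, (∀ r, 2 ≤ r → 0 < c r) ∧
      ∀ (d₁ d₂ : ℕ) (Ω : Type u) (Ω' : Type v) [MeasurableSpace Ω] [MeasurableSpace Ω']
        (𝔐 : FilterModel d₁ d₂ Ω Ω') (T : ℝ≥0)
        (φ Lφ : Vec d₁ → ℝ), HasGenerator 𝔐.P 𝔐.X φ Lφ →
        ∃ (M QM : ℝ≥0 → Ω × Ω' → ℝ) (QX : ℕ → ℕ → ℝ≥0 → Ω × Ω' → ℝ),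
          -- the semimartingale equation
          (∀ t ω, (∫ x, φ x ∂(𝔐.μn t ω)) = (∫ x, φ x ∂(𝔐.μn 0 ω))
            + (∫ s in (0 : ℝ)..t, (∫ x, Lφ x ∂(𝔐.μn s.toNNReal ω)))
            + (∑ k ∈ Finset.Icc 1 ⌊t / 𝔐.ε⌋₊, ∫ x, 𝔐.weight k x ω.1 * φ x ∂(𝔐.μnLeft k ω))
            + M t ω) ∧
          Martingale M (𝔐.filtG T) 𝔐.Phat ∧
          (∀ᵐ ω ∂𝔐.Phat, IsCadlag (fun t => M t ω)) ∧
          -- the quadratic variation processes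
          IsQuadraticVariation 𝔐.Phat M QM ∧
          (∀ t, Integrable (QM t) 𝔐.Phat) ∧
          (∀ k i, IsQuadraticVariation 𝔐.Phat (𝔐.segment φ k i) (QX k i)) ∧
          -- the conditional mean of the quadratic variation
          (∀ t, ∀ᵐ ω ∂𝔐.Phat, 𝔐.expU QM t ω =
            1 / (𝔐.n : ℝ) ^ 2 * (∑ k ∈ Finset.range (⌊t / 𝔐.ε⌋₊ + 1),
                ∑ i ∈ Finset.range (𝔐.gen k ω).length,
                  (QX k i (min (𝔐.tk (k + 1)) t) ω - QX k i (𝔐.tk k) ω))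
            + 1 / (𝔐.n : ℝ) * (∑ k ∈ Finset.Icc 1 ⌊t / 𝔐.ε⌋₊,
                ∫ x, (|𝔐.xi k x ω.1| - 𝔐.xi k x ω.1 ^ 2) * φ x ^ 2 ∂(𝔐.μnLeft k ω))) ∧
          -- the moment bound
          (∀ (r : ℝ), 2 ≤ r → ∀ (f : ℕ → ℝ) (s t : ℝ≥0), s < t → t ≤ T →
            (∫⁻ ω, ENNReal.ofReal
              (|∑ k ∈ Finset.Icc (⌊s / 𝔐.ε⌋₊ + 1) ⌊t / 𝔐.ε⌋₊,
                f k * ((QM (𝔐.tk k) ω - 𝔐.expU QM (𝔐.tk k) ω)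
                  - (QM (𝔐.tk (k - 1)) ω - 𝔐.expU QM (𝔐.tk (k - 1)) ω))| ^ r) ∂𝔐.Phat)
            ≤ ENNReal.ofReal
                (c r * (max (⨆ x, ⟪𝔐.h x, 𝔐.h x⟫) 1) ^ (r / 2)
                  * |∑ k ∈ Finset.Icc (⌊s / 𝔐.ε⌋₊ + 1) ⌊t / 𝔐.ε⌋₊, f k ^ 2| ^ (r / 2)
                  * ((𝔐.ε : ℝ) ^ (1 / 2 : ℝ) / (𝔐.n : ℝ) ^ r)
                  * (⨆ x, |φ x|) ^ (2 * r))
              * ⨆ (τ : ℝ≥0) (_ : τ ≤ T), ∫⁻ ω, (𝔐.μn τ ω univ) ^ r ∂𝔐.Phat) := by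
  refine ⟨momentConst, fun r hr => momentConst_pos hr, fun d₁ d₂ Ω Ω' _ _ 𝔐 T φ Lφ hL => ?_⟩
  obtain ⟨C, h'⟩ := hL.exists_isGeneratorPair 𝔐.stableX
  have h : IsGenPair 𝔐.incrLaw φ Lφ C := h'
  exact ⟨𝔐.mart φ Lφ, FilterModel.quadVar h, FilterModel.segQ h,
    fun t ω => by unfold FilterModel.mart; ring, FilterModel.martingale_mart h T,
    𝔐.ae_regularPaths.mono fun ω hω => hω.isCadlag_mart h,
    FilterModel.isQuadraticVariation_mart h, FilterModel.integrable_quadVar h,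
    FilterModel.isQuadraticVariation_segment h, FilterModel.expU_quadVar_eq h,
    fun r hr f s t _ htT => FilterModel.moment_bound h hr f htT _⟩
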